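/- Let $k$ be a field, and let $H=(H,\Delta,\varepsilon,\phi,S,\alpha,\beta)$ be a finite-dimensional quasi-Hopf algebra over $k$: $H$ is a $k$-algebra, $\Delta:H\to H\otimes H$ and $\varepsilon:H\to k$ are algebra maps, $\phi\in H^{\otimes 3}$ is invertible, $S:H\to H$ is an anti-algebra map, $\alpha,\beta\in H$, and $$(\mathrm{id}\otimes\Delta)\Delta(h)=\phi\,(\Delta\otimes\mathrm{id})\Delta(h)\,\phi^{-1},\quad (\varepsilon\otimes\mathrm{id})\Delta=\mathrm{id}=(\mathrm{id}\otimes\varepsilon)\Delta,$$ $$(\mathrm{id}\otimes\mathrm{id}\otimes\Delta)(\phi)(\Delta\otimes\mathrm{id}\otimes\mathrm{id})(\phi)=(1\otimes\phi)(\mathrm{id}\otimes\Delta\otimes\mathrm{id})(\phi)(\phi\otimes1),\quad(\mathrm{id}\otimes\varepsilon\otimes\mathrm{id})(\phi)=1\otimes 1,$$ $$S(h_{(1)})\alpha h_{(2)}=\varepsilon(h)\alpha,\quad h_{(1)}\beta S(h_{(2)})=\varepsilon(h)\beta,\quad \phi_1\beta S(\phi_2)\alpha\phi_3=1=S(\bar\phi_1)\alpha\bar\phi_2\beta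 S(\bar\phi_3),$$ normalised by $\varepsilon(\alpha)=\varepsilon(\beta)=1$. Here and below sums are suppressed, $\phi=\phi_1\otimes\phi_2\otimes\phi_3$, $\phi^{-1}=\bar\phi_1\otimes\bar\phi_2\otimes\bar\phi_3$, $\phi'$ is a copy of $\phi$, and $h_{(1)}\otimes h_{(2)}=\Delta(h)$. Since $H$ is finite-dimensional, $S$ is bijective; $\bar S$ denotes its inverse. **Notation.** Put $$p^R=\bar\phi_1\otimes\bar\phi_2\beta S(\bar\phi_3),\quad q^R=\phi_1\otimes\bar S(\alpha\phi_3)\phi_2,\quad p^L=\phi_2\bar S(\phi_1\beta)\otimes\phi_3,\quad q^L=S(\bar\phi_1)\alpha\bar\phi_2\otimes\bar\phi_3,$$ $$\mathbf a=S(\bar\phi_1\phi_2)\alpha\bar\phi_2\phi_{3(1)}\otimes S(\phi_1)\alpha\bar\phi_3\phi_{3(2)},\quad \mathbf b=\phi_{1(1)}\bar\phi_1\beta S(\phi_3)\otimes\phi_{1(2)}\bar\phi_2\beta S(\phi_2\bar\phi_3),$$ and let $f$ be Drinfeld's gauge transformation, $$f=(S\otimes S)\Delta^{\rm cop}(p^R_1)\,\mathbf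 a\,\Delta(p^R_2),\qquad f^{-1}=\bar f_1\otimes\bar f_2=\Delta(q^L_1)\,\mathbf b\,(S\otimes S)\Delta^{\rm cop}(q^L_2).$$ Let $$U^L=\bar f_1S(q^R_2)\otimes\bar f_2S(q^R_1),\quad V^R=S(p^L_2)f_1\otimes S(p^L_1)f_2,\quad U^R=\bar S(q^L_2\bar f_2)\otimes\bar S(q^L_1\bar f_1),\quad V^L=\bar S(f_2p^R_2)\otimes\bar S(f_1p^R_1).$$ **Integrals and cointegrals.** A left integral is an element $\Lambda\in H$ with $h\Lambda=\varepsilon(h)\Lambda$ for all $h\in H$. Let $\{m_i\}$ be a basis of $H$ with dual basis $\{m^i\}$ of $H^*$. On $H^*$ consider the $H$-bimodule structure $\langle h\cdot\xi\cdot h',m\rangle=\langle\xi,\bar S(h)mS(h')\rangle$, the right coaction $\xi\mapsto\xi_{(0)}\otimes\xi_{(1)}=m^i\otimes V^L_1m_{i(1)}U^L_1\langle\xi,V^L_2m_{i(2)}U^L_2\rangle$ and the map $E(\xi)=q^R_1\cdot\xi_{(0)}\cdot\beta S(q^R_2\xi_{(1)})$. Left cointegrals are the elements of $\mathrm{Im}\,E$;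 they form a one-dimensional space on which $H$ acts by $h\triangleright\lambda=E(h\cdot\lambda)=\mu(h)\lambda$ for an algebra map $\mu:H\to k$, the modular function. $H$ is called unimodular if $\mu=\varepsilon$. Now consider on $H^*$ the $H$-bimodule structure $\langle h\cdot\xi\cdot h',m\rangle=\langle\xi,S(h)m\bar S(h')\rangle$, the left coaction $\xi\mapsto\xi_{(-1)}\otimes\xi_{(0)}=\langle\xi,V^R_1m_{i(1)}U^R_1\rangle V^R_2m_{i(2)}U^R_2\otimes m^i$ and the map $E^{\rm cop}(\xi)=q^L_2\cdot\xi_{(0)}\cdot\bar S(\beta)\bar S(q^L_1\xi_{(-1)})$. Right cointegrals are the elements of $\mathrm{Im}\,E^{\rm cop}$. **Yetter–Drinfeld modules.** A Yetter–Drinfeld module is a left $H$-module $V$ with a linear map $\delta:V\to H\otimes V$, $\delta(v)=v_{[-1]}\otimes v_{[0]}$, such that $$\phi_1v_{[-1]}\otimes(\phi_2v_{[0]})_{[-1]}\phi_3\otimes(\phi_2v_{[0]})_{[0]}=\phi'_1(\phi_1v)_{[-1](1)}\phi_2\otimes\phi'_2(\phi_1v)_{[-1](2)}\phi_3\otimes\phi'_3(\phi_1v)_{[0]},$$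 $$\varepsilon(v_{[-1]})v_{[0]}=v,\qquad h_{(1)}v_{[-1]}\otimes h_{(2)}v_{[0]}=(h_{(1)}v)_{[-1]}h_{(2)}\otimes(h_{(1)}v)_{[0]}.$$ Morphisms are the $H$-linear maps which preserve $\delta$. These form a braided monoidal category ${}^H_H\mathcal{YD}$ (identified with the Drinfeld centre of the category of left $H$-modules): the unit object is $\mathbb 1=k$, with $H$ acting through $\varepsilon$ and $\delta(1)=1\otimes1$; $H$ acts on $V\otimes W$ through $\Delta$ and $$\delta(v\otimes w)=\phi_1(\bar\phi_1\phi'_1v)_{[-1]}\bar\phi_2(\phi'_2w)_{[-1]}\phi'_3\otimes\phi_2(\bar\phi_1\phi'_1v)_{[0]}\otimes\phi_3\bar\phi_3(\phi'_2w)_{[0]};$$ the associator is $\Phi((x\otimes y)\otimes z)=\phi_1x\otimes(\phi_2y\otimes\phi_3z)$, and the braiding is $v\otimes w\mapsto v_{[-1]}w\otimes v_{[0]}$. **The adjoint algebra** $\mathbf A$ is the vector space $H$ with $$h\triangleright a=h_{(1)}aS(h_{(2)}),\qquad a\star b=\phi_1aS(\bar\phi_1\phi_2)\alpha\bar\phi_2\phi_{3(1)}bS(\bar\phi_3\phi_{3(2)}),\qquad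 1_{\mathbf A}=\beta,$$ $$\delta(a)=\phi_1\phi'_{1(1)}a_{(1)}\bar f_1S(q^R_2\phi'_{2(2)})\phi'_3\otimes\phi_2\phi'_{1(2)}a_{(2)}\bar f_2S(\phi_3q^R_1\phi'_{2(1)}).$$ **Theorem.** Suppose that $H$ is unimodular, and let $\lambda$ be a non-zero right cointegral on $H$. Then there is a unique left integral $\Lambda$ in $H$ with $\langle\lambda,\Lambda\rangle=1$. Put $\lambda^{\rm cat}(a)=\langle\lambda,\alpha\bar S(a)\rangle$ for $a\in\mathbf A$. Then $\mathbf A$ is a Yetter–Drinfeld module and is a self-dual object of ${}^H_H\mathcal{YD}$: the linear maps $e:\mathbf A\otimes\mathbf A\to\mathbb 1$ and $d:\mathbb 1\to\mathbf A\otimes\mathbf A$ given by $$e(a\otimes b)=\langle\lambda^{\rm cat},a\star b\rangle,\qquad d(1)=\beta\triangleright S(\bar f_2\,q^L_1\Lambda_{(1)}p^L_1)\otimes q^L_2\Lambda_{(2)}p^L_2\,\bar f_1$$ are morphisms in ${}^H_H\mathcal{YD}$ such that $(\mathrm{id}\otimes e)\,\Phi\,(d\otimes\mathrm{id})=\mathrm{id}_{\mathbf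 A}$ and $(e\otimes\mathrm{id})\,\Phi^{-1}(\mathrm{id}\otimes d)=\mathrm{id}_{\mathbf A}$. In particular, $(\mathbf A,\star,1_{\mathbf A})$ is an algebra in ${}^H_H\mathcal{YD}$ that is commutative with respect to the braiding, and it is a Frobenius algebra with Frobenius form $\lambda^{\rm cat}$, that is, $\lambda^{\rm cat}:\mathbf A\to\mathbb 1$ is a morphism in ${}^H_H\mathcal{YD}$ and the pairing $\lambda^{\rm cat}\circ\star$ is the evaluation of a self-duality of $\mathbf A$. -/

import Mathlib

open scoped TensorProduct

noncomputable section

/-! ### Evaluating multilinear Sweedler-type expressions on tensors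

`sweedler₂ f`, `sweedler₃ f`, ... is the linear map determined by `x₁ ⊗ ⋯ ⊗ xₙ ↦ f x₁ ⋯ xₙ`, for a
multilinear `f`.  Iterated tensor products are nested to the right. -/

section Sweedler

variable {k : Type*} [CommRing k] {M₁ M₂ M₃ M₄ M₅ P : Type*}
  [AddCommGroup M₁] [Module k M₁] [AddCommGroup M₂] [Module k M₂]
  [AddCommGroup M₃] [Module k M₃] [AddCommGroup M₄] [Module k M₄]
  [AddCommGroup M₅] [Module k M₅] [AddCommGroup P] [Module k P]

def sweedler₂ (f : M₁ → M₂ → P)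
    (h₁ : ∀ y, IsLinearMap k (fun x => f x y)) (h₂ : ∀ x, IsLinearMap k (fun y => f x y)) :
    M₁ ⊗[k] M₂ →ₗ[k] P :=
  TensorProduct.lift (LinearMap.mk₂ k f
    (fun x x' y => (h₁ y).map_add x x') (fun c x y => (h₁ y).map_smul c x)
    (fun x y y' => (h₂ x).map_add y y') (fun c x y => (h₂ x).map_smul c y))

def sweedler₃ (f : M₁ → M₂ → M₃ → P)
    (h₁ : ∀ y z, IsLinearMap k (fun x => f x y z)) (h₂ : ∀ x z, IsLinearMap k (fun y => f x y z))
    (h₃ : ∀ x y, IsLinearMap k (fun z => f x y z)) :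
    M₁ ⊗[k] (M₂ ⊗[k] M₃) →ₗ[k] P :=
  TensorProduct.lift
    { toFun := fun x => sweedler₂ (f x) (h₂ x) (h₃ x)
      map_add' := fun x x' => TensorProduct.ext' fun y z => (h₁ y z).map_add x x'
      map_smul' := fun c x => TensorProduct.ext' fun y z => (h₁ y z).map_smul c x }

def sweedler₄ (f : M₁ → M₂ → M₃ → M₄ → P)
    (h₁ : ∀ y z w, IsLinearMap k (fun x => f x y z w))
    (h₂ : ∀ x z w, IsLinearMap k (fun y => f x y z w))
    (h₃ : ∀ x y w, IsLinearMap k (fun z => f x y z w))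
    (h₄ : ∀ x y z, IsLinearMap k (fun w => f x y z w)) :
    M₁ ⊗[k] (M₂ ⊗[k] (M₃ ⊗[k] M₄)) →ₗ[k] P :=
  TensorProduct.lift
    { toFun := fun x => sweedler₃ (f x) (h₂ x) (h₃ x) (h₄ x)
      map_add' := fun x x' => TensorProduct.ext (LinearMap.ext fun y =>
        TensorProduct.ext' fun z w => (h₁ y z w).map_add x x')
      map_smul' := fun c x => TensorProduct.ext (LinearMap.ext fun y =>
        TensorProduct.ext' fun z w => (h₁ y z w).map_smul c x) }

def sweedler₅ (f : M₁ → M₂ → M₃ → M₄ → M₅ → P)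
    (h₁ : ∀ y z w t, IsLinearMap k (fun x => f x y z w t))
    (h₂ : ∀ x z w t, IsLinearMap k (fun y => f x y z w t))
    (h₃ : ∀ x y w t, IsLinearMap k (fun z => f x y z w t))
    (h₄ : ∀ x y z t, IsLinearMap k (fun w => f x y z w t))
    (h₅ : ∀ x y z w, IsLinearMap k (fun t => f x y z w t)) :
    M₁ ⊗[k] (M₂ ⊗[k] (M₃ ⊗[k] (M₄ ⊗[k] M₅))) →ₗ[k] P :=
  TensorProduct.lift
    { toFun := fun x => sweedler₄ (f x) (h₂ x) (h₃ x) (h₄ x) (h₅ x)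
      map_add' := fun x x' => TensorProduct.ext (LinearMap.ext fun y =>
        TensorProduct.ext (LinearMap.ext fun z =>
          TensorProduct.ext' fun w t => (h₁ y z w t).map_add x x'))
      map_smul' := fun c x => TensorProduct.ext (LinearMap.ext fun y =>
        TensorProduct.ext (LinearMap.ext fun z =>
          TensorProduct.ext' fun w t => (h₁ y z w t).map_smul c x)) }

end Sweedler

/-- A quasi-Hopf algebra `(H, Δ, ε, φ, S, α, β)` over a field `k`, normalised by
`ε(α) = ε(β) = 1`. -/
structure QuasiHopfAlgebra (k H : Type*) [Field k] [Ring H] [Algebra k H] where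
  /-- the comultiplication `Δ` -/
  comul : H →ₐ[k] H ⊗[k] H
  /-- the counit `ε` -/
  counit : H →ₐ[k] k
  /-- the associator `φ ∈ H ⊗ H ⊗ H` -/
  phi : (H ⊗[k] (H ⊗[k] H))ˣ
  /-- the antipode `S`, an anti-algebra map -/
  antipode : H →ₗ[k] H
  alpha : H
  beta : H
  antipode_one : antipode 1 = 1
  antipode_mul : ∀ x y : H, antipode (x * y) = antipode y * antipode x
  /-- `(id ⊗ Δ)Δ(h) = φ (Δ ⊗ id)Δ(h) φ⁻¹` -/
  comul_assoc : ∀ h : H,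
    Algebra.TensorProduct.map (AlgHom.id k H) comul (comul h) =
      phi * Algebra.TensorProduct.assoc k k k H H H
        (Algebra.TensorProduct.map comul (AlgHom.id k H) (comul h)) *
        (phi⁻¹ : (H ⊗[k] (H ⊗[k] H))ˣ)
  counit_left : ∀ h : H, TensorProduct.lid k H
    (Algebra.TensorProduct.map counit (AlgHom.id k H) (comul h)) = h
  counit_right : ∀ h : H, TensorProduct.rid k H
    (Algebra.TensorProduct.map (AlgHom.id k H) counit (comul h)) = h
  /-- `(id ⊗ id ⊗ Δ)(φ) (Δ ⊗ id ⊗ id)(φ) = (1 ⊗ φ) (id ⊗ Δ ⊗ id)(φ) (φ ⊗ 1)` -/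
  pentagon :
    Algebra.TensorProduct.map (AlgHom.id k H)
        (Algebra.TensorProduct.map (AlgHom.id k H) comul) (phi : H ⊗[k] (H ⊗[k] H)) *
      Algebra.TensorProduct.assoc k k k H H (H ⊗[k] H)
        (Algebra.TensorProduct.map comul (AlgHom.id k (H ⊗[k] H)) phi.val) =
    ((1 : H) ⊗ₜ[k] phi.val) *
      Algebra.TensorProduct.map (AlgHom.id k H)
        ((Algebra.TensorProduct.assoc k k k H H H).toAlgHom.comp
          (Algebra.TensorProduct.map comul (AlgHom.id k H))) phi.val *
      Algebra.TensorProduct.map (AlgHom.id k H)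
        (Algebra.TensorProduct.map (AlgHom.id k H)
          (Algebra.TensorProduct.includeLeft : H →ₐ[k] H ⊗[k] H)) phi.val
  /-- `(id ⊗ ε ⊗ id)(φ) = 1 ⊗ 1` -/
  counit_phi :
    Algebra.TensorProduct.map (AlgHom.id k H)
      ((Algebra.TensorProduct.lid k H).toAlgHom.comp
        (Algebra.TensorProduct.map counit (AlgHom.id k H))) phi.val = 1
  /-- `S(h₍₁₎) α h₍₂₎ = ε(h) α` -/
  antipode_alpha : ∀ h : H,
    sweedler₂ (k := k) (fun x y => antipode x * alpha * y)
      (fun _ => ⟨by intros; simp [add_mul], by intros; simp⟩)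
      (fun _ => ⟨by intros; simp [mul_add], by intros; simp⟩) (comul h) = counit h • alpha
  /-- `h₍₁₎ β S(h₍₂₎) = ε(h) β` -/
  antipode_beta : ∀ h : H,
    sweedler₂ (k := k) (fun x y => x * beta * antipode y)
      (fun _ => ⟨by intros; simp [add_mul], by intros; simp⟩)
      (fun _ => ⟨by intros; simp [mul_add], by intros; simp⟩) (comul h) = counit h • beta
  /-- `φ₁ β S(φ₂) α φ₃ = 1` -/
  phi_beta_alpha :
    sweedler₃ (k := k) (fun x y z => x * beta * antipode y * alpha * z)
      (fun _ _ => ⟨by intros; simp [add_mul], by intros; simp⟩)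
      (fun _ _ => ⟨by intros; simp [add_mul, mul_add], by intros; simp⟩)
      (fun _ _ => ⟨by intros; simp [mul_add], by intros; simp⟩) phi.val = 1
  /-- `S(φ̄₁) α φ̄₂ β S(φ̄₃) = 1`, where `φ̄ = φ⁻¹` -/
  phi_inv_alpha_beta :
    sweedler₃ (k := k) (fun x y z => antipode x * alpha * y * beta * antipode z)
      (fun _ _ => ⟨by intros; simp [add_mul], by intros; simp⟩)
      (fun _ _ => ⟨by intros; simp [add_mul, mul_add], by intros; simp⟩)
      (fun _ _ => ⟨by intros; simp [mul_add], by intros; simp⟩)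
      (phi⁻¹ : (H ⊗[k] (H ⊗[k] H))ˣ).val = 1
  counit_alpha : counit alpha = 1
  counit_beta : counit beta = 1

namespace QuasiHopfAlgebra

variable {k H : Type*} [Field k] [Ring H] [Algebra k H] (Q : QuasiHopfAlgebra k H)

/-! ### Canonical elements -/

/-- `φ⁻¹` -/
def phiInv : H ⊗[k] (H ⊗[k] H) := (Q.phi⁻¹ : (H ⊗[k] (H ⊗[k] H))ˣ)

/-- The inverse `S̄` of the antipode.  (`Ring.inverse` is the composition inverse of an invertible
endomorphism.) -/
def antipodeInv : H →ₗ[k] H := Ring.inverse (Q.antipode : Module.End k H)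

/-- `p^R = φ̄₁ ⊗ φ̄₂ β S(φ̄₃)` -/
def pR : H ⊗[k] H :=
  sweedler₃ (k := k) (fun x y z => x ⊗ₜ[k] (y * Q.beta * Q.antipode z))
    (fun _ _ => ⟨by intros; simp [TensorProduct.add_tmul], by intros; simp [TensorProduct.smul_tmul']⟩)
    (fun _ _ => ⟨by intros; simp [add_mul, TensorProduct.tmul_add], by intros; simp⟩)
    (fun _ _ => ⟨by intros; simp [mul_add, TensorProduct.tmul_add], by intros; simp⟩) Q.phiInv

/-- `q^R = φ₁ ⊗ S̄(α φ₃) φ₂` -/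
def qR : H ⊗[k] H :=
  sweedler₃ (k := k) (fun x y z => x ⊗ₜ[k] (Q.antipodeInv (Q.alpha * z) * y))
    (fun _ _ => ⟨by intros; simp [TensorProduct.add_tmul], by intros; simp [TensorProduct.smul_tmul']⟩)
    (fun _ _ => ⟨by intros; simp [mul_add, TensorProduct.tmul_add], by intros; simp⟩)
    (fun _ _ => ⟨by intros; simp [mul_add, add_mul, TensorProduct.tmul_add], by intros; simp⟩)
    Q.phi.val

/-- `p^L = φ₂ S̄(φ₁ β) ⊗ φ₃` -/
def pL : H ⊗[k] H :=
  sweedler₃ (k := k) (fun x y z => (y * Q.antipodeInv (x * Q.beta)) ⊗ₜ[k] z)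
    (fun _ _ => ⟨by intros; simp [mul_add, add_mul, TensorProduct.add_tmul],
      by intros; simp [TensorProduct.smul_tmul']⟩)
    (fun _ _ => ⟨by intros; simp [add_mul, TensorProduct.add_tmul],
      by intros; simp [TensorProduct.smul_tmul']⟩)
    (fun _ _ => ⟨by intros; simp [TensorProduct.tmul_add], by intros; simp⟩) Q.phi.val

/-- `q^L = S(φ̄₁) α φ̄₂ ⊗ φ̄₃` -/
def qL : H ⊗[k] H :=
  sweedler₃ (k := k) (fun x y z => (Q.antipode x * Q.alpha * y) ⊗ₜ[k] z)
    (fun _ _ => ⟨by intros; simp [add_mul, TensorProduct.add_tmul],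
      by intros; simp [TensorProduct.smul_tmul']⟩)
    (fun _ _ => ⟨by intros; simp [mul_add, TensorProduct.add_tmul],
      by intros; simp [TensorProduct.smul_tmul']⟩)
    (fun _ _ => ⟨by intros; simp [TensorProduct.tmul_add], by intros; simp⟩) Q.phiInv

/-- `(1 ⊗ φ⁻¹) (id ⊗ id ⊗ Δ)(φ) = φ₁ ⊗ φ̄₁ φ₂ ⊗ φ̄₂ φ₃₍₁₎ ⊗ φ̄₃ φ₃₍₂₎` -/
def kappa : H ⊗[k] (H ⊗[k] (H ⊗[k] H)) :=
  ((1 : H) ⊗ₜ[k] Q.phiInv) *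
    Algebra.TensorProduct.map (AlgHom.id k H)
      (Algebra.TensorProduct.map (AlgHom.id k H) Q.comul) Q.phi.val

/-- `a = S(φ̄₁ φ₂) α φ̄₂ φ₃₍₁₎ ⊗ S(φ₁) α φ̄₃ φ₃₍₂₎` -/
def drinfeldA : H ⊗[k] H :=
  sweedler₄ (k := k)
    (fun x y z w => (Q.antipode y * Q.alpha * z) ⊗ₜ[k] (Q.antipode x * Q.alpha * w))
    (fun _ _ _ => ⟨by intros; simp [add_mul, TensorProduct.tmul_add], by intros; simp⟩)
    (fun _ _ _ => ⟨by intros; simp [add_mul, TensorProduct.add_tmul],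
      by intros; simp [TensorProduct.smul_tmul']⟩)
    (fun _ _ _ => ⟨by intros; simp [mul_add, TensorProduct.add_tmul],
      by intros; simp [TensorProduct.smul_tmul']⟩)
    (fun _ _ _ => ⟨by intros; simp [mul_add, TensorProduct.tmul_add], by intros; simp⟩) Q.kappa

/-- `b = φ₁₍₁₎ φ̄₁ β S(φ₃) ⊗ φ₁₍₂₎ φ̄₂ β S(φ₂ φ̄₃)`, evaluated on
`(Δ ⊗ id ⊗ id)(φ) (φ⁻¹ ⊗ 1) = φ₁₍₁₎ φ̄₁ ⊗ φ₁₍₂₎ φ̄₂ ⊗ φ₂ φ̄₃ ⊗ φ₃` -/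
def drinfeldB : H ⊗[k] H :=
  sweedler₄ (k := k)
    (fun x y z w => (x * Q.beta * Q.antipode w) ⊗ₜ[k] (y * Q.beta * Q.antipode z))
    (fun _ _ _ => ⟨by intros; simp [add_mul, TensorProduct.add_tmul],
      by intros; simp [TensorProduct.smul_tmul']⟩)
    (fun _ _ _ => ⟨by intros; simp [add_mul, TensorProduct.tmul_add], by intros; simp⟩)
    (fun _ _ _ => ⟨by intros; simp [mul_add, TensorProduct.tmul_add], by intros; simp⟩)
    (fun _ _ _ => ⟨by intros; simp [mul_add, TensorProduct.add_tmul],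
      by intros; simp [TensorProduct.smul_tmul']⟩)
    (Algebra.TensorProduct.assoc k k k H H (H ⊗[k] H)
        (Algebra.TensorProduct.map Q.comul (AlgHom.id k (H ⊗[k] H)) Q.phi.val) *
      Algebra.TensorProduct.map (AlgHom.id k H)
        (Algebra.TensorProduct.map (AlgHom.id k H)
          (Algebra.TensorProduct.includeLeft : H →ₐ[k] H ⊗[k] H)) Q.phiInv)

/-- `(S ⊗ S) Δ^cop(h) = S(h₍₂₎) ⊗ S(h₍₁₎)` -/
def antipodeCop : H →ₗ[k] H ⊗[k] H :=
  TensorProduct.map Q.antipode Q.antipode ∘ₗ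
    (TensorProduct.comm k H H).toLinearMap ∘ₗ Q.comul.toLinearMap

/-- Drinfeld's gauge transformation `f = (S ⊗ S)Δ^cop(p^R₁) a Δ(p^R₂)`. -/
def drinfeldF : H ⊗[k] H :=
  sweedler₂ (k := k) (fun x y => Q.antipodeCop x * Q.drinfeldA * Q.comul y)
    (fun _ => ⟨by intros; simp [add_mul], by intros; simp⟩)
    (fun _ => ⟨by intros; simp [mul_add], by intros; simp⟩) Q.pR

/-- The inverse `f̄ = f⁻¹ = Δ(q^L₁) b (S ⊗ S)Δ^cop(q^L₂)` of Drinfeld's gauge transformation. -/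
def drinfeldFInv : H ⊗[k] H :=
  sweedler₂ (k := k) (fun x y => Q.comul x * Q.drinfeldB * Q.antipodeCop y)
    (fun _ => ⟨by intros; simp [add_mul], by intros; simp⟩)
    (fun _ => ⟨by intros; simp [mul_add], by intros; simp⟩) Q.qL

/-- `U^L = f̄₁ S(q^R₂) ⊗ f̄₂ S(q^R₁)` -/
def UL : H ⊗[k] H :=
  Q.drinfeldFInv * TensorProduct.map Q.antipode Q.antipode (TensorProduct.comm k H H Q.qR)

/-- `V^R = S(p^L₂) f₁ ⊗ S(p^L₁) f₂` -/
def VR : H ⊗[k] H :=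
  TensorProduct.map Q.antipode Q.antipode (TensorProduct.comm k H H Q.pL) * Q.drinfeldF

/-- `U^R = S̄(q^L₂ f̄₂) ⊗ S̄(q^L₁ f̄₁)` -/
def UR : H ⊗[k] H :=
  TensorProduct.map Q.antipodeInv Q.antipodeInv
    (TensorProduct.comm k H H (Q.qL * Q.drinfeldFInv))

/-- `V^L = S̄(f₂ p^R₂) ⊗ S̄(f₁ p^R₁)` -/
def VL : H ⊗[k] H :=
  TensorProduct.map Q.antipodeInv Q.antipodeInv
    (TensorProduct.comm k H H (Q.drinfeldF * Q.pR))

/-! ### Integrals and cointegrals -/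

/-- `h Λ = ε(h) Λ` for all `h`. -/
def IsLeftIntegral (Lam : H) : Prop := ∀ h : H, h * Lam = Q.counit h • Lam

section Cointegrals

variable [Module.Finite k H]

/-- The `H`-bimodule structure of the right dual `ᵛH = H^*` of the regular bimodule:
`⟨h · ξ · h', m⟩ = ⟨ξ, S̄(h) m S(h')⟩`. -/
def rightDualAct (h : H) (ξ : Module.Dual k H) (h' : H) : Module.Dual k H :=
  ξ ∘ₗ LinearMap.mulLeft k (Q.antipodeInv h) ∘ₗ LinearMap.mulRight k (Q.antipode h')

/-- The right coaction `ξ ↦ mⁱ ⊗ V^L₁ mᵢ₍₁₎ U^L₁ ⟨ξ, V^L₂ mᵢ₍₂₎ U^L₂⟩` of `H` on `ᵛH`, where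
`mᵢ` is a basis of `H` with dual basis `mⁱ`: the tensor which corresponds to the linear map
`m ↦ V^L₁ m₍₁₎ U^L₁ ⟨ξ, V^L₂ m₍₂₎ U^L₂⟩` under `H^* ⊗ H ≃ Hom(H, H)`. -/
def rightDualCoact (ξ : Module.Dual k H) : Module.Dual k H ⊗[k] H :=
  (dualTensorHomEquiv k H H).symm
    ((TensorProduct.rid k H).toLinearMap ∘ₗ TensorProduct.map LinearMap.id ξ ∘ₗ
      LinearMap.mulLeft k Q.VL ∘ₗ LinearMap.mulRight k Q.UL ∘ₗ Q.comul.toLinearMap)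

/-- The projection `E(ξ) = q^R₁ · ξ₍₀₎ · (β S(q^R₂ ξ₍₁₎))` onto the coinvariants of the right
quasi-Hopf bimodule `ᵛH`. -/
def rightDualE (ξ : Module.Dual k H) : Module.Dual k H :=
  sweedler₄ (k := k) (fun x y η z => Q.rightDualAct x η (Q.beta * Q.antipode (y * z)))
    (fun _ _ _ => ⟨by intros; ext; simp [rightDualAct, add_mul],
      by intros; ext; simp [rightDualAct]⟩)
    (fun _ _ _ => ⟨by intros; ext; simp [rightDualAct, add_mul, mul_add],
      by intros; ext; simp [rightDualAct]⟩)
    (fun _ _ _ => ⟨by intros; ext; simp [rightDualAct], by intros; ext; simp [rightDualAct]⟩)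
    (fun _ _ _ => ⟨by intros; ext; simp [rightDualAct, mul_add],
      by intros; ext; simp [rightDualAct]⟩)
    (TensorProduct.assoc k H H (Module.Dual k H ⊗[k] H) (Q.qR ⊗ₜ[k] Q.rightDualCoact ξ))

/-- Left cointegrals on `H`: the coinvariants `Im E` of `ᵛH`. -/
def IsLeftCointegral (lam : Module.Dual k H) : Prop := ∃ ξ, Q.rightDualE ξ = lam

/-- The left action `h ▷ λ = E(h · λ)` on coinvariants. -/
def leftCointegralAct (h : H) (lam : Module.Dual k H) : Module.Dual k H :=
  Q.rightDualE (Q.rightDualAct h lam 1)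

/-- `μ` is the modular function: `h ▷ λ = μ(h) λ` for all left cointegrals `λ`
(which form a one-dimensional space). -/
def IsModularFunction (mu : H →ₐ[k] k) : Prop :=
  ∀ (h : H) (lam : Module.Dual k H), Q.IsLeftCointegral lam →
    Q.leftCointegralAct h lam = mu h • lam

/-- `H` is unimodular if its modular function is the counit. -/
def IsUnimodular : Prop := Q.IsModularFunction Q.counit

/-- The `H`-bimodule structure of the left dual `Hᵛ = H^*` of the regular bimodule:
`⟨h · ξ · h', m⟩ = ⟨ξ, S(h) m S̄(h')⟩`. -/
def leftDualAct (h : H) (ξ : Module.Dual k H) (h' : H) : Module.Dual k H :=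
  ξ ∘ₗ LinearMap.mulLeft k (Q.antipode h) ∘ₗ LinearMap.mulRight k (Q.antipodeInv h')

/-- The left coaction `ξ ↦ ⟨ξ, V^R₁ mᵢ₍₁₎ U^R₁⟩ V^R₂ mᵢ₍₂₎ U^R₂ ⊗ mⁱ` of `H` on `Hᵛ`, where
`mᵢ` is a basis of `H` with dual basis `mⁱ`. -/
def leftDualCoact (ξ : Module.Dual k H) : H ⊗[k] Module.Dual k H :=
  TensorProduct.comm k (Module.Dual k H) H ((dualTensorHomEquiv k H H).symm
    ((TensorProduct.lid k H).toLinearMap ∘ₗ TensorProduct.map ξ LinearMap.id ∘ₗ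
      LinearMap.mulLeft k Q.VR ∘ₗ LinearMap.mulRight k Q.UR ∘ₗ Q.comul.toLinearMap))

/-- The projection `E^cop(ξ) = q^L₂ · ξ₍₀₎ · (S̄(β) S̄(q^L₁ ξ₍₋₁₎))` onto the coinvariants of the
left quasi-Hopf bimodule `Hᵛ`. -/
def leftDualE (ξ : Module.Dual k H) : Module.Dual k H :=
  sweedler₄ (k := k)
    (fun x y z η => Q.leftDualAct y η (Q.antipodeInv Q.beta * Q.antipodeInv (x * z)))
    (fun _ _ _ => ⟨by intros; ext; simp [leftDualAct, add_mul, mul_add],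
      by intros; ext; simp [leftDualAct]⟩)
    (fun _ _ _ => ⟨by intros; ext; simp [leftDualAct, add_mul],
      by intros; ext; simp [leftDualAct]⟩)
    (fun _ _ _ => ⟨by intros; ext; simp [leftDualAct, mul_add],
      by intros; ext; simp [leftDualAct]⟩)
    (fun _ _ _ => ⟨by intros; ext; simp [leftDualAct], by intros; ext; simp [leftDualAct]⟩)
    (TensorProduct.assoc k H H (H ⊗[k] Module.Dual k H) (Q.qL ⊗ₜ[k] Q.leftDualCoact ξ))

/-- Right cointegrals on `H`: the coinvariants `Im E^cop` of `Hᵛ`. -/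
def IsRightCointegral (lam : Module.Dual k H) : Prop := ∃ ξ, Q.leftDualE ξ = lam

end Cointegrals

/-! ### The monoidal category of left `H`-modules

A left `H`-module structure on a vector space `V` is an algebra map `H → End(V)`. -/

section Modules

variable {X Y Z : Type*} [AddCommGroup X] [Module k X] [AddCommGroup Y] [Module k Y]
  [AddCommGroup Z] [Module k Z]

/-- The action of `H ⊗ A` on `X ⊗ Y`, `(h ⊗ a) (x ⊗ y) = h x ⊗ a y`. -/
def actTensor {A : Type*} [Ring A] [Algebra k A] (ρ : H →ₐ[k] Module.End k X)
    (σ : A →ₐ[k] Module.End k Y) : H ⊗[k] A →ₐ[k] Module.End k (X ⊗[k] Y) :=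
  Module.endTensorEndAlgHom.comp (Algebra.TensorProduct.map ρ σ)

/-- The trivial module: `k` with `H` acting through `ε`. -/
def unitAct : H →ₐ[k] Module.End k k := (Algebra.lmul k k).comp Q.counit

/-- The tensor product module: `h (x ⊗ y) = h₍₁₎ x ⊗ h₍₂₎ y`. -/
def tensorAct (ρ : H →ₐ[k] Module.End k X) (σ : H →ₐ[k] Module.End k Y) :
    H →ₐ[k] Module.End k (X ⊗[k] Y) :=
  (actTensor ρ σ).comp Q.comul

/-- The associator `(x ⊗ y) ⊗ z ↦ φ₁ x ⊗ (φ₂ y ⊗ φ₃ z)`. -/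
def associatorHom (ρ : H →ₐ[k] Module.End k X) (σ : H →ₐ[k] Module.End k Y)
    (τ : H →ₐ[k] Module.End k Z) : (X ⊗[k] Y) ⊗[k] Z →ₗ[k] X ⊗[k] (Y ⊗[k] Z) :=
  actTensor ρ (actTensor σ τ) Q.phi.val ∘ₗ (TensorProduct.assoc k X Y Z).toLinearMap

/-- The inverse associator `x ⊗ (y ⊗ z) ↦ (φ̄₁ x ⊗ φ̄₂ y) ⊗ φ̄₃ z`. -/
def associatorInv (ρ : H →ₐ[k] Module.End k X) (σ : H →ₐ[k] Module.End k Y)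
    (τ : H →ₐ[k] Module.End k Z) : X ⊗[k] (Y ⊗[k] Z) →ₗ[k] (X ⊗[k] Y) ⊗[k] Z :=
  (TensorProduct.assoc k X Y Z).symm.toLinearMap ∘ₗ actTensor ρ (actTensor σ τ) Q.phiInv

end Modules

/-! ### Yetter-Drinfeld modules (of the first kind) -/

/-- A left `H`-module `V` with a linear map `δ : V → H ⊗ V`, `δ(v) = v₍₋₁₎ ⊗ v₍₀₎`; the axioms are
in `YDData.IsYetterDrinfeld`. -/
structure YDData (k H V : Type*) [Field k] [Ring H] [Algebra k H] [AddCommGroup V]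
    [Module k V] where
  act : H →ₐ[k] Module.End k V
  coact : V →ₗ[k] H ⊗[k] V

namespace YDData

variable {U V W : Type*} [AddCommGroup U] [Module k U] [AddCommGroup V] [Module k V]
  [AddCommGroup W] [Module k W]

/-- The Yetter-Drinfeld axioms for a left `H`-module with a coaction. -/
structure IsYetterDrinfeld (M : YDData k H V) : Prop where
  /-- `φ₁ v₍₋₁₎ ⊗ (φ₂ v₍₀₎)₍₋₁₎ φ₃ ⊗ (φ₂ v₍₀₎)₍₀₎
  = φ'₁ (φ₁ v)₍₋₁₎₍₁₎ φ₂ ⊗ φ'₂ (φ₁ v)₍₋₁₎₍₂₎ φ₃ ⊗ φ'₃ (φ₁ v)₍₀₎` -/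
  coact_coact : ∀ v : V,
    sweedler₃ (k := k) (P := H ⊗[k] (H ⊗[k] V))
      (fun x y z => TensorProduct.map (LinearMap.mul k H x)
        (TensorProduct.map ((LinearMap.mul k H).flip z) LinearMap.id ∘ₗ M.coact ∘ₗ M.act y)
        (M.coact v))
      (fun _ _ => ⟨by intros; simp [TensorProduct.map_add_left],
        by intros; simp [TensorProduct.map_smul_left]⟩)
      (fun _ _ => ⟨by intros; simp [LinearMap.comp_add, TensorProduct.map_add_right],
        by intros; simp [LinearMap.comp_smul, TensorProduct.map_smul_right]⟩)
      (fun _ _ => ⟨by intros; simp [LinearMap.add_comp,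
          TensorProduct.map_add_left, TensorProduct.map_add_right],
        by intros; simp [LinearMap.smul_comp,
          TensorProduct.map_smul_left, TensorProduct.map_smul_right]⟩)
      Q.phi.val =
    sweedler₃ (k := k) (P := H ⊗[k] (H ⊗[k] V))
      (fun x y z => actTensor (Algebra.lmul k H) (actTensor (Algebra.lmul k H) M.act) Q.phi.val
        (TensorProduct.assoc k H H V
          (TensorProduct.map ((LinearMap.mul k (H ⊗[k] H)).flip (y ⊗ₜ[k] z) ∘ₗ Q.comul.toLinearMap)
            LinearMap.id (M.coact (M.act x v)))))
      (fun _ _ => ⟨by intros; simp, by intros; simp⟩)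
      (fun _ _ => ⟨by intros; simp [TensorProduct.add_tmul, LinearMap.add_comp,
          TensorProduct.map_add_left],
        by intros; simp [← TensorProduct.smul_tmul', LinearMap.smul_comp,
          TensorProduct.map_smul_left]⟩)
      (fun _ _ => ⟨by intros; simp [TensorProduct.tmul_add, LinearMap.add_comp,
          TensorProduct.map_add_left],
        by intros; simp [LinearMap.smul_comp,
          TensorProduct.map_smul_left]⟩)
      Q.phi.val
  /-- `ε(v₍₋₁₎) v₍₀₎ = v` -/
  counit_coact : ∀ v : V,
    TensorProduct.lid k V (TensorProduct.map Q.counit.toLinearMap LinearMap.id (M.coact v)) = v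
  /-- `h₍₁₎ v₍₋₁₎ ⊗ h₍₂₎ v₍₀₎ = (h₍₁₎ v)₍₋₁₎ h₍₂₎ ⊗ (h₍₁₎ v)₍₀₎` -/
  act_coact : ∀ (h : H) (v : V),
    Q.tensorAct (Algebra.lmul k H) M.act h (M.coact v) =
    sweedler₂ (k := k) (P := H ⊗[k] V)
      (fun x y => TensorProduct.map ((LinearMap.mul k H).flip y) LinearMap.id (M.coact (M.act x v)))
      (fun _ => ⟨by intros; simp, by intros; simp⟩)
      (fun _ => ⟨by intros; simp [TensorProduct.map_add_left],
        by intros; simp [TensorProduct.map_smul_left]⟩)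
      (Q.comul h)

/-- Morphisms of Yetter-Drinfeld modules: linear maps which preserve the action and the
coaction. -/
structure IsHom (M : YDData k H V) (N : YDData k H W) (f : V →ₗ[k] W) : Prop where
  act : ∀ h : H, f ∘ₗ M.act h = N.act h ∘ₗ f
  coact : N.coact ∘ₗ f = TensorProduct.map LinearMap.id f ∘ₗ M.coact

/-- The map `V ⊗ X → X ⊗ V`, `v ⊗ x ↦ v₍₋₁₎ x ⊗ v₍₀₎` for a left `H`-module `X` (for a
Yetter-Drinfeld module `X`, this is the braiding). -/
def braid (M : YDData k H V) (ρ : H →ₐ[k] Module.End k W) : V ⊗[k] W →ₗ[k] W ⊗[k] V :=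
  sweedler₂ (k := k)
    (fun v x => TensorProduct.map ((LinearMap.applyₗ x : Module.End k W →ₗ[k] W) ∘ₗ
      ρ.toLinearMap) LinearMap.id (M.coact v))
    (fun _ => ⟨by intros; simp, by intros; simp⟩)
    (fun _ => ⟨by intros; simp [LinearMap.add_comp, TensorProduct.map_add_left],
      by intros; simp [LinearMap.smul_comp, TensorProduct.map_smul_left]⟩)

/-- The unit object: `k` with `δ(1) = 1 ⊗ 1`. -/
def unit : YDData k H k where
  act := Q.unitAct
  coact := TensorProduct.mk k H k 1

/-- The tensor product of Yetter-Drinfeld modules, with the coaction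
`δ(v ⊗ w) = φ₁ (φ̄₁ φ'₁ v)₍₋₁₎ φ̄₂ (φ'₂ w)₍₋₁₎ φ'₃ ⊗ φ₂ (φ̄₁ φ'₁ v)₍₀₎ ⊗ φ₃ φ̄₃ (φ'₂ w)₍₀₎`,
i.e. the image of `(v ⊗ w) ⊗ 1` under the composite
`(V ⊗ W) ⊗ H → V ⊗ (W ⊗ H) → V ⊗ (H ⊗ W) → (V ⊗ H) ⊗ W → (H ⊗ V) ⊗ W → H ⊗ (V ⊗ W)` of
associators and the maps `braid`, where `H` is the left regular module. -/
def tensor (M : YDData k H V) (N : YDData k H W) : YDData k H (V ⊗[k] W) where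
  act := Q.tensorAct M.act N.act
  coact :=
    Q.associatorHom (Algebra.lmul k H) M.act N.act ∘ₗ
      TensorProduct.map (M.braid (Algebra.lmul k H)) LinearMap.id ∘ₗ
      Q.associatorInv M.act (Algebra.lmul k H) N.act ∘ₗ
      TensorProduct.map LinearMap.id (N.braid (Algebra.lmul k H)) ∘ₗ
      Q.associatorHom M.act N.act (Algebra.lmul k H) ∘ₗ
      (TensorProduct.mk k (V ⊗[k] W) H).flip 1

/-- `(N, e, c)` is a left dual object of `M` in the category of Yetter-Drinfeld modules:
`e : N ⊗ M → 𝟙` and `c : 𝟙 → M ⊗ N` are morphisms with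
`(id_M ⊗ e) Φ (c ⊗ id_M) = id_M` and `(e ⊗ id_N) Φ⁻¹ (id_N ⊗ c) = id_N`. -/
structure IsLeftDual (M : YDData k H V) (N : YDData k H W)
    (e : W ⊗[k] V →ₗ[k] k) (c : k →ₗ[k] V ⊗[k] W) : Prop where
  eval_isHom : IsHom (tensor Q N M) (unit Q) e
  coeval_isHom : IsHom (unit Q) (tensor Q M N) c
  zigzag_left :
    (TensorProduct.rid k V).toLinearMap ∘ₗ TensorProduct.map LinearMap.id e ∘ₗ
      Q.associatorHom M.act N.act M.act ∘ₗ
      TensorProduct.map c LinearMap.id ∘ₗ (TensorProduct.lid k V).symm.toLinearMap =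
    LinearMap.id
  zigzag_right :
    (TensorProduct.lid k W).toLinearMap ∘ₗ TensorProduct.map e LinearMap.id ∘ₗ
      Q.associatorInv N.act M.act N.act ∘ₗ
      TensorProduct.map LinearMap.id c ∘ₗ (TensorProduct.rid k W).symm.toLinearMap =
    LinearMap.id

/-- `(M, m, u)` is an algebra in the monoidal category of Yetter-Drinfeld modules. -/
structure IsAlgebra (M : YDData k H V) (m : V ⊗[k] V →ₗ[k] V) (u : k →ₗ[k] V) : Prop where
  isYetterDrinfeld : M.IsYetterDrinfeld Q
  mul_isHom : IsHom (tensor Q M M) M m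
  unit_isHom : IsHom (unit Q) M u
  mul_assoc : m ∘ₗ TensorProduct.map m LinearMap.id =
    m ∘ₗ TensorProduct.map LinearMap.id m ∘ₗ Q.associatorHom M.act M.act M.act
  unit_mul : m ∘ₗ TensorProduct.map u LinearMap.id ∘ₗ
    (TensorProduct.lid k V).symm.toLinearMap = LinearMap.id
  mul_unit : m ∘ₗ TensorProduct.map LinearMap.id u ∘ₗ
    (TensorProduct.rid k V).symm.toLinearMap = LinearMap.id

/-- Commutativity with respect to the braiding: `m σ_{M,M} = m`. -/
def IsCommutative (M : YDData k H V) (m : V ⊗[k] V →ₗ[k] V) : Prop :=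
  m ∘ₗ M.braid M.act = m

/-- `(M, m, u)` is a Frobenius algebra with Frobenius form `t`: `t : M → 𝟙` is a morphism and the
pairing `t ∘ m` is the evaluation of a self-duality of `M`. -/
structure IsFrobeniusAlgebra (M : YDData k H V) (m : V ⊗[k] V →ₗ[k] V) (u : k →ₗ[k] V)
    (t : V →ₗ[k] k) : Prop where
  isAlgebra : M.IsAlgebra Q m u
  form_isHom : IsHom M (unit Q) t
  nondegenerate : ∃ c : k →ₗ[k] V ⊗[k] V, IsLeftDual Q M M (t ∘ₗ m) c

end YDData

/-! ### The adjoint algebra -/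

/-- Right multiplication by `S(h)`, as an algebra map `H → End(H)`. -/
def mulRightAntipode : H →ₐ[k] Module.End k H :=
  AlgHom.ofLinearMap ((LinearMap.mul k H).flip ∘ₗ Q.antipode)
    (by ext x; simp [Q.antipode_one])
    (by intro x y; ext z; simp [Q.antipode_mul, mul_assoc])

/-- The adjoint action `h ▷ a = h₍₁₎ a S(h₍₂₎)` of `H` on itself. -/
def adjointAct : H →ₐ[k] Module.End k H :=
  (Algebra.TensorProduct.lift (Algebra.lmul k H) Q.mulRightAntipode
    (fun x y => LinearMap.ext fun z => by
      simp [mulRightAntipode, mul_assoc])).comp Q.comul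

/-- `φ₁ φ'₁₍₁₎ ⊗ φ₂ φ'₁₍₂₎ ⊗ φ₃ q^R₁ φ'₂₍₁₎ ⊗ q^R₂ φ'₂₍₂₎ ⊗ φ'₃`, i.e.
`(φ ⊗ 1 ⊗ 1) (1 ⊗ 1 ⊗ q^R ⊗ 1) (Δ ⊗ Δ ⊗ id)(φ)`. -/
def adjointCoactElement : H ⊗[k] (H ⊗[k] (H ⊗[k] (H ⊗[k] H))) :=
  Algebra.TensorProduct.map (AlgHom.id k H)
      (Algebra.TensorProduct.map (AlgHom.id k H)
        (Algebra.TensorProduct.includeLeft : H →ₐ[k] H ⊗[k] (H ⊗[k] H))) Q.phi.val *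
    ((1 : H) ⊗ₜ[k] ((1 : H) ⊗ₜ[k] Algebra.TensorProduct.map (AlgHom.id k H)
        (Algebra.TensorProduct.includeLeft : H →ₐ[k] H ⊗[k] H) Q.qR)) *
    Algebra.TensorProduct.map (AlgHom.id k H)
      (Algebra.TensorProduct.map (AlgHom.id k H)
        (Algebra.TensorProduct.assoc k k k H H H).toAlgHom)
      (Algebra.TensorProduct.assoc k k k H H ((H ⊗[k] H) ⊗[k] H)
        (Algebra.TensorProduct.map Q.comul
          (Algebra.TensorProduct.map Q.comul (AlgHom.id k H)) Q.phi.val))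

/-- The coaction (of the first kind) of the adjoint algebra,
`δ(a) = φ₁ φ'₁₍₁₎ a₍₁₎ f̄₁ S(q^R₂ φ'₂₍₂₎) φ'₃ ⊗ φ₂ φ'₁₍₂₎ a₍₂₎ f̄₂ S(φ₃ q^R₁ φ'₂₍₁₎)`. -/
def adjointCoact : H →ₗ[k] H ⊗[k] H :=
  sweedler₅ (k := k) (P := H →ₗ[k] H ⊗[k] H)
    (fun x y z w t =>
      LinearMap.mulLeft k (x ⊗ₜ[k] y) ∘ₗ
        LinearMap.mulRight k (Q.drinfeldFInv * ((Q.antipode w * t) ⊗ₜ[k] Q.antipode z)) ∘ₗ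
        Q.comul.toLinearMap)
    (fun _ _ _ _ => ⟨by intros; ext; simp [TensorProduct.add_tmul, add_mul],
      by intros; ext; simp [← TensorProduct.smul_tmul']⟩)
    (fun _ _ _ _ => ⟨by intros; ext; simp [TensorProduct.tmul_add, add_mul],
      by intros; ext; simp⟩)
    (fun _ _ _ _ => ⟨by intros; ext; simp [TensorProduct.tmul_add, mul_add, mul_assoc],
      by intros; ext; simp [mul_assoc]⟩)
    (fun _ _ _ _ => ⟨by intros; ext; simp [TensorProduct.add_tmul, add_mul, mul_add, mul_assoc],
      by intros; ext; simp [← TensorProduct.smul_tmul', mul_assoc]⟩)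
    (fun _ _ _ _ => ⟨by intros; ext; simp [TensorProduct.add_tmul, mul_add, mul_assoc],
      by intros; ext; simp [← TensorProduct.smul_tmul', mul_assoc]⟩)
    Q.adjointCoactElement

/-- The Yetter-Drinfeld module `A`, with underlying vector space `H`. -/
def adjoint : YDData k H H where
  act := Q.adjointAct
  coact := Q.adjointCoact

/-- The multiplication `a ⋆ b = φ₁ a S(φ̄₁ φ₂) α φ̄₂ φ₃₍₁₎ b S(φ̄₃ φ₃₍₂₎)` of `A`. -/
def adjointMul : H ⊗[k] H →ₗ[k] H :=
  sweedler₄ (k := k) (P := H ⊗[k] H →ₗ[k] H)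
    (fun x y z w => sweedler₂ (k := k)
      (fun a b => x * a * Q.antipode y * Q.alpha * z * b * Q.antipode w)
      (fun _ => ⟨by intros; simp [add_mul, mul_add], by intros; simp⟩)
      (fun _ => ⟨by intros; simp [add_mul, mul_add], by intros; simp⟩))
    (fun _ _ _ => ⟨by intros; ext; simp [sweedler₂, add_mul],
      by intros; ext; simp [sweedler₂]⟩)
    (fun _ _ _ => ⟨by intros; ext; simp [sweedler₂, add_mul, mul_add],
      by intros; ext; simp [sweedler₂]⟩)
    (fun _ _ _ => ⟨by intros; ext; simp [sweedler₂, add_mul, mul_add],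
      by intros; ext; simp [sweedler₂]⟩)
    (fun _ _ _ => ⟨by intros; ext; simp [sweedler₂, mul_add],
      by intros; ext; simp [sweedler₂]⟩) Q.kappa

/-- The unit `1 ↦ β` of `A`. -/
def adjointUnit : k →ₗ[k] H := LinearMap.toSpanSingleton k H Q.beta

/-- `λ^cat(a) = ⟨λ, α S̄(a)⟩` -/
def catForm (lam : Module.Dual k H) : H →ₗ[k] k :=
  lam ∘ₗ LinearMap.mulLeft k Q.alpha ∘ₗ Q.antipodeInv

/-- The pairing `e(a ⊗ b) = ⟨λ^cat, a ⋆ b⟩`. -/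
def adjointEval (lam : Module.Dual k H) : H ⊗[k] H →ₗ[k] k := Q.catForm lam ∘ₗ Q.adjointMul

/-- The copairing
`d(1) = β ▷ S(f̄₂ q^L₁ Λ₍₁₎ p^L₁) ⊗ q^L₂ Λ₍₂₎ p^L₂ f̄₁`. -/
def adjointCoeval (Lam : H) : k →ₗ[k] H ⊗[k] H :=
  LinearMap.toSpanSingleton k (H ⊗[k] H)
    (sweedler₄ (k := k)
      (fun x y z w => Q.adjointAct Q.beta (Q.antipode (y * z)) ⊗ₜ[k] (w * x))
      (fun _ _ _ => ⟨by intros; simp [mul_add, TensorProduct.tmul_add], by intros; simp⟩)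
      (fun _ _ _ => ⟨by intros; simp [add_mul, TensorProduct.add_tmul],
        by intros; simp [TensorProduct.smul_tmul']⟩)
      (fun _ _ _ => ⟨by intros; simp [mul_add, TensorProduct.add_tmul],
        by intros; simp [TensorProduct.smul_tmul']⟩)
      (fun _ _ _ => ⟨by intros; simp [add_mul, TensorProduct.tmul_add], by intros; simp⟩)
      (TensorProduct.assoc k H H (H ⊗[k] H)
        (Q.drinfeldFInv ⊗ₜ[k] (Q.qL * Q.comul Lam * Q.pL))))

end QuasiHopfAlgebra

end

/-!
# The adjoint algebra of a unimodular quasi-Hopf algebra is Frobenius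

*Coherence.* An `H`-linear map between tensor powers which is built from `φ` and the coproduct is
an element of an algebra in which `H` has several commuting copies, the legs. `LegTree` describes
bracketings of the legs and `can` the associator between two of them; by Mac Lane's theorem
(`AssocPath.can_eq`) every word of associators depends only on its two ends. Contracting adjacent
legs by `S(x) α y` or `x β S(y)` makes a block of legs trivial, and `kill_can_left` and its relatives
remove the block from such a word. The identities for `p`, `q`, `U`, `V` and Drinfeld's `f` are
contractions of a word of associators evaluated in two ways.

*The antipode* is bijective: algebra maps which agree on its image agree
(`algHom_eq_of_eq_antipode`), so the projection of the Fitting decomposition of a power of `S²` is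
the identity.

*Integrals.* For a two-sided integral `Λ` the element `d = q^L Δ(Λ) p^L` (`casimir`) satisfies
`S(h) d₁ ⊗ d₂ = d₁ ⊗ h d₂` and `d₁ ⊗ d₂ h = d₁ S̄(h) ⊗ d₂`, and `ξ ↦ ξ(d₁) d₂` is injective
(`contrFst_casimir_injective`), hence bijective. This yields uniqueness of integrals and a form `λ`
with `λ(d₁) d₂ = 1`. In the unimodular case `λ` spans the right cointegrals
(`IsUnimodular.exists_integral`).

*The adjoint algebra.* The map `g(a) = φ₁ a S(φ₂) α φ₃` (`toReg`) lets `A` act on every `H`-module.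
An element of `A ⊗ W` is determined by the action of `A` on a regular module adjoined to `W`
(`eq_of_probe_eq`). After that action the coaction becomes left multiplication by `g(a)` past `W`
(`actOn_braidOn`) and `⋆` becomes composition (`actOn_mulOn`), so the Yetter–Drinfeld axioms,
associativity, braided commutativity and colinearity of `⋆` reduce to coherence.

*Frobenius property.* The identities `λ(S(x) y) = λ(y S̄(x))` and `IsDualTo.contrFst_VR_pR`, which
says that `d` is compatible with `Δ`, make `λ^cat` linear and colinear. Since `d` and `λ` are dual and
`f⁻¹` cancels the element `𝐚` in `a ⋆ b` up to `Δ(α)`, the pairing and the copairing satisfy the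
first zigzag identity up to `α` (`contrSnd_preCoeval`); the remaining `φ`, `α`, `β` cancel by the
antipode axioms. The second zigzag identity follows from a dimension count
(`contrFst_eq_of_contrSnd_eq`). The pairing is colinear and the zigzag identities force the copairing
to be so as well (`copairing_isHom`).
-/

open scoped TensorProduct

noncomputable section

open LinearMap (lTensor rTensor mulLeft mulRight lTensor_tmul rTensor_tmul
  mulRight_apply mulLeft_apply comp_apply)
open TensorProduct (tmul_add add_tmul smul_tmul' map_add_left map_add_right
  map_smul_left map_smul_right)
open Algebra.TensorProduct (includeLeft includeRight tmul_mul_tmul)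

/-! ### Words of associators -/

/-- Bracketed words in legs: `one` stands for the unit object, `leaf i` for the `i`-th leg. -/
inductive LegTree : Type
  | one : LegTree
  | leaf : ℕ → LegTree
  | node : LegTree → LegTree → LegTree
  deriving DecidableEq

namespace LegTree

instance (n : ℕ) : OfNat LegTree n := ⟨leaf n⟩
instance : Mul LegTree := ⟨node⟩

/-- The legs of a bracketed word, from left to right. -/
def leaves : LegTree → List ℕ
  | one => []
  | leaf i => [i]
  | node a b => a.leaves ++ b.leaves

/-- Substitution of bracketed words for legs. -/
def bind (f : ℕ → LegTree) : LegTree → LegTree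
  | one => one
  | leaf i => f i
  | node a b => node (a.bind f) (b.bind f)

/-- The word with all unit objects removed. -/
def strip : LegTree → LegTree
  | one => one
  | leaf i => leaf i
  | node a b =>
    if a.strip = one then b.strip else if b.strip = one then a.strip else node a.strip b.strip

/-- The right-nested word with the legs of `t` followed by the word `r`. -/
def comb : LegTree → LegTree → LegTree
  | one, r => r
  | leaf i, r => node (leaf i) r
  | node a b, r => a.comb (b.comb r)

/-- The word `t` with the subword `b` replaced by the leg `0`. -/
def collapse (b : LegTree) : LegTree → LegTree
  | one => one
  | leaf i => if leaf i = b then leaf 0 else leaf i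
  | node s t => if node s t = b then leaf 0 else node (collapse b s) (collapse b t)

/-- The word `t` with the subword `b` removed. -/
def kill (b t : LegTree) : LegTree :=
  ((collapse b t).bind fun i => if i = 0 then one else leaf i).strip

/-- `b` can be treated as a single leg in `t`. -/
def Contains (b t : LegTree) : Prop :=
  ((collapse b t).bind fun i => if i = 0 then b else leaf i) = t ∧
    (collapse b t).leaves.Nodup ∧ 0 ∉ b.leaves ∧ ∀ i ∈ (collapse b t).leaves, i ∉ b.leaves

instance (b t : LegTree) : Decidable (Contains b t) := by unfold Contains; infer_instance

end LegTree

open LegTree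

section Pairing

variable {k : Type*} [Field k] {M N B C : Type*} [Ring M] [Algebra k M] [Ring N] [Algebra k N]
  [Ring B] [Algebra k B] [Ring C] [Algebra k C]

/-- `x ⊗ y ↦ f x * g y` -/
def pw (f : M →ₗ[k] B) (g : N →ₗ[k] B) : M ⊗[k] N →ₗ[k] B :=
  LinearMap.mul' k B ∘ₗ TensorProduct.map f g

@[simp] lemma pw_tmul (f : M →ₗ[k] B) (g : N →ₗ[k] B) (x : M) (y : N) :
    pw f g (x ⊗ₜ y) = f x * g y := rfl

lemma pw_one (f : M →ₗ[k] B) (g : N →ₗ[k] B) (hf : f 1 = 1) (hg : g 1 = 1) :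
    pw f g 1 = 1 := by
  rw [Algebra.TensorProduct.one_def, pw_tmul, hf, hg, mul_one]

lemma pw_mul (f : M →ₗ[k] B) (g : N →ₗ[k] B) (hf : ∀ x y, f (x * y) = f x * f y)
    (hg : ∀ x y, g (x * y) = g x * g y) (hc : ∀ x y, Commute (f x) (g y)) (s t : M ⊗[k] N) :
    pw f g (s * t) = pw f g s * pw f g t := by
  induction s using TensorProduct.induction_on with
  | zero => simp
  | add s s' hs hs' => simp only [add_mul, map_add, hs, hs']
  | tmul x y =>
    induction t using TensorProduct.induction_on with
    | zero => simp
    | add s s' hs hs' => simp only [mul_add, map_add, hs, hs']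
    | tmul x' y' =>
      simp only [tmul_mul_tmul, pw_tmul, hf, hg]
      have := (hc x' y).eq
      simp only [mul_assoc]
      rw [← mul_assoc (f x') (g y), this, mul_assoc]

lemma pw_commute (f : M →ₗ[k] B) (g : N →ₗ[k] B) (z : B) (hf : ∀ x, Commute (f x) z)
    (hg : ∀ x, Commute (g x) z) (s : M ⊗[k] N) : Commute (pw f g s) z := by
  induction s using TensorProduct.induction_on with
  | zero => simp
  | add s s' hs hs' => rw [map_add]; exact hs.add_left hs'
  | tmul x y => exact (hf x).mul_left (hg y)

lemma pw_mem (R : Subalgebra k B) (f : M →ₗ[k] B) (g : N →ₗ[k] B) (hf : ∀ x, f x ∈ R)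
    (hg : ∀ x, g x ∈ R) (s : M ⊗[k] N) : pw f g s ∈ R := by
  induction s using TensorProduct.induction_on with
  | zero => simp
  | add s s' hs hs' => rw [map_add]; exact R.add_mem hs hs'
  | tmul x y => exact R.mul_mem (hf x) (hg y)

lemma pw_map (F : B →ₐ[k] C) (f : M →ₗ[k] B) (g : N →ₗ[k] B) (s : M ⊗[k] N) :
    F (pw f g s) = pw (F.toLinearMap ∘ₗ f) (F.toLinearMap ∘ₗ g) s := by
  induction s using TensorProduct.induction_on with
  | zero => simp
  | add s s' hs hs' => simp only [map_add, hs, hs']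
  | tmul x y => simp

end Pairing

namespace QuasiHopfAlgebra

variable {k H : Type*} [Field k] [Ring H] [Algebra k H] (Q : QuasiHopfAlgebra k H)

section Legs

variable {B C P : Type*} [Ring B] [Algebra k B] [Ring C] [Algebra k C] [AddCommGroup P] [Module k P]

/-- A family of mutually commuting algebra maps `H → B`. -/
structure IsLegs (L : ℕ → H →ₗ[k] B) : Prop where
  one : ∀ i, L i 1 = 1
  mul : ∀ i x y, L i (x * y) = L i x * L i y
  comm : ∀ i j, i ≠ j → ∀ x y, Commute (L i x) (L j y)

/-- The trivial leg `h ↦ ε(h) 1`. -/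
def unitLeg : H →ₗ[k] B := Algebra.linearMap k B ∘ₗ Q.counit.toLinearMap

lemma unitLeg_apply (h : H) : Q.unitLeg (B := B) h = algebraMap k B (Q.counit h) := rfl

/-- The iterated coproduct of `h` with the bracketing `t`, in the legs `L`. -/
def ev (L : ℕ → H →ₗ[k] B) : LegTree → H →ₗ[k] B
  | .one => Q.unitLeg
  | .leaf i => L i
  | .node a b => pw (ev L a) (ev L b) ∘ₗ Q.comul.toLinearMap

/-- `x ⊗ y ⊗ z` placed in the blocks `a`, `b`, `c`. -/
def place (L : ℕ → H →ₗ[k] B) (a b c : LegTree) : H ⊗[k] (H ⊗[k] H) →ₗ[k] B :=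
  pw (Q.ev L a) (pw (Q.ev L b) (Q.ev L c))

/-- The associator in the blocks `a`, `b`, `c`. -/
def ph (L : ℕ → H →ₗ[k] B) (a b c : LegTree) : B := Q.place L a b c Q.phi.val

/-- The inverse associator in the blocks `a`, `b`, `c`. -/
def phi' (L : ℕ → H →ₗ[k] B) (a b c : LegTree) : B := Q.place L a b c Q.phiInv

lemma ev_node (L : ℕ → H →ₗ[k] B) (a b : LegTree) (h : H) :
    Q.ev L (.node a b) h = pw (Q.ev L a) (Q.ev L b) (Q.comul h) := rfl

variable {L : ℕ → H →ₗ[k] B}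

lemma ev_commute (hL : IsLegs L) {a b : LegTree} (h : a.leaves.Disjoint b.leaves) (x y : H) :
    Commute (Q.ev L a x) (Q.ev L b y) := by
  induction a generalizing x with
  | one => exact Algebra.commute_algebraMap_left _ _
  | node a a' iha iha' =>
    simp only [leaves, List.disjoint_append_left] at h
    exact pw_commute _ _ _ (fun x => iha h.1 x) (fun x => iha' h.2 x) _
  | leaf i =>
    induction b generalizing y with
    | one => exact Algebra.commute_algebraMap_right _ _
    | node b b' ihb ihb' =>
      simp only [leaves, List.disjoint_append_right] at h
      exact (pw_commute _ _ _ (fun y => (ihb y h.1).symm) (fun y => (ihb' y h.2).symm) _).symm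
    | leaf j =>
      exact hL.comm _ _ (by rintro rfl; simp [leaves] at h) _ _

lemma ev_one (hL : IsLegs L) (a : LegTree) : Q.ev L a 1 = 1 := by
  induction a with
  | one => simp [ev, unitLeg]
  | leaf i => exact hL.one i
  | node a b iha ihb => rw [ev_node, map_one]; exact pw_one _ _ iha ihb

lemma ev_mul (hL : IsLegs L) {a : LegTree} (h : a.leaves.Nodup) (x y : H) :
    Q.ev L a (x * y) = Q.ev L a x * Q.ev L a y := by
  induction a generalizing x y with
  | one => simp [ev, unitLeg]
  | leaf i => exact hL.mul i x y
  | node a b iha ihb =>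
    simp only [leaves, List.nodup_append'] at h
    rw [ev_node, map_mul]
    exact pw_mul _ _ (iha h.1) (ihb h.2.1) (fun x y => Q.ev_commute hL h.2.2 x y) _ _

section Place
variable {a b c : LegTree}

lemma place_commute (hL : IsLegs L) {d : LegTree} (ha : a.leaves.Disjoint d.leaves)
    (hb : b.leaves.Disjoint d.leaves) (hc : c.leaves.Disjoint d.leaves) (t) (x : H) :
    Commute (Q.place L a b c t) (Q.ev L d x) :=
  pw_commute _ _ _ (fun y => Q.ev_commute hL ha y x)
    (fun _ => pw_commute _ _ _ (fun y => Q.ev_commute hL hb y x)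
      (fun y => Q.ev_commute hL hc y x) _) _

lemma place_one (hL : IsLegs L) : Q.place L a b c 1 = 1 :=
  pw_one _ _ (Q.ev_one hL a) (pw_one _ _ (Q.ev_one hL b) (Q.ev_one hL c))

lemma place_mul (hL : IsLegs L) (h : (a.leaves ++ (b.leaves ++ c.leaves)).Nodup) (s t) :
    Q.place L a b c (s * t) = Q.place L a b c s * Q.place L a b c t := by
  simp only [List.nodup_append', List.disjoint_append_right] at h
  exact pw_mul _ _ (Q.ev_mul hL h.1) (pw_mul _ _ (Q.ev_mul hL h.2.1.1) (Q.ev_mul hL h.2.1.2.1)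
      (Q.ev_commute hL h.2.1.2.2))
    (fun x _ => (pw_commute _ _ _ (fun y => Q.ev_commute hL h.2.2.1.symm y x)
      (fun y => Q.ev_commute hL h.2.2.2.symm y x) _).symm) _ _

lemma ph_mul_phi' (hL : IsLegs L) (h : (a.leaves ++ (b.leaves ++ c.leaves)).Nodup) :
    Q.ph L a b c * Q.phi' L a b c = 1 := by
  rw [ph, phi', ← Q.place_mul hL h, phiInv, Units.mul_inv, Q.place_one hL]

lemma phi'_mul_ph (hL : IsLegs L) (h : (a.leaves ++ (b.leaves ++ c.leaves)).Nodup) :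
    Q.phi' L a b c * Q.ph L a b c = 1 := by
  rw [ph, phi', ← Q.place_mul hL h, phiInv, Units.inv_mul, Q.place_one hL]

lemma place_map_id_comul (t : H ⊗[k] H) :
    Q.place L a b c (Algebra.TensorProduct.map (AlgHom.id k H) Q.comul t) =
      pw (Q.ev L a) (Q.ev L (.node b c)) t := by
  induction t using TensorProduct.induction_on with
  | zero => simp
  | add s s' hs hs' => simp only [map_add, hs, hs']
  | tmul x y => rfl

lemma pw_assoc' {M₁ M₂ M₃ : Type*} [Ring M₁] [Ring M₂] [Ring M₃] [Algebra k M₁] [Algebra k M₂]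
    [Algebra k M₃] (f : M₁ →ₗ[k] B) (g : M₂ →ₗ[k] B) (h : M₃ →ₗ[k] B) (t) :
    pw f (pw g h) (TensorProduct.assoc k M₁ M₂ M₃ t) = pw (pw f g) h t := by
  induction t using TensorProduct.induction_on with
  | zero => simp
  | add s s' hs hs' => simp only [map_add, hs, hs']
  | tmul x y =>
    induction x using TensorProduct.induction_on with
    | zero => simp
    | add s s' hs hs' => simp only [map_add, hs, hs', add_tmul]
    | tmul x z => simp [mul_assoc]

lemma pw_map_map {M₁ M₂ M₃ M₄ : Type*} [Ring M₁] [Ring M₂] [Ring M₃] [Algebra k M₁] [Algebra k M₂]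
    [Algebra k M₃] [Ring M₄] [Algebra k M₄] (f : M₁ →ₗ[k] B) (g : M₂ →ₗ[k] B) (u : M₃ →ₐ[k] M₁)
    (v : M₄ →ₐ[k] M₂) (t) :
    pw f g (Algebra.TensorProduct.map u v t) = pw (f ∘ₗ u.toLinearMap) (g ∘ₗ v.toLinearMap) t := by
  induction t using TensorProduct.induction_on with
  | zero => simp
  | add s s' hs hs' => simp only [map_add, hs, hs']
  | tmul x y => rfl

lemma ph_mul_ev (hL : IsLegs L) (h : (a.leaves ++ (b.leaves ++ c.leaves)).Nodup) (x : H) :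
    Q.ph L a b c * Q.ev L (.node (.node a b) c) x = Q.ev L (.node a (.node b c)) x * Q.ph L a b c := by
  have e := congrArg (· * Q.phi.val) (Q.comul_assoc x)
  simp only [Units.inv_mul_cancel_right] at e
  have e := congrArg (Q.place L a b c) e
  rw [Q.place_mul hL h, Q.place_mul hL h, place_map_id_comul] at e
  have e2 : Q.place L a b c (Algebra.TensorProduct.assoc k k k H H H
        (Algebra.TensorProduct.map Q.comul (AlgHom.id k H) (Q.comul x))) =
      Q.ev L (.node (.node a b) c) x := by
    refine (pw_assoc' (Q.ev L a) (Q.ev L b) (Q.ev L c) _).trans ?_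
    rw [pw_map_map]; rfl
  rw [e2] at e
  exact e.symm

lemma ev_mul_phi' (hL : IsLegs L) (h : (a.leaves ++ (b.leaves ++ c.leaves)).Nodup) (x : H) :
    Q.phi' L a b c * Q.ev L (.node a (.node b c)) x =
      Q.ev L (.node (.node a b) c) x * Q.phi' L a b c := by
  calc _ = Q.phi' L a b c * (Q.ev L (.node a (.node b c)) x * Q.ph L a b c) * Q.phi' L a b c := by
        rw [mul_assoc, mul_assoc, Q.ph_mul_phi' hL h, mul_one]
    _ = _ := by rw [← Q.ph_mul_ev hL h, ← mul_assoc, Q.phi'_mul_ph hL h, one_mul]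

lemma pw_comp_map {M₁ M₂ M₃ M₄ : Type*} [Ring M₁] [Ring M₂] [Ring M₃] [Algebra k M₁] [Algebra k M₂]
    [Algebra k M₃] [Ring M₄] [Algebra k M₄] (f : M₁ →ₗ[k] B) (g : M₂ →ₗ[k] B) (u : M₃ →ₐ[k] M₁)
    (v : M₄ →ₐ[k] M₂) :
    pw f g ∘ₗ (Algebra.TensorProduct.map u v).toLinearMap =
      pw (f ∘ₗ u.toLinearMap) (g ∘ₗ v.toLinearMap) :=
  LinearMap.ext fun _ => pw_map_map _ _ _ _ _

lemma ph_pentagon (hL : IsLegs L) {d : LegTree}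
    (h : (a.leaves ++ (b.leaves ++ (c.leaves ++ d.leaves))).Nodup) :
    Q.ph L a b (.node c d) * Q.ph L (.node a b) c d =
      Q.ph L b c d * Q.ph L a (.node b c) d * Q.ph L a b c := by
  simp only [List.nodup_append', List.disjoint_append_right] at h
  have hbcd := Q.place_mul (a := b) (b := c) (c := d) hL
    (by simp only [List.nodup_append', List.disjoint_append_right]; tauto)
  have hm := pw_mul (Q.ev L a) (Q.place L b c d) (Q.ev_mul hL h.1) hbcd
    (fun x t => (Q.place_commute hL h.2.2.1.symm h.2.2.2.1.symm h.2.2.2.2.symm t x).symm)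
  have e := congrArg (pw (Q.ev L a) (Q.place L b c d)) Q.pentagon
  rw [hm, hm, hm, pw_map_map, pw_map_map, pw_map_map, pw_tmul, Q.ev_one hL, one_mul] at e
  have e1 : pw (Q.ev L a) (Q.place L b c d) (Algebra.TensorProduct.assoc k k k H H (H ⊗[k] H)
        (Algebra.TensorProduct.map Q.comul (AlgHom.id k (H ⊗[k] H)) Q.phi.val)) =
        Q.ph L (.node a b) c d := by
    refine (pw_assoc' (Q.ev L a) (Q.ev L b) (pw (Q.ev L c) (Q.ev L d)) _).trans ?_
    rw [pw_map_map]; rfl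
  have e2 : Q.place L b c d ∘ₗ ((Algebra.TensorProduct.assoc k k k H H H).toAlgHom.comp
        (Algebra.TensorProduct.map Q.comul (AlgHom.id k H))).toLinearMap =
        pw (Q.ev L (.node b c)) (Q.ev L d) := by
    refine LinearMap.ext fun x => ?_
    exact (pw_assoc' (Q.ev L b) (Q.ev L c) (Q.ev L d) _).trans (pw_map_map _ _ _ _ _)
  have e3 : Q.place L b c d ∘ₗ (Algebra.TensorProduct.map (AlgHom.id k H)
          (includeLeft : H →ₐ[k] H ⊗[k] H)).toLinearMap =
        pw (Q.ev L b) (Q.ev L c) := by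
    rw [place, pw_comp_map]
    congr 1
    ext x
    simp [Q.ev_one hL]
  have e4 : Q.place L b c d ∘ₗ (Algebra.TensorProduct.map (AlgHom.id k H) Q.comul).toLinearMap =
        pw (Q.ev L b) (Q.ev L (.node c d)) := by
    rw [place, pw_comp_map]; rfl
  rw [e1, e2, e3, e4] at e
  exact e

lemma pw_unit_left (t : H ⊗[k] H) (f : H →ₗ[k] B) : pw Q.unitLeg f t =
    f (TensorProduct.lid k H (Algebra.TensorProduct.map Q.counit (AlgHom.id k H) t)) := by
  induction t using TensorProduct.induction_on with
  | zero => simp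
  | add s s' hs hs' => simp only [map_add, hs, hs']
  | tmul x y => simp [unitLeg_apply, ← Algebra.smul_def]

lemma pw_unit_right (t : H ⊗[k] H) (f : H →ₗ[k] B) : pw f Q.unitLeg t =
    f (TensorProduct.rid k H (Algebra.TensorProduct.map (AlgHom.id k H) Q.counit t)) := by
  induction t using TensorProduct.induction_on with
  | zero => simp
  | add s s' hs hs' => simp only [map_add, hs, hs']
  | tmul x y => simp [unitLeg_apply, ← Algebra.commutes, ← Algebra.smul_def]

lemma ev_one_node (a : LegTree) : Q.ev L (.node .one a) = Q.ev L a :=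
  LinearMap.ext fun x => by rw [ev_node, ev, pw_unit_left, counit_left]

lemma ev_node_one (a : LegTree) : Q.ev L (.node a .one) = Q.ev L a :=
  LinearMap.ext fun x => by
    rw [ev_node]; exact (pw_unit_right _ _ _).trans (by rw [counit_right])

lemma ph_mid_one (hL : IsLegs L) : Q.ph L a .one b = 1 := by
  have e := congrArg (pw (Q.ev L a) (Q.ev L b)) Q.counit_phi
  rw [pw_one _ _ (Q.ev_one hL a) (Q.ev_one hL b), pw_map_map] at e
  rw [← e, ph, place]
  congr 2
  refine LinearMap.ext fun t => ?_
  exact pw_unit_left _ _ _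

lemma ph_isUnit (hL : IsLegs L) (h : (a.leaves ++ (b.leaves ++ c.leaves)).Nodup) :
    IsUnit (Q.ph L a b c) :=
  ⟨⟨_, _, Q.ph_mul_phi' hL h, Q.phi'_mul_ph hL h⟩, rfl⟩

lemma ph_congr {a' b' c' : LegTree} (ha : Q.ev L a = Q.ev L a') (hb : Q.ev L b = Q.ev L b')
    (hc : Q.ev L c = Q.ev L c') : Q.ph L a b c = Q.ph L a' b' c' := by
  rw [ph, ph, place, place, ha, hb, hc]

lemma ph_one_left (hL : IsLegs L) (h : (a.leaves ++ b.leaves).Nodup) : Q.ph L .one a b = 1 := by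
  have e := Q.ph_pentagon (a := .one) (b := .one) (c := a) (d := b) hL h
  rw [Q.ph_mid_one hL, one_mul, Q.ph_mid_one hL, mul_one,
    Q.ph_congr (a := .node .one .one) (Q.ev_one_node _) rfl rfl,
    Q.ph_congr (b := .node .one a) rfl (Q.ev_one_node _) rfl] at e
  have hu := Q.ph_isUnit (a := .one) hL h
  exact hu.mul_right_cancel (by rw [one_mul]; exact e.symm)

end Place

end Legs
end QuasiHopfAlgebra

open LegTree

/-! ### Coherence of associators -/

namespace LegTree

lemma leaves_comb (t r : LegTree) : (t.comb r).leaves = t.leaves ++ r.leaves := by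
  induction t generalizing r with
  | one => rfl
  | leaf i => rfl
  | node a b iha ihb => simp [comb, leaves, iha, ihb]

lemma comb_eq (t r : LegTree) :
    t.comb r = t.leaves.foldr (fun i u => node (leaf i) u) r := by
  induction t generalizing r with
  | one => rfl
  | leaf i => rfl
  | node a b iha ihb => simp [comb, leaves, iha, ihb]

end LegTree

section
variable {k : Type*} [Field k] {M N B C : Type*} [Ring M] [Algebra k M] [Ring N] [Algebra k N]
  [Ring B] [Algebra k B]

lemma pw_conj {f f' : M →ₗ[k] B} {g g' : N →ₗ[k] B} {X : B} (hf : ∀ x, f x * X = X * f' x)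
    (hg : ∀ x, g x * X = X * g' x) (t : M ⊗[k] N) : pw f g t * X = X * pw f' g' t := by
  induction t using TensorProduct.induction_on with
  | zero => simp
  | add s s' hs hs' => simp only [map_add, mul_add, add_mul, hs, hs']
  | tmul x y => rw [pw_tmul, pw_tmul, mul_assoc, hg, ← mul_assoc, hf, mul_assoc]
end

namespace QuasiHopfAlgebra

variable {k H : Type*} [Field k] [Ring H] [Algebra k H] (Q : QuasiHopfAlgebra k H)

variable {B C P : Type*} [Ring B] [Algebra k B] [Ring C] [Algebra k C] [AddCommGroup P] [Module k P]

/-- `AssocPath L s t X`: the element `X` is a composite of associators which leads from the bracketing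
`s` to the bracketing `t`. -/
inductive AssocPath (L : ℕ → H →ₗ[k] B) : LegTree → LegTree → B → Prop
  | refl (t) : AssocPath L t t 1
  | assoc (a b c) : AssocPath L (.node (.node a b) c) (.node a (.node b c)) (Q.ph L a b c)
  | assocInv (a b c) : AssocPath L (.node a (.node b c)) (.node (.node a b) c) (Q.phi' L a b c)
  | unitLeft (t) : AssocPath L (.node .one t) t 1
  | unitLeftInv (t) : AssocPath L t (.node .one t) 1
  | unitRight (t) : AssocPath L (.node t .one) t 1
  | unitRightInv (t) : AssocPath L t (.node t .one) 1
  | left {a a' X} (b) (h : AssocPath L a a' X) : AssocPath L (.node a b) (.node a' b) X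
  | right {b b' X} (a) (h : AssocPath L b b' X) : AssocPath L (.node a b) (.node a b') X
  | trans {s t u X Y} (h : AssocPath L s t X) (h' : AssocPath L t u Y) : AssocPath L s u (Y * X)

/-- The composite of associators from `t` followed by `r` to the right-nested bracketing. -/
def normal (L : ℕ → H →ₗ[k] B) : LegTree → LegTree → B
  | .one, _ => 1
  | .leaf _, _ => 1
  | .node a b, r => normal L a (b.comb r) * normal L b r * Q.ph L a b r

/-- The canonical composite of associators from the bracketing `s` to the bracketing `t`. -/
def can (L : ℕ → H →ₗ[k] B) (s t : LegTree) : B :=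
  open Classical in if h : ∃ X, Q.AssocPath L s t X then h.choose else 1

variable {L : ℕ → H →ₗ[k] B} {Q}

namespace AssocPath
variable {s t u : LegTree} {X Y : B}

lemma leaves_eq (h : Q.AssocPath L s t X) : s.leaves = t.leaves := by
  induction h <;> simp_all [leaves]

lemma exists_symm (h : Q.AssocPath L s t X) : ∃ Y, Q.AssocPath L t s Y := by
  induction h with
  | refl t => exact ⟨_, .refl t⟩
  | assoc a b c => exact ⟨_, .assocInv a b c⟩
  | assocInv a b c => exact ⟨_, .assoc a b c⟩
  | unitLeft a => exact ⟨_, .unitLeftInv a⟩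
  | unitLeftInv a => exact ⟨_, .unitLeft a⟩
  | unitRight a => exact ⟨_, .unitRightInv a⟩
  | unitRightInv a => exact ⟨_, .unitRight a⟩
  | left b _ ih => exact ⟨_, .left b ih.choose_spec⟩
  | right b _ ih => exact ⟨_, .right b ih.choose_spec⟩
  | trans _ _ ih ih' => exact ⟨_, .trans ih'.choose_spec ih.choose_spec⟩

lemma commute (hL : IsLegs L) (h : Q.AssocPath L s t X) {d : LegTree} (hd : s.leaves.Disjoint d.leaves)
    (x : H) : Commute X (Q.ev L d x) := by
  induction h with
  | assoc a b c =>
    simp only [leaves, List.disjoint_append_left] at hd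
    exact Q.place_commute hL hd.1.1 hd.1.2 hd.2 _ _
  | assocInv a b c =>
    simp only [leaves, List.disjoint_append_left] at hd
    exact Q.place_commute hL hd.1 hd.2.1 hd.2.2 _ _
  | left b _ ih => simp only [leaves, List.disjoint_append_left] at hd; exact ih hd.1
  | right b _ ih => simp only [leaves, List.disjoint_append_left] at hd; exact ih hd.2
  | trans h h' ih ih' => exact (ih' (h.leaves_eq ▸ hd)).mul_left (ih hd)
  | _ => exact Commute.one_left _

/-- Naturality of the associators with respect to the iterated coproducts. -/
lemma mul_ev (hL : IsLegs L) (h : Q.AssocPath L s t X) (hs : s.leaves.Nodup) (x : H) :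
    X * Q.ev L s x = Q.ev L t x * X := by
  induction h generalizing x with
  | refl => simp
  | assoc a b c => exact Q.ph_mul_ev hL (by simpa [leaves] using hs) x
  | assocInv a b c => exact Q.ev_mul_phi' hL (by simpa [leaves] using hs) x
  | unitLeft a => simp [ev_one_node]
  | unitLeftInv a => simp [ev_one_node]
  | unitRight a => simp [ev_node_one]
  | unitRightInv a => simp [ev_node_one]
  | left b h ih =>
    simp only [leaves, List.nodup_append'] at hs
    exact (pw_conj (fun x => (ih hs.1 x).symm)
      (fun x => (h.commute hL hs.2.2 x).symm) _).symm
  | right b h ih =>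
    simp only [leaves, List.nodup_append'] at hs
    exact (pw_conj (fun x => (h.commute hL hs.2.2.symm x).symm) (fun x => (ih hs.2.1 x).symm) _).symm
  | trans h h' ih ih' =>
    rw [mul_assoc, ih hs, ← mul_assoc, ih' (h.leaves_eq ▸ hs), mul_assoc]

lemma comb (t r : LegTree) : Q.AssocPath L (.node t r) (t.comb r) (Q.normal L t r) := by
  induction t generalizing r with
  | one => exact .unitLeft r
  | leaf i => exact .refl _
  | node a b iha ihb =>
    rw [normal, mul_assoc]
    exact .trans (.trans (.assoc a b r) (.right a (ihb r))) (iha _)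

lemma comb_one (t : LegTree) : Q.AssocPath L t (t.comb .one) (Q.normal L t .one) := by
  simpa using AssocPath.trans (.unitRightInv t) (AssocPath.comb (Q := Q) (L := L) t .one)

lemma exists_of_leaves_eq (Q : QuasiHopfAlgebra k H) (L : ℕ → H →ₗ[k] B)
    (h : s.leaves = t.leaves) : ∃ X, Q.AssocPath L s t X := by
  obtain ⟨Y, hY⟩ := (comb_one (Q := Q) (L := L) t).exists_symm
  rw [comb_eq, ← h, ← comb_eq] at hY
  exact ⟨_, .trans (comb_one s) hY⟩

end AssocPath

open AssocPath

lemma ph_conj {a b c a' b' c' : LegTree} {X : B}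
    (ha : ∀ x, Q.ev L a x * X = X * Q.ev L a' x) (hb : ∀ x, Q.ev L b x * X = X * Q.ev L b' x)
    (hc : ∀ x, Q.ev L c x * X = X * Q.ev L c' x) : Q.ph L a b c * X = X * Q.ph L a' b' c' :=
  pw_conj ha (pw_conj hb hc) _

lemma normal_isUnit (hL : IsLegs L) {t r : LegTree} (h : (t.leaves ++ r.leaves).Nodup) :
    IsUnit (Q.normal L t r) := by
  induction t generalizing r with
  | one => exact isUnit_one
  | leaf => exact isUnit_one
  | node a b iha ihb =>
    simp only [leaves, List.append_assoc] at h
    refine ((iha ?_).mul (ihb ?_)).mul (Q.ph_isUnit hL h)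
    · simpa [leaves_comb] using h
    · exact h.of_append_right

/-- Coherence: a composite of associators depends only on its source and its target. -/
lemma AssocPath.normal_mul (hL : IsLegs L) {s t : LegTree} {X : B} (h : Q.AssocPath L s t X) (r : LegTree)
    (hs : (s.leaves ++ r.leaves).Nodup) : Q.normal L t r * X = Q.normal L s r := by
  have key : ∀ a b c r : LegTree, (a.leaves ++ (b.leaves ++ (c.leaves ++ r.leaves))).Nodup →
      Q.normal L (.node a (.node b c)) r * Q.ph L a b c = Q.normal L (.node (.node a b) c) r := by
    intro a b c r h
    simp only [normal, LegTree.comb]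
    have h1 : Q.ph L a b (c.comb r) * Q.normal L c r = Q.normal L c r * Q.ph L a b (.node c r) := by
      have hd := h
      simp only [List.nodup_append', List.disjoint_append_right] at hd
      refine ph_conj (fun x => ?_) (fun x => ?_)
        (fun x => ((AssocPath.comb c r).mul_ev hL (by simpa [leaves] using h.of_append_right.of_append_right) x).symm)
      · exact ((AssocPath.comb c r).commute hL (by simp [leaves]; tauto) x).symm
      · exact ((AssocPath.comb c r).commute hL (by simp [leaves]; tauto) x).symm
    have h2 := Q.ph_pentagon hL h
    simp only [mul_assoc] at h2 ⊢
    rw [← mul_assoc (Q.ph L a b (c.comb r)), h1, mul_assoc, h2]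
  induction h generalizing r with
  | refl => simp
  | assoc a b c => exact key a b c r (by simpa [leaves] using hs)
  | assocInv a b c =>
    have h' : (a.leaves ++ (b.leaves ++ (c.leaves ++ r.leaves))).Nodup := by simpa [leaves] using hs
    rw [← key a b c r h', mul_assoc, Q.ph_mul_phi' hL, mul_one]
    rw [← List.append_assoc, ← List.append_assoc] at h'
    simpa using h'.of_append_left
  | unitLeft a => simp [normal, Q.ph_one_left (a := a) (b := r) hL hs]
  | unitLeftInv a => simp [normal, Q.ph_one_left (a := a) (b := r) hL hs]
  | unitRight a => simp [normal, Q.ph_mid_one hL, LegTree.comb]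
  | unitRightInv a => simp [normal, Q.ph_mid_one hL, LegTree.comb]
  | @left a a' X b h ih =>
    simp only [leaves, List.append_assoc] at hs
    have hs' := hs
    simp only [List.nodup_append', List.disjoint_append_right] at hs
    have h1 : Q.ph L a' b r * X = X * Q.ph L a b r :=
      ph_conj (fun x => (h.mul_ev hL hs.1 x).symm) (fun x => (h.commute hL hs.2.2.1 x).symm)
        (fun x => (h.commute hL hs.2.2.2 x).symm)
    have h2 : Q.normal L b r * X = X * Q.normal L b r := by
      have : ∀ b r : LegTree, a.leaves.Disjoint b.leaves → a.leaves.Disjoint r.leaves →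
          Q.normal L b r * X = X * Q.normal L b r := by
        intro b
        induction b with
        | one => simp [normal]
        | leaf => simp [normal]
        | node c d ihc ihd =>
          intro r hb hr
          simp only [leaves, List.disjoint_append_right] at hb
          have h3 : Q.ph L c d r * X = X * Q.ph L c d r :=
            ph_conj (fun x => (h.commute hL hb.1 x).symm) (fun x => (h.commute hL hb.2 x).symm)
              (fun x => (h.commute hL hr x).symm)
          rw [normal, mul_assoc, h3, ← mul_assoc, mul_assoc (Q.normal L c _), ihd _ hb.2 hr,
            ← mul_assoc, ihc _ hb.1 (by simp [leaves_comb]; tauto)]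
          simp only [mul_assoc]
      exact this b r hs.2.2.1 hs.2.2.2
    rw [normal, normal, mul_assoc, h1, ← mul_assoc, mul_assoc (Q.normal L a' _), h2, ← mul_assoc,
      ih _ (by simpa [leaves_comb] using hs')]
  | @right b b' X a h ih =>
    simp only [leaves, List.append_assoc] at hs
    have hs' := hs
    simp only [List.nodup_append', List.disjoint_append_right] at hs
    have h1 : Q.ph L a b' r * X = X * Q.ph L a b r :=
      ph_conj (fun x => (h.commute hL hs.2.2.1.symm x).symm) (fun x => (h.mul_ev hL hs.2.1.1 x).symm)
        (fun x => (h.commute hL hs.2.1.2.2 x).symm)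
    rw [normal, normal, mul_assoc, h1, ← mul_assoc, mul_assoc (Q.normal L a _), ih r hs'.of_append_right,
      comb_eq, comb_eq b, h.leaves_eq]
  | trans h h' ih ih' =>
    rw [← mul_assoc, ih' r (h.leaves_eq ▸ hs), ih r hs]

section Can
variable {s t u a a' b b' c : LegTree}

/-- Side condition for manipulating the canonical composite `can L s t`. -/
def SameLegs (s t : LegTree) : Prop := s.leaves = t.leaves ∧ s.leaves.Nodup

instance (s t : LegTree) : Decidable (SameLegs s t) := by unfold SameLegs; infer_instance

lemma can_path (h : s.leaves = t.leaves) : Q.AssocPath L s t (Q.can L s t) := by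
  have h := exists_of_leaves_eq Q L h
  rw [can, dif_pos h]
  exact h.choose_spec

lemma AssocPath.can_eq (hL : IsLegs L) {X : B} (h : Q.AssocPath L s t X) (hs : s.leaves.Nodup) :
    Q.can L s t = X := by
  have hs' : (s.leaves ++ LegTree.one.leaves).Nodup := by simpa [leaves] using hs
  have h1 := h.normal_mul hL .one hs'
  have h2 := (can_path (Q := Q) (L := L) h.leaves_eq).normal_mul hL .one hs'
  have hu : IsUnit (Q.normal L t .one) := normal_isUnit hL (h.leaves_eq ▸ hs')
  exact hu.mul_left_cancel (h2.trans h1.symm)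

lemma can_self (hL : IsLegs L) (h : s.leaves.Nodup) : Q.can L s s = 1 :=
  (AssocPath.refl s).can_eq hL h

lemma can_trans (hL : IsLegs L) (t : LegTree) (h : SameLegs s t) (h' : t.leaves = u.leaves) :
    Q.can L t u * Q.can L s t = Q.can L s u :=
  ((AssocPath.trans (can_path h.1) (can_path h')).can_eq hL h.2).symm

lemma can_left (hL : IsLegs L) (h : a.leaves = a'.leaves) (hn : (LegTree.node a b).leaves.Nodup) :
    Q.can L (.node a b) (.node a' b) = Q.can L a a' :=
  (AssocPath.left b (can_path h)).can_eq hL hn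

lemma can_right (hL : IsLegs L) (h : b.leaves = b'.leaves) (hn : (LegTree.node a b).leaves.Nodup) :
    Q.can L (.node a b) (.node a b') = Q.can L b b' :=
  (AssocPath.right a (can_path h)).can_eq hL hn

lemma can_assoc (hL : IsLegs L) (h : (a.leaves ++ (b.leaves ++ c.leaves)).Nodup) :
    Q.can L (.node (.node a b) c) (.node a (.node b c)) = Q.ph L a b c :=
  (AssocPath.assoc a b c).can_eq hL (by simpa [leaves] using h)

lemma can_assocInv (hL : IsLegs L) (h : (a.leaves ++ (b.leaves ++ c.leaves)).Nodup) :
    Q.can L (.node a (.node b c)) (.node (.node a b) c) = Q.phi' L a b c :=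
  (AssocPath.assocInv a b c).can_eq hL (by simpa [leaves] using h)

lemma can_mul_ev (hL : IsLegs L) (h : SameLegs s t) (x : H) :
    Q.can L s t * Q.ev L s x = Q.ev L t x * Q.can L s t :=
  (can_path h.1).mul_ev hL h.2 x

lemma can_commute (hL : IsLegs L) (h : s.leaves = t.leaves) (hu : s.leaves.Disjoint u.leaves)
    (x : H) : Commute (Q.can L s t) (Q.ev L u x) :=
  (can_path h).commute hL hu x

lemma path_strip (t : LegTree) : Q.AssocPath L t t.strip 1 := by
  induction t with
  | one => exact .refl _
  | leaf => exact .refl _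
  | node a b iha ihb =>
    have h : Q.AssocPath L (.node a b) (.node a.strip b.strip) 1 := by
      simpa using AssocPath.trans (.left b iha) (.right _ ihb)
    rw [strip]
    split_ifs with h1 h2
    · rw [h1] at h; simpa using AssocPath.trans h (.unitLeft _)
    · rw [h2] at h; simpa using AssocPath.trans h (.unitRight _)
    · exact h

lemma path_strip_symm (t : LegTree) : Q.AssocPath L t.strip t 1 := by
  induction t with
  | one => exact .refl _
  | leaf => exact .refl _
  | node a b iha ihb =>
    have h : Q.AssocPath L (.node a.strip b.strip) (.node a b) 1 := by
      simpa using AssocPath.trans (.left _ iha) (.right _ ihb)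
    rw [strip]
    split_ifs with h1 h2
    · rw [h1] at h; simpa using AssocPath.trans (.unitLeftInv _) h
    · rw [h2] at h; simpa using AssocPath.trans (.unitRightInv _) h
    · exact h

lemma ev_strip (hL : IsLegs L) (h : s.leaves.Nodup) : Q.ev L s.strip = Q.ev L s :=
  LinearMap.ext fun x => by
    simpa using ((path_strip (Q := Q) (L := L) s).mul_ev hL h x).symm

lemma can_strip (hL : IsLegs L) (h : SameLegs s t) : Q.can L s.strip t.strip = Q.can L s t := by
  have := AssocPath.trans (.trans (path_strip_symm (Q := Q) (L := L) s) (can_path h.1)) (path_strip t)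
  simpa using this.can_eq hL ((path_strip (Q := Q) (L := L) s).leaves_eq ▸ h.2)

end Can

section Functoriality
variable {s t : LegTree} {X : B}

lemma ev_map (F : B →ₐ[k] C) (t : LegTree) (x : H) :
    F (Q.ev L t x) = Q.ev (fun i => F.toLinearMap ∘ₗ L i) t x := by
  induction t generalizing x with
  | one => simp [ev, unitLeg_apply]
  | leaf => rfl
  | node a b iha ihb =>
    rw [ev_node, ev_node, pw_map]
    congr 2 <;> exact LinearMap.ext (by assumption)

lemma place_map (F : B →ₐ[k] C) (a b c : LegTree) (x) :
    F (Q.place L a b c x) = Q.place (fun i => F.toLinearMap ∘ₗ L i) a b c x := by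
  have h : ∀ t, F.toLinearMap ∘ₗ Q.ev L t = Q.ev (fun i => F.toLinearMap ∘ₗ L i) t :=
    fun t => LinearMap.ext fun x => ev_map F t x
  have h2 : F.toLinearMap ∘ₗ pw (Q.ev L b) (Q.ev L c) =
      pw (F.toLinearMap ∘ₗ Q.ev L b) (F.toLinearMap ∘ₗ Q.ev L c) :=
    LinearMap.ext fun _ => pw_map _ _ _ _
  rw [place, pw_map, h2, h, h, h]; rfl

lemma AssocPath.map (F : B →ₐ[k] C) (h : Q.AssocPath L s t X) :
    Q.AssocPath (fun i => F.toLinearMap ∘ₗ L i) s t (F X) := by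
  induction h with
  | refl t => rw [map_one]; exact .refl t
  | assoc a b c => rw [ph, place_map]; exact .assoc a b c
  | assocInv a b c => rw [phi', place_map]; exact .assocInv a b c
  | unitLeft a => rw [map_one]; exact .unitLeft a
  | unitLeftInv a => rw [map_one]; exact .unitLeftInv a
  | unitRight a => rw [map_one]; exact .unitRight a
  | unitRightInv a => rw [map_one]; exact .unitRightInv a
  | left b _ ih => exact .left b ih
  | right b _ ih => exact .right b ih
  | trans _ _ ih ih' => rw [map_mul]; exact .trans ih ih'

lemma ev_mem (R : Subalgebra k B) (h : ∀ i ∈ t.leaves, ∀ x, L i x ∈ R) (x : H) :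
    Q.ev L t x ∈ R := by
  induction t generalizing x with
  | one => exact R.algebraMap_mem _
  | leaf i => exact h i (by simp [leaves]) x
  | node a b iha ihb =>
    simp only [leaves, List.mem_append] at h
    exact pw_mem R _ _ (iha fun i hi => h i (.inl hi)) (ihb fun i hi => h i (.inr hi)) _

lemma AssocPath.mem (R : Subalgebra k B) (h : Q.AssocPath L s t X)
    (hR : ∀ i ∈ s.leaves, ∀ x, L i x ∈ R) : X ∈ R := by
  induction h with
  | assoc a b c =>
    simp only [leaves, List.mem_append] at hR
    exact pw_mem R _ _ (ev_mem R fun i hi => hR i (by tauto))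
      (pw_mem R _ _ (ev_mem R fun i hi => hR i (by tauto)) (ev_mem R fun i hi => hR i (by tauto))) _
  | assocInv a b c =>
    simp only [leaves, List.mem_append] at hR
    exact pw_mem R _ _ (ev_mem R fun i hi => hR i (by tauto))
      (pw_mem R _ _ (ev_mem R fun i hi => hR i (by tauto)) (ev_mem R fun i hi => hR i (by tauto))) _
  | left b _ ih => exact ih fun i hi => hR i (by simp [leaves, hi])
  | right b _ ih => exact ih fun i hi => hR i (by simp [leaves, hi])
  | trans h h' ih ih' => exact R.mul_mem (ih' (h.leaves_eq ▸ hR)) (ih hR)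
  | _ => exact R.one_mem

lemma ev_bind {L' : ℕ → H →ₗ[k] B} (f : ℕ → LegTree)
    (h : ∀ i ∈ t.leaves, Q.ev L (f i) = L' i) : Q.ev L (t.bind f) = Q.ev L' t := by
  induction t with
  | one => rfl
  | leaf i => exact h i (by simp [leaves])
  | node a b iha ihb =>
    simp only [leaves, List.mem_append] at h
    rw [LegTree.bind, ev, ev, iha fun i hi => h i (.inl hi), ihb fun i hi => h i (.inr hi)]

lemma AssocPath.bind {L' : ℕ → H →ₗ[k] B} (f : ℕ → LegTree) (hp : Q.AssocPath L' s t X)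
    (h : ∀ i ∈ s.leaves, Q.ev L (f i) = L' i) : Q.AssocPath L (s.bind f) (t.bind f) X := by
  induction hp with
  | refl t => exact .refl _
  | assoc a b c =>
    simp only [leaves, List.mem_append] at h
    rw [ph, place, ← ev_bind f fun i hi => h i (by tauto), ← ev_bind f fun i hi => h i (by tauto),
      ← ev_bind f fun i hi => h i (by tauto)]
    exact .assoc _ _ _
  | assocInv a b c =>
    simp only [leaves, List.mem_append] at h
    rw [phi', place, ← ev_bind f fun i hi => h i (by tauto), ← ev_bind f fun i hi => h i (by tauto),
      ← ev_bind f fun i hi => h i (by tauto)]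
    exact .assocInv _ _ _
  | unitLeft a => exact .unitLeft _
  | unitLeftInv a => exact .unitLeftInv _
  | unitRight a => exact .unitRight _
  | unitRightInv a => exact .unitRightInv _
  | left b _ ih => exact .left _ (ih fun i hi => h i (by simp [leaves, hi]))
  | right b _ ih => exact .right _ (ih fun i hi => h i (by simp [leaves, hi]))
  | trans h1 h2 ih ih' => exact .trans (ih h) (ih' (h1.leaves_eq ▸ h))

end Functoriality

/-! ### Removing blocks of legs -/

section Kill
variable {s t b : LegTree}

/-- The legs in which the block `b` has become the leg `0`. -/
def blockLegs (Q : QuasiHopfAlgebra k H) (L : ℕ → H →ₗ[k] B) (b : LegTree) (i : ℕ) : H →ₗ[k] B :=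
  if i = 0 then Q.ev L b else if i ∈ b.leaves then Q.unitLeg else L i

/-- The legs in which the block `b` has become trivial. -/
def deadLegs (Q : QuasiHopfAlgebra k H) (L : ℕ → H →ₗ[k] B) (b : LegTree) (i : ℕ) : H →ₗ[k] B :=
  if i = 0 then Q.unitLeg else if i ∈ b.leaves then Q.unitLeg else L i

lemma isLegs_unit : Q.unitLeg (B := B) 1 = 1 ∧
    (∀ x y, Q.unitLeg (B := B) (x * y) = Q.unitLeg x * Q.unitLeg y) ∧
    (∀ x (z : B), Commute (Q.unitLeg x) z) :=
  ⟨by simp [unitLeg_apply], by simp [unitLeg_apply], fun _ _ => Algebra.commute_algebraMap_left _ _⟩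

/-- `R` relates elements of `B` in which the block `b` occurs to those in which it is trivial. -/
structure IsKill (Q : QuasiHopfAlgebra k H) (L : ℕ → H →ₗ[k] B) (b : LegTree)
    (R : Subalgebra k (B × B)) : Prop where
  block : ∀ x, (Q.ev L b x, algebraMap k B (Q.counit x)) ∈ R
  other : ∀ i ∉ b.leaves, ∀ x, (L i x, L i x) ∈ R

lemma contains_nodup_bind (h : Contains b t) (hb : b.leaves.Nodup) : t.leaves.Nodup := by
  have key : ∀ u : LegTree, u.leaves.Nodup → (∀ i ∈ u.leaves, i ∉ b.leaves) →
      (u.bind fun i => if i = 0 then b else leaf i).leaves.Nodup := by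
    intro u
    induction u with
    | one => simp [LegTree.bind, leaves]
    | leaf i => intro _ _; simp only [LegTree.bind]; split_ifs; exacts [hb, by simp [leaves]]
    | node a c iha ihc =>
      intro hn hd
      simp only [leaves, List.nodup_append', List.mem_append] at hn hd
      simp only [LegTree.bind, leaves, List.nodup_append']
      refine ⟨iha hn.1 fun i hi => hd i (.inl hi), ihc hn.2.1 fun i hi => hd i (.inr hi), ?_⟩
      have hmem : ∀ (u : LegTree) i, i ∈ (u.bind fun i => if i = 0 then b else leaf i).leaves →
          i ∈ u.leaves ∨ (0 ∈ u.leaves ∧ i ∈ b.leaves) := by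
        intro u i
        induction u with
        | one => simp [LegTree.bind, leaves]
        | leaf j =>
          simp only [LegTree.bind]; split_ifs with hj
          · subst hj; simp only [leaves]; intro h; right; exact ⟨by simp, h⟩
          · intro h; exact .inl h
        | node a c iha ihc =>
          simp only [LegTree.bind, leaves, List.mem_append]
          tauto
      intro i hi hi'
      rcases hmem _ _ hi with h1 | h1 <;> rcases hmem _ _ hi' with h2 | h2
      · exact hn.2.2 h1 h2
      · exact hd i (.inl h1) h2.2
      · exact hd i (.inr h2) h1.2
      · exact hn.2.2 h1.1 h2.1
  rw [← h.1]
  exact key _ h.2.1 h.2.2.2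

section
variable {R : Subalgebra k (B × B)}

lemma IsKill.leg_mem (hR : IsKill Q L b R) (i : ℕ) (x : H) :
    ((blockLegs Q L b i).prod (deadLegs Q L b i)) x ∈ R := by
  simp only [blockLegs, deadLegs, LinearMap.prod_apply]
  split_ifs with h1 h2
  · exact hR.block x
  · exact R.algebraMap_mem (Q.counit x)
  · exact hR.other i h2 x

lemma contains_ev_eq (ht : Contains b t) :
    Q.ev (blockLegs Q L b) (collapse b t) = Q.ev L t ∧
      ∀ i ∈ (collapse b t).leaves, Q.ev L (if i = 0 then b else leaf i) = blockLegs Q L b i := by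
  have : ∀ i ∈ (collapse b t).leaves,
      Q.ev L (if i = 0 then b else leaf i) = blockLegs Q L b i := by
    intro i hi
    unfold blockLegs
    split_ifs with h1 h2
    · rfl
    · exact absurd h2 (ht.2.2.2 i hi)
    · rfl
  refine ⟨?_, this⟩
  conv_rhs => rw [← ht.1]
  exact (ev_bind _ this).symm

lemma contains_dead_eq (ht : Contains b t) :
      ∀ i ∈ (collapse b t).leaves,
        Q.ev L (if i = 0 then .one else leaf i) = deadLegs Q L b i := by
  intro i hi
  unfold deadLegs
  split_ifs with h1 h2
  · rfl
  · exact absurd h2 (ht.2.2.2 i hi)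
  · rfl

lemma leaves_bind_nodup (u : LegTree) (h : u.leaves.Nodup) :
    (u.bind fun i => if i = 0 then .one else leaf i).leaves.Nodup := by
  have hl : (u.bind fun i => if i = 0 then .one else leaf i).leaves =
      u.leaves.filter (· ≠ 0) := by
    clear h
    induction u with
    | one => rfl
    | leaf i =>
      simp only [LegTree.bind]
      split_ifs with hi <;> simp [leaves, hi]
    | node a c iha ihc => simp [LegTree.bind, leaves, iha, ihc]
  rw [hl]; exact h.filter _

lemma IsKill.ev_mem (hR : IsKill Q L b R) (hL : IsLegs L) (ht : Contains b t) (x : H) :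
    (Q.ev L t x, Q.ev L (kill b t) x) ∈ R := by
  have h := QuasiHopfAlgebra.ev_mem (Q := Q) (t := collapse b t)
    (L := fun i => (blockLegs Q L b i).prod (deadLegs Q L b i)) R (fun i _ => hR.leg_mem i) x
  have h1 := ev_map (Q := Q) (AlgHom.fst k B B)
    (L := fun i => (blockLegs Q L b i).prod (deadLegs Q L b i)) (collapse b t) x
  have h2 := ev_map (Q := Q) (AlgHom.snd k B B)
    (L := fun i => (blockLegs Q L b i).prod (deadLegs Q L b i)) (collapse b t) x
  have e1 : (Q.ev (blockLegs Q L b) (collapse b t)) x = Q.ev L t x := by rw [(contains_ev_eq (Q := Q) (L := L) ht).1]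
  have e2 : (Q.ev (deadLegs Q L b) (collapse b t)) x = Q.ev L (kill b t) x := by
    rw [kill, ev_strip hL (leaves_bind_nodup _ ht.2.1), ev_bind _ (contains_dead_eq (Q := Q) (L := L) ht)]
  rw [← e1, ← e2]
  rw [show ((Q.ev (blockLegs Q L b) (collapse b t)) x, (Q.ev (deadLegs Q L b) (collapse b t)) x) =
    Q.ev (fun i => (blockLegs Q L b i).prod (deadLegs Q L b i)) (collapse b t) x from
      Prod.ext h1.symm h2.symm]
  exact h

lemma IsKill.can_mem (hR : IsKill Q L b R) (hL : IsLegs L) (hb : b.leaves.Nodup)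
    (hs : Contains b s) (ht : Contains b t) (hst : (collapse b s).leaves = (collapse b t).leaves) :
    (Q.can L s t, Q.can L (kill b s) (kill b t)) ∈ R := by
  set L' : ℕ → H →ₗ[k] B × B := fun i => (blockLegs Q L b i).prod (deadLegs Q L b i)
  have hp := can_path (Q := Q) (L := L') hst
  have h := hp.mem R (fun i _ => hR.leg_mem i)
  have h1 : Q.can L s t = (Q.can L' (collapse b s) (collapse b t)).1 := by
    have := (hp.map (AlgHom.fst k B B)).bind (L := L) _ (contains_ev_eq (Q := Q) (L := L) hs).2
    rw [hs.1, ht.1] at this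
    exact this.can_eq hL (contains_nodup_bind hs hb)
  have h2 : Q.can L (kill b s) (kill b t) = (Q.can L' (collapse b s) (collapse b t)).2 := by
    have := (hp.map (AlgHom.snd k B B)).bind (L := L) _ (contains_dead_eq (Q := Q) (L := L) hs)
    rw [kill, kill, can_strip hL ⟨this.leaves_eq, leaves_bind_nodup _ hs.2.1⟩]
    exact this.can_eq hL (leaves_bind_nodup _ hs.2.1)
  rw [h1, h2]; exact h

end

/-- Elements which agree under `E` to the right of everything commuting with the legs of `b`. -/
def killLeft (Q : QuasiHopfAlgebra k H) (L : ℕ → H →ₗ[k] B) (b : LegTree) (E : B →ₗ[k] P) :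
    Subalgebra k (B × B) where
  carrier := {X | (∀ x, Commute X.2 (Q.ev L b x)) ∧
    ∀ y, (∀ x, Commute y (Q.ev L b x)) → ∀ Z, E (y * (X.1 * Z)) = E (y * (X.2 * Z))}
  mul_mem' := by
    rintro ⟨X, X'⟩ ⟨Y, Y'⟩ ⟨h1, h2⟩ ⟨h3, h4⟩
    refine ⟨fun x => (h1 x).mul_left (h3 x), fun y hy Z => ?_⟩
    change E (y * (X * Y * Z)) = E (y * (X' * Y' * Z))
    rw [mul_assoc X, h2 y hy (Y * Z), mul_assoc, ← mul_assoc,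
      h4 (y * X') (fun x => (hy x).mul_left (h1 x)) Z, mul_assoc]
  add_mem' := by
    rintro ⟨X, X'⟩ ⟨Y, Y'⟩ ⟨h1, h2⟩ ⟨h3, h4⟩
    refine ⟨fun x => (h1 x).add_left (h3 x), fun y hy Z => ?_⟩
    change E (y * ((X + Y) * Z)) = E (y * ((X' + Y') * Z))
    simp only [add_mul, mul_add, map_add]
    exact congrArg₂ _ (h2 y hy Z) (h4 y hy Z)
  algebraMap_mem' := fun c => ⟨fun x => Algebra.commute_algebraMap_left _ _, fun y hy Z => rfl⟩

/-- Elements which agree under `E` to the left of everything commuting with the legs of `b`. -/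
def killRight (Q : QuasiHopfAlgebra k H) (L : ℕ → H →ₗ[k] B) (b : LegTree) (E : B →ₗ[k] P) :
    Subalgebra k (B × B) where
  carrier := {X | (∀ x, Commute X.2 (Q.ev L b x)) ∧
    ∀ y, (∀ x, Commute y (Q.ev L b x)) → ∀ Z, E (Z * X.1 * y) = E (Z * X.2 * y)}
  mul_mem' := by
    rintro ⟨X, X'⟩ ⟨Y, Y'⟩ ⟨h1, h2⟩ ⟨h3, h4⟩
    refine ⟨fun x => (h1 x).mul_left (h3 x), fun y hy Z => ?_⟩
    change E (Z * (X * Y) * y) = E (Z * (X' * Y') * y)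
    rw [← mul_assoc, h4 y hy (Z * X), mul_assoc, h2 (Y' * y) (fun x => (h3 x).mul_left (hy x)) Z]
    simp only [mul_assoc]
  add_mem' := by
    rintro ⟨X, X'⟩ ⟨Y, Y'⟩ ⟨h1, h2⟩ ⟨h3, h4⟩
    refine ⟨fun x => (h1 x).add_left (h3 x), fun y hy Z => ?_⟩
    change E (Z * (X + Y) * y) = E (Z * (X' + Y') * y)
    simp only [add_mul, mul_add, map_add]
    exact congrArg₂ _ (h2 y hy Z) (h4 y hy Z)
  algebraMap_mem' := fun c => ⟨fun x => Algebra.commute_algebraMap_left _ _, fun y hy Z => rfl⟩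

variable {E : B →ₗ[k] P}

lemma isKill_killLeft (hL : IsLegs L)
    (hE : ∀ x X, E (Q.ev L b x * X) = Q.counit x • E X) : IsKill Q L b (killLeft Q L b E) where
  block x := ⟨fun _ => Algebra.commute_algebraMap_left _ _, fun y hy Z => by
    change E (y * (Q.ev L b x * Z)) = E (y * (algebraMap k B (Q.counit x) * Z))
    rw [← mul_assoc, hy, mul_assoc, hE, ← Algebra.smul_def, mul_smul_comm, map_smul]⟩
  other i hi x := ⟨fun y => Q.ev_commute hL (a := .leaf i) (by simpa [leaves] using hi) x y,
    fun _ _ _ => rfl⟩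

lemma isKill_killRight (hL : IsLegs L)
    (hE : ∀ x X, E (X * Q.ev L b x) = Q.counit x • E X) : IsKill Q L b (killRight Q L b E) where
  block x := ⟨fun _ => Algebra.commute_algebraMap_left _ _, fun y hy Z => by
    change E (Z * Q.ev L b x * y) = E (Z * algebraMap k B (Q.counit x) * y)
    rw [mul_assoc, ← (hy x).eq, ← mul_assoc, hE, ← Algebra.commutes, mul_assoc, ← Algebra.smul_def,
      map_smul]⟩
  other i hi x := ⟨fun y => Q.ev_commute hL (a := .leaf i) (by simpa [leaves] using hi) x y,
    fun _ _ _ => rfl⟩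

/-- Side condition for removing the block `b` from `can L s t`. -/
def Killable (b s t : LegTree) : Prop := b.leaves.Nodup ∧ Contains b s ∧ Contains b t ∧
  (collapse b s).leaves = (collapse b t).leaves

instance (b s t : LegTree) : Decidable (Killable b s t) := by unfold Killable; infer_instance

/-- If `E` absorbs the block `b` on the left, then `b` may be removed from a composite of
associators on the left which does not break up `b`. -/
lemma kill_can_left (b : LegTree) (hL : IsLegs L)
    (hE : ∀ x X, E (Q.ev L b x * X) = Q.counit x • E X) (h : Killable b s t) (Z : B) :
    E (Q.can L s t * Z) = E (Q.can L (kill b s) (kill b t) * Z) := by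
  simpa using ((isKill_killLeft hL hE).can_mem hL h.1 h.2.1 h.2.2.1 h.2.2.2).2 1
    (fun _ => Commute.one_left _) Z

lemma kill_can_right (b : LegTree) (hL : IsLegs L)
    (hE : ∀ x X, E (X * Q.ev L b x) = Q.counit x • E X) (h : Killable b s t) (Z : B) :
    E (Z * Q.can L s t) = E (Z * Q.can L (kill b s) (kill b t)) := by
  simpa using ((isKill_killRight hL hE).can_mem hL h.1 h.2.1 h.2.2.1 h.2.2.2).2 1
    (fun _ => Commute.one_left _) Z

lemma kill_can_mid (b : LegTree) (hL : IsLegs L)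
    (hE : ∀ x X, E (X * Q.ev L b x) = Q.counit x • E X) (h : Killable b s t) (Z y : B)
    (hy : ∀ x, Commute y (Q.ev L b x)) :
    E (Z * (Q.can L s t * y)) = E (Z * (Q.can L (kill b s) (kill b t) * y)) := by
  simpa [mul_assoc] using ((isKill_killRight hL hE).can_mem hL h.1 h.2.1 h.2.2.1 h.2.2.2).2 y hy Z

lemma kill_ev_left (b : LegTree) (hL : IsLegs L)
    (hE : ∀ x X, E (Q.ev L b x * X) = Q.counit x • E X) (h : Contains b t) (x : H) (Z : B) :
    E (Q.ev L t x * Z) = E (Q.ev L (kill b t) x * Z) := by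
  simpa using ((isKill_killLeft hL hE).ev_mem hL h x).2 1 (fun _ => Commute.one_left _) Z

lemma kill_ev_right (b : LegTree) (hL : IsLegs L)
    (hE : ∀ x X, E (X * Q.ev L b x) = Q.counit x • E X) (h : Contains b t) (x : H) (Z : B) :
    E (Z * Q.ev L t x) = E (Z * Q.ev L (kill b t) x) := by
  simpa using ((isKill_killRight hL hE).ev_mem hL h x).2 1 (fun _ => Commute.one_left _) Z

lemma kill_can_left_to (b u v : LegTree) (hL : IsLegs L)
    (hE : ∀ x X, E (Q.ev L b x * X) = Q.counit x • E X)
    (h : Killable b s t ∧ kill b s = u ∧ kill b t = v) (Z : B) :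
    E (Q.can L s t * Z) = E (Q.can L u v * Z) := by
  obtain ⟨h, rfl, rfl⟩ := h
  exact kill_can_left b hL hE h Z

lemma kill_can_right_to (b u v : LegTree) (hL : IsLegs L)
    (hE : ∀ x X, E (X * Q.ev L b x) = Q.counit x • E X)
    (h : Killable b s t ∧ kill b s = u ∧ kill b t = v) (Z : B) :
    E (Z * Q.can L s t) = E (Z * Q.can L u v) := by
  obtain ⟨h, rfl, rfl⟩ := h
  exact kill_can_right b hL hE h Z

lemma kill_can_left_one (b : LegTree) (hL : IsLegs L)
    (hE : ∀ x X, E (Q.ev L b x * X) = Q.counit x • E X)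
    (h : Killable b s t ∧ kill b s = kill b t ∧ (kill b t).leaves.Nodup) (Z : B) :
    E (Q.can L s t * Z) = E Z := by
  rw [kill_can_left b hL hE h.1, h.2.1, can_self hL h.2.2, one_mul]

lemma kill_can_right_one (b : LegTree) (hL : IsLegs L)
    (hE : ∀ x X, E (X * Q.ev L b x) = Q.counit x • E X)
    (h : Killable b s t ∧ kill b s = kill b t ∧ (kill b t).leaves.Nodup) (Z : B) :
    E (Z * Q.can L s t) = E Z := by
  rw [kill_can_right b hL hE h.1, h.2.1, can_self hL h.2.2, mul_one]

lemma kill_can_mid_one (b : LegTree) (hL : IsLegs L)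
    (hE : ∀ x X, E (X * Q.ev L b x) = Q.counit x • E X)
    (h : Killable b s t ∧ kill b s = kill b t ∧ (kill b t).leaves.Nodup) (Z y : B)
    (hy : ∀ x, Commute y (Q.ev L b x)) :
    E (Z * (Q.can L s t * y)) = E (Z * y) := by
  rw [kill_can_mid b hL hE h.1 Z y hy, h.2.1, can_self hL h.2.2, one_mul]

lemma can_commute_of {u : LegTree} (hL : IsLegs L)
    (h : s.leaves = t.leaves ∧ ∀ i ∈ s.leaves, i ∉ u.leaves) (x : H) :
    Commute (Q.can L s t) (Q.ev L u x) :=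
  can_commute hL h.1 (fun i hi => h.2 i hi) x

end Kill

end QuasiHopfAlgebra

/-! ### Tensors in Sweedler notation -/

section
variable {k : Type*} [Field k] {A B C D E F: Type*} [Ring A] [Algebra k A] [Ring B] [Algebra k B] [Ring C] [Algebra k C] [Ring D] [Algebra k D] [Ring E] [Algebra k E] [Ring F] [Algebra k F]
instance tensorRing₃ : Ring (A ⊗[k] (B ⊗[k] C)) := Algebra.TensorProduct.instRing
instance tensorAlgebra₃ : Algebra k (A ⊗[k] (B ⊗[k] C)) := Algebra.TensorProduct.leftAlgebra
instance tensorRing₄ : Ring (A ⊗[k] (B ⊗[k] (C ⊗[k] D))) := Algebra.TensorProduct.instRing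
instance tensorAlgebra₄ : Algebra k (A ⊗[k] (B ⊗[k] (C ⊗[k] D))) := Algebra.TensorProduct.leftAlgebra
instance tensorRing₅ : Ring (A ⊗[k] (B ⊗[k] (C ⊗[k] (D ⊗[k] E)))) := Algebra.TensorProduct.instRing
instance tensorAlgebra₅ : Algebra k (A ⊗[k] (B ⊗[k] (C ⊗[k] (D ⊗[k] E)))) := Algebra.TensorProduct.leftAlgebra
end

section
variable {k : Type*} [CommRing k] {M₁ M₂ M₃ M₄ M₅ P : Type*}
  [AddCommGroup M₁] [Module k M₁] [AddCommGroup M₂] [Module k M₂]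
  [AddCommGroup M₃] [Module k M₃] [AddCommGroup M₄] [Module k M₄]
  [AddCommGroup M₅] [Module k M₅] [AddCommGroup P] [Module k P]

/-! Induction on tensors for additive predicates; the additivity obligation is discharged by
default for equalities between (multi)linear expressions. -/

lemma tensor_ind₂ {p : M₁ ⊗[k] M₂ → Prop} (t)
    (tmul : ∀ x y, p (x ⊗ₜ y))
    (add : ∀ s t, p s → p t → p (s + t) := by
      intro s t hs ht
      simp only [map_add, mul_add, add_mul, smul_add, tmul_add,
        add_tmul, LinearMap.add_apply, hs, ht]) : p t := by
  induction t using TensorProduct.induction_on with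
  | zero => simpa using tmul 0 0
  | add s t hs ht => exact add s t hs ht
  | tmul x y => exact tmul x y

lemma tensor_ind₃ {p : M₁ ⊗[k] (M₂ ⊗[k] M₃) → Prop} (t)
    (tmul : ∀ x y z, p (x ⊗ₜ (y ⊗ₜ z)))
    (add : ∀ s t, p s → p t → p (s + t) := by
      intro s t hs ht
      simp only [map_add, mul_add, add_mul, smul_add, tmul_add,
        add_tmul, LinearMap.add_apply, hs, ht]) : p t := by
  refine tensor_ind₂ t (fun x r => ?_) add
  refine tensor_ind₂ (p := fun r => p (x ⊗ₜ r)) r (tmul x) fun s t hs ht => ?_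
  rw [tmul_add]; exact add _ _ hs ht

lemma tensor_ind₄ {p : M₁ ⊗[k] (M₂ ⊗[k] (M₃ ⊗[k] M₄)) → Prop} (t)
    (tmul : ∀ x y z w, p (x ⊗ₜ (y ⊗ₜ (z ⊗ₜ w))))
    (add : ∀ s t, p s → p t → p (s + t) := by
      intro s t hs ht
      simp only [map_add, mul_add, add_mul, smul_add, tmul_add,
        add_tmul, LinearMap.add_apply, hs, ht]) : p t := by
  refine tensor_ind₂ t (fun x r => ?_) add
  refine tensor_ind₃ (p := fun r => p (x ⊗ₜ r)) r (tmul x) fun s t hs ht => ?_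
  rw [tmul_add]; exact add _ _ hs ht

lemma tensor_ind₅ {p : M₁ ⊗[k] (M₂ ⊗[k] (M₃ ⊗[k] (M₄ ⊗[k] M₅))) → Prop} (t)
    (tmul : ∀ x y z w v, p (x ⊗ₜ (y ⊗ₜ (z ⊗ₜ (w ⊗ₜ v)))))
    (add : ∀ s t, p s → p t → p (s + t) := by
      intro s t hs ht
      simp only [map_add, mul_add, add_mul, smul_add, tmul_add,
        add_tmul, LinearMap.add_apply, hs, ht]) : p t := by
  refine tensor_ind₂ t (fun x r => ?_) add
  refine tensor_ind₄ (p := fun r => p (x ⊗ₜ r)) r (tmul x) fun s t hs ht => ?_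
  rw [tmul_add]; exact add _ _ hs ht

lemma mulLeft_add {A : Type*} [Ring A] [Algebra k A] (a b : A) :
    mulLeft k (a + b) = mulLeft k a + mulLeft k b :=
  map_add (LinearMap.mul k A) a b

lemma mulRight_add {A : Type*} [Ring A] [Algebra k A] (a b : A) :
    mulRight k (a + b) = mulRight k a + mulRight k b :=
  map_add (LinearMap.mul k A).flip a b

lemma mulLeft_smul {A : Type*} [Ring A] [Algebra k A] (c : k) (a : A) :
    mulLeft k (c • a) = c • mulLeft k a :=
  map_smul (LinearMap.mul k A) c a

lemma mulRight_smul {A : Type*} [Ring A] [Algebra k A] (c : k) (a : A) :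
    mulRight k (c • a) = c • mulRight k a :=
  map_smul (LinearMap.mul k A).flip c a

/-! The maps `sweedlerₙ` with their linearity obligations discharged by default. -/

abbrev multilin₂ (f : M₁ → M₂ → P)
    (h : (∀ y, IsLinearMap k (fun x => f x y)) ∧ (∀ x, IsLinearMap k (fun y => f x y)) := by
      refine ⟨?_, ?_⟩ <;> intros <;> constructor <;> intros <;>
        first
      | simp [mul_add, add_mul, tmul_add, add_tmul,
        ← smul_tmul', LinearMap.add_comp, LinearMap.comp_add, LinearMap.smul_comp,
        LinearMap.comp_smul, map_add_left, map_add_right,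
        map_smul_left, map_smul_right, mulLeft_add, mulRight_add,
        mulLeft_smul, mulRight_smul]; done
      | ext; simp [mul_add, add_mul, tmul_add, add_tmul,
        ← smul_tmul', LinearMap.add_comp, LinearMap.comp_add, LinearMap.smul_comp,
        LinearMap.comp_smul, map_add_left, map_add_right,
        map_smul_left, map_smul_right, mulLeft_add, mulRight_add,
        mulLeft_smul, mulRight_smul]) :=
  sweedler₂ f h.1 h.2

abbrev multilin₃ (f : M₁ → M₂ → M₃ → P)
    (h : (∀ y z, IsLinearMap k (fun x => f x y z)) ∧
      (∀ x z, IsLinearMap k (fun y => f x y z)) ∧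
      (∀ x y, IsLinearMap k (fun z => f x y z)) := by
      refine ⟨?_, ?_, ?_⟩ <;> intros <;> constructor <;> intros <;>
        first
      | simp [mul_add, add_mul, tmul_add, add_tmul,
        ← smul_tmul', LinearMap.add_comp, LinearMap.comp_add, LinearMap.smul_comp,
        LinearMap.comp_smul, map_add_left, map_add_right,
        map_smul_left, map_smul_right, mulLeft_add, mulRight_add,
        mulLeft_smul, mulRight_smul]; done
      | ext; simp [mul_add, add_mul, tmul_add, add_tmul,
        ← smul_tmul', LinearMap.add_comp, LinearMap.comp_add, LinearMap.smul_comp,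
        LinearMap.comp_smul, map_add_left, map_add_right,
        map_smul_left, map_smul_right, mulLeft_add, mulRight_add,
        mulLeft_smul, mulRight_smul]) :=
  sweedler₃ f h.1 h.2.1 h.2.2

abbrev multilin₄ (f : M₁ → M₂ → M₃ → M₄ → P)
    (h : (∀ y z w, IsLinearMap k (fun x => f x y z w)) ∧
      (∀ x z w, IsLinearMap k (fun y => f x y z w)) ∧
      (∀ x y w, IsLinearMap k (fun z => f x y z w)) ∧
      (∀ x y z, IsLinearMap k (fun w => f x y z w)) := by
      refine ⟨?_, ?_, ?_, ?_⟩ <;> intros <;> constructor <;> intros <;>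
        simp [mul_add, add_mul, tmul_add, add_tmul,
          ← smul_tmul']) :=
  sweedler₄ f h.1 h.2.1 h.2.2.1 h.2.2.2

abbrev multilin₅ (f : M₁ → M₂ → M₃ → M₄ → M₅ → P)
    (h : (∀ y z w t, IsLinearMap k (fun x => f x y z w t)) ∧
      (∀ x z w t, IsLinearMap k (fun y => f x y z w t)) ∧
      (∀ x y w t, IsLinearMap k (fun z => f x y z w t)) ∧
      (∀ x y z t, IsLinearMap k (fun w => f x y z w t)) ∧
      (∀ x y z w, IsLinearMap k (fun t => f x y z w t)) := by
      refine ⟨?_, ?_, ?_, ?_, ?_⟩ <;> intros <;> constructor <;> intros <;>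
        simp [mul_add, add_mul, tmul_add, add_tmul,
          ← smul_tmul']) :=
  sweedler₅ f h.1 h.2.1 h.2.2.1 h.2.2.2.1 h.2.2.2.2

@[simp] lemma sweedler₂_tmul (f : M₁ → M₂ → P) (h₁ h₂) (x y) :
    sweedler₂ (k := k) f h₁ h₂ (x ⊗ₜ y) = f x y := rfl
@[simp] lemma sweedler₃_tmul (f : M₁ → M₂ → M₃ → P) (h₁ h₂ h₃) (x y z) :
    sweedler₃ (k := k) f h₁ h₂ h₃ (x ⊗ₜ (y ⊗ₜ z)) = f x y z := rfl
@[simp] lemma sweedler₄_tmul (f : M₁ → M₂ → M₃ → M₄ → P) (h₁ h₂ h₃ h₄) (x y z w) :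
    sweedler₄ (k := k) f h₁ h₂ h₃ h₄ (x ⊗ₜ (y ⊗ₜ (z ⊗ₜ w))) = f x y z w := rfl
@[simp] lemma sweedler₅_tmul (f : M₁ → M₂ → M₃ → M₄ → M₅ → P) (h₁ h₂ h₃ h₄ h₅) (x y z w v) :
    sweedler₅ (k := k) f h₁ h₂ h₃ h₄ h₅ (x ⊗ₜ (y ⊗ₜ (z ⊗ₜ (w ⊗ₜ v)))) = f x y z w v := rfl
end

section
variable {k : Type*} [Field k] {M P : Type*} [AddCommGroup M] [Module k M] [Ring P] [Algebra k P]

/-- `x ↦ l * j x * r` -/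
def sandwich (j : M →ₗ[k] P) (l r : P) : M →ₗ[k] P :=
  mulLeft k l ∘ₗ mulRight k r ∘ₗ j

@[simp] lemma sandwich_apply (j : M →ₗ[k] P) (l r : P) (x : M) :
    sandwich j l r x = l * (j x * r) := rfl
end

/-- `id ⊗ f` -/
abbrev idTensor {k A B C : Type*} [CommRing k] [Ring A] [Algebra k A] [Ring B] [Algebra k B]
    [Ring C] [Algebra k C] (f : B →ₐ[k] C) : A ⊗[k] B →ₐ[k] A ⊗[k] C :=
  Algebra.TensorProduct.map (AlgHom.id k A) f

namespace QuasiHopfAlgebra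

variable {k H : Type*} [Field k] [Ring H] [Algebra k H] (Q : QuasiHopfAlgebra k H)

/-! ### The legs of tensor powers -/

section ConcreteLegs
variable {B : Type*} [Ring B] [Algebra k B]

/-- The legs of `H ⊗ B`: the first factor, followed by the legs of `B`. -/
def consLegs (L : ℕ → H →ₗ[k] B) : ℕ → H →ₗ[k] H ⊗[k] B
  | 0 => Q.unitLeg
  | 1 => (includeLeft : H →ₐ[k] H ⊗[k] B).toLinearMap
  | n + 2 => (includeRight : B →ₐ[k] H ⊗[k] B).toLinearMap ∘ₗ L (n + 1)

lemma isLegs_consLegs {L : ℕ → H →ₗ[k] B} (hL : IsLegs L) : IsLegs (Q.consLegs L) where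
  one i := by
    match i with
    | 0 => exact isLegs_unit.1
    | 1 => rfl
    | n + 2 => exact congrArg (fun z => (1 : H) ⊗ₜ[k] z) (hL.one _)
  mul i x y := by
    match i with
    | 0 => simp [consLegs, unitLeg_apply]
    | 1 => simp [consLegs]
    | n + 2 => simp [consLegs, hL.mul]
  comm i j hij x y := by
    match i, j with
    | 0, _ => exact (Algebra.commute_algebraMap_left (Q.counit x) _)
    | _ + 1, 0 => exact (Algebra.commute_algebraMap_right (Q.counit y) _)
    | 1, 1 => omega
    | 1, n + 2 => simp [consLegs, Commute, SemiconjBy]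
    | n + 2, 1 => simp [consLegs, Commute, SemiconjBy]
    | n + 2, m + 2 =>
      simp [consLegs, Commute, SemiconjBy, (hL.comm (n + 1) (m + 1) (by omega) x y).eq]

/-- The single leg of `H`. -/
def legs₁ : ℕ → H →ₗ[k] H
  | 1 => LinearMap.id
  | _ => Q.unitLeg

lemma isLegs_legs₁ : IsLegs (Q.legs₁) where
  one i := by
    unfold legs₁; split; exacts [rfl, by simp [unitLeg_apply]]
  mul i x y := by
    unfold legs₁; split; exacts [rfl, by simp [unitLeg_apply]]
  comm i j hij x y := by
    unfold legs₁; split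
    · split
      · omega
      · exact Algebra.commute_algebraMap_right _ _
    · exact Algebra.commute_algebraMap_left _ _

/-- The legs of `H ⊗ H`. -/
def legs₂ : ℕ → H →ₗ[k] H ⊗[k] H := Q.consLegs Q.legs₁
/-- The legs of `H ⊗ H ⊗ H`. -/
def legs₃ : ℕ → H →ₗ[k] H ⊗[k] (H ⊗[k] H) := Q.consLegs Q.legs₂
/-- The legs of `H ⊗ H ⊗ H ⊗ H`. -/
def legs₄ : ℕ → H →ₗ[k] H ⊗[k] (H ⊗[k] (H ⊗[k] H)) := Q.consLegs (B := H ⊗[k] (H ⊗[k] H)) Q.legs₃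
/-- The legs of the fivefold tensor power of `H`. -/
def legs₅ : ℕ → H →ₗ[k] H ⊗[k] (H ⊗[k] (H ⊗[k] (H ⊗[k] H))) := Q.consLegs (B := H ⊗[k] (H ⊗[k] (H ⊗[k] H))) Q.legs₄
/-- The legs of the sixfold tensor power of `H`. -/
def legs₆ : ℕ → H →ₗ[k] H ⊗[k] (H ⊗[k] (H ⊗[k] (H ⊗[k] (H ⊗[k] H)))) := Q.consLegs (B := H ⊗[k] (H ⊗[k] (H ⊗[k] (H ⊗[k] H)))) Q.legs₅

lemma isLegs_legs₂ : IsLegs Q.legs₂ := Q.isLegs_consLegs Q.isLegs_legs₁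
lemma isLegs_legs₃ : IsLegs Q.legs₃ := Q.isLegs_consLegs Q.isLegs_legs₂
lemma isLegs_legs₄ : IsLegs Q.legs₄ := Q.isLegs_consLegs Q.isLegs_legs₃
lemma isLegs_legs₅ : IsLegs Q.legs₅ := Q.isLegs_consLegs Q.isLegs_legs₄
lemma isLegs_legs₆ : IsLegs Q.legs₆ := Q.isLegs_consLegs Q.isLegs_legs₅

@[simp] lemma legs₂_one (x : H) : Q.legs₂ 1 x = x ⊗ₜ 1 := rfl
@[simp] lemma legs₂_two (x : H) : Q.legs₂ 2 x = 1 ⊗ₜ x := rfl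
@[simp] lemma legs₃_one (x : H) : Q.legs₃ 1 x = x ⊗ₜ (1 ⊗ₜ 1) := rfl
@[simp] lemma legs₃_two (x : H) : Q.legs₃ 2 x = 1 ⊗ₜ (x ⊗ₜ 1) := rfl
@[simp] lemma legs₃_three (x : H) : Q.legs₃ 3 x = 1 ⊗ₜ (1 ⊗ₜ x) := rfl
@[simp] lemma legs₄_one (x : H) : Q.legs₄ 1 x = x ⊗ₜ (1 ⊗ₜ (1 ⊗ₜ 1)) := rfl
@[simp] lemma legs₄_two (x : H) : Q.legs₄ 2 x = 1 ⊗ₜ (x ⊗ₜ (1 ⊗ₜ 1)) := rfl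
@[simp] lemma legs₄_three (x : H) : Q.legs₄ 3 x = 1 ⊗ₜ (1 ⊗ₜ (x ⊗ₜ 1)) := rfl
@[simp] lemma legs₄_four (x : H) : Q.legs₄ 4 x = 1 ⊗ₜ (1 ⊗ₜ (1 ⊗ₜ x)) := rfl
@[simp] lemma legs₅_one (x : H) : Q.legs₅ 1 x = x ⊗ₜ (1 ⊗ₜ (1 ⊗ₜ (1 ⊗ₜ 1))) := rfl
@[simp] lemma legs₅_two (x : H) : Q.legs₅ 2 x = 1 ⊗ₜ (x ⊗ₜ (1 ⊗ₜ (1 ⊗ₜ 1))) := rfl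
@[simp] lemma legs₅_three (x : H) : Q.legs₅ 3 x = 1 ⊗ₜ (1 ⊗ₜ (x ⊗ₜ (1 ⊗ₜ 1))) := rfl
@[simp] lemma legs₅_four (x : H) : Q.legs₅ 4 x = 1 ⊗ₜ (1 ⊗ₜ (1 ⊗ₜ (x ⊗ₜ 1))) := rfl
@[simp] lemma legs₅_five (x : H) : Q.legs₅ 5 x = 1 ⊗ₜ (1 ⊗ₜ (1 ⊗ₜ (1 ⊗ₜ x))) := rfl

end ConcreteLegs

lemma place_legs₃ (t) : Q.place Q.legs₃ 1 2 3 t = t := by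
  apply tensor_ind₃ t; intro a b c
  simp [place, ev]

lemma ph_legs₃ : Q.ph Q.legs₃ 1 2 3 = Q.phi.val := Q.place_legs₃ _
lemma phi'_legs₃ : Q.phi' Q.legs₃ 1 2 3 = Q.phiInv := Q.place_legs₃ _

/-- `x ⊗ y ↦ S(x) α y` -/
def contrAlpha : H ⊗[k] H →ₗ[k] H :=
  multilin₂ (k := k) (fun x y => Q.antipode x * Q.alpha * y)

/-- `x ⊗ y ↦ x β S(y)` -/
def contrBeta : H ⊗[k] H →ₗ[k] H :=
  multilin₂ (k := k) (fun x y => x * Q.beta * Q.antipode y)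

@[simp] lemma contrAlpha_tmul (x y : H) : Q.contrAlpha (x ⊗ₜ y) = Q.antipode x * Q.alpha * y := rfl
@[simp] lemma contrBeta_tmul (x y : H) : Q.contrBeta (x ⊗ₜ y) = x * Q.beta * Q.antipode y := rfl
lemma contrAlpha_comul (h : H) : Q.contrAlpha (Q.comul h) = Q.counit h • Q.alpha :=
  Q.antipode_alpha h
lemma contrBeta_comul (h : H) : Q.contrBeta (Q.comul h) = Q.counit h • Q.beta :=
  Q.antipode_beta h

section
variable {B P C : Type*} [Ring B] [Algebra k B] [AddCommGroup P] [Module k P]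
  [AddCommGroup C] [Module k C] {L : ℕ → H →ₗ[k] B} {E : B →ₗ[k] P}

/-- If `E` contracts the legs `i`, `j` by a map `c` with `c(Δ(h)) = ε(h) γ`, then a factor `Δ(h)` in
these legs contributes only `ε(h)`. -/
lemma absorb_left {c : H ⊗[k] H →ₗ[k] C} {γ : C} (hc : ∀ h, c (Q.comul h) = Q.counit h • γ)
    {i j : ℕ} {X : B} (F : C →ₗ[k] P) (h : ∀ u v, E (L i u * L j v * X) = F (c (u ⊗ₜ v)))
    (h0 : F γ = E X) (x : H) :
    E (Q.ev L (.node (.leaf i) (.leaf j)) x * X) = Q.counit x • E X := by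
  have : ∀ v, E (pw (L i) (L j) v * X) = F (c v) := by
    intro v
    apply tensor_ind₂ v; intro u v
    exact h u v
  exact (this (Q.comul x)).trans (by rw [hc, map_smul, h0])

lemma absorb_right {c : H ⊗[k] H →ₗ[k] C} {γ : C} (hc : ∀ h, c (Q.comul h) = Q.counit h • γ)
    {i j : ℕ} {X : B} (F : C →ₗ[k] P) (h : ∀ u v, E (X * (L i u * L j v)) = F (c (u ⊗ₜ v)))
    (h0 : F γ = E X) (x : H) :
    E (X * Q.ev L (.node (.leaf i) (.leaf j)) x) = Q.counit x • E X := by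
  have : ∀ v, E (X * pw (L i) (L j) v) = F (c v) := by
    intro v
    apply tensor_ind₂ v; intro u v
    exact h u v
  exact (this (Q.comul x)).trans (by rw [hc, map_smul, h0])

end

/-! ### The antipode is bijective -/

section AgreeOnImage
variable {R : Type*} [Ring R] [Algebra k R] (ρ σ : H →ₐ[k] R)

/-- `x ⊗ y ⊗ z ↦ σ(x β S(y)) ρ(α z)` -/
def intertwinerMap : H ⊗[k] (H ⊗[k] H) →ₗ[k] R :=
  multilin₃ (k := k) (fun x y z => σ x * σ Q.beta * σ (Q.antipode y) * ρ Q.alpha * ρ z)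

/-- `x ⊗ y ⊗ z ⊗ w ↦ σ(S(x) α y β S(z)) ρ(α w)` -/
def intertwinerMap₄ : H ⊗[k] (H ⊗[k] (H ⊗[k] H)) →ₗ[k] R :=
  multilin₄ (k := k) (fun x y z w => σ (Q.antipode x) * σ Q.alpha * σ y * σ Q.beta *
      σ (Q.antipode z) * ρ Q.alpha * ρ w)

variable {ρ σ} (hρσ : ∀ h, ρ (Q.antipode h) = σ (Q.antipode h))
include hρσ

lemma intertwiner_mul (h : H) : σ h * Q.intertwinerMap ρ σ Q.phi.val =
    Q.intertwinerMap ρ σ Q.phi.val * ρ h := by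
  have hL := Q.isLegs_legs₃
  have k12 : ∀ x X, Q.intertwinerMap ρ σ (X * Q.ev Q.legs₃ (1 * 2) x) =
      Q.counit x • Q.intertwinerMap ρ σ X := by
    intro x X
    apply tensor_ind₃ X; intro a b c
    exact Q.absorb_right Q.contrBeta_comul
      (sandwich σ.toLinearMap (σ a) (σ (Q.antipode b) * ρ Q.alpha * ρ c))
      (by simp [intertwinerMap, Q.antipode_mul, mul_assoc]) (by simp [intertwinerMap, mul_assoc]) x
  have k23 : ∀ x X, Q.intertwinerMap ρ σ (Q.ev Q.legs₃ (2 * 3) x * X) =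
      Q.counit x • Q.intertwinerMap ρ σ X := by
    intro x X
    apply tensor_ind₃ X; intro a b c
    exact Q.absorb_left Q.contrAlpha_comul
      (sandwich ρ.toLinearMap (σ a * σ Q.beta * σ (Q.antipode b)) (ρ c))
      (by simp [intertwinerMap, Q.antipode_mul, mul_assoc, hρσ])
      (by simp [intertwinerMap, mul_assoc]) x
  have e := congrArg (Q.intertwinerMap ρ σ) (Q.ph_mul_ev (a := 1) (b := 2) (c := 3) hL (by decide) h)
  have e1 := kill_ev_right (1 * 2) hL k12 (t := 1 * 2 * 3) (by decide) h (Q.ph Q.legs₃ 1 2 3)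
  have e2 := kill_ev_left (2 * 3) hL k23 (t := 1 * (2 * 3)) (by decide) h (Q.ph Q.legs₃ 1 2 3)
  have e := e1.symm.trans (e.trans e2)
  rw [ph_legs₃] at e
  have r1 : ∀ X, Q.intertwinerMap ρ σ (X * Q.ev Q.legs₃ 3 h) = Q.intertwinerMap ρ σ X * ρ h := by
    intro X
    apply tensor_ind₃ X; intro a b c
    simp [ev, intertwinerMap, mul_assoc]
  have r2 : ∀ X, Q.intertwinerMap ρ σ (Q.ev Q.legs₃ 1 h * X) = σ h * Q.intertwinerMap ρ σ X := by
    intro X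
    apply tensor_ind₃ X; intro a b c
    simp [ev, intertwinerMap, mul_assoc]
  exact (r2 _).symm.trans (e.symm.trans (r1 _))

lemma alpha_mul_intertwiner :
    σ Q.alpha * Q.intertwinerMap ρ σ Q.phi.val = ρ Q.alpha := by
  set E := Q.intertwinerMap₄ ρ σ
  have hL := Q.isLegs_legs₄
  have k12 : ∀ x X, E (Q.ev Q.legs₄ (1 * 2) x * X) = Q.counit x • E X := by
    intro x X
    apply tensor_ind₄ X; intro a b c d
    exact Q.absorb_left Q.contrAlpha_comul (sandwich σ.toLinearMap (σ (Q.antipode a))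
        (σ b * σ Q.beta * σ (Q.antipode c) * ρ Q.alpha * ρ d))
      (by simp [E, intertwinerMap₄, Q.antipode_mul, mul_assoc])
      (by simp [E, intertwinerMap₄, mul_assoc]) x
  have k23 : ∀ x X, E (X * Q.ev Q.legs₄ (2 * 3) x) = Q.counit x • E X := by
    intro x X
    apply tensor_ind₄ X; intro a b c d
    exact Q.absorb_right Q.contrBeta_comul (sandwich σ.toLinearMap
        (σ (Q.antipode a) * σ Q.alpha * σ b) (σ (Q.antipode c) * ρ Q.alpha * ρ d))
      (by simp [E, intertwinerMap₄, Q.antipode_mul, mul_assoc])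
      (by simp [E, intertwinerMap₄, mul_assoc]) x
  have k34 : ∀ x X, E (Q.ev Q.legs₄ (3 * 4) x * X) = Q.counit x • E X := by
    intro x X
    apply tensor_ind₄ X; intro a b c d
    exact Q.absorb_left Q.contrAlpha_comul (sandwich ρ.toLinearMap
        (σ (Q.antipode a) * σ Q.alpha * σ b * σ Q.beta * σ (Q.antipode c)) (ρ d))
      (by simp [E, intertwinerMap₄, Q.antipode_mul, mul_assoc, hρσ])
      (by simp [E, intertwinerMap₄, mul_assoc]) x
  have e1 : E (Q.can Q.legs₄ (1 * (2 * 3 * 4)) (1 * (2 * (3 * 4)))) =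
      σ Q.alpha * Q.intertwinerMap ρ σ Q.phi.val := by
    rw [show Q.can Q.legs₄ (1 * (2 * 3 * 4)) (1 * (2 * (3 * 4))) = Q.ph Q.legs₄ 2 3 4 from
      (can_right hL (by decide) (by decide)).trans (can_assoc hL (by decide)), ph]
    generalize Q.phi.val = t
    apply tensor_ind₃ t; intro a b c
    simp [E, place, ev, intertwinerMap, intertwinerMap₄, Q.antipode_one, mul_assoc]
  have e2 : E (Q.can Q.legs₄ (1 * (2 * 3) * 4) (1 * 2 * 3 * 4)) = ρ Q.alpha := by
    rw [show Q.can Q.legs₄ (1 * (2 * 3) * 4) (1 * 2 * 3 * 4) = Q.phi' Q.legs₄ 1 2 3 from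
      (can_left hL (by decide) (by decide)).trans (can_assocInv hL (by decide)), phi']
    have h := congrArg (fun z => σ z * ρ Q.alpha) Q.phi_inv_alpha_beta
    simp only [map_one, one_mul] at h
    refine Eq.trans ?_ h
    rw [phiInv]
    generalize ((Q.phi⁻¹ : (H ⊗[k] (H ⊗[k] H))ˣ).val) = t
    apply tensor_ind₃ t; intro a b c
    simp [E, place, ev, intertwinerMap₄, mul_assoc]
  rw [← e1, ← e2, ← mul_one (Q.can Q.legs₄ (1 * (2 * 3 * 4)) _),
    ← kill_can_right_one (s := 1 * (2 * 3) * 4) (t := 1 * (2 * 3 * 4)) (2 * 3) hL k23 (by decide),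
    mul_one, can_trans hL _ (by decide) (by decide),
    ← can_trans hL (1 * 2 * (3 * 4)) (by decide) (by decide),
    kill_can_left_one (3 * 4) hL k34 (by decide),
    ← can_trans hL (1 * 2 * 3 * 4) (by decide) (by decide),
    kill_can_left_one (1 * 2) hL k12 (by decide)]

/-- Two algebra maps which agree on the image of the antipode agree: `σ(φ₁ β S(φ₂)) ρ(α φ₃)`
intertwines them and equals `1`. -/
lemma algHom_eq_of_eq_antipode : ρ = σ := by
  have key : Q.intertwinerMap ρ σ Q.phi.val = 1 := by
    have h1 : ∀ t, σ ((multilin₃ (k := k) (fun x y z => Q.antipode x * Q.alpha * y * Q.beta * Q.antipode z)) t) * Q.intertwinerMap ρ σ Q.phi.val =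
        ρ ((multilin₃ (k := k) (fun x y z => Q.antipode x * Q.alpha * y * Q.beta * Q.antipode z)) t) := by
      intro t
      apply tensor_ind₃ t; intro x y z
      have e := Q.intertwiner_mul hρσ (y * Q.beta * Q.antipode z)
      simp only [map_mul, mul_assoc] at e
      simp only [sweedler₃_tmul, map_mul, mul_assoc]
      rw [e, ← mul_assoc (σ Q.alpha), Q.alpha_mul_intertwiner hρσ, hρσ x]
    have := h1 (Q.phi⁻¹ : (H ⊗[k] (H ⊗[k] H))ˣ).val
    rw [Q.phi_inv_alpha_beta] at this
    simpa using this
  ext h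
  have := Q.intertwiner_mul hρσ h
  rw [key] at this
  simpa using this.symm

end AgreeOnImage

/-- The antipode of a finite-dimensional quasi-Hopf algebra is bijective. -/
theorem antipode_bijective [Module.Finite k H] : Function.Bijective Q.antipode := by
  have step : ∀ {R : Type _} [Ring R] [Algebra k R] (ρ σ : H →ₐ[k] R),
      (∀ h, ρ (Q.antipode (Q.antipode h)) = σ (Q.antipode (Q.antipode h))) → ρ = σ := by
    intro R _ _ ρ σ h
    refine Q.algHom_eq_of_eq_antipode fun x => ?_
    let op : (H →ₐ[k] R) → (H →ₐ[k] Rᵐᵒᵖ) := fun τ => AlgHom.ofLinearMap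
      ((MulOpposite.opLinearEquiv k).toLinearMap ∘ₗ τ.toLinearMap ∘ₗ Q.antipode)
      (by simp [Q.antipode_one]) (by intro x y; simp [Q.antipode_mul])
    have := Q.algHom_eq_of_eq_antipode (ρ := op ρ) (σ := op σ) (fun y =>
      congrArg MulOpposite.op (h y))
    exact congrArg MulOpposite.unop (DFunLike.congr_fun this x)
  let T : H →ₐ[k] H := AlgHom.ofLinearMap (Q.antipode ∘ₗ Q.antipode) (by simp [Q.antipode_one])
    (by intro x y; simp [Q.antipode_mul])
  have hpow : ∀ n {R : Type _} [Ring R] [Algebra k R] (ρ σ : H →ₐ[k] R),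
      (∀ h, ρ ((T ^ n) h) = σ ((T ^ n) h)) → ρ = σ := by
    intro n
    induction n with
    | zero => intro R _ _ ρ σ h; ext x; simpa using h x
    | succ n ih =>
      intro R _ _ ρ σ h
      refine step ρ σ fun x => ?_
      have := ih (ρ.comp T) (σ.comp T) (fun x => by
        have := h x
        rw [pow_succ'] at this
        exact this)
      exact DFunLike.congr_fun this x
  -- On the Fitting decomposition of a power of `T`, the projection onto the image along the kernel
  -- is an algebra map which agrees with the identity on the image, so it is the identity.
  obtain ⟨n, hn, hn1⟩ := ((LinearMap.eventually_isCompl_ker_pow_range_pow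
    (T.toLinearMap : Module.End k H)).and (Filter.eventually_ge_atTop 1)).exists
  have hT : ∀ n x, ((T.toLinearMap : Module.End k H) ^ n) x = (T ^ n) x := by
    intro n
    induction n with
    | zero => intro x; rfl
    | succ n ih => intro x; rw [pow_succ', pow_succ', Module.End.mul_apply, ih]; rfl
  set p := LinearMap.range ((T.toLinearMap : Module.End k H) ^ n) with hp
  set q := LinearMap.ker ((T.toLinearMap : Module.End k H) ^ n) with hq
  have hpq : IsCompl p q := hn.symm
  have memq : ∀ x, x ∈ q ↔ (T ^ n) x = 0 := fun x => by rw [hq, LinearMap.mem_ker, hT]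
  have memp : ∀ x, x ∈ p ↔ ∃ y, (T ^ n) y = x := fun x => by
    rw [hp, LinearMap.mem_range]; simp only [hT]
  have hproj : ∀ x y, y ∈ p → x - y ∈ q → p.projection q hpq x = y := by
    intro x y hy hxy
    have := (Submodule.projection_apply_eq_zero_iff hpq).2 hxy
    rw [map_sub, Submodule.projection_apply_of_mem_left hpq hy, sub_eq_zero] at this
    exact this
  let e : H →ₐ[k] H := AlgHom.ofLinearMap (p.projection q hpq)
    (Submodule.projection_apply_of_mem_left hpq ((memp 1).2 ⟨1, map_one _⟩))
    (fun x y => by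
      refine hproj _ _ ?_ ?_
      · obtain ⟨a, ha⟩ := (memp _).1 (Submodule.projection_apply_mem hpq x)
        obtain ⟨b, hb⟩ := (memp _).1 (Submodule.projection_apply_mem hpq y)
        exact (memp _).2 ⟨a * b, by rw [map_mul, ha, hb]⟩
      · have hx := (memq _).1 (Submodule.sub_projection_mem hpq x)
        have hy := (memq _).1 (Submodule.sub_projection_mem hpq y)
        rw [map_sub, sub_eq_zero] at hx hy
        rw [memq, map_sub, map_mul, map_mul, hx, hy, sub_self])
  have he : e = AlgHom.id k H := hpow n _ _ fun x =>
    Submodule.projection_apply_of_mem_left hpq ((memp _).2 ⟨x, rfl⟩)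
  have hinj : Function.Injective Q.antipode := by
    rw [injective_iff_map_eq_zero]
    intro x hx
    have h0 : x ∈ q := by
      obtain ⟨m, rfl⟩ : ∃ m, n = m + 1 := ⟨n - 1, by omega⟩
      rw [memq, pow_succ]
      change (T ^ m) (Q.antipode (Q.antipode x)) = 0
      rw [hx, map_zero, map_zero]
    have h1 := DFunLike.congr_fun he x
    exact h1.symm.trans ((Submodule.projection_apply_eq_zero_iff hpq).2 h0)
  exact ⟨hinj, LinearMap.injective_iff_surjective.1 hinj⟩

end QuasiHopfAlgebra

namespace QuasiHopfAlgebra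

variable {k H : Type*} [Field k] [Ring H] [Algebra k H] (Q : QuasiHopfAlgebra k H)

/-! ### The elements `p` and `q` -/

section AntipodeInv

lemma contrAlphaInv_comul (h : H) :
    (Q.antipodeInv ∘ₗ Q.contrAlpha) (Q.comul h) = Q.counit h • Q.antipodeInv Q.alpha := by
  simp [contrAlpha_comul]

lemma contrBetaInv_comul (h : H) :
    (Q.antipodeInv ∘ₗ Q.contrBeta) (Q.comul h) = Q.counit h • Q.antipodeInv Q.beta := by
  simp [contrBeta_comul]

variable [Module.Finite k H]

lemma isUnit_antipode : IsUnit (Q.antipode : Module.End k H) :=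
  (Module.End.isUnit_iff _).2 Q.antipode_bijective

@[simp] lemma antipode_antipodeInv (x : H) : Q.antipode (Q.antipodeInv x) = x :=
  DFunLike.congr_fun (Ring.mul_inverse_cancel _ Q.isUnit_antipode) x

@[simp] lemma antipodeInv_antipode (x : H) : Q.antipodeInv (Q.antipode x) = x :=
  DFunLike.congr_fun (Ring.inverse_mul_cancel _ Q.isUnit_antipode) x

lemma antipodeInv_one : Q.antipodeInv 1 = 1 := by
  simpa [Q.antipode_one] using Q.antipodeInv_antipode 1

lemma antipodeInv_mul (x y : H) : Q.antipodeInv (x * y) = Q.antipodeInv y * Q.antipodeInv x := by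
  apply Q.antipode_bijective.1
  simp [Q.antipode_mul]

end AntipodeInv

lemma counit_antipode (h : H) : Q.counit (Q.antipode h) = Q.counit h := by
  have e : ∀ v, Q.counit (Q.contrAlpha v) = Q.counit (Q.antipode
      (TensorProduct.rid k H (idTensor Q.counit v))) := by
    intro v
    apply tensor_ind₂ v; intro u v
    simp [Q.counit_alpha, mul_comm]
  have := e (Q.comul h)
  rw [contrAlpha_comul, counit_right] at this
  simpa [Q.counit_alpha] using this.symm

/-- The inclusion of the first factor. -/
def inL : H →ₗ[k] H ⊗[k] H := (includeLeft : H →ₐ[k] H ⊗[k] H).toLinearMap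
/-- The inclusion of the second factor. -/
def inR : H →ₗ[k] H ⊗[k] H := (includeRight : H →ₐ[k] H ⊗[k] H).toLinearMap

@[simp] lemma inL_apply (x : H) : inL (k := k) x = x ⊗ₜ 1 := rfl
@[simp] lemma inR_apply (x : H) : inR (k := k) x = 1 ⊗ₜ x := rfl

section QL

/-- `x ⊗ y ⊗ z ↦ S(x) α y ⊗ z` -/
def qLMap : H ⊗[k] (H ⊗[k] H) →ₗ[k] H ⊗[k] H :=
  multilin₃ (k := k) (fun x y z => (Q.antipode x * Q.alpha * y) ⊗ₜ[k] z)

@[simp] lemma qLMap_tmul (x y z : H) :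
    Q.qLMap (x ⊗ₜ (y ⊗ₜ z)) = (Q.antipode x * Q.alpha * y) ⊗ₜ[k] z := rfl

lemma qL_eq : Q.qL = Q.qLMap Q.phiInv := rfl

/-- `S(h₁) q₁ h₂₁ ⊗ q₂ h₂₂ = q₁ ⊗ h q₂` for `q = q^L`. -/
lemma qL_comul (h : H) :
    pw (mulRight k Q.qL ∘ₗ inL ∘ₗ Q.antipode) Q.comul.toLinearMap (Q.comul h) =
      (1 ⊗ₜ h) * Q.qL := by
  have hL := Q.isLegs_legs₃
  have k12 : ∀ x X, Q.qLMap (Q.ev Q.legs₃ (1 * 2) x * X) = Q.counit x • Q.qLMap X := by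
    intro x X
    apply tensor_ind₃ X; intro a b c
    exact Q.absorb_left Q.contrAlpha_comul (sandwich inL (Q.antipode a ⊗ₜ 1) (b ⊗ₜ c))
      (by simp [Q.antipode_mul, mul_assoc]) (by simp [mul_assoc]) x
  have e := congrArg Q.qLMap (Q.ev_mul_phi' (a := 1) (b := 2) (c := 3) hL (by decide) h)
  have e1 := kill_ev_left (1 * 2) hL k12 (t := 1 * 2 * 3) (by decide) h (Q.phi' Q.legs₃ 1 2 3)
  have e := e.trans e1
  rw [phi'_legs₃] at e
  rw [qL_eq]
  have r1 : ∀ s, Q.qLMap (Q.ev Q.legs₃ 3 h * s) = (1 ⊗ₜ h) * Q.qLMap s := by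
    intro s
    apply tensor_ind₃ s; intro a b c
    simp [ev]
  have r2 : ∀ s v, pw (mulRight k (Q.qLMap s) ∘ₗ inL ∘ₗ Q.antipode) Q.comul.toLinearMap v =
      Q.qLMap (s * pw (Q.ev Q.legs₃ 1) (Q.ev Q.legs₃ (2 * 3)) v) := by
    intro s v
    apply tensor_ind₂ v; intro u v
    change _ = Q.qLMap (s * (_ * pw _ _ (Q.comul v)))
    simp only [pw_tmul, AlgHom.toLinearMap_apply]
    generalize Q.comul v = w
    apply tensor_ind₂ w; intro v w
    induction s using tensor_ind₃ with
    | add => intro s t hs ht; simp_all [mul_add, add_mul]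
    | tmul a b c => simp [ev, Q.antipode_mul, mul_assoc]
  exact (r2 _ _).trans (e.trans (r1 _))

end QL

section PR

/-- `x ⊗ y ⊗ z ↦ x ⊗ y β S(z)` -/
def pRMap : H ⊗[k] (H ⊗[k] H) →ₗ[k] H ⊗[k] H := TensorProduct.map LinearMap.id Q.contrBeta

@[simp] lemma pRMap_tmul (x y z : H) :
    Q.pRMap (x ⊗ₜ (y ⊗ₜ z)) = x ⊗ₜ[k] (y * Q.beta * Q.antipode z) := rfl

lemma pR_eq : Q.pR = Q.pRMap Q.phiInv := by
  unfold pR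
  generalize Q.phiInv = t
  apply tensor_ind₃ t; intro a b c
  rfl

end PR

section QR
variable [Module.Finite k H]

/-- `x ⊗ y ⊗ z ↦ x ⊗ S̄(α z) y` -/
def qRMap : H ⊗[k] (H ⊗[k] H) →ₗ[k] H ⊗[k] H :=
  TensorProduct.map LinearMap.id (Q.antipodeInv ∘ₗ Q.contrAlpha)

@[simp] lemma qRMap_tmul (x y z : H) :
    Q.qRMap (x ⊗ₜ (y ⊗ₜ z)) = x ⊗ₜ[k] (Q.antipodeInv (Q.alpha * z) * y) := by
  simp [qRMap, antipodeInv_mul, mul_assoc]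

lemma qR_eq : Q.qR = Q.qRMap Q.phi.val := by
  unfold qR
  generalize Q.phi.val = t
  apply tensor_ind₃ t; intro a b c
  simp

end QR

section PL
variable [Module.Finite k H]

/-- `x ⊗ y ⊗ z ↦ y S̄(x β) ⊗ z` -/
def pLMap : H ⊗[k] (H ⊗[k] H) →ₗ[k] H ⊗[k] H :=
  TensorProduct.map (Q.antipodeInv ∘ₗ Q.contrBeta) LinearMap.id ∘ₗ
    (TensorProduct.assoc k H H H).symm.toLinearMap

@[simp] lemma pLMap_tmul (x y z : H) :
    Q.pLMap (x ⊗ₜ (y ⊗ₜ z)) = (y * Q.antipodeInv (x * Q.beta)) ⊗ₜ[k] z := by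
  simp [pLMap, antipodeInv_mul]

lemma pL_eq : Q.pL = Q.pLMap Q.phi.val := by
  unfold pL
  generalize Q.phi.val = t
  apply tensor_ind₃ t; intro a b c
  simp

/-- `h₂₁ p₁ S̄(h₁) ⊗ h₂₂ p₂ = p₁ ⊗ p₂ h` for `p = p^L`. -/
lemma pL_comul (h : H) :
    pw Q.comul.toLinearMap (mulLeft k Q.pL ∘ₗ inL ∘ₗ Q.antipodeInv)
      (TensorProduct.comm k H H (Q.comul h)) = Q.pL * (1 ⊗ₜ h) := by
  have hL := Q.isLegs_legs₃
  have k12 : ∀ x X, Q.pLMap (X * Q.ev Q.legs₃ (1 * 2) x) = Q.counit x • Q.pLMap X := by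
    intro x X
    apply tensor_ind₃ X; intro a b c
    exact Q.absorb_right Q.contrBetaInv_comul (sandwich inL (b ⊗ₜ c) (Q.antipodeInv a ⊗ₜ 1))
      (by simp [antipodeInv_mul, mul_assoc]) (by simp [antipodeInv_mul]) x
  have e := congrArg Q.pLMap (Q.ph_mul_ev (a := 1) (b := 2) (c := 3) hL (by decide) h)
  have e1 := kill_ev_right (1 * 2) hL k12 (t := 1 * 2 * 3) (by decide) h (Q.ph Q.legs₃ 1 2 3)
  have e := e.symm.trans e1
  rw [ph_legs₃] at e
  rw [pL_eq]
  have r1 : ∀ s, Q.pLMap (s * Q.ev Q.legs₃ 3 h) = Q.pLMap s * (1 ⊗ₜ h) := by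
    intro s
    apply tensor_ind₃ s; intro a b c
    simp [ev]
  have r2 : ∀ s v, pw Q.comul.toLinearMap (mulLeft k (Q.pLMap s) ∘ₗ inL ∘ₗ Q.antipodeInv)
      (TensorProduct.comm k H H v) =
      Q.pLMap (pw (Q.ev Q.legs₃ 1) (Q.ev Q.legs₃ (2 * 3)) v * s) := by
    intro s v
    apply tensor_ind₂ v; intro u v
    change _ = Q.pLMap (_ * pw _ _ (Q.comul v) * s)
    simp only [pw_tmul, AlgHom.toLinearMap_apply, TensorProduct.comm_tmul]
    generalize Q.comul v = w
    apply tensor_ind₂ w; intro v w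
    induction s using tensor_ind₃ with
    | add => intro s t hs ht; simp_all [mul_add, add_mul]
    | tmul a b c => simp [ev, antipodeInv_mul, mul_assoc]
  exact (r2 _ _).trans (e.trans (r1 _))

end PL

section Zigzag

/-- `x ⊗ y ⊗ z ↦ x β S(y) α z` -/
def zigMap : H ⊗[k] (H ⊗[k] H) →ₗ[k] H :=
  multilin₃ (k := k) (fun x y z => x * Q.beta * Q.antipode y * Q.alpha * z)

/-- `x ⊗ y ⊗ z ↦ S(x) α y β S(z)` -/
def zagMap : H ⊗[k] (H ⊗[k] H) →ₗ[k] H :=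
  multilin₃ (k := k) (fun x y z => Q.antipode x * Q.alpha * y * Q.beta * Q.antipode z)

@[simp] lemma zigMap_tmul (x y z : H) : Q.zigMap (x ⊗ₜ (y ⊗ₜ z)) =
    x * Q.beta * Q.antipode y * Q.alpha * z := rfl
@[simp] lemma zagMap_tmul (x y z : H) : Q.zagMap (x ⊗ₜ (y ⊗ₜ z)) =
    Q.antipode x * Q.alpha * y * Q.beta * Q.antipode z := rfl
lemma zigMap_phi : Q.zigMap Q.phi.val = 1 := Q.phi_beta_alpha
lemma zagMap_phiInv : Q.zagMap Q.phiInv = 1 := Q.phi_inv_alpha_beta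

/-- `S(p₁) q₁ p₂₁ ⊗ q₂ p₂₂ = 1 ⊗ 1` for `p = p^L` and `q = q^L`. -/
lemma qL_comul_pL [Module.Finite k H] :
    pw (mulRight k Q.qL ∘ₗ inL ∘ₗ Q.antipode) Q.comul.toLinearMap Q.pL = 1 := by
  have hL := Q.isLegs_legs₄
  let E : H ⊗[k] (H ⊗[k] (H ⊗[k] H)) →ₗ[k] H ⊗[k] H :=
    multilin₄ (k := k) (fun x y z w => (x * Q.beta * Q.antipode y * Q.alpha * z) ⊗ₜ w)
  have k23 : ∀ x X, E (Q.ev Q.legs₄ (2 * 3) x * X) = Q.counit x • E X := by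
    intro x X
    apply tensor_ind₄ X; intro a b c d
    exact Q.absorb_left Q.contrAlpha_comul
      (sandwich inL ((a * Q.beta * Q.antipode b) ⊗ₜ 1) (c ⊗ₜ d))
      (by simp [E, Q.antipode_mul, mul_assoc]) (by simp [E, mul_assoc]) x
  have k12 : ∀ x X, E (X * Q.ev Q.legs₄ (1 * 2) x) = Q.counit x • E X := by
    intro x X
    apply tensor_ind₄ X; intro a b c d
    exact Q.absorb_right Q.contrBeta_comul
      (sandwich inL (a ⊗ₜ 1) ((Q.antipode b * Q.alpha * c) ⊗ₜ d))
      (by simp [E, Q.antipode_mul, mul_assoc]) (by simp [E, mul_assoc]) x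
  have e1 : E (Q.can Q.legs₄ (1 * 2 * (3 * 4)) (1 * (2 * 3 * 4))) = 1 := by
    rw [← can_trans hL (1 * (2 * 3) * 4) (by decide) (by decide),
      kill_can_left (2 * 3) hL k23 (by decide),
      show kill (2 * 3) (1 * (2 * 3) * 4) = 1 * 4 by decide,
      show kill (2 * 3) (1 * (2 * 3 * 4)) = 1 * 4 by decide, can_self hL (by decide), one_mul,
      ← can_trans hL (1 * 2 * 3 * 4) (by decide) (by decide),
      kill_can_right (1 * 2) hL k12 (by decide),
      show kill (1 * 2) (1 * 2 * (3 * 4)) = 3 * 4 by decide,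
      show kill (1 * 2) (1 * 2 * 3 * 4) = 3 * 4 by decide, can_self hL (by decide), mul_one,
      show Q.can Q.legs₄ (1 * 2 * 3 * 4) (1 * (2 * 3) * 4) = Q.ph Q.legs₄ 1 2 3 from
      (can_left hL (by decide) (by decide)).trans (can_assoc hL (by decide)), ph]
    have h := congrArg (inL (k := k)) Q.zigMap_phi
    refine Eq.trans ?_ h
    generalize Q.phi.val = t
    apply tensor_ind₃ t; intro a b c
    simp [E, place, ev]
  have e2 : Q.can Q.legs₄ (1 * 2 * (3 * 4)) (1 * (2 * 3 * 4)) =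
      Q.phi' Q.legs₄ 2 3 4 * Q.ph Q.legs₄ 1 2 (3 * 4) := by
    rw [← can_trans hL (1 * (2 * (3 * 4))) (by decide) (by decide)]
    exact congrArg₂ _ ((can_right hL (by decide) (by decide)).trans (can_assocInv hL (by decide)))
      (can_assoc hL (by decide))
  rw [← e1, e2, ph, phi', qL_eq, pL_eq]
  generalize Q.phi.val = t
  generalize Q.phiInv = s
  apply tensor_ind₃ t; intro a b c
  change _ = E (_ * (_ * (_ * pw _ _ (Q.comul c))))
  simp only [pLMap_tmul, pw_tmul, AlgHom.toLinearMap_apply]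
  generalize Q.comul c = w
  apply tensor_ind₂ w; intro v w
  induction s using tensor_ind₃ with
  | add => intro s t hs ht; simp_all [mul_add, add_mul]
  | tmul a b c => simp [E, place, ev, Q.antipode_mul, mul_assoc]

/-- `q₂₁ p₁ S̄(q₁) ⊗ q₂₂ p₂ = 1 ⊗ 1` for `p = p^L` and `q = q^L`. -/
lemma pL_comul_qL [Module.Finite k H] :
    pw Q.comul.toLinearMap (mulLeft k Q.pL ∘ₗ inL ∘ₗ Q.antipodeInv)
      (TensorProduct.comm k H H Q.qL) = 1 := by
  have hL := Q.isLegs_legs₄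
  let E : H ⊗[k] (H ⊗[k] (H ⊗[k] H)) →ₗ[k] H ⊗[k] H :=
    multilin₄ (k := k) (fun x y z w => (z * Q.antipodeInv (Q.antipode x * Q.alpha * y * Q.beta)) ⊗ₜ w)
  have k12 : ∀ x X, E (Q.ev Q.legs₄ (1 * 2) x * X) = Q.counit x • E X := by
    intro x X
    apply tensor_ind₄ X; intro a b c d
    exact Q.absorb_left Q.contrAlphaInv_comul
      (sandwich inL ((c * Q.antipodeInv Q.beta * Q.antipodeInv b) ⊗ₜ d) (a ⊗ₜ 1))
      (by simp [E, antipodeInv_mul, mul_assoc, Q.antipode_mul])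
      (by simp [E, antipodeInv_mul, mul_assoc]) x
  have k23 : ∀ x X, E (X * Q.ev Q.legs₄ (2 * 3) x) = Q.counit x • E X := by
    intro x X
    apply tensor_ind₄ X; intro a b c d
    exact Q.absorb_right Q.contrBetaInv_comul
      (sandwich inL (c ⊗ₜ d) ((Q.antipodeInv b * Q.antipodeInv Q.alpha * a) ⊗ₜ 1))
      (by simp [E, antipodeInv_mul, mul_assoc])
      (by simp [E, antipodeInv_mul, mul_assoc]) x
  have e1 : E (Q.can Q.legs₄ (1 * (2 * 3 * 4)) (1 * 2 * (3 * 4))) = 1 := by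
    rw [← can_trans hL (1 * 2 * 3 * 4) (by decide) (by decide),
      kill_can_left (1 * 2) hL k12 (by decide),
      show kill (1 * 2) (1 * 2 * (3 * 4)) = 3 * 4 by decide,
      show kill (1 * 2) (1 * 2 * 3 * 4) = 3 * 4 by decide, can_self hL (by decide), one_mul,
      ← can_trans hL (1 * (2 * 3) * 4) (by decide) (by decide),
      kill_can_right (2 * 3) hL k23 (by decide),
      show kill (2 * 3) (1 * (2 * 3) * 4) = 1 * 4 by decide,
      show kill (2 * 3) (1 * (2 * 3 * 4)) = 1 * 4 by decide, can_self hL (by decide), mul_one,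
      show Q.can Q.legs₄ (1 * (2 * 3) * 4) (1 * 2 * 3 * 4) = Q.phi' Q.legs₄ 1 2 3 from
      (can_left hL (by decide) (by decide)).trans (can_assocInv hL (by decide)), phi']
    have h := congrArg (inL (k := k) ∘ₗ Q.antipodeInv) Q.zagMap_phiInv
    refine Eq.trans ?_ (h.trans (by simp [antipodeInv_one, Algebra.TensorProduct.one_def]))
    generalize Q.phiInv = t
    apply tensor_ind₃ t; intro a b c
    simp [E, place, ev, antipodeInv_mul]
  have e2 : Q.can Q.legs₄ (1 * (2 * 3 * 4)) (1 * 2 * (3 * 4)) =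
      Q.phi' Q.legs₄ 1 2 (3 * 4) * Q.ph Q.legs₄ 2 3 4 := by
    rw [← can_trans hL (1 * (2 * (3 * 4))) (by decide) (by decide)]
    exact congrArg₂ _ (can_assocInv hL (by decide))
      ((can_right hL (by decide) (by decide)).trans (can_assoc hL (by decide)))
  rw [← e1, e2, ph, phi', qL_eq, pL_eq]
  generalize Q.phi.val = t
  generalize Q.phiInv = s
  apply tensor_ind₃ s; intro a b c
  change _ = E (_ * (_ * pw _ _ (Q.comul c)) * _)
  simp only [qLMap_tmul, pw_tmul, AlgHom.toLinearMap_apply, TensorProduct.comm_tmul]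
  generalize Q.comul c = w
  apply tensor_ind₂ w; intro v w
  induction t using tensor_ind₃ with
  | add => intro s t hs ht; simp_all [mul_add, add_mul]
  | tmul a b c => simp [E, place, ev, antipodeInv_mul, mul_assoc]

end Zigzag

end QuasiHopfAlgebra

namespace QuasiHopfAlgebra

variable {k H : Type*} [Field k] [Ring H] [Algebra k H] (Q : QuasiHopfAlgebra k H)

/-! ### Drinfeld's gauge transformation -/

section Drinfeld

lemma antipodeCop_mul (x y : H) : Q.antipodeCop (x * y) = Q.antipodeCop y * Q.antipodeCop x := by
  simp only [antipodeCop, comp_apply, AlgHom.toLinearMap_apply, map_mul,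
    LinearEquiv.coe_coe]
  generalize Q.comul x = u
  generalize Q.comul y = v
  apply tensor_ind₂ u; intro a b
  apply tensor_ind₂ v; intro c d
  simp [Q.antipode_mul]

lemma antipodeCop_one : Q.antipodeCop 1 = 1 := by
  simp [antipodeCop, Algebra.TensorProduct.one_def, Q.antipode_one]

/-- `x ⊗ y ↦ (S ⊗ S)Δ^cop(x) a Δ(y)` -/
def contrA : H ⊗[k] H →ₗ[k] H ⊗[k] H :=
  pw (mulRight k Q.drinfeldA ∘ₗ Q.antipodeCop) Q.comul.toLinearMap

/-- `x ⊗ y ↦ Δ(x) b (S ⊗ S)Δ^cop(y)` -/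
def contrB : H ⊗[k] H →ₗ[k] H ⊗[k] H :=
  pw (mulRight k Q.drinfeldB ∘ₗ Q.comul.toLinearMap) Q.antipodeCop

@[simp] lemma contrA_tmul (x y : H) :
    Q.contrA (x ⊗ₜ y) = Q.antipodeCop x * Q.drinfeldA * Q.comul y := rfl
@[simp] lemma contrB_tmul (x y : H) :
    Q.contrB (x ⊗ₜ y) = Q.comul x * Q.drinfeldB * Q.antipodeCop y := rfl

lemma drinfeldF_eq : Q.drinfeldF = Q.contrA Q.pR := by
  unfold drinfeldF
  generalize Q.pR = t
  apply tensor_ind₂ t; intro a b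
  rfl

lemma drinfeldFInv_eq : Q.drinfeldFInv = Q.contrB Q.qL := by
  unfold drinfeldFInv
  generalize Q.qL = t
  apply tensor_ind₂ t; intro a b
  rfl

/-- `x ⊗ y ⊗ z ⊗ w ↦ S(y) α z ⊗ S(x) α w` -/
def drinfeldAMap : H ⊗[k] (H ⊗[k] (H ⊗[k] H)) →ₗ[k] H ⊗[k] H :=
  multilin₄ (k := k)
    (fun x y z w => (Q.antipode y * Q.alpha * z) ⊗ₜ[k] (Q.antipode x * Q.alpha * w))

@[simp] lemma drinfeldAMap_tmul (x y z w : H) : Q.drinfeldAMap (x ⊗ₜ (y ⊗ₜ (z ⊗ₜ w))) =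
    (Q.antipode y * Q.alpha * z) ⊗ₜ[k] (Q.antipode x * Q.alpha * w) := rfl

/-- `x ⊗ y ⊗ z ⊗ w ↦ x β S(w) ⊗ y β S(z)` -/
def drinfeldBMap : H ⊗[k] (H ⊗[k] (H ⊗[k] H)) →ₗ[k] H ⊗[k] H :=
  multilin₄ (k := k)
    (fun x y z w => (x * Q.beta * Q.antipode w) ⊗ₜ[k] (y * Q.beta * Q.antipode z))

@[simp] lemma drinfeldBMap_tmul (x y z w : H) : Q.drinfeldBMap (x ⊗ₜ (y ⊗ₜ (z ⊗ₜ w))) =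
    (x * Q.beta * Q.antipode w) ⊗ₜ[k] (y * Q.beta * Q.antipode z) := rfl

lemma kappa_eq_can : Q.kappa = Q.can Q.legs₄ (1 * 2 * (3 * 4)) (1 * (2 * 3 * 4)) := by
  have hL := Q.isLegs_legs₄
  rw [← can_trans hL (1 * (2 * (3 * 4))) (by decide) (by decide),
    show Q.can Q.legs₄ (1 * 2 * (3 * 4)) (1 * (2 * (3 * 4))) = Q.ph Q.legs₄ 1 2 (3 * 4) from
      can_assoc hL (by decide),
    show Q.can Q.legs₄ (1 * (2 * (3 * 4))) (1 * (2 * 3 * 4)) = Q.phi' Q.legs₄ 2 3 4 from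
      (can_right hL (by decide) (by decide)).trans (can_assocInv hL (by decide)), kappa, ph, phi']
  congr 1
  · generalize Q.phiInv = t
    apply tensor_ind₃ t; intro a b c
    simp [place, ev]
  · generalize Q.phi.val = t
    apply tensor_ind₃ t; intro a b c
    change a ⊗ₜ (b ⊗ₜ Q.comul c) = Q.legs₄ 1 a * (Q.legs₄ 2 b * pw _ _ (Q.comul c))
    generalize Q.comul c = w
    apply tensor_ind₂ w; intro v w
    simp [ev]

lemma drinfeldA_eq : Q.drinfeldA =
    Q.drinfeldAMap (Q.can Q.legs₄ (1 * 2 * (3 * 4)) (1 * (2 * 3 * 4))) := by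
  rw [← kappa_eq_can]; rfl

lemma drinfeldB_eq : Q.drinfeldB =
    Q.drinfeldBMap (Q.can Q.legs₄ (1 * (2 * 3) * 4) (1 * 2 * (3 * 4))) := by
  have hL := Q.isLegs_legs₄
  rw [← can_trans hL (1 * 2 * 3 * 4) (by decide) (by decide),
    show Q.can Q.legs₄ (1 * 2 * 3 * 4) (1 * 2 * (3 * 4)) = Q.ph Q.legs₄ (1 * 2) 3 4 from
      can_assoc hL (by decide),
    show Q.can Q.legs₄ (1 * (2 * 3) * 4) (1 * 2 * 3 * 4) = Q.phi' Q.legs₄ 1 2 3 from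
      (can_left hL (by decide) (by decide)).trans (can_assocInv hL (by decide)), ph, phi']
  refine congrArg Q.drinfeldBMap ?_
  congr 1
  · generalize Q.phi.val = t
    apply tensor_ind₃ t; intro a b c
    change TensorProduct.assoc k H H (H ⊗[k] H) (Q.comul a ⊗ₜ (b ⊗ₜ c)) =
      pw (Q.legs₄ 1) (Q.legs₄ 2) (Q.comul a) * (Q.legs₄ 3 b * Q.legs₄ 4 c)
    generalize Q.comul a = w
    apply tensor_ind₂ w; intro v w
    simp
  · generalize Q.phiInv = t
    apply tensor_ind₃ t; intro a b c
    simp [place, ev]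

lemma drinfeldAMap_absorb₂₃ (x : H) (X) : Q.drinfeldAMap (Q.ev Q.legs₄ (2 * 3) x * X) =
    Q.counit x • Q.drinfeldAMap X := by
  apply tensor_ind₄ X; intro a b c d
  exact Q.absorb_left Q.contrAlpha_comul
    (sandwich inL (Q.antipode b ⊗ₜ 1) (c ⊗ₜ (Q.antipode a * Q.alpha * d)))
    (by simp [Q.antipode_mul, mul_assoc]) (by simp [mul_assoc]) x

lemma drinfeldAMap_absorb₁₄ (x : H) (X) : Q.drinfeldAMap (Q.ev Q.legs₄ (1 * 4) x * X) =
    Q.counit x • Q.drinfeldAMap X := by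
  apply tensor_ind₄ X; intro a b c d
  exact Q.absorb_left Q.contrAlpha_comul
    (sandwich inR (1 ⊗ₜ Q.antipode a) ((Q.antipode b * Q.alpha * c) ⊗ₜ d))
    (by simp [Q.antipode_mul, mul_assoc]) (by simp [mul_assoc]) x

lemma drinfeldBMap_absorb₂₃ (x : H) (X) : Q.drinfeldBMap (X * Q.ev Q.legs₄ (2 * 3) x) =
    Q.counit x • Q.drinfeldBMap X := by
  apply tensor_ind₄ X; intro a b c d
  exact Q.absorb_right Q.contrBeta_comul
    (sandwich inR ((a * Q.beta * Q.antipode d) ⊗ₜ b) (1 ⊗ₜ Q.antipode c))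
    (by simp [Q.antipode_mul, mul_assoc]) (by simp [mul_assoc]) x

lemma drinfeldBMap_absorb₁₄ (x : H) (X) : Q.drinfeldBMap (X * Q.ev Q.legs₄ (1 * 4) x) =
    Q.counit x • Q.drinfeldBMap X := by
  apply tensor_ind₄ X; intro a b c d
  exact Q.absorb_right Q.contrBeta_comul
    (sandwich inL (a ⊗ₜ (b * Q.beta * Q.antipode c)) (Q.antipode d ⊗ₜ 1))
    (by simp [Q.antipode_mul, mul_assoc]) (by simp [mul_assoc]) x

lemma contrA_comul (h : H) : Q.contrA (Q.comul h) = Q.counit h • Q.drinfeldA := by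
  have hL := Q.isLegs_legs₄
  have e := congrArg Q.drinfeldAMap
    (can_mul_ev (Q := Q) hL (s := 1 * 2 * (3 * 4)) (t := 1 * (2 * 3 * 4)) (by decide) h)
  rw [kill_ev_left (2 * 3) hL Q.drinfeldAMap_absorb₂₃ (t := 1 * (2 * 3 * 4)) (by decide),
    show kill (2 * 3) (1 * (2 * 3 * 4)) = 1 * 4 by decide, drinfeldAMap_absorb₁₄,
    ← drinfeldA_eq] at e
  rw [← e, contrA, drinfeldA_eq]
  change _ = Q.drinfeldAMap (_ * pw _ _ (Q.comul h))
  generalize Q.can Q.legs₄ (1 * 2 * (3 * 4)) (1 * (2 * 3 * 4)) = s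
  generalize Q.comul h = v
  apply tensor_ind₂ v; intro u v
  change (_ * _) * Q.comul v = Q.drinfeldAMap (s * (pw (Q.legs₄ 1) (Q.legs₄ 2) (Q.comul u) *
    pw (Q.legs₄ 3) (Q.legs₄ 4) (Q.comul v)))
  simp only [antipodeCop, comp_apply, AlgHom.toLinearMap_apply, LinearEquiv.coe_coe]
  generalize Q.comul u = u
  generalize Q.comul v = v
  apply tensor_ind₂ u; intro u u'
  apply tensor_ind₂ v; intro v v'
  apply tensor_ind₄ s; intro a b c d
  simp [Q.antipode_mul, mul_assoc]

lemma contrB_comul (h : H) : Q.contrB (Q.comul h) = Q.counit h • Q.drinfeldB := by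
  have hL := Q.isLegs_legs₄
  have e := congrArg Q.drinfeldBMap
    (can_mul_ev (Q := Q) hL (s := 1 * (2 * 3) * 4) (t := 1 * 2 * (3 * 4)) (by decide) h)
  rw [kill_ev_right (2 * 3) hL Q.drinfeldBMap_absorb₂₃ (t := 1 * (2 * 3) * 4) (by decide),
    show kill (2 * 3) (1 * (2 * 3) * 4) = 1 * 4 by decide, drinfeldBMap_absorb₁₄,
    ← drinfeldB_eq] at e
  rw [e, contrB, drinfeldB_eq]
  change _ = Q.drinfeldBMap (pw _ _ (Q.comul h) * _)
  generalize Q.can Q.legs₄ (1 * (2 * 3) * 4) (1 * 2 * (3 * 4)) = s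
  generalize Q.comul h = v
  apply tensor_ind₂ v; intro u v
  change (_ * _) * _ = Q.drinfeldBMap (pw (Q.legs₄ 1) (Q.legs₄ 2) (Q.comul u) *
    pw (Q.legs₄ 3) (Q.legs₄ 4) (Q.comul v) * s)
  simp only [antipodeCop, comp_apply, AlgHom.toLinearMap_apply, LinearEquiv.coe_coe]
  generalize Q.comul u = u
  generalize Q.comul v = v
  apply tensor_ind₂ u; intro u u'
  apply tensor_ind₂ v; intro v v'
  apply tensor_ind₄ s; intro a b c d
  simp [Q.antipode_mul, mul_assoc]

lemma drinfeldF_comul_antipode (h : H) :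
    Q.drinfeldF * Q.comul (Q.antipode h) = Q.antipodeCop h * Q.drinfeldF := by
  have hL := Q.isLegs_legs₃
  set E := Q.contrA ∘ₗ Q.pRMap with hE
  have k12 : ∀ x X, E (Q.ev Q.legs₃ (1 * 2) x * X) = Q.counit x • E X := by
    intro x X
    apply tensor_ind₃ X; intro a b c
    exact Q.absorb_left Q.contrA_comul
      (sandwich LinearMap.id (Q.antipodeCop a) (Q.comul (b * Q.beta * Q.antipode c)))
      (by simp [E, antipodeCop_mul, mul_assoc]) (by simp [E, mul_assoc]) x
  have k23 : ∀ x X, E (X * Q.ev Q.legs₃ (2 * 3) x) = Q.counit x • E X := by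
    intro x X
    apply tensor_ind₃ X; intro a b c
    exact Q.absorb_right Q.contrBeta_comul
      (sandwich Q.comul.toLinearMap (Q.antipodeCop a * Q.drinfeldA * Q.comul b)
        (Q.comul (Q.antipode c)))
      (by simp [E, Q.antipode_mul, mul_assoc]) (by simp [E, mul_assoc]) x
  have e := congrArg E (Q.ev_mul_phi' (a := 1) (b := 2) (c := 3) hL (by decide) h)
  have e1 := kill_ev_right (2 * 3) hL k23 (t := 1 * (2 * 3)) (by decide) h (Q.phi' Q.legs₃ 1 2 3)
  have e2 := kill_ev_left (1 * 2) hL k12 (t := 1 * 2 * 3) (by decide) h (Q.phi' Q.legs₃ 1 2 3)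
  have e := (e1.symm.trans (e.trans e2)).symm
  rw [phi'_legs₃, show kill (1 * 2) (1 * 2 * 3) = 3 by decide,
    show kill (2 * 3) (1 * (2 * 3)) = 1 by decide] at e
  rw [drinfeldF_eq, pR_eq]
  refine Eq.trans ?_ (e.trans ?_)
  · generalize Q.phiInv = s
    apply tensor_ind₃ s; intro a b c
    simp [E, ev, Q.antipode_mul, mul_assoc]
  · generalize Q.phiInv = s
    apply tensor_ind₃ s; intro a b c
    simp [E, ev, antipodeCop_mul, mul_assoc]

lemma drinfeldF_comul_alpha : Q.drinfeldF * Q.comul Q.alpha = Q.drinfeldA := by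
  have hL := Q.isLegs_legs₄
  set E := Q.contrA ∘ₗ TensorProduct.map LinearMap.id Q.zigMap with hE
  have k12 : ∀ x X, E (Q.ev Q.legs₄ (1 * 2) x * X) = Q.counit x • E X := by
    intro x X
    apply tensor_ind₄ X; intro a b c d
    exact Q.absorb_left Q.contrA_comul
      (sandwich LinearMap.id (Q.antipodeCop a)
        (Q.comul (b * Q.beta * Q.antipode c * Q.alpha * d)))
      (by simp [E, antipodeCop_mul, mul_assoc]) (by simp [E, mul_assoc]) x
  have k23 : ∀ x X, E (X * Q.ev Q.legs₄ (2 * 3) x) = Q.counit x • E X := by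
    intro x X
    apply tensor_ind₄ X; intro a b c d
    exact Q.absorb_right Q.contrBeta_comul
      (sandwich Q.comul.toLinearMap (Q.antipodeCop a * Q.drinfeldA * Q.comul b)
        (Q.comul (Q.antipode c * Q.alpha * d)))
      (by simp [E, Q.antipode_mul, mul_assoc]) (by simp [E, mul_assoc]) x
  have k34 : ∀ x X, E (Q.ev Q.legs₄ (3 * 4) x * X) = Q.counit x • E X := by
    intro x X
    apply tensor_ind₄ X; intro a b c d
    exact Q.absorb_left Q.contrAlpha_comul
      (sandwich Q.comul.toLinearMap (Q.antipodeCop a * Q.drinfeldA *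
        Q.comul (b * Q.beta * Q.antipode c)) (Q.comul d))
      (by simp [E, Q.antipode_mul, mul_assoc]) (by simp [E, mul_assoc]) x
  have e1 : E (Q.can Q.legs₄ (1 * (2 * 3) * 4) (1 * 2 * 3 * 4)) =
      Q.drinfeldF * Q.comul Q.alpha := by
    rw [show Q.can Q.legs₄ (1 * (2 * 3) * 4) (1 * 2 * 3 * 4) = Q.phi' Q.legs₄ 1 2 3 from
      (can_left hL (by decide) (by decide)).trans (can_assocInv hL (by decide)), phi',
      drinfeldF_eq, pR_eq]
    generalize Q.phiInv = s
    apply tensor_ind₃ s; intro a b c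
    simp [E, place, ev, mul_assoc]
  rw [← e1]
  calc E (Q.can Q.legs₄ (1 * (2 * 3) * 4) (1 * 2 * 3 * 4))
      = E (Q.can Q.legs₄ (1 * 2 * 3 * 4) (1 * 2 * (3 * 4)) *
          Q.can Q.legs₄ (1 * (2 * 3) * 4) (1 * 2 * 3 * 4)) := by
        rw [kill_can_left (1 * 2) hL k12 (by decide),
          show kill (1 * 2) (1 * 2 * 3 * 4) = 3 * 4 by decide,
          show kill (1 * 2) (1 * 2 * (3 * 4)) = 3 * 4 by decide, can_self hL (by decide), one_mul]
    _ = E (Q.can Q.legs₄ (1 * (2 * (3 * 4))) (1 * 2 * (3 * 4)) *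
          Q.can Q.legs₄ (1 * (2 * 3) * 4) (1 * (2 * (3 * 4)))) := by
        rw [can_trans hL _ (by decide) (by decide), can_trans hL _ (by decide) (by decide)]
    _ = E (Q.can Q.legs₄ (1 * (2 * 3 * 4)) (1 * (2 * (3 * 4))) *
          Q.can Q.legs₄ (1 * (2 * 3) * 4) (1 * (2 * 3 * 4))) := by
        rw [kill_can_left (3 * 4) hL k34 (by decide),
          show kill (3 * 4) (1 * (2 * (3 * 4))) = 1 * 2 by decide,
          show kill (3 * 4) (1 * 2 * (3 * 4)) = 1 * 2 by decide, can_self hL (by decide), one_mul,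
          can_trans hL _ (by decide) (by decide)]
    _ = E (Q.ph Q.legs₄ 2 3 4) := by
        rw [kill_can_right (2 * 3) hL k23 (by decide),
          show kill (2 * 3) (1 * (2 * 3) * 4) = 1 * 4 by decide,
          show kill (2 * 3) (1 * (2 * 3 * 4)) = 1 * 4 by decide, can_self hL (by decide), mul_one,
          show Q.can Q.legs₄ (1 * (2 * 3 * 4)) (1 * (2 * (3 * 4))) = Q.ph Q.legs₄ 2 3 4 from
          (can_right hL (by decide) (by decide)).trans (can_assoc hL (by decide))]
    _ = Q.drinfeldA * Q.comul (Q.zigMap Q.phi.val) := by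
        rw [ph]
        generalize Q.phi.val = t
        apply tensor_ind₃ t; intro a b c
        simp [E, place, ev, antipodeCop_one]
    _ = Q.drinfeldA := by rw [zigMap_phi, map_one, mul_one]

lemma comul_beta_drinfeldFInv : Q.comul Q.beta * Q.drinfeldFInv = Q.drinfeldB := by
  have hL := Q.isLegs_legs₄
  let E : H ⊗[k] (H ⊗[k] (H ⊗[k] H)) →ₗ[k] H ⊗[k] H :=
    multilin₄ (k := k) (fun x y z w =>
      Q.contrB ((x * Q.beta * Q.antipode y * Q.alpha * z) ⊗ₜ[k] w))
  have k34 : ∀ x X, E (X * Q.ev Q.legs₄ (3 * 4) x) = Q.counit x • E X := by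
    intro x X
    apply tensor_ind₄ X; intro a b c d
    exact Q.absorb_right Q.contrB_comul
      (sandwich LinearMap.id (Q.comul (a * Q.beta * Q.antipode b * Q.alpha * c))
        (Q.antipodeCop d))
      (by simp [E, antipodeCop_mul, mul_assoc]) (by simp [E, mul_assoc]) x
  have k23 : ∀ x X, E (Q.ev Q.legs₄ (2 * 3) x * X) = Q.counit x • E X := by
    intro x X
    apply tensor_ind₄ X; intro a b c d
    exact Q.absorb_left Q.contrAlpha_comul
      (sandwich Q.comul.toLinearMap (Q.comul (a * Q.beta * Q.antipode b))
        (Q.comul c * Q.drinfeldB * Q.antipodeCop d))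
      (by simp [E, Q.antipode_mul, mul_assoc]) (by simp [E, mul_assoc]) x
  have k12 : ∀ x X, E (X * Q.ev Q.legs₄ (1 * 2) x) = Q.counit x • E X := by
    intro x X
    apply tensor_ind₄ X; intro a b c d
    exact Q.absorb_right Q.contrBeta_comul
      (sandwich Q.comul.toLinearMap (Q.comul a)
        (Q.comul (Q.antipode b * Q.alpha * c) * Q.drinfeldB * Q.antipodeCop d))
      (by simp [E, Q.antipode_mul, mul_assoc]) (by simp [E, mul_assoc]) x
  have e1 : E (Q.can Q.legs₄ (1 * (2 * (3 * 4))) (1 * (2 * 3 * 4))) =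
      Q.comul Q.beta * Q.drinfeldFInv := by
    rw [show Q.can Q.legs₄ (1 * (2 * (3 * 4))) (1 * (2 * 3 * 4)) = Q.phi' Q.legs₄ 2 3 4 from
      (can_right hL (by decide) (by decide)).trans (can_assocInv hL (by decide)), phi',
      drinfeldFInv_eq, qL_eq]
    generalize Q.phiInv = s
    apply tensor_ind₃ s; intro a b c
    simp [E, place, ev, mul_assoc]
  rw [← e1]
  calc E (Q.can Q.legs₄ (1 * (2 * (3 * 4))) (1 * (2 * 3 * 4)))
      = E (Q.can Q.legs₄ (1 * (2 * (3 * 4))) (1 * (2 * 3 * 4)) *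
          Q.can Q.legs₄ (1 * 2 * (3 * 4)) (1 * (2 * (3 * 4)))) := by
        rw [kill_can_right (3 * 4) hL k34 (by decide),
          show kill (3 * 4) (1 * (2 * (3 * 4))) = 1 * 2 by decide,
          show kill (3 * 4) (1 * 2 * (3 * 4)) = 1 * 2 by decide, can_self hL (by decide), mul_one]
    _ = E (Q.can Q.legs₄ (1 * (2 * 3) * 4) (1 * (2 * 3 * 4)) *
          Q.can Q.legs₄ (1 * 2 * (3 * 4)) (1 * (2 * 3) * 4)) := by
        rw [can_trans hL _ (by decide) (by decide), can_trans hL _ (by decide) (by decide)]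
    _ = E (Q.can Q.legs₄ (1 * 2 * 3 * 4) (1 * (2 * 3) * 4) *
          Q.can Q.legs₄ (1 * 2 * (3 * 4)) (1 * 2 * 3 * 4)) := by
        rw [kill_can_left (2 * 3) hL k23 (by decide),
          show kill (2 * 3) (1 * (2 * 3) * 4) = 1 * 4 by decide,
          show kill (2 * 3) (1 * (2 * 3 * 4)) = 1 * 4 by decide, can_self hL (by decide), one_mul,
          can_trans hL _ (by decide) (by decide)]
    _ = E (Q.ph Q.legs₄ 1 2 3) := by
        rw [kill_can_right (1 * 2) hL k12 (by decide),
          show kill (1 * 2) (1 * 2 * 3 * 4) = 3 * 4 by decide,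
          show kill (1 * 2) (1 * 2 * (3 * 4)) = 3 * 4 by decide, can_self hL (by decide), mul_one,
          show Q.can Q.legs₄ (1 * 2 * 3 * 4) (1 * (2 * 3) * 4) = Q.ph Q.legs₄ 1 2 3 from
          (can_left hL (by decide) (by decide)).trans (can_assoc hL (by decide))]
    _ = Q.comul (Q.zigMap Q.phi.val) * Q.drinfeldB := by
        rw [ph]
        generalize Q.phi.val = t
        apply tensor_ind₃ t; intro a b c
        simp [E, place, ev, antipodeCop_one]
    _ = Q.drinfeldB := by rw [zigMap_phi, map_one, one_mul]

end Drinfeld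
end QuasiHopfAlgebra

namespace QuasiHopfAlgebra

variable {k H : Type*} [Field k] [Ring H] [Algebra k H] {Q : QuasiHopfAlgebra k H}

section
variable {M₁ M₂ M₃ M₄ M₅ M₆ : Type*}
  [AddCommGroup M₁] [Module k M₁] [AddCommGroup M₂] [Module k M₂]
  [AddCommGroup M₃] [Module k M₃] [AddCommGroup M₄] [Module k M₄]
  [AddCommGroup M₅] [Module k M₅] [AddCommGroup M₆] [Module k M₆]
lemma tensor_ind₆ {p : M₁ ⊗[k] (M₂ ⊗[k] (M₃ ⊗[k] (M₄ ⊗[k] (M₅ ⊗[k] M₆)))) → Prop} (t)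
    (tmul : ∀ x y z w v u, p (x ⊗ₜ (y ⊗ₜ (z ⊗ₜ (w ⊗ₜ (v ⊗ₜ u))))))
    (add : ∀ s t, p s → p t → p (s + t) := by
      intro s t hs ht
      simp only [map_add, mul_add, add_mul, smul_add, tmul_add,
        add_tmul, LinearMap.add_apply, hs, ht]) : p t := by
  refine tensor_ind₂ t (fun x r => ?_) add
  refine tensor_ind₅ (p := fun r => p (x ⊗ₜ r)) r (tmul x) fun s t hs ht => ?_
  rw [tmul_add]; exact add _ _ hs ht
end

variable (Q)

@[simp] lemma legs₆_one (x : H) : Q.legs₆ 1 x = x ⊗ₜ (1 ⊗ₜ (1 ⊗ₜ (1 ⊗ₜ (1 ⊗ₜ 1)))) := rfl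
@[simp] lemma legs₆_two (x : H) : Q.legs₆ 2 x = 1 ⊗ₜ (x ⊗ₜ (1 ⊗ₜ (1 ⊗ₜ (1 ⊗ₜ 1)))) := rfl
@[simp] lemma legs₆_three (x : H) : Q.legs₆ 3 x = 1 ⊗ₜ (1 ⊗ₜ (x ⊗ₜ (1 ⊗ₜ (1 ⊗ₜ 1)))) := rfl
@[simp] lemma legs₆_four (x : H) : Q.legs₆ 4 x = 1 ⊗ₜ (1 ⊗ₜ (1 ⊗ₜ (x ⊗ₜ (1 ⊗ₜ 1)))) := rfl
@[simp] lemma legs₆_five (x : H) : Q.legs₆ 5 x = 1 ⊗ₜ (1 ⊗ₜ (1 ⊗ₜ (1 ⊗ₜ (x ⊗ₜ 1)))) := rfl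
@[simp] lemma legs₆_six (x : H) : Q.legs₆ 6 x = 1 ⊗ₜ (1 ⊗ₜ (1 ⊗ₜ (1 ⊗ₜ (1 ⊗ₜ x)))) := rfl

section DrinfeldInverse

/-- The contraction `x₁ ⊗ ⋯ ⊗ x₆ ↦ S(x₂) α x₃ β S(x₆) ⊗ S(x₁) α x₄ β S(x₅)`. -/
def drinfeldABMap : H ⊗[k] (H ⊗[k] (H ⊗[k] (H ⊗[k] (H ⊗[k] H)))) →ₗ[k] H ⊗[k] H :=
  Q.drinfeldAMap ∘ₗ TensorProduct.map LinearMap.id (TensorProduct.map LinearMap.id Q.drinfeldBMap)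

@[simp] lemma drinfeldABMap_tmul (x y z w v u : H) :
    Q.drinfeldABMap (x ⊗ₜ (y ⊗ₜ (z ⊗ₜ (w ⊗ₜ (v ⊗ₜ u))))) =
      (Q.antipode y * Q.alpha * (z * Q.beta * Q.antipode u)) ⊗ₜ[k]
        (Q.antipode x * Q.alpha * (w * Q.beta * Q.antipode v)) := rfl

/-- `x ⊗ y ⊗ z ↦ (S ⊗ S)Δ^cop(x) a Δ(y) b (S ⊗ S)Δ^cop(z)` -/
def contrAB : H ⊗[k] (H ⊗[k] H) →ₗ[k] H ⊗[k] H :=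
  pw (mulRight k Q.drinfeldA ∘ₗ Q.antipodeCop) Q.contrB

@[simp] lemma contrAB_tmul (x y z : H) : Q.contrAB (x ⊗ₜ (y ⊗ₜ z)) =
    Q.antipodeCop x * Q.drinfeldA * (Q.comul y * Q.drinfeldB * Q.antipodeCop z) := rfl

lemma map_can {B C : Type*} [Ring B] [Algebra k B] [Ring C] [Algebra k C]
    {L : ℕ → H →ₗ[k] B} {L' : ℕ → H →ₗ[k] C} (F : B →ₐ[k] C) (f : ℕ → LegTree) {s t : LegTree}
    (hL : IsLegs L') (h : s.leaves = t.leaves) (hn : (s.bind f).leaves.Nodup)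
    (hf : ∀ i ∈ s.leaves, Q.ev L' (f i) = F.toLinearMap ∘ₗ L i) :
    F (Q.can L s t) = Q.can L' (s.bind f) (t.bind f) :=
  ((((can_path h).map F).bind f hf).can_eq hL hn).symm

/-- The first four factors of the sixfold tensor power. -/
def firstFour : H ⊗[k] (H ⊗[k] (H ⊗[k] H)) →ₐ[k]
    H ⊗[k] (H ⊗[k] (H ⊗[k] (H ⊗[k] (H ⊗[k] H)))) :=
  idTensor (idTensor
    (idTensor includeLeft))

/-- The last four factors of the sixfold tensor power. -/
def lastFour : H ⊗[k] (H ⊗[k] (H ⊗[k] H)) →ₐ[k]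
    H ⊗[k] (H ⊗[k] (H ⊗[k] (H ⊗[k] (H ⊗[k] H)))) :=
  includeRight.comp includeRight

@[simp] lemma firstFour_tmul (x y z w : H) : firstFour (k := k) (x ⊗ₜ (y ⊗ₜ (z ⊗ₜ w))) =
    x ⊗ₜ (y ⊗ₜ (z ⊗ₜ (w ⊗ₜ (1 ⊗ₜ 1)))) := rfl
@[simp] lemma lastFour_tmul (x y z w : H) : lastFour (k := k) (x ⊗ₜ (y ⊗ₜ (z ⊗ₜ w))) =
    1 ⊗ₜ (1 ⊗ₜ (x ⊗ₜ (y ⊗ₜ (z ⊗ₜ w)))) := rfl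

/-- The six-fold contraction which produces `contrAB φ⁻¹`. -/
lemma contrAB_phiInv_eq : Q.contrAB Q.phiInv = Q.drinfeldABMap
    (Q.can Q.legs₆ (1 * 2 * ((3 * (4 * 5)) * 6)) (1 * (2 * 3 * 4) * (5 * 6))) := by
  have hL := Q.isLegs_legs₆
  have e : Q.can Q.legs₆ (1 * 2 * ((3 * (4 * 5)) * 6)) (1 * (2 * 3 * 4) * (5 * 6)) =
      firstFour (Q.can Q.legs₄ (1 * 2 * (3 * 4)) (1 * (2 * 3 * 4))) *
        (Q.phi' Q.legs₆ (1 * 2) (3 * 4) (5 * 6) *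
          lastFour (Q.can Q.legs₄ (1 * (2 * 3) * 4) (1 * 2 * (3 * 4)))) := by
    rw [← can_trans hL (1 * 2 * (3 * 4) * (5 * 6)) (by decide) (by decide),
      ← can_trans hL (u := 1 * 2 * (3 * 4) * (5 * 6)) (1 * 2 * (3 * 4 * (5 * 6)))
        (by decide) (by decide)]
    refine congrArg₂ _ ((can_left hL (by decide) (by decide)).trans ?_) (congrArg₂ _
      (can_assocInv hL (by decide)) ((can_right hL (by decide) (by decide)).trans ?_))
    · refine ((Q.map_can (L := Q.legs₄) (L' := Q.legs₆) (s := 1 * 2 * (3 * 4))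
        (t := 1 * (2 * 3 * 4)) firstFour .leaf hL (by decide) (by decide) ?_)).symm
      intro i hi
      fin_cases hi <;> rfl
    · refine ((Q.map_can (L := Q.legs₄) (L' := Q.legs₆) (s := 1 * (2 * 3) * 4)
        (t := 1 * 2 * (3 * 4)) lastFour (fun i => .leaf (i + 2)) hL
        (by decide) (by decide) ?_)).symm
      intro i hi
      fin_cases hi <;> rfl
  rw [e, contrAB, contrB, drinfeldA_eq, drinfeldB_eq, phi']
  generalize Q.can Q.legs₄ (1 * 2 * (3 * 4)) (1 * (2 * 3 * 4)) = A
  generalize Q.can Q.legs₄ (1 * (2 * 3) * 4) (1 * 2 * (3 * 4)) = B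
  generalize Q.phiInv = s
  apply tensor_ind₃ s; intro a b c
  change (Q.antipodeCop a * _) * (Q.comul b * _ * Q.antipodeCop c) =
    Q.drinfeldABMap (_ * (pw (Q.legs₆ 1) (Q.legs₆ 2) (Q.comul a) *
      (pw (Q.legs₆ 3) (Q.legs₆ 4) (Q.comul b) * pw (Q.legs₆ 5) (Q.legs₆ 6) (Q.comul c)) * _))
  simp only [antipodeCop, comp_apply, AlgHom.toLinearMap_apply, LinearEquiv.coe_coe]
  generalize Q.comul a = a
  generalize Q.comul b = b
  generalize Q.comul c = c
  apply tensor_ind₄ A; intro A₁ A₂ A₃ A₄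
  apply tensor_ind₄ B; intro B₁ B₂ B₃ B₄
  apply tensor_ind₂ a; intro a₁ a₂
  apply tensor_ind₂ b; intro b₁ b₂
  apply tensor_ind₂ c; intro c₁ c₂
  simp [Q.antipode_mul, mul_assoc]

lemma contrAB_phiInv : Q.contrAB Q.phiInv = 1 := by
  have hL := Q.isLegs_legs₆
  set E := Q.drinfeldABMap with hE
  have k23 : ∀ x X, E (Q.ev Q.legs₆ (2 * 3) x * X) = Q.counit x • E X := by
    intro x X
    apply tensor_ind₆ X; intro a b c d e f
    exact Q.absorb_left Q.contrAlpha_comul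
      (sandwich inL (Q.antipode b ⊗ₜ 1) ((c * Q.beta * Q.antipode f) ⊗ₜ
        (Q.antipode a * Q.alpha * (d * Q.beta * Q.antipode e))))
      (by simp [E, Q.antipode_mul, mul_assoc]) (by simp [E, mul_assoc]) x
  have k14 : ∀ x X, E (Q.ev Q.legs₆ (1 * 4) x * X) = Q.counit x • E X := by
    intro x X
    apply tensor_ind₆ X; intro a b c d e f
    exact Q.absorb_left Q.contrAlpha_comul
      (sandwich inR (1 ⊗ₜ Q.antipode a) ((Q.antipode b * Q.alpha * (c * Q.beta * Q.antipode f)) ⊗ₜ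
        (d * Q.beta * Q.antipode e)))
      (by simp [E, Q.antipode_mul, mul_assoc]) (by simp [E, mul_assoc]) x
  have k45 : ∀ x X, E (X * Q.ev Q.legs₆ (4 * 5) x) = Q.counit x • E X := by
    intro x X
    apply tensor_ind₆ X; intro a b c d e f
    exact Q.absorb_right Q.contrBeta_comul
      (sandwich inR ((Q.antipode b * Q.alpha * (c * Q.beta * Q.antipode f)) ⊗ₜ
        (Q.antipode a * Q.alpha * d)) (1 ⊗ₜ Q.antipode e))
      (by simp [E, Q.antipode_mul, mul_assoc]) (by simp [E, mul_assoc]) x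
  have k36 : ∀ x X, E (X * Q.ev Q.legs₆ (3 * 6) x) = Q.counit x • E X := by
    intro x X
    apply tensor_ind₆ X; intro a b c d e f
    exact Q.absorb_right Q.contrBeta_comul
      (sandwich inL ((Q.antipode b * Q.alpha * c) ⊗ₜ
        (Q.antipode a * Q.alpha * (d * Q.beta * Q.antipode e))) (Q.antipode f ⊗ₜ 1))
      (by simp [E, Q.antipode_mul, mul_assoc]) (by simp [E, mul_assoc]) x
  rw [contrAB_phiInv_eq, ← can_trans hL (1 * ((2 * 3) * (4 * 5) * 6)) (by decide) (by decide),
    kill_can_left_to (2 * 3) (1 * (4 * 5 * 6)) (1 * 4 * (5 * 6)) hL k23 (by decide),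
    kill_can_right_to (4 * 5) (1 * 2 * (3 * 6)) (1 * (2 * 3 * 6)) hL k45 (by decide),
    ← can_trans hL (u := 1 * 4 * (5 * 6)) (1 * 4 * 5 * 6) (by decide) (by decide), mul_assoc,
    kill_can_left_one (1 * 4) hL k14 (by decide),
    ← can_trans hL (u := 1 * 4 * 5 * 6) (1 * (4 * 5) * 6) (by decide) (by decide), mul_assoc,
    kill_can_mid_one (4 * 5) hL k45 (by decide) _ _
      (fun x => can_commute_of hL (by decide) x),
    ← can_trans hL (u := 1 * (2 * 3 * 6)) (1 * (2 * (3 * 6))) (by decide) (by decide), ← mul_assoc,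
    kill_can_right_one (3 * 6) hL k36 (by decide),
    show Q.can Q.legs₆ (1 * (4 * 5) * 6) (1 * 4 * 5 * 6) = Q.phi' Q.legs₆ 1 4 5 from
      (can_left hL (by decide) (by decide)).trans (can_assocInv hL (by decide)),
    show Q.can Q.legs₆ (1 * (2 * (3 * 6))) (1 * (2 * 3 * 6)) = Q.phi' Q.legs₆ 2 3 6 from
      (can_right hL (by decide) (by decide)).trans (can_assocInv hL (by decide)), phi', phi']
  have h : ∀ s t, E (Q.place Q.legs₆ 1 4 5 s * Q.place Q.legs₆ 2 3 6 t) =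
      Q.zagMap t ⊗ₜ Q.zagMap s := by
    intro s t
    apply tensor_ind₃ s; intro a b c
    apply tensor_ind₃ t; intro a b c
    simp [E, place, ev, mul_assoc]
  rw [h, zagMap_phiInv, Algebra.TensorProduct.one_def]

lemma drinfeldF_mul_drinfeldFInv : Q.drinfeldF * Q.drinfeldFInv = 1 := by
  rw [← contrAB_phiInv, drinfeldFInv_eq, qL_eq]
  generalize Q.phiInv = s
  apply tensor_ind₃ s; intro a b c
  have := congrArg (· * (Q.comul b * Q.drinfeldB * Q.antipodeCop c))
    (congrArg (· * Q.comul Q.alpha) (Q.drinfeldF_comul_antipode a))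
  simpa [mul_assoc, ← drinfeldF_comul_alpha] using this

lemma drinfeldFInv_mul_drinfeldF [Module.Finite k H] : Q.drinfeldFInv * Q.drinfeldF = 1 := by
  have : IsArtinianRing (H ⊗[k] H) := IsArtinianRing.of_finite k _
  exact mul_eq_one_symm Q.drinfeldF_mul_drinfeldFInv

lemma comul_antipode_drinfeldFInv [Module.Finite k H] (h : H) :
    Q.comul (Q.antipode h) * Q.drinfeldFInv = Q.drinfeldFInv * Q.antipodeCop h := by
  calc _ = Q.drinfeldFInv * (Q.drinfeldF * Q.comul (Q.antipode h)) * Q.drinfeldFInv := by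
        rw [← mul_assoc, drinfeldFInv_mul_drinfeldF, one_mul]
    _ = _ := by
        rw [drinfeldF_comul_antipode, mul_assoc, mul_assoc, drinfeldF_mul_drinfeldFInv, mul_one]

lemma drinfeldFInv_mul_drinfeldA [Module.Finite k H] :
    Q.drinfeldFInv * Q.drinfeldA = Q.comul Q.alpha := by
  rw [← drinfeldF_comul_alpha, ← mul_assoc, drinfeldFInv_mul_drinfeldF, one_mul]

end DrinfeldInverse
end QuasiHopfAlgebra

namespace QuasiHopfAlgebra

variable {k H : Type*} [Field k] [Ring H] [Algebra k H] (Q : QuasiHopfAlgebra k H)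

/-! ### Counits and the elements `U` and `V` -/

section Counits

/-- `id ⊗ ε` -/
def idCounit : H ⊗[k] H →ₐ[k] H :=
  (Algebra.TensorProduct.rid k k H).toAlgHom.comp
    (idTensor Q.counit)

/-- `ε ⊗ id` -/
def counitId : H ⊗[k] H →ₐ[k] H :=
  (Algebra.TensorProduct.lid k H).toAlgHom.comp
    (Algebra.TensorProduct.map Q.counit (AlgHom.id k H))

@[simp] lemma idCounit_tmul (x y : H) : Q.idCounit (x ⊗ₜ y) = Q.counit y • x := by
  simp [idCounit]
@[simp] lemma counitId_tmul (x y : H) : Q.counitId (x ⊗ₜ y) = Q.counit x • y := by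
  simp [counitId]
@[simp] lemma idCounit_comul (h : H) : Q.idCounit (Q.comul h) = h := Q.counit_right h
@[simp] lemma counitId_comul (h : H) : Q.counitId (Q.comul h) = h := Q.counit_left h

lemma counit_idCounit (t) : Q.counit (Q.idCounit t) = Q.counit (Q.counitId t) := by
  apply tensor_ind₂ t; intro a b
  simp [mul_comm]

variable {B : Type*} [Ring B] [Algebra k B] {L : ℕ → H →ₗ[k] B}

lemma map_can_eq_one {C : Type*} [Ring C] [Algebra k C] {L' : ℕ → H →ₗ[k] C}
    (F : C →ₐ[k] B) (f : ℕ → LegTree) (s t : LegTree) (hL : IsLegs L)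
    (h : s.leaves = t.leaves ∧ (s.bind f).leaves = (t.bind f).leaves ∧
      (s.bind f).leaves.Nodup ∧ (s.bind f).strip = (t.bind f).strip ∧
      (s.bind f).strip.leaves.Nodup)
    (hf : ∀ i ∈ s.leaves, Q.ev L (f i) = F.toLinearMap ∘ₗ L' i) :
    F (Q.can L' s t) = 1 := by
  rw [Q.map_can F f hL h.1 h.2.2.1 hf, ← can_strip hL ⟨h.2.1, h.2.2.1⟩, h.2.2.2.1, can_self hL
    (h.2.2.2.1 ▸ h.2.2.2.2)]

lemma phiInv_eq_can : Q.phiInv = Q.can Q.legs₃ (1 * (2 * 3)) (1 * 2 * 3) :=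
  (can_assocInv (a := 1) (b := 2) (c := 3) Q.isLegs_legs₃ (by decide)).trans Q.phi'_legs₃ |>.symm

lemma phi_eq_can : Q.phi.val = Q.can Q.legs₃ (1 * 2 * 3) (1 * (2 * 3)) :=
  (can_assoc (a := 1) (b := 2) (c := 3) Q.isLegs_legs₃ (by decide)).trans Q.ph_legs₃ |>.symm

/-- `id ⊗ ε ⊗ ε` -/
def idCounitCounit : H ⊗[k] (H ⊗[k] H) →ₐ[k] H :=
  Q.idCounit.comp (idTensor Q.counitId)

/-- `ε ⊗ ε ⊗ id` -/
def counitCounitId : H ⊗[k] (H ⊗[k] H) →ₐ[k] H :=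
  Q.counitId.comp (idTensor Q.counitId)

@[simp] lemma idCounitCounit_tmul (x y z : H) :
    Q.idCounitCounit (x ⊗ₜ (y ⊗ₜ z)) = Q.counit y • Q.counit z • x := by
  simp [idCounitCounit, smul_smul]
@[simp] lemma counitCounitId_tmul (x y z : H) :
    Q.counitCounitId (x ⊗ₜ (y ⊗ₜ z)) = Q.counit y • Q.counit x • z := by
  simp [counitCounitId]

lemma idCounitCounit_phiInv : Q.idCounitCounit Q.phiInv = 1 := by
  rw [phiInv_eq_can]
  refine Q.map_can_eq_one (L := Q.legs₁) _ (fun i => if i = 1 then 1 else .one) _ _ Q.isLegs_legs₁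
    (by decide) fun i hi => ?_
  fin_cases hi <;> ext <;> simp [ev, legs₁, unitLeg_apply, Algebra.algebraMap_eq_smul_one]

lemma idCounitCounit_phi : Q.idCounitCounit Q.phi.val = 1 := by
  rw [phi_eq_can]
  refine Q.map_can_eq_one (L := Q.legs₁) _ (fun i => if i = 1 then 1 else .one) _ _ Q.isLegs_legs₁
    (by decide) fun i hi => ?_
  fin_cases hi <;> ext <;> simp [ev, legs₁, unitLeg_apply, Algebra.algebraMap_eq_smul_one]

lemma counitCounitId_phiInv : Q.counitCounitId Q.phiInv = 1 := by
  rw [phiInv_eq_can]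
  refine Q.map_can_eq_one (L := Q.legs₁) _ (fun i => if i = 3 then 1 else .one) _ _ Q.isLegs_legs₁
    (by decide) fun i hi => ?_
  fin_cases hi <;> ext <;> simp [ev, legs₁, unitLeg_apply, Algebra.algebraMap_eq_smul_one]

lemma counitCounitId_phi : Q.counitCounitId Q.phi.val = 1 := by
  rw [phi_eq_can]
  refine Q.map_can_eq_one (L := Q.legs₁) _ (fun i => if i = 3 then 1 else .one) _ _ Q.isLegs_legs₁
    (by decide) fun i hi => ?_
  fin_cases hi <;> ext <;> simp [ev, legs₁, unitLeg_apply, Algebra.algebraMap_eq_smul_one]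

lemma idCounit_pR : Q.idCounit Q.pR = 1 := by
  rw [← Q.idCounitCounit_phiInv, pR_eq]
  generalize Q.phiInv = t
  apply tensor_ind₃ t; intro a b c
  simp [counit_antipode, counit_beta, smul_smul]

lemma counitId_qL : Q.counitId Q.qL = 1 := by
  rw [← Q.counitCounitId_phiInv, qL_eq]
  generalize Q.phiInv = t
  apply tensor_ind₃ t; intro a b c
  simp [counit_antipode, counit_alpha, smul_smul, mul_comm]

lemma idCounit_drinfeldA : Q.idCounit Q.drinfeldA = Q.alpha := by
  let F : H ⊗[k] (H ⊗[k] (H ⊗[k] H)) →ₐ[k] H ⊗[k] H :=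
    ((Algebra.TensorProduct.lid k (H ⊗[k] H)).toAlgHom.comp
      (Algebra.TensorProduct.map Q.counit
        (idTensor Q.idCounit)))
  have h1 : F (Q.can Q.legs₄ (1 * 2 * (3 * 4)) (1 * (2 * 3 * 4))) = 1 := by
    refine Q.map_can_eq_one (L := Q.legs₂) _ (fun i => if i = 2 then 1 else if i = 3 then 2 else .one)
      _ _ Q.isLegs_legs₂ (by decide) fun i hi => ?_
    fin_cases hi <;> ext <;> simp [F, ev, unitLeg_apply, Algebra.algebraMap_eq_smul_one,
      Algebra.TensorProduct.one_def]
  have h2 := congrArg Q.contrAlpha h1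
  rw [drinfeldA_eq]
  refine Eq.trans ?_ (h2.trans (by simp [Algebra.TensorProduct.one_def, Q.antipode_one]))
  generalize Q.can Q.legs₄ (1 * 2 * (3 * 4)) (1 * (2 * 3 * 4)) = t
  apply tensor_ind₄ t; intro a b c d
  simp [F, counit_antipode, counit_alpha, smul_smul, mul_comm]

lemma idCounit_drinfeldF : Q.idCounit Q.drinfeldF = 1 := by
  have h : ∀ x, Q.idCounit (Q.antipodeCop x) = Q.antipode x := by
    intro x
    have : ∀ v, Q.idCounit (TensorProduct.map Q.antipode Q.antipode (TensorProduct.comm k H H v)) =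
        Q.antipode (Q.counitId v) := by
      intro v
      apply tensor_ind₂ v; intro a b
      simp [counit_antipode]
    exact (this _).trans (by simp)
  rw [drinfeldF_eq, pR_eq, ← Q.zagMap_phiInv]
  generalize Q.phiInv = t
  apply tensor_ind₃ t; intro a b c
  simp [h, idCounit_drinfeldA, mul_assoc]

lemma counit_idCounit_drinfeldFInv : Q.counit (Q.idCounit Q.drinfeldFInv) = 1 := by
  have := congrArg (fun x => Q.counit (Q.idCounit x)) Q.drinfeldF_mul_drinfeldFInv
  simpa [idCounit_drinfeldF] using this

end Counits

section FlipAntipode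

/-- `x ⊗ y ↦ S(y) ⊗ S(x)` -/
def flipAntipode : H ⊗[k] H →ₗ[k] H ⊗[k] H :=
  TensorProduct.map Q.antipode Q.antipode ∘ₗ (TensorProduct.comm k H H).toLinearMap

/-- `x ⊗ y ↦ S̄(y) ⊗ S̄(x)` -/
def flipAntipodeInv : H ⊗[k] H →ₗ[k] H ⊗[k] H :=
  TensorProduct.map Q.antipodeInv Q.antipodeInv ∘ₗ (TensorProduct.comm k H H).toLinearMap

@[simp] lemma flipAntipode_tmul (x y : H) :
    Q.flipAntipode (x ⊗ₜ y) = Q.antipode y ⊗ₜ Q.antipode x := rfl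
@[simp] lemma flipAntipodeInv_tmul (x y : H) :
    Q.flipAntipodeInv (x ⊗ₜ y) = Q.antipodeInv y ⊗ₜ Q.antipodeInv x := rfl

lemma flipAntipode_comul (h : H) : Q.flipAntipode (Q.comul h) = Q.antipodeCop h := rfl
lemma VR_eq : Q.VR = Q.flipAntipode Q.pL * Q.drinfeldF := rfl
lemma UR_eq : Q.UR = Q.flipAntipodeInv (Q.qL * Q.drinfeldFInv) := rfl
lemma VL_eq : Q.VL = Q.flipAntipodeInv (Q.drinfeldF * Q.pR) := rfl

lemma flipAntipode_mul (s t) : Q.flipAntipode (s * t) = Q.flipAntipode t * Q.flipAntipode s := by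
  apply tensor_ind₂ s; intro a b
  apply tensor_ind₂ t; intro c d
  simp [Q.antipode_mul]

lemma counit_idCounit_flipAntipode (t) :
    Q.counit (Q.idCounit (Q.flipAntipode t)) = Q.counit (Q.counitId t) := by
  apply tensor_ind₂ t; intro c d
  simp [counit_antipode]

/-- `V Δ(S(h)) = (S ⊗ S)((Δ(h) p^L)₂₁) f` for `V = V^R`. -/
lemma VR_comul_antipode (h : H) :
    Q.VR * Q.comul (Q.antipode h) = Q.flipAntipode (Q.comul h * Q.pL) * Q.drinfeldF := by
  rw [VR_eq, mul_assoc, drinfeldF_comul_antipode, flipAntipode_mul, flipAntipode_comul, mul_assoc]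

variable [Module.Finite k H]

lemma flipAntipodeInv_mul (s t) :
    Q.flipAntipodeInv (s * t) = Q.flipAntipodeInv t * Q.flipAntipodeInv s := by
  apply tensor_ind₂ s; intro a b
  apply tensor_ind₂ t; intro c d
  simp [antipodeInv_mul]

lemma flipAntipodeInv_flipAntipode (t) : Q.flipAntipodeInv (Q.flipAntipode t) = t := by
  apply tensor_ind₂ t; intro c d
  simp

lemma counit_antipodeInv (h : H) : Q.counit (Q.antipodeInv h) = Q.counit h := by
  rw [← counit_antipode, antipode_antipodeInv]

lemma counitId_flipAntipodeInv (t) :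
    Q.counitId (Q.flipAntipodeInv t) = Q.antipodeInv (Q.idCounit t) := by
  apply tensor_ind₂ t; intro c d
  simp [counit_antipodeInv]

lemma counitId_pL : Q.counitId Q.pL = 1 := by
  rw [← Q.counitCounitId_phi, pL_eq]
  generalize Q.phi.val = t
  apply tensor_ind₃ t; intro a b c
  simp [counit_antipodeInv, counit_beta, smul_smul, mul_comm]

lemma idCounit_qR : Q.idCounit Q.qR = 1 := by
  rw [← Q.idCounitCounit_phi, qR_eq]
  generalize Q.phi.val = t
  apply tensor_ind₃ t; intro a b c
  simp [counit_antipodeInv, counit_alpha, smul_smul, mul_comm]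

lemma counitId_VL : Q.counitId Q.VL = 1 := by
  rw [VL_eq, counitId_flipAntipodeInv, map_mul, idCounit_drinfeldF, idCounit_pR, one_mul,
    antipodeInv_one]

lemma counit_counitId_UL : Q.counit (Q.counitId Q.UL) = 1 := by
  have h : Q.counit (Q.counitId (Q.flipAntipode Q.qR)) = 1 := by
    rw [← counit_idCounit, counit_idCounit_flipAntipode, ← counit_idCounit, idCounit_qR, map_one]
  have : Q.UL = Q.drinfeldFInv * Q.flipAntipode Q.qR := rfl
  rw [this, map_mul, map_mul, h, ← counit_idCounit, counit_idCounit_drinfeldFInv, one_mul]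

/-- `Δ(S̄(h)) ĝ = (S̄ ⊗ S̄)((Δ(h) f̄)₂₁)` for `ĝ = (S̄ ⊗ S̄)(f̄₂₁)`. -/
lemma comul_antipodeInv_mul (h : H) :
    Q.comul (Q.antipodeInv h) * Q.flipAntipodeInv Q.drinfeldFInv =
      Q.flipAntipodeInv (Q.comul h * Q.drinfeldFInv) := by
  conv_rhs => rw [← Q.antipode_antipodeInv h]
  rw [comul_antipode_drinfeldFInv, flipAntipodeInv_mul, ← flipAntipode_comul,
    flipAntipodeInv_flipAntipode]

/-- `Δ(S̄(h)) U = (S̄ ⊗ S̄)((q^L Δ(h) f̄)₂₁)` for `U = U^R`. -/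
lemma comul_antipodeInv_UR (h : H) :
    Q.comul (Q.antipodeInv h) * Q.UR = Q.flipAntipodeInv (Q.qL * Q.comul h * Q.drinfeldFInv) := by
  rw [UR_eq, flipAntipodeInv_mul, ← mul_assoc, comul_antipodeInv_mul, mul_assoc,
    flipAntipodeInv_mul (Q := Q) Q.qL]

/-- `Δ(S̄(h₂)) U (1 ⊗ h₁) = U (S̄(h) ⊗ 1)` for `U = U^R`. -/
lemma UR_comul (h : H) :
    pw (mulRight k Q.UR ∘ₗ Q.comul.toLinearMap ∘ₗ Q.antipodeInv) inR
      (TensorProduct.comm k H H (Q.comul h)) = Q.UR * (Q.antipodeInv h ⊗ₜ 1) := by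
  have e := congrArg (fun x => Q.flipAntipodeInv (x * Q.drinfeldFInv)) (Q.qL_comul h)
  rw [mul_assoc, Q.flipAntipodeInv_mul (_ ⊗ₜ _), ← UR_eq, flipAntipodeInv_tmul, antipodeInv_one] at e
  rw [← e]
  generalize Q.comul h = v
  apply tensor_ind₂ v; intro a b
  simp only [TensorProduct.comm_tmul, pw_tmul, comp_apply, AlgHom.toLinearMap_apply,
    mulRight_apply, inL_apply, inR_apply, comul_antipodeInv_UR]
  rw [mul_assoc, mul_assoc, mul_assoc, flipAntipodeInv_mul (Q := Q) (_ ⊗ₜ _)]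
  simp [antipodeInv_one, mul_assoc]

/-- `(1 ⊗ h₁) V Δ(S(h₂)) = (S(h) ⊗ 1) V` for `V = V^R`. -/
lemma VR_comul (h : H) :
    pw inR (mulLeft k Q.VR ∘ₗ Q.comul.toLinearMap ∘ₗ Q.antipode) (Q.comul h) =
      (Q.antipode h ⊗ₜ 1) * Q.VR := by
  have e := congrArg (fun x => Q.flipAntipode x * Q.drinfeldF) (Q.pL_comul h)
  rw [Q.flipAntipode_mul _ (_ ⊗ₜ _), mul_assoc, ← VR_eq, flipAntipode_tmul, Q.antipode_one] at e
  rw [← e]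
  generalize Q.comul h = v
  apply tensor_ind₂ v; intro a b
  simp only [TensorProduct.comm_tmul, pw_tmul, comp_apply, AlgHom.toLinearMap_apply,
    mulLeft_apply, inL_apply, inR_apply, VR_comul_antipode]
  rw [← mul_assoc (Q.comul b), flipAntipode_mul (Q := Q) _ (_ ⊗ₜ _)]
  simp [Q.antipode_one, mul_assoc]

end FlipAntipode

section QLFromVR

/-- `x ⊗ y ⊗ z ↦ (1 ⊗ x) V^R Δ(S(y) α z)` -/
def qLFromVRMap : H ⊗[k] (H ⊗[k] H) →ₗ[k] H ⊗[k] H :=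
  pw inR (mulLeft k Q.VR ∘ₗ Q.comul.toLinearMap ∘ₗ Q.contrAlpha)

@[simp] lemma qLFromVRMap_tmul (x y z : H) : Q.qLFromVRMap (x ⊗ₜ (y ⊗ₜ z)) =
    (1 ⊗ₜ x) * (Q.VR * Q.comul (Q.antipode y * Q.alpha * z)) := rfl

/-- `q^L = (1 ⊗ q^R₁) V^R Δ(S(q^R₂))`, where `q^R₁ ⊗ S(q^R₂) = φ₁ ⊗ S(φ₂) α φ₃`. -/
lemma qLFromVRMap_phi [Module.Finite k H] : Q.qLFromVRMap Q.phi.val = Q.qL := by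
  have hL := Q.isLegs_legs₅
  let E : H ⊗[k] (H ⊗[k] (H ⊗[k] (H ⊗[k] H))) →ₗ[k] H ⊗[k] H :=
    multilin₅ (k := k) (fun a b c d e => (Q.antipode c * Q.alpha * d) ⊗ₜ[k]
        (a * Q.beta * Q.antipode b * Q.alpha * e))
  have k34 : ∀ x X, E (Q.ev Q.legs₅ (3 * 4) x * X) = Q.counit x • E X := by
    intro x X
    apply tensor_ind₅ X; intro a b c d e
    exact Q.absorb_left Q.contrAlpha_comul
      (sandwich inL (Q.antipode c ⊗ₜ 1) (d ⊗ₜ (a * Q.beta * Q.antipode b * Q.alpha * e)))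
      (by simp [E, Q.antipode_mul, mul_assoc]) (by simp [E, mul_assoc]) x
  have k12 : ∀ x X, E (X * Q.ev Q.legs₅ (1 * 2) x) = Q.counit x • E X := by
    intro x X
    apply tensor_ind₅ X; intro a b c d e
    exact Q.absorb_right Q.contrBeta_comul
      (sandwich inR ((Q.antipode c * Q.alpha * d) ⊗ₜ a) (1 ⊗ₜ (Q.antipode b * Q.alpha * e)))
      (by simp [E, Q.antipode_mul, mul_assoc]) (by simp [E, mul_assoc]) x
  have e1 : Q.qLFromVRMap Q.phi.val =
      E (Q.can Q.legs₅ (1 * 2 * 3 * (4 * 5)) (1 * (2 * (3 * 4 * 5)))) := by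
    have e : Q.can Q.legs₅ (1 * 2 * 3 * (4 * 5)) (1 * (2 * (3 * 4 * 5))) =
        includeRight
            (Q.can Q.legs₄ (1 * 2 * (3 * 4)) (1 * (2 * 3 * 4))) *
          (Q.ph Q.legs₅ 1 (2 * 3) (4 * 5) * Q.ph Q.legs₅ 1 2 3) := by
      rw [← can_trans hL (1 * (2 * 3 * (4 * 5))) (by decide) (by decide),
        ← can_trans hL (u := 1 * (2 * 3 * (4 * 5))) (1 * (2 * 3) * (4 * 5))
          (by decide) (by decide)]
      refine congrArg₂ _ ((can_right hL (by decide) (by decide)).trans ?_) (congrArg₂ _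
        (can_assoc hL (by decide)) ((can_left hL (by decide) (by decide)).trans
          (can_assoc hL (by decide))))
      refine ((Q.map_can (L := Q.legs₄) (L' := Q.legs₅) (s := 1 * 2 * (3 * 4))
        (t := 1 * (2 * 3 * 4)) includeRight (fun i => .leaf (i + 1)) hL
        (by decide) (by decide) ?_)).symm
      intro i hi
      fin_cases hi <;> rfl
    have e0 : ∀ y z, Q.VR * Q.comul (Q.antipode y * Q.alpha * z) =
        Q.flipAntipode (Q.comul y * Q.pL) * (Q.drinfeldA * Q.comul z) := by
      intro y z
      rw [map_mul, map_mul, ← mul_assoc, ← mul_assoc, VR_comul_antipode, mul_assoc _ Q.drinfeldF,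
        drinfeldF_comul_alpha, mul_assoc]
    rw [e, ph, ph]
    have e2 : ∀ s, Q.qLFromVRMap s = pw inR (pw (Q.flipAntipode ∘ₗ mulRight k Q.pL ∘ₗ
        Q.comul.toLinearMap) (mulLeft k Q.drinfeldA ∘ₗ Q.comul.toLinearMap)) s := by
      intro s
      apply tensor_ind₃ s; intro a b c
      simp only [qLFromVRMap_tmul, e0]; rfl
    rw [e2, drinfeldA_eq, pL_eq]
    generalize Q.can Q.legs₄ (1 * 2 * (3 * 4)) (1 * (2 * 3 * 4)) = A
    suffices h : ∀ s u, pw inR (pw (Q.flipAntipode ∘ₗ mulRight k (Q.pLMap u) ∘ₗ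
        Q.comul.toLinearMap) (mulLeft k (Q.drinfeldAMap A) ∘ₗ Q.comul.toLinearMap)) s =
        E (includeRight A *
          (Q.place Q.legs₅ 1 (2 * 3) (4 * 5) s * Q.place Q.legs₅ 1 2 3 u)) from h _ _
    intro s u
    apply tensor_ind₃ s; intro a b c
    change (1 ⊗ₜ a) * (Q.flipAntipode (Q.comul b * _) * (_ * Q.comul c)) =
      E (_ * (Q.legs₅ 1 a * (pw (Q.legs₅ 2) (Q.legs₅ 3) (Q.comul b) *
        pw (Q.legs₅ 4) (Q.legs₅ 5) (Q.comul c)) * _))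
    generalize Q.comul b = b
    generalize Q.comul c = c
    apply tensor_ind₂ b; intro b₁ b₂
    apply tensor_ind₂ c; intro c₁ c₂
    apply tensor_ind₄ A; intro A₁ A₂ A₃ A₄
    apply tensor_ind₃ u; intro u v w
    simp [E, place, ev, Q.antipode_mul, mul_assoc]
  rw [e1, ← can_trans hL (1 * 2 * (3 * 4 * 5)) (by decide) (by decide),
    kill_can_left_to (3 * 4) (1 * 2 * 5) (1 * (2 * 5)) hL k34 (by decide),
    kill_can_right_to (1 * 2) (3 * (4 * 5)) (3 * 4 * 5) hL k12 (by decide),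
    show Q.can Q.legs₅ (1 * 2 * 5) (1 * (2 * 5)) = Q.ph Q.legs₅ 1 2 5 from
      can_assoc hL (by decide),
    show Q.can Q.legs₅ (3 * (4 * 5)) (3 * 4 * 5) = Q.phi' Q.legs₅ 3 4 5 from
      can_assocInv hL (by decide), ph, phi', qL_eq]
  have h : ∀ s t, E (Q.place Q.legs₅ 1 2 5 s * Q.place Q.legs₅ 3 4 5 t) =
      (1 ⊗ₜ Q.zigMap s) * Q.qLMap t := by
    intro s t
    apply tensor_ind₃ s; intro a b c
    apply tensor_ind₃ t; intro a b c
    simp [E, place, ev, mul_assoc]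
  rw [h, zigMap_phi, ← Algebra.TensorProduct.one_def, one_mul]

end QLFromVR
end QuasiHopfAlgebra

namespace QuasiHopfAlgebra

variable {k H : Type*} [Field k] [Ring H] [Algebra k H] (Q : QuasiHopfAlgebra k H)

/-! ### Coproducts of integrals -/

section ThreeLegs

lemma map_ev {B C : Type*} [Ring B] [Algebra k B] [Ring C] [Algebra k C]
    {L : ℕ → H →ₗ[k] B} {L' : ℕ → H →ₗ[k] C} (F : B →ₐ[k] C) (f : ℕ → LegTree) {t : LegTree}
    (hf : ∀ i ∈ t.leaves, Q.ev L' (f i) = F.toLinearMap ∘ₗ L i) (x : H) :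
    F (Q.ev L t x) = Q.ev L' (t.bind f) x := by
  rw [ev_map, ev_bind f hf]

/-- `Δ ⊗ id` -/
def comulL : H ⊗[k] H →ₐ[k] H ⊗[k] (H ⊗[k] H) :=
  (Algebra.TensorProduct.assoc k k k H H H).toAlgHom.comp
    (Algebra.TensorProduct.map Q.comul (AlgHom.id k H))

/-- `id ⊗ Δ` -/
def comulR : H ⊗[k] H →ₐ[k] H ⊗[k] (H ⊗[k] H) :=
  idTensor Q.comul

/-- `t ↦ t ⊗ 1` -/
def in12 : H ⊗[k] H →ₐ[k] H ⊗[k] (H ⊗[k] H) :=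
  idTensor includeLeft

/-- `t ↦ 1 ⊗ t` -/
def in23 : H ⊗[k] H →ₐ[k] H ⊗[k] (H ⊗[k] H) := includeRight

@[simp] lemma in12_tmul (x y : H) : in12 (k := k) (x ⊗ₜ y) = x ⊗ₜ (y ⊗ₜ 1) := rfl
@[simp] lemma in23_apply (t : H ⊗[k] H) : in23 t = 1 ⊗ₜ t := rfl
@[simp] lemma comulR_tmul (x y : H) : Q.comulR (x ⊗ₜ y) = x ⊗ₜ Q.comul y := rfl
@[simp] lemma comulL_tmul (x y : H) :
    Q.comulL (x ⊗ₜ y) = in12 (Q.comul x) * (1 ⊗ₜ (1 ⊗ₜ y)) := by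
  change TensorProduct.assoc k H H H (Q.comul x ⊗ₜ y) = _
  generalize Q.comul x = v
  apply tensor_ind₂ v; intro a b
  simp

lemma comulR_comul (h : H) : Q.comulR (Q.comul h) * Q.phi.val = Q.phi.val * Q.comulL (Q.comul h) := by
  have := Q.comul_assoc h
  change Q.comulR (Q.comul h) = Q.phi * Q.comulL (Q.comul h) * _ at this
  rw [this, mul_assoc, Units.inv_mul, mul_one]

lemma comulL_comul (h : H) : Q.comulL (Q.comul h) = Q.ev Q.legs₃ (1 * 2 * 3) h := by
  change _ = pw (Q.ev Q.legs₃ (1 * 2)) (Q.ev Q.legs₃ 3) (Q.comul h)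
  generalize Q.comul h = v
  apply tensor_ind₂ v; intro a b
  change _ = pw (Q.ev Q.legs₃ 1) (Q.ev Q.legs₃ 2) (Q.comul a) * _
  rw [comulL_tmul]
  generalize Q.comul a = v
  apply tensor_ind₂ v; intro a b
  simp [ev]

lemma comulR_comul_eq (h : H) : Q.comulR (Q.comul h) = Q.ev Q.legs₃ (1 * (2 * 3)) h := by
  change _ = pw (Q.ev Q.legs₃ 1) (Q.ev Q.legs₃ (2 * 3)) (Q.comul h)
  generalize Q.comul h = v
  apply tensor_ind₂ v; intro a b
  change _ = _ * pw (Q.ev Q.legs₃ 2) (Q.ev Q.legs₃ 3) (Q.comul b)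
  rw [comulR_tmul]
  generalize Q.comul b = v
  apply tensor_ind₂ v; intro a b
  simp [ev]

/-- `y ↦ 1 ⊗ 1 ⊗ y` -/
def lastThree : H ⊗[k] (H ⊗[k] H) →ₐ[k] H ⊗[k] (H ⊗[k] (H ⊗[k] (H ⊗[k] H))) :=
  includeRight.comp includeRight

/-- `y ↦ y ⊗ 1` -/
def firstFour₅ : H ⊗[k] (H ⊗[k] (H ⊗[k] H)) →ₐ[k] H ⊗[k] (H ⊗[k] (H ⊗[k] (H ⊗[k] H))) :=
  idTensor (idTensor
    (idTensor includeLeft))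

@[simp] lemma lastThree_tmul (x y z : H) : lastThree (k := k) (x ⊗ₜ (y ⊗ₜ z)) =
    1 ⊗ₜ (1 ⊗ₜ (x ⊗ₜ (y ⊗ₜ z))) := rfl
@[simp] lemma firstFour₅_tmul (x y z w : H) : firstFour₅ (k := k) (x ⊗ₜ (y ⊗ₜ (z ⊗ₜ w))) =
    x ⊗ₜ (y ⊗ₜ (z ⊗ₜ (w ⊗ₜ 1))) := rfl

lemma lastThree_phi : lastThree Q.phi.val = Q.ph Q.legs₅ 3 4 5 := by
  rw [ph]
  generalize Q.phi.val = t
  apply tensor_ind₃ t; intro a b c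
  simp [place, ev]

end ThreeLegs

lemma idCounit_qL : Q.idCounit Q.qL = Q.alpha := by
  have h : (idTensor Q.idCounit) Q.phiInv = 1 := by
    rw [phiInv_eq_can]
    refine Q.map_can_eq_one (L := Q.legs₂) _
      (fun i => if i = 1 then 1 else if i = 2 then 2 else .one) _ _ Q.isLegs_legs₂
      (by decide) fun i hi => ?_
    fin_cases hi <;> ext <;>
      simp [ev, unitLeg_apply, Algebra.algebraMap_eq_smul_one, Algebra.TensorProduct.one_def]
  have e := congrArg Q.contrAlpha h
  rw [Algebra.TensorProduct.one_def, contrAlpha_tmul, Q.antipode_one, one_mul, mul_one] at e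
  rw [← e, qL_eq]
  generalize Q.phiInv = t
  apply tensor_ind₃ t; intro a b c
  simp

section Integral
variable {Q} {Lam : H}

/-- Drinfeld's gauge transformation measures the failure of `q^L Δ(Λ)` to be coassociative:
`(f ⊗ 1)(Δ ⊗ id)(z) = (1 ⊗ q^L)(id ⊗ Δ)(z) φ` for `z = q^L Δ(Λ)`. -/
lemma IsLeftIntegral.drinfeldF_comulL (h : Q.IsLeftIntegral Lam) :
    in12 Q.drinfeldF * Q.comulL (Q.qL * Q.comul Lam) =
      in23 Q.qL * Q.comulR (Q.qL * Q.comul Lam) * Q.phi.val := by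
  have hL := Q.isLegs_legs₅
  let E : H ⊗[k] (H ⊗[k] (H ⊗[k] (H ⊗[k] H))) →ₗ[k] H ⊗[k] (H ⊗[k] H) :=
    multilin₅ (k := k) (fun a b c d e => (Q.antipode b * Q.alpha * c) ⊗ₜ[k]
        ((Q.antipode a * Q.alpha * d) ⊗ₜ[k] e))
  have k23 : ∀ x X, E (Q.ev Q.legs₅ (2 * 3) x * X) = Q.counit x • E X := by
    intro x X
    apply tensor_ind₅ X; intro a b c d e
    exact Q.absorb_left Q.contrAlpha_comul
      (sandwich ((includeLeft : H →ₐ[k] _).toLinearMap)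
        (Q.antipode b ⊗ₜ (1 ⊗ₜ 1)) (c ⊗ₜ ((Q.antipode a * Q.alpha * d) ⊗ₜ e)))
      (by simp [E, Q.antipode_mul, mul_assoc]) (by simp [E, mul_assoc]) x
  have hE : ∀ X Y, E X * Y = E (X * lastThree Y) := by
    intro X Y
    apply tensor_ind₅ X; intro a b c d e
    apply tensor_ind₃ Y; intro u v w
    simp [E, mul_assoc]
  have hLam : lastThree (Q.comulL (Q.comul Lam)) = Q.ev Q.legs₅ (3 * 4 * 5) Lam := by
    rw [comulL_comul]
    refine Q.map_ev (L' := Q.legs₅) (t := 1 * 2 * 3) lastThree (fun i => .leaf (i + 2)) ?_ Lam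
    intro i hi
    fin_cases hi <;> rfl
  -- the integral absorbs the block in which its coproduct is placed
  let E' := E ∘ₗ mulRight k (Q.ev Q.legs₅ (3 * 4 * 5) Lam)
  have kLam : ∀ x X, E' (X * Q.ev Q.legs₅ (3 * 4 * 5) x) = Q.counit x • E' X := by
    intro x X
    simp only [E', comp_apply, mulRight_apply]
    rw [mul_assoc, ← Q.ev_mul hL (by decide), h, map_smul, mul_smul_comm, map_smul]
  have e1 : in12 Q.drinfeldF * Q.comulL Q.qL =
      E (Q.can Q.legs₅ (1 * 2 * (3 * 4 * 5)) (1 * (2 * 3 * 4) * 5)) := by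
    have e : Q.can Q.legs₅ (1 * 2 * (3 * 4 * 5)) (1 * (2 * 3 * 4) * 5) =
        firstFour₅ (Q.can Q.legs₄ (1 * 2 * (3 * 4)) (1 * (2 * 3 * 4))) *
          Q.phi' Q.legs₅ (1 * 2) (3 * 4) 5 := by
      rw [← can_trans hL (1 * 2 * (3 * 4) * 5) (by decide) (by decide)]
      refine congrArg₂ _ ((can_left hL (by decide) (by decide)).trans ?_)
        (can_assocInv hL (by decide))
      refine ((Q.map_can (L := Q.legs₄) (L' := Q.legs₅) (s := 1 * 2 * (3 * 4))
        (t := 1 * (2 * 3 * 4)) firstFour₅ .leaf hL (by decide) (by decide) ?_)).symm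
      intro i hi
      fin_cases hi <;> rfl
    have e0 : ∀ x y, Q.drinfeldF * Q.comul (Q.antipode x * Q.alpha * y) =
        Q.antipodeCop x * (Q.drinfeldA * Q.comul y) := by
      intro x y
      rw [map_mul, map_mul, ← mul_assoc, ← mul_assoc, drinfeldF_comul_antipode, mul_assoc _ Q.drinfeldF,
        drinfeldF_comul_alpha, mul_assoc]
    rw [e, phi', qL_eq]
    generalize Q.phiInv = s
    apply tensor_ind₃ s; intro a b c
    rw [qLMap_tmul, comulL_tmul, ← mul_assoc, ← map_mul, e0, drinfeldA_eq]
    generalize Q.can Q.legs₄ (1 * 2 * (3 * 4)) (1 * (2 * 3 * 4)) = A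
    change in12 (Q.flipAntipode (Q.comul a) * _) * _ = E (_ *
      (pw (Q.legs₅ 1) (Q.legs₅ 2) (Q.comul a) * (pw (Q.legs₅ 3) (Q.legs₅ 4) (Q.comul b) * _)))
    generalize Q.comul a = a
    generalize Q.comul b = b
    apply tensor_ind₂ b; intro b₁ b₂
    apply tensor_ind₂ a; intro c₁ c₂
    apply tensor_ind₄ A; intro A₁ A₂ A₃ A₄
    simp [E, ev, Q.antipode_mul, mul_assoc]
  have e2 : in23 Q.qL * Q.comulR Q.qL =
      E (Q.phi' Q.legs₅ 1 4 5 * Q.phi' Q.legs₅ 2 3 (4 * 5)) := by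
    rw [phi', phi', qL_eq]
    suffices h : ∀ s t, in23 (Q.qLMap s) * Q.comulR (Q.qLMap t) =
        E (Q.place Q.legs₅ 1 4 5 s * Q.place Q.legs₅ 2 3 (4 * 5) t) from h _ _
    intro s t
    apply tensor_ind₃ t; intro a b c
    rw [qLMap_tmul, comulR_tmul]
    change _ = E (_ * (_ * (_ * pw (Q.legs₅ 4) (Q.legs₅ 5) (Q.comul c))))
    generalize Q.comul c = c
    apply tensor_ind₂ c; intro b₁ b₂
    apply tensor_ind₃ s; intro u v w
    simp [E, place, ev, mul_assoc]
  rw [map_mul, map_mul, ← mul_assoc, e1, ← mul_assoc, mul_assoc _ _ Q.phi.val, comulR_comul,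
    ← mul_assoc, e2, hE, hE, hE, hLam, lastThree_phi]
  change E' _ = E' _
  rw [← can_trans hL (1 * (2 * (3 * 4 * 5))) (by decide) (by decide),
    kill_can_right_one (3 * 4 * 5) hL kLam (by decide)]
  have e3 : Q.phi' Q.legs₅ 2 3 (4 * 5) * Q.ph Q.legs₅ 3 4 5 =
      Q.can Q.legs₅ (1 * (2 * (3 * 4 * 5))) (1 * (2 * 3 * (4 * 5))) := by
    rw [← can_trans hL (1 * (2 * (3 * (4 * 5)))) (by decide) (by decide)]
    exact congrArg₂ _ (((can_right hL (by decide) (by decide)).trans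
      (can_assocInv hL (by decide))).symm) (((can_right hL (by decide) (by decide)).trans
      ((can_right hL (by decide) (by decide)).trans (can_assoc hL (by decide)))).symm)
  rw [mul_assoc, e3, ← can_trans hL (1 * (2 * 3 * (4 * 5))) (by decide) (by decide)]
  simp only [E', comp_apply, mulRight_apply, mul_assoc]
  rw [kill_can_left_to (2 * 3) (1 * (4 * 5)) (1 * 4 * 5) hL k23 (by decide),
    show Q.can Q.legs₅ (1 * (4 * 5)) (1 * 4 * 5) = Q.phi' Q.legs₅ 1 4 5 from
      can_assocInv hL (by decide)]


variable [Module.Finite k H]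

omit [Module.Finite k H] in
lemma IsLeftIntegral.qL_move (h : Q.IsLeftIntegral Lam) (x : H) :
    (Q.antipode x ⊗ₜ 1) * (Q.qL * Q.comul Lam) = (1 ⊗ₜ x) * (Q.qL * Q.comul Lam) := by
  rw [← mul_assoc (1 ⊗ₜ x), ← qL_comul]
  have : ∀ v, pw (mulRight k Q.qL ∘ₗ inL ∘ₗ Q.antipode) Q.comul.toLinearMap v *
      Q.comul Lam = (Q.antipode (Q.idCounit v) ⊗ₜ 1) * (Q.qL * Q.comul Lam) := by
    intro v
    apply tensor_ind₂ v; intro a b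
    simp only [pw_tmul, AlgHom.toLinearMap_apply, mul_assoc, ← map_mul, h b]
    simp [← smul_tmul', mul_assoc]
  rw [this, idCounit_comul]

variable (Q Lam) in
/-- `Λ h = ε(h) Λ` for all `h`. -/
def IsRightIntegral : Prop := ∀ h : H, Lam * h = Q.counit h • Lam

lemma IsRightIntegral.pL_move (h : Q.IsRightIntegral Lam) (x : H) :
    Q.comul Lam * Q.pL * (Q.antipodeInv x ⊗ₜ 1) = Q.comul Lam * Q.pL * (1 ⊗ₜ x) := by
  rw [mul_assoc _ _ (1 ⊗ₜ x), ← pL_comul]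
  have : ∀ v, Q.comul Lam * pw Q.comul.toLinearMap (mulLeft k Q.pL ∘ₗ inL ∘ₗ
      Q.antipodeInv) (TensorProduct.comm k H H v) =
      Q.comul Lam * Q.pL * (Q.antipodeInv (Q.idCounit v) ⊗ₜ 1) := by
    intro v
    apply tensor_ind₂ v; intro a b
    simp only [pw_tmul, AlgHom.toLinearMap_apply, ← mul_assoc, ← map_mul, h b,
      TensorProduct.comm_tmul]
    simp [← smul_tmul', mul_assoc]
  rw [this, idCounit_comul]

/-- The mirror image of `IsLeftIntegral.drinfeldF_comulL`. -/
lemma IsRightIntegral.comulL_drinfeldFInv (h : Q.IsRightIntegral Lam) :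
    Q.phi.val * Q.comulL (Q.comul Lam * Q.pL) * in12 (Q.flipAntipodeInv Q.drinfeldFInv) =
      Q.comulR (Q.comul Lam * Q.pL) * in23 Q.pL := by
  have hL := Q.isLegs_legs₅
  let E : H ⊗[k] (H ⊗[k] (H ⊗[k] (H ⊗[k] H))) →ₗ[k] H ⊗[k] (H ⊗[k] H) :=
    multilin₅ (k := k) (fun a b c d e => (c * Q.antipodeInv (b * Q.beta)) ⊗ₜ[k]
        ((d * Q.antipodeInv (a * Q.beta)) ⊗ₜ[k] e))
  have k23 : ∀ x X, E (X * Q.ev Q.legs₅ (2 * 3) x) = Q.counit x • E X := by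
    intro x X
    apply tensor_ind₅ X; intro a b c d e
    exact Q.absorb_right Q.contrBetaInv_comul
      (sandwich ((includeLeft : H →ₐ[k] _).toLinearMap)
        (c ⊗ₜ ((d * Q.antipodeInv (a * Q.beta)) ⊗ₜ e)) (Q.antipodeInv b ⊗ₜ (1 ⊗ₜ 1)))
      (by simp [E, antipodeInv_mul, mul_assoc]) (by simp [E, antipodeInv_mul]) x
  have hE : ∀ X Y, Y * E X = E (lastThree Y * X) := by
    intro X Y
    apply tensor_ind₅ X; intro a b c d e
    apply tensor_ind₃ Y; intro u v w
    simp [E, mul_assoc]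
  have hLam : lastThree (Q.comulL (Q.comul Lam)) = Q.ev Q.legs₅ (3 * 4 * 5) Lam := by
    rw [comulL_comul]
    refine Q.map_ev (L' := Q.legs₅) (t := 1 * 2 * 3) lastThree (fun i => .leaf (i + 2)) ?_ Lam
    intro i hi
    fin_cases hi <;> rfl
  let E' := E ∘ₗ mulLeft k (Q.ev Q.legs₅ (3 * 4 * 5) Lam)
  have kLam : ∀ x X, E' (Q.ev Q.legs₅ (3 * 4 * 5) x * X) = Q.counit x • E' X := by
    intro x X
    simp only [E', comp_apply, mulLeft_apply]
    rw [← mul_assoc, ← Q.ev_mul hL (by decide), h, map_smul, smul_mul_assoc, map_smul]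
  have hE' : ∀ X, Q.comulL (Q.comul Lam) * E X = E' X := by intro X; rw [hE, hLam]; rfl
  have e1 : Q.comulL Q.pL * in12 (Q.flipAntipodeInv Q.drinfeldFInv) =
      E (Q.can Q.legs₅ (1 * (2 * 3) * 4 * 5) (1 * 2 * (3 * 4 * 5))) := by
    have e : Q.can Q.legs₅ (1 * (2 * 3) * 4 * 5) (1 * 2 * (3 * 4 * 5)) =
        Q.ph Q.legs₅ (1 * 2) (3 * 4) 5 *
        firstFour₅ (Q.can Q.legs₄ (1 * (2 * 3) * 4) (1 * 2 * (3 * 4))) := by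
      rw [← can_trans hL (1 * 2 * (3 * 4) * 5) (by decide) (by decide)]
      refine congrArg₂ _ (can_assoc hL (by decide)) ((can_left hL (by decide) (by decide)).trans ?_)
      refine ((Q.map_can (L := Q.legs₄) (L' := Q.legs₅) (s := 1 * (2 * 3) * 4)
        (t := 1 * 2 * (3 * 4)) firstFour₅ .leaf hL (by decide) (by decide) ?_)).symm
      intro i hi
      fin_cases hi <;> rfl
    have e0 : ∀ x y, Q.comul (y * Q.antipodeInv (x * Q.beta)) * Q.flipAntipodeInv Q.drinfeldFInv =
        Q.comul y * Q.flipAntipodeInv (Q.comul x * Q.drinfeldB) := by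
      intro x y
      rw [map_mul, mul_assoc, comul_antipodeInv_mul, map_mul Q.comul x, mul_assoc (Q.comul x),
        comul_beta_drinfeldFInv]
    rw [e, ph, pL_eq]
    generalize Q.phi.val = s
    apply tensor_ind₃ s; intro a b c
    have hc : ∀ t : H ⊗[k] H, ((1 : H) ⊗ₜ[k] ((1 : H) ⊗ₜ[k] c)) * in12 t = in12 t * (1 ⊗ₜ (1 ⊗ₜ c)) := by
      intro t
      apply tensor_ind₂ t; intro a b
      simp
    rw [pLMap_tmul, comulL_tmul, mul_assoc, hc, ← mul_assoc, ← map_mul, e0, drinfeldB_eq]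
    generalize Q.can Q.legs₄ (1 * (2 * 3) * 4) (1 * 2 * (3 * 4)) = A
    change in12 (_ * Q.flipAntipodeInv (Q.comul a * _)) * _ = E (
      (pw (Q.legs₅ 1) (Q.legs₅ 2) (Q.comul a) * (pw (Q.legs₅ 3) (Q.legs₅ 4) (Q.comul b) * _)) * _)
    generalize Q.comul a = a
    generalize Q.comul b = b
    apply tensor_ind₂ b; intro b₁ b₂
    apply tensor_ind₂ a; intro c₁ c₂
    apply tensor_ind₄ A; intro A₁ A₂ A₃ A₄
    simp [E, ev, antipodeInv_mul, mul_assoc]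
  have e2 : Q.comulR Q.pL * in23 Q.pL =
      E (Q.ph Q.legs₅ 2 3 (4 * 5) * Q.ph Q.legs₅ 1 4 5) := by
    rw [ph, ph, pL_eq]
    suffices h : ∀ s t, Q.comulR (Q.pLMap t) * in23 (Q.pLMap s) =
        E (Q.place Q.legs₅ 2 3 (4 * 5) t * Q.place Q.legs₅ 1 4 5 s) from h _ _
    intro s t
    apply tensor_ind₃ t; intro a b c
    rw [pLMap_tmul, comulR_tmul]
    change _ = E ((_ * (_ * pw (Q.legs₅ 4) (Q.legs₅ 5) (Q.comul c))) * _)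
    generalize Q.comul c = c
    apply tensor_ind₂ c; intro b₁ b₂
    apply tensor_ind₃ s; intro u v w
    simp [E, place, ev, mul_assoc]
  have e3 : Q.ph Q.legs₅ 2 3 (4 * 5) = Q.ph Q.legs₅ 3 4 5 *
      Q.can Q.legs₅ (1 * (2 * 3 * (4 * 5))) (1 * (2 * (3 * 4 * 5))) := by
    rw [show Q.ph Q.legs₅ 2 3 (4 * 5) = Q.can Q.legs₅ (1 * (2 * 3 * (4 * 5))) (1 * (2 * (3 * (4 * 5))))
      from ((can_right hL (by decide) (by decide)).trans (can_assoc hL (by decide))).symm,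
      show Q.ph Q.legs₅ 3 4 5 = Q.can Q.legs₅ (1 * (2 * (3 * 4 * 5))) (1 * (2 * (3 * (4 * 5))))
      from ((can_right hL (by decide) (by decide)).trans
      ((can_right hL (by decide) (by decide)).trans (can_assoc hL (by decide)))).symm,
      can_trans hL _ (by decide) (by decide)]
  rw [map_mul, map_mul, ← mul_assoc, ← comulR_comul, mul_assoc, mul_assoc, mul_assoc, e1, e2, e3,
    mul_assoc, ← lastThree_phi, ← hE, ← mul_assoc, ← mul_assoc, comulR_comul, mul_assoc, mul_assoc,
    hE', hE']
  refine congrArg (Q.phi.val * ·) ?_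
  rw [← can_trans hL (1 * (2 * (3 * 4 * 5))) (by decide) (by decide),
    kill_can_left_one (3 * 4 * 5) hL kLam (by decide),
    ← can_trans hL (1 * (2 * 3 * (4 * 5))) (by decide) (by decide)]
  simp only [E', comp_apply, mulLeft_apply, ← mul_assoc]
  rw [kill_can_right_to (2 * 3) (1 * 4 * 5) (1 * (4 * 5)) hL k23 (by decide),
    show Q.can Q.legs₅ (1 * 4 * 5) (1 * (4 * 5)) = Q.ph Q.legs₅ 1 4 5 from
      can_assoc hL (by decide)]


lemma IsRightIntegral.comul_eq (h : Q.IsRightIntegral Lam) :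
    Q.comul Lam = Q.comul Lam * Q.pL * (Q.antipodeInv Q.alpha ⊗ₜ 1) := by
  have e := congrArg (Q.comul Lam * ·) Q.pL_comul_qL
  simp only [mul_one] at e
  conv_lhs => rw [← e]
  rw [← idCounit_qL]
  generalize Q.qL = v
  apply tensor_ind₂ v; intro a b
  simp only [pw_tmul, AlgHom.toLinearMap_apply, ← mul_assoc, ← map_mul, h b,
    TensorProduct.comm_tmul]
  simp [← smul_tmul', mul_assoc]

/-- `Δ(Λ) p^L = Δ(Λ) p^R`. -/
lemma IsRightIntegral.pL_eq_pR (h : Q.IsRightIntegral Lam) :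
    Q.comul Lam * Q.pL = Q.comul Lam * Q.pR := by
  conv_rhs => rw [h.comul_eq]
  have e := congrArg (fun x => Q.comul Lam * Q.pL * (Q.antipodeInv x ⊗ₜ[k] (1 : H))) Q.zagMap_phiInv
  simp only [antipodeInv_one, ← Algebra.TensorProduct.one_def, mul_one] at e
  conv_lhs => rw [← e]
  rw [pR_eq]
  have hm := h.pL_move
  generalize Q.comul Lam * Q.pL = X at hm
  generalize Q.phiInv = v
  apply tensor_ind₃ v; intro a b c
  have : ∀ x y : H, x ⊗ₜ[k] y = (1 ⊗ₜ y) * (x ⊗ₜ 1) := by intros; simp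
  rw [mul_assoc, pRMap_tmul, tmul_mul_tmul, this (_ * a), ← mul_assoc,
    ← hm, mul_assoc, tmul_mul_tmul]
  simp [antipodeInv_mul, mul_assoc]

/-- The analogue of `IsRightIntegral.comulL_drinfeldFInv` for `p^R`. -/
lemma IsRightIntegral.comulR_drinfeldFInv (h : Q.IsRightIntegral Lam) :
    Q.comulR (Q.comul Lam * Q.pR) * in23 Q.drinfeldFInv =
      Q.phi.val * Q.comulL (Q.comul Lam * Q.pR) * in12 Q.pR := by
  have hL := Q.isLegs_legs₅
  let E : H ⊗[k] (H ⊗[k] (H ⊗[k] (H ⊗[k] H))) →ₗ[k] H ⊗[k] (H ⊗[k] H) :=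
    multilin₅ (k := k) (fun a b c d e => a ⊗ₜ[k] ((b * Q.beta * Q.antipode e) ⊗ₜ[k]
        (c * Q.beta * Q.antipode d)))
  have k34 : ∀ x X, E (X * Q.ev Q.legs₅ (3 * 4) x) = Q.counit x • E X := by
    intro x X
    apply tensor_ind₅ X; intro a b c d e
    exact Q.absorb_right Q.contrBeta_comul
      (sandwich (in23.comp includeRight : H →ₐ[k] _).toLinearMap
        (a ⊗ₜ ((b * Q.beta * Q.antipode e) ⊗ₜ c)) (1 ⊗ₜ (1 ⊗ₜ Q.antipode d)))
      (by simp [E, Q.antipode_mul, mul_assoc]) (by simp [E, mul_assoc]) x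
  -- `y ↦ y ⊗ 1 ⊗ 1`
  let firstThree : H ⊗[k] (H ⊗[k] H) →ₐ[k] H ⊗[k] (H ⊗[k] (H ⊗[k] (H ⊗[k] H))) :=
    idTensor (idTensor
      includeLeft)
  have hE : ∀ X Y, Y * E X = E (firstThree Y * X) := by
    intro X Y
    apply tensor_ind₅ X; intro a b c d e
    apply tensor_ind₃ Y; intro u v w
    simp [E, firstThree, Algebra.TensorProduct.one_def, mul_assoc]
  have hLam : firstThree (Q.comulR (Q.comul Lam)) = Q.ev Q.legs₅ (1 * (2 * 3)) Lam := by
    rw [comulR_comul_eq]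
    refine Q.map_ev (L' := Q.legs₅) (t := 1 * (2 * 3)) firstThree .leaf ?_ Lam
    intro i hi
    fin_cases hi <;> rfl
  have hphi : firstThree Q.phi.val = Q.ph Q.legs₅ 1 2 3 := by
    rw [ph]
    generalize Q.phi.val = t
    apply tensor_ind₃ t; intro a b c
    simp [place, ev, firstThree, Algebra.TensorProduct.one_def]
  let E' := E ∘ₗ mulLeft k (Q.ev Q.legs₅ (1 * (2 * 3)) Lam)
  have kLam : ∀ x X, E' (Q.ev Q.legs₅ (1 * (2 * 3)) x * X) = Q.counit x • E' X := by
    intro x X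
    simp only [E', comp_apply, mulLeft_apply]
    rw [← mul_assoc, ← Q.ev_mul hL (by decide), h, map_smul, smul_mul_assoc, map_smul]
  have hE' : ∀ X, Q.comulR (Q.comul Lam) * E X = E' X := by intro X; rw [hE, hLam]; rfl
  have e1 : Q.comulR Q.pR * in23 Q.drinfeldFInv =
      E (Q.can Q.legs₅ (1 * (2 * (3 * 4) * 5)) (1 * (2 * 3) * (4 * 5))) := by
    have e : Q.can Q.legs₅ (1 * (2 * (3 * 4) * 5)) (1 * (2 * 3) * (4 * 5)) =
        Q.phi' Q.legs₅ 1 (2 * 3) (4 * 5) *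
        includeRight
          (Q.can Q.legs₄ (1 * (2 * 3) * 4) (1 * 2 * (3 * 4))) := by
      rw [← can_trans hL (1 * (2 * 3 * (4 * 5))) (by decide) (by decide)]
      refine congrArg₂ _ (can_assocInv hL (by decide))
        ((can_right hL (by decide) (by decide)).trans ?_)
      refine ((Q.map_can (L := Q.legs₄) (L' := Q.legs₅) (s := 1 * (2 * 3) * 4)
        (t := 1 * 2 * (3 * 4)) includeRight (fun i => .leaf (i + 1)) hL
        (by decide) (by decide) ?_)).symm
      intro i hi
      fin_cases hi <;> rfl
    have e0 : ∀ x y, Q.comul (x * Q.beta * Q.antipode y) * Q.drinfeldFInv =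
        Q.comul x * Q.drinfeldB * Q.antipodeCop y := by
      intro x y
      rw [map_mul, mul_assoc, comul_antipode_drinfeldFInv, ← mul_assoc, map_mul,
        mul_assoc (Q.comul x), comul_beta_drinfeldFInv]
    rw [e, phi', pR_eq]
    generalize Q.phiInv = s
    apply tensor_ind₃ s; intro a b c
    rw [pRMap_tmul, comulR_tmul, in23_apply, tmul_mul_tmul, e0, drinfeldB_eq]
    generalize Q.can Q.legs₄ (1 * (2 * 3) * 4) (1 * 2 * (3 * 4)) = A
    rw [← flipAntipode_comul]
    change _ = E ((Q.legs₅ 1 a * (pw (Q.legs₅ 2) (Q.legs₅ 3) (Q.comul b) *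
      pw (Q.legs₅ 4) (Q.legs₅ 5) (Q.comul c))) * _)
    generalize Q.comul c = c
    generalize Q.comul b = b
    apply tensor_ind₂ b; intro b₁ b₂
    apply tensor_ind₂ c; intro c₁ c₂
    apply tensor_ind₄ A; intro A₁ A₂ A₃ A₄
    simp [E, Q.antipode_mul, mul_assoc]
  have e2 : Q.comulL Q.pR * in12 Q.pR =
      E (Q.phi' Q.legs₅ (1 * 2) 3 4 * Q.phi' Q.legs₅ 1 2 5) := by
    rw [phi', phi', pR_eq]
    suffices h : ∀ s t, Q.comulL (Q.pRMap t) * in12 (Q.pRMap s) =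
        E (Q.place Q.legs₅ (1 * 2) 3 4 t * Q.place Q.legs₅ 1 2 5 s) from h _ _
    intro s t
    apply tensor_ind₃ t; intro a b c
    rw [pRMap_tmul, comulL_tmul]
    change _ = E ((pw (Q.legs₅ 1) (Q.legs₅ 2) (Q.comul a) * _) * _)
    generalize Q.comul a = a
    apply tensor_ind₂ a; intro b₁ b₂
    apply tensor_ind₃ s; intro u v w
    simp [E, place, ev, mul_assoc]
  have e3 : Q.ph Q.legs₅ 1 2 3 * Q.phi' Q.legs₅ (1 * 2) 3 4 =
      Q.can Q.legs₅ (1 * 2 * (3 * 4) * 5) (1 * (2 * 3) * 4 * 5) := by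
    rw [← can_trans hL (1 * 2 * 3 * 4 * 5) (by decide) (by decide)]
    exact congrArg₂ _ (((can_left hL (by decide) (by decide)).trans
      ((can_left hL (by decide) (by decide)).trans (can_assoc hL (by decide)))).symm)
      (((can_left hL (by decide) (by decide)).trans (can_assocInv hL (by decide))).symm)
  rw [map_mul, map_mul, ← mul_assoc, ← comulR_comul, mul_assoc, mul_assoc, mul_assoc, e1, e2, hE',
    hE, hphi, hE', ← mul_assoc, e3,
    ← can_trans hL (1 * (2 * 3) * 4 * 5) (by decide) (by decide),
    kill_can_left_one (1 * (2 * 3)) hL kLam (by decide),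
    ← can_trans hL (1 * 2 * (3 * 4) * 5) (by decide) (by decide)]
  simp only [E', comp_apply, mulLeft_apply, ← mul_assoc]
  rw [kill_can_right_to (3 * 4) (1 * (2 * 5)) (1 * 2 * 5) hL k34 (by decide),
    show Q.can Q.legs₅ (1 * (2 * 5)) (1 * 2 * 5) = Q.phi' Q.legs₅ 1 2 5 from
      can_assocInv hL (by decide)]

/-- `(S(p₂) ⊗ S(p₁) q₁ ⊗ q₂) Z = Z` for `p = p^L`, `q = q^L`, if `(S(x) ⊗ 1) Z = (1 ⊗ Δ(x)) Z`. -/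
lemma flipAntipode_pL_qL {Z : H ⊗[k] (H ⊗[k] H)}
    (hZ : ∀ x, (Q.antipode x ⊗ₜ 1) * Z = (1 ⊗ₜ Q.comul x) * Z) :
    in12 (Q.flipAntipode Q.pL) * in23 Q.qL * Z = Z := by
  have : ∀ p, in12 (Q.flipAntipode p) * in23 Q.qL * Z = in23
      (pw (mulRight k Q.qL ∘ₗ inL ∘ₗ Q.antipode) Q.comul.toLinearMap p) * Z := by
    intro p
    apply tensor_ind₂ p; intro a b
    have : in12 (Q.flipAntipode (a ⊗ₜ[k] b)) * in23 Q.qL =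
      (1 ⊗ₜ ((Q.antipode a ⊗ₜ 1) * Q.qL)) * (Q.antipode b ⊗ₜ 1) := by simp
    rw [this, mul_assoc, hZ, ← mul_assoc]
    simp
  rw [this, qL_comul_pL, map_one, one_mul]

/-- `Z (S̄(q₂) ⊗ p₁ S̄(q₁) ⊗ p₂) = Z` for `p = p^L`, `q = q^L`, if `Z (S̄(x) ⊗ 1) = Z (1 ⊗ Δ(x))`. -/
lemma pL_flipAntipodeInv_qL {Z : H ⊗[k] (H ⊗[k] H)}
    (hZ : ∀ x, Z * (Q.antipodeInv x ⊗ₜ 1) = Z * (1 ⊗ₜ Q.comul x)) :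
    Z * in23 Q.pL * in12 (Q.flipAntipodeInv Q.qL) = Z := by
  have : ∀ q, Z * in23 Q.pL * in12 (Q.flipAntipodeInv q) = Z * in23
      (pw Q.comul.toLinearMap (mulLeft k Q.pL ∘ₗ inL ∘ₗ Q.antipodeInv)
        (TensorProduct.comm k H H q)) := by
    intro p
    apply tensor_ind₂ p; intro a b
    have : in23 Q.pL * in12 (Q.flipAntipodeInv (a ⊗ₜ[k] b)) =
      (Q.antipodeInv b ⊗ₜ 1) * (1 ⊗ₜ (Q.pL * (Q.antipodeInv a ⊗ₜ 1))) := by simp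
    rw [mul_assoc, this, ← mul_assoc, hZ, mul_assoc]
    simp
  rw [this, pL_comul_qL, map_one, mul_one]

lemma IsLeftIntegral.VR_comulL (h : Q.IsLeftIntegral Lam) :
    in12 Q.VR * Q.comulL (Q.qL * Q.comul Lam) = Q.comulR (Q.qL * Q.comul Lam) * Q.phi.val := by
  rw [VR_eq, map_mul, mul_assoc, h.drinfeldF_comulL, ← mul_assoc, ← mul_assoc]
  rw [flipAntipode_pL_qL]
  intro x
  simpa using congrArg Q.comulR (h.qL_move x)

/-- `V (Δ(d₁)) U ⊗ d₂ = d₁ ⊗ Δ(d₂)` for `d = q^L Δ(Λ) p^L` and a two-sided integral `Λ`. -/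
lemma IsLeftIntegral.VR_comulL_UR (h : Q.IsLeftIntegral Lam) (h' : Q.IsRightIntegral Lam) :
    in12 Q.VR * Q.comulL (Q.qL * Q.comul Lam * Q.pL) * in12 Q.UR =
      Q.comulR (Q.qL * Q.comul Lam * Q.pL) := by
  have hZ : ∀ x, Q.comulR (Q.comul Lam * Q.pL) * (Q.antipodeInv x ⊗ₜ 1) =
      Q.comulR (Q.comul Lam * Q.pL) * (1 ⊗ₜ Q.comul x) := by
    intro x
    simpa using congrArg Q.comulR (h'.pL_move x)
  rw [map_mul Q.comulL, ← mul_assoc, h.VR_comulL, UR_eq, flipAntipodeInv_mul, map_mul Q.comulR,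
    mul_assoc (Q.comulR Q.qL), comulR_comul, mul_assoc _ _ (in12 _), map_mul in12,
    ← mul_assoc (Q.comulL _), mul_assoc _ _ (_ * _ * _), ← mul_assoc _ _ (in12 (Q.flipAntipodeInv Q.qL)),
    ← mul_assoc (_ * _) (Q.comulL _), mul_assoc _ (Q.comulL _) (Q.comulL _), ← map_mul Q.comulL,
    h'.comulL_drinfeldFInv, pL_flipAntipodeInv_qL hZ, ← map_mul, mul_assoc]

/-- `d₁ ⊗ Δ(d₂) f̄ = (V ⊗ 1) (Δ ⊗ id)(d) (p^R ⊗ 1)` for `d = q^L Δ(Λ) p^L` and a two-sided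
integral `Λ`. -/
lemma IsLeftIntegral.comulR_drinfeldFInv (h : Q.IsLeftIntegral Lam) (h' : Q.IsRightIntegral Lam) :
    Q.comulR (Q.qL * Q.comul Lam * Q.pL) * in23 Q.drinfeldFInv =
      in12 Q.VR * Q.comulL (Q.qL * Q.comul Lam * Q.pL) * in12 Q.pR := by
  have e := congrArg (Q.comulR Q.qL * ·) h'.comulR_drinfeldFInv
  rw [← mul_assoc, ← map_mul, ← mul_assoc] at e
  rw [mul_assoc, h'.pL_eq_pR, ← mul_assoc Q.qL, e, ← mul_assoc, map_mul Q.comulL (Q.comul Lam), ← mul_assoc,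
    ← mul_assoc, map_mul Q.comulL (_ * _), ← mul_assoc, h.VR_comulL, map_mul Q.comulR,
    mul_assoc (Q.comulR Q.qL) (Q.comulR _), comulR_comul, ← mul_assoc]

end Integral
end QuasiHopfAlgebra

/-! ### Cointegrals and the form dual to an integral -/

namespace QuasiHopfAlgebra

variable {k H : Type*} [Field k] [Ring H] [Algebra k H] (Q : QuasiHopfAlgebra k H)

/-- `η ⊗ id` -/
def contrFst (η : Module.Dual k H) : H ⊗[k] H →ₗ[k] H :=
  (TensorProduct.lid k H).toLinearMap ∘ₗ TensorProduct.map η LinearMap.id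

/-- `id ⊗ η` -/
def contrSnd (η : Module.Dual k H) : H ⊗[k] H →ₗ[k] H :=
  (TensorProduct.rid k H).toLinearMap ∘ₗ TensorProduct.map LinearMap.id η

@[simp] lemma contrFst_tmul (η : Module.Dual k H) (x y : H) :
    contrFst η (x ⊗ₜ y) = η x • y := by simp [contrFst]
@[simp] lemma contrSnd_tmul (η : Module.Dual k H) (x y : H) :
    contrSnd η (x ⊗ₜ y) = η y • x := by simp [contrSnd]

lemma apply_contrFst (ξ η : Module.Dual k H) (t) : η (contrFst ξ t) = ξ (contrSnd η t) := by
  apply tensor_ind₂ t; intro a b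
  simp [mul_comm]

lemma counit_contrFst (ξ : Module.Dual k H) (t) : Q.counit (contrFst ξ t) = ξ (Q.idCounit t) := by
  apply tensor_ind₂ t; intro a b
  simp [mul_comm]

lemma counit_contrSnd (ξ : Module.Dual k H) (t) : Q.counit (contrSnd ξ t) = ξ (Q.counitId t) := by
  apply tensor_ind₂ t; intro a b
  simp [mul_comm]

lemma contrFst_comp_mulLeft (η : Module.Dual k H) (x : H) (t) :
    contrFst (η ∘ₗ mulLeft k x) t = contrFst η ((x ⊗ₜ 1) * t) := by
  apply tensor_ind₂ t; intro a b
  simp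

lemma contrFst_comp_mulRight (η : Module.Dual k H) (x : H) (t) :
    contrFst (η ∘ₗ mulRight k x) t = contrFst η (t * (x ⊗ₜ 1)) := by
  apply tensor_ind₂ t; intro a b
  simp

lemma contrFst_one_tmul_mul (η : Module.Dual k H) (x : H) (t) :
    contrFst η ((1 ⊗ₜ x) * t) = x * contrFst η t := by
  apply tensor_ind₂ t; intro a b
  simp

lemma contrFst_mul_one_tmul (η : Module.Dual k H) (x : H) (t) :
    contrFst η (t * (1 ⊗ₜ x)) = contrFst η t * x := by
  apply tensor_ind₂ t; intro a b
  simp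

section Cointegral
variable [Module.Finite k H]

lemma idCounit_pL : Q.idCounit Q.pL = Q.antipodeInv Q.beta := by
  have h : (idTensor Q.idCounit) Q.phi.val = 1 := by
    rw [phi_eq_can]
    refine Q.map_can_eq_one (L := Q.legs₂) _
      (fun i => if i = 1 then 1 else if i = 2 then 2 else .one) _ _ Q.isLegs_legs₂
      (by decide) fun i hi => ?_
    fin_cases hi <;> ext <;>
      simp [ev, unitLeg_apply, Algebra.algebraMap_eq_smul_one, Algebra.TensorProduct.one_def]
  have e := congrArg (pw LinearMap.id (Q.antipodeInv ∘ₗ mulRight k Q.beta) ∘ₗ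
    (TensorProduct.comm k H H).toLinearMap) h
  refine Eq.trans ?_ (e.trans (by simp [Algebra.TensorProduct.one_def]))
  rw [pL_eq]
  generalize Q.phi.val = t
  apply tensor_ind₃ t; intro a b c
  simp

lemma trace_comp_dualTensorHom (F : H →ₗ[k] H) (t : Module.Dual k H ⊗[k] H) :
    LinearMap.trace k H (F ∘ₗ dualTensorHom k H H t) =
      contractLeft k H (TensorProduct.map LinearMap.id F t) := by
  rw [← LinearMap.trace_eq_contract_apply]
  congr 1
  induction t using TensorProduct.induction_on with
  | zero => simp
  | add s t hs ht => simp only [map_add, LinearMap.comp_add, hs, ht]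
  | tmul a b => ext x; simp

/-- `x ⊗ y ↦ (z ↦ S̄(x) m S(β S(y z)))` -/
def rightDualTwist (m : H) : H ⊗[k] H →ₗ[k] Module.End k H :=
  multilin₂ (k := k) (fun x y => mulLeft k (Q.antipodeInv x * m) ∘ₗ Q.antipode ∘ₗ
      mulLeft k Q.beta ∘ₗ Q.antipode ∘ₗ mulLeft k y)

/-- `y ↦ V^L₁ y₁ U^L₁ ⟨ξ, V^L₂ y₂ U^L₂⟩` -/
def rightDualCoactHom (ξ : Module.Dual k H) : H →ₗ[k] H :=
  contrSnd ξ ∘ₗ mulLeft k Q.VL ∘ₗ mulRight k Q.UL ∘ₗ Q.comul.toLinearMap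

/-- `x ⊗ y ↦ (z ↦ S(y) m S̄(S̄(β) S̄(x z)))` -/
def leftDualTwist (m : H) : H ⊗[k] H →ₗ[k] Module.End k H :=
  multilin₂ (k := k) (fun x y => mulLeft k (Q.antipode y * m) ∘ₗ Q.antipodeInv ∘ₗ
      mulLeft k (Q.antipodeInv Q.beta) ∘ₗ Q.antipodeInv ∘ₗ mulLeft k x)

/-- `y ↦ ⟨ξ, V^R₁ y₁ U^R₁⟩ V^R₂ y₂ U^R₂` -/
def leftDualCoactHom (ξ : Module.Dual k H) : H →ₗ[k] H :=
  contrFst ξ ∘ₗ mulLeft k Q.VR ∘ₗ mulRight k Q.UR ∘ₗ Q.comul.toLinearMap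

lemma rightDualE_apply (ξ : Module.Dual k H) (m : H) :
    Q.rightDualE ξ m =
      LinearMap.trace k H (Q.rightDualTwist m Q.qR ∘ₗ Q.rightDualCoactHom ξ) := by
  have h : dualTensorHom k H H (Q.rightDualCoact ξ) = Q.rightDualCoactHom ξ :=
    (dualTensorHomEquiv k H H).apply_symm_apply _
  rw [← h, trace_comp_dualTensorHom, rightDualE]
  generalize Q.rightDualCoact ξ = t
  generalize Q.qR = q
  induction q using tensor_ind₂ with
  | add =>
    intro s t hs ht
    simp only [map_add, add_tmul, LinearMap.add_apply, map_add_right,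
      hs, ht]
  | tmul a b =>
  induction t using TensorProduct.induction_on with
  | zero => simp
  | add s t hs ht => simp only [map_add, tmul_add, LinearMap.add_apply, hs, ht]
  | tmul η z => simp [rightDualTwist, rightDualAct]

lemma leftDualE_apply (ξ : Module.Dual k H) (m : H) :
    Q.leftDualE ξ m =
      LinearMap.trace k H (Q.leftDualTwist m Q.qL ∘ₗ Q.leftDualCoactHom ξ) := by
  have h : dualTensorHom k H H (TensorProduct.comm k _ _ (Q.leftDualCoact ξ)) =
      Q.leftDualCoactHom ξ := by
    rw [leftDualCoact, TensorProduct.comm_comm]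
    exact (dualTensorHomEquiv k H H).apply_symm_apply _
  rw [← h, trace_comp_dualTensorHom, leftDualE]
  generalize Q.leftDualCoact ξ = t
  generalize Q.qL = q
  induction q using tensor_ind₂ with
  | add =>
    intro s t hs ht
    simp only [map_add, add_tmul, LinearMap.add_apply, map_add_right,
      hs, ht]
  | tmul a b =>
  induction t using TensorProduct.induction_on with
  | zero => simp
  | add s t hs ht => simp only [map_add, tmul_add, LinearMap.add_apply, hs, ht]
  | tmul η z => simp [leftDualTwist, leftDualAct]

variable {Q} {Lam : H}

lemma IsRightIntegral.rightDualE_apply (h : Q.IsRightIntegral Lam) (ξ : Module.Dual k H) :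
    Q.rightDualE ξ Lam = ξ Lam := by
  have e : Q.rightDualTwist Lam Q.qR = LinearMap.smulRight Q.counit.toLinearMap Lam := by
    have : ∀ q, Q.rightDualTwist Lam q =
        LinearMap.smulRight Q.counit.toLinearMap (Q.antipodeInv (Q.idCounit q) * Lam) := by
      intro q
      induction q using tensor_ind₂ with
      | add => intro s t hs ht; simp only [map_add, add_mul, hs, ht]; ext; simp
      | tmul a b =>
        ext z
        simp [rightDualTwist, h _, counit_antipode, counit_beta, smul_smul, mul_comm]
    rw [this, idCounit_qR, antipodeInv_one, one_mul]
  have : Q.rightDualTwist Lam Q.qR ∘ₗ Q.rightDualCoactHom ξ =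
      LinearMap.smulRight (Q.counit.toLinearMap ∘ₗ Q.rightDualCoactHom ξ) Lam := by
    rw [e]; rfl
  rw [QuasiHopfAlgebra.rightDualE_apply, this, LinearMap.trace_smulRight]
  change Q.counit (contrSnd ξ (Q.VL * (Q.comul Lam * Q.UL))) = _
  rw [counit_contrSnd, map_mul Q.counitId, map_mul Q.counitId, counitId_VL, counitId_comul, one_mul, h, counit_counitId_UL,
    one_smul]

lemma IsUnimodular.isLeftIntegral (hQ : Q.IsUnimodular) (h : Q.IsRightIntegral Lam) :
    Q.IsLeftIntegral Lam := by
  intro x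
  obtain ⟨x, rfl⟩ : ∃ y, Q.antipodeInv y = x := ⟨Q.antipode x, by simp⟩
  rw [← sub_eq_zero, ← Module.forall_dual_apply_eq_zero_iff k]
  intro ξ
  have h' : Q.IsRightIntegral (Q.antipodeInv x * Lam) := fun y => by
    rw [mul_assoc, h, mul_smul_comm]
  have e := LinearMap.congr_fun (hQ x _ ⟨ξ, rfl⟩) Lam
  rw [leftCointegralAct, h.rightDualE_apply, LinearMap.smul_apply, h.rightDualE_apply] at e
  have e2 : Q.rightDualAct x (Q.rightDualE ξ) 1 Lam = Q.rightDualE ξ (Q.antipodeInv x * Lam) := by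
    simp [rightDualAct, Q.antipode_one]
  rw [e2, h'.rightDualE_apply] at e
  rw [map_sub, e, map_smul, counit_antipodeInv, sub_self]

variable (Q) in
lemma leftDualCoactHom_comp (ξ : Module.Dual k H) (x y : H) :
    Q.leftDualCoactHom (ξ ∘ₗ mulRight k (Q.antipodeInv x)) y =
      (multilin₂ (k := k) (fun a b => Q.leftDualCoactHom ξ (y * Q.antipodeInv b) * a)) (Q.comul x) := by
  change contrFst _ (Q.VR * (Q.comul y * Q.UR)) = _
  rw [contrFst_comp_mulRight, mul_assoc, mul_assoc, ← UR_comul]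
  generalize Q.comul x = v
  apply tensor_ind₂ v; intro a b
  change _ = contrFst ξ (Q.VR * (Q.comul (y * Q.antipodeInv b) * Q.UR)) * a
  rw [← contrFst_mul_one_tmul]
  simp [inR, mul_assoc]

variable (Q) in
lemma leftDualE_comp_mulRight (ξ : Module.Dual k H) (x : H) :
    Q.leftDualE (ξ ∘ₗ mulRight k (Q.antipodeInv x)) = Q.counit x • Q.leftDualE ξ := by
  ext m
  rw [LinearMap.smul_apply, leftDualE_apply, leftDualE_apply]
  -- move the two tensor factors of `Δ(x)` to the same side of the trace
  have h1 : ∀ v : H ⊗[k] H, LinearMap.trace k H (Q.leftDualTwist m Q.qL ∘ₗ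
      (multilin₂ (k := k) (P := Module.End k H) (fun a b => mulRight k a ∘ₗ
        Q.leftDualCoactHom ξ ∘ₗ mulRight k (Q.antipodeInv b))) v) =
      LinearMap.trace k H ((multilin₂ (k := k) (P := Module.End k H)
        (fun a b => mulRight k (Q.antipodeInv b) ∘ₗ Q.leftDualTwist m Q.qL ∘ₗ
          mulRight k a)) v ∘ₗ
          Q.leftDualCoactHom ξ) := by
    intro v
    induction v using tensor_ind₂ with
    | add => intro s t hs ht; simp only [map_add, LinearMap.comp_add, LinearMap.add_comp, hs, ht]
    | tmul a b =>
      exact LinearMap.trace_mul_comm k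
        (Q.leftDualTwist m Q.qL ∘ₗ mulRight k a ∘ₗ Q.leftDualCoactHom ξ)
        (mulRight k (Q.antipodeInv b))
  have h2 : Q.leftDualCoactHom (ξ ∘ₗ mulRight k (Q.antipodeInv x)) =
      (multilin₂ (k := k) (P := Module.End k H) (fun a b => mulRight k a ∘ₗ
        Q.leftDualCoactHom ξ ∘ₗ mulRight k (Q.antipodeInv b))) (Q.comul x) := by
    ext y
    rw [leftDualCoactHom_comp]
    generalize Q.comul x = v
    apply tensor_ind₂ v; intro a b
    simp
  rw [h2, h1, ← map_smul, ← LinearMap.smul_comp]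
  congr 2
  generalize Q.qL = q
  induction q using tensor_ind₂ with
  | add =>
    intro s t hs ht
    rw [map_add, smul_add, ← hs, ← ht]
    generalize Q.comul x = v
    induction v using tensor_ind₂ with
    | add => intro s t hs ht; simp only [map_add] at hs ht ⊢; rw [hs, ht]; abel
    | tmul a b => ext; simp [add_mul]
  | tmul c d =>
    ext z
    have e := Q.antipode_beta x
    have : ∀ v : H ⊗[k] H, (multilin₂ (k := k) (P := Module.End k H)
        (fun a b => mulRight k (Q.antipodeInv b) ∘ₗ Q.leftDualTwist m (c ⊗ₜ d) ∘ₗ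
          mulRight k a)) v z =
        Q.antipode d * m * Q.antipodeInv (Q.antipodeInv (c * z * Q.contrBeta v)) := by
      intro v
      apply tensor_ind₂ v; intro a b
      simp [leftDualTwist, antipodeInv_mul, mul_assoc]
    rw [this, contrBeta_comul]
    simp [leftDualTwist, antipodeInv_mul, mul_assoc]

variable (Q) in
/-- The elements which represent the functionals `ξ ↦ E^cop(ξ)(m)` are right integrals. -/
lemma exists_leftDualE_eq (m : H) :
    ∃ r : H, Q.IsRightIntegral r ∧ ∀ ξ, Q.leftDualE ξ m = ξ r := by
  let F : Module.Dual k (Module.Dual k H) :=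
    { toFun := fun ξ => Q.leftDualE ξ m
      map_add' := fun ξ η => by
        rw [leftDualE_apply, leftDualE_apply, leftDualE_apply, ← map_add, ← LinearMap.comp_add]
        congr 2
        ext y
        simp [leftDualCoactHom, contrFst, map_add_left]
      map_smul' := fun c ξ => by
        rw [leftDualE_apply, leftDualE_apply, RingHom.id_apply, ← map_smul, ← LinearMap.comp_smul]
        congr 2
        ext y
        simp [leftDualCoactHom, contrFst, map_smul_left] }
  have hF : ∀ ξ, Q.leftDualE ξ m = ξ ((Module.evalEquiv k H).symm F) := by
    intro ξ
    rw [Module.apply_evalEquiv_symm_apply]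
    rfl
  refine ⟨_, fun x => ?_, hF⟩
  obtain ⟨x, rfl⟩ : ∃ y, Q.antipodeInv y = x := ⟨Q.antipode x, by simp⟩
  rw [← sub_eq_zero, ← Module.forall_dual_apply_eq_zero_iff k]
  intro ξ
  have e := LinearMap.congr_fun (Q.leftDualE_comp_mulRight ξ x) m
  rw [LinearMap.smul_apply, hF, hF] at e
  rw [map_sub, map_smul, counit_antipodeInv, ← e, sub_eq_zero]
  rfl


section Casimir

variable (Q Lam) in
/-- `d = q^L Δ(Λ) p^L`, for an integral `Λ`. -/
def casimir : H ⊗[k] H := Q.qL * Q.comul Lam * Q.pL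

lemma IsLeftIntegral.comul_eq (h : Q.IsLeftIntegral Lam) :
    Q.comul Lam = (Q.beta ⊗ₜ 1) * (Q.qL * Q.comul Lam) := by
  have e := congrArg (· * Q.comul Lam) Q.qL_comul_pL
  simp only [one_mul] at e
  conv_lhs => rw [← e]
  rw [← Q.antipode_antipodeInv Q.beta, ← idCounit_pL]
  generalize Q.pL = v
  apply tensor_ind₂ v; intro a b
  simp only [pw_tmul, AlgHom.toLinearMap_apply, mul_assoc, ← map_mul, h b]
  simp [← smul_tmul', mul_assoc]

omit [Module.Finite k H] in
/-- `S(x) d₁ ⊗ d₂ = d₁ ⊗ x d₂` -/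
lemma IsLeftIntegral.casimir_move (h : Q.IsLeftIntegral Lam) (x : H) :
    (Q.antipode x ⊗ₜ 1) * Q.casimir Lam = (1 ⊗ₜ x) * Q.casimir Lam := by
  rw [casimir, ← mul_assoc, h.qL_move, mul_assoc]

/-- `d₁ S̄(x) ⊗ d₂ = d₁ ⊗ d₂ x` -/
lemma IsRightIntegral.casimir_move (h : Q.IsRightIntegral Lam) (x : H) :
    Q.casimir Lam * (Q.antipodeInv x ⊗ₜ 1) = Q.casimir Lam * (1 ⊗ₜ x) := by
  rw [casimir, mul_assoc Q.qL, mul_assoc Q.qL, h.pL_move, mul_assoc Q.qL]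

/-- The copairing `d` of a non-zero integral is non-degenerate in its first factor. -/
lemma contrFst_casimir_injective (h : Q.IsLeftIntegral Lam)
    (h0 : Lam ≠ 0) {ξ : Module.Dual k H} (hξ : contrFst ξ (Q.casimir Lam) = 0) : ξ = 0 := by
  -- `ξ(u w₁) w₂ = 0` for all `u`, where `w = Δ(Λ) p^L`
  have h1 : ∀ u, contrFst ξ ((u ⊗ₜ 1) * (Q.comul Lam * Q.pL)) = 0 := by
    intro u
    obtain ⟨v, hv⟩ : ∃ v, Q.antipode v = u * Q.beta := ⟨Q.antipodeInv (u * Q.beta), by simp⟩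
    rw [h.comul_eq, ← mul_assoc, ← mul_assoc, mul_assoc _ _ Q.pL, tmul_mul_tmul,
      mul_one, ← hv]
    change contrFst ξ (_ * Q.casimir Lam) = 0
    rw [h.casimir_move, contrFst_one_tmul_mul, hξ, mul_zero]
  let ρ : H →ₗ[k] Module.Dual k H := (LinearMap.mul k H).flip.compr₂ ξ
  have h2 : TensorProduct.map ρ LinearMap.id (Q.comul Lam * Q.pL) = 0 := by
    apply (dualTensorHomEquiv k H H).injective
    rw [map_zero]
    ext u
    rw [LinearMap.zero_apply, ← h1 u]
    generalize Q.comul Lam * Q.pL = v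
    apply tensor_ind₂ v; intro a b
    simp [ρ, dualTensorHom_apply]
  have h3 : pw (mulRight k Q.qL ∘ₗ inL ∘ₗ Q.antipode) Q.comul.toLinearMap
      (Q.comul Lam * Q.pL) = 1 ⊗ₜ Lam := by
    have e1 : ∀ v w, pw (mulRight k Q.qL ∘ₗ inL ∘ₗ Q.antipode) Q.comul.toLinearMap
        (v * w) = pw (mulRight k (pw (mulRight k Q.qL ∘ₗ inL ∘ₗ Q.antipode)
          Q.comul.toLinearMap v) ∘ₗ inL ∘ₗ Q.antipode) Q.comul.toLinearMap w := by
      intro v w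
      apply tensor_ind₂ w; intro c d
      induction v using tensor_ind₂ with
      | add =>
        intro s t hs ht
        simp only [map_add, mul_add, add_mul, hs, ht, pw_tmul, comp_apply,
          mulRight_apply]
      | tmul a b => simp [inL, Q.antipode_mul, mul_assoc]
    have e2 : ∀ w, pw (mulRight k ((1 ⊗ₜ[k] Lam) * Q.qL) ∘ₗ inL ∘ₗ Q.antipode)
        Q.comul.toLinearMap w = (1 ⊗ₜ[k] Lam) *
          pw (mulRight k Q.qL ∘ₗ inL ∘ₗ Q.antipode) Q.comul.toLinearMap w := by
      intro w
      apply tensor_ind₂ w; intro a b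
      simp [inL, ← mul_assoc]
    rw [e1, qL_comul, e2, qL_comul_pL, mul_one]
  ext u
  let Ψ : Module.Dual k H ⊗[k] H →ₗ[k] H := sweedler₂ (k := k)
    (fun η b => contrFst (η ∘ₗ mulLeft k u ∘ₗ Q.antipodeInv) (Q.qL * Q.comul b))
    (fun _ => ⟨by intros; simp [contrFst, LinearMap.add_comp, map_add_left],
      by intros; simp [contrFst, LinearMap.smul_comp, map_smul_left]⟩)
    (fun _ => ⟨by intros; simp [mul_add], by intros; simp⟩)
  have h4 : ∀ v, Ψ (TensorProduct.map ρ LinearMap.id v) =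
      contrFst (ξ ∘ₗ mulLeft k u ∘ₗ Q.antipodeInv)
        (pw (mulRight k Q.qL ∘ₗ inL ∘ₗ Q.antipode) Q.comul.toLinearMap v) := by
    intro v
    apply tensor_ind₂ v; intro a b
    simp only [TensorProduct.map_tmul, LinearMap.id_apply, pw_tmul, Ψ, sweedler₂_tmul,
      comp_apply, mulRight_apply, AlgHom.toLinearMap_apply, mul_assoc]
    generalize Q.qL * Q.comul b = v
    apply tensor_ind₂ v; intro a b
    simp [ρ, inL, antipodeInv_mul, mul_assoc]
  have h5 := h4 (Q.comul Lam * Q.pL)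
  rw [h2, map_zero, h3, contrFst_tmul] at h5
  simpa [antipodeInv_one, h0] using h5.symm

lemma exists_contrFst_casimir_eq (h : Q.IsLeftIntegral Lam)
    (h0 : Lam ≠ 0) (x : H) : ∃ ξ, contrFst ξ (Q.casimir Lam) = x := by
  let κ : Module.Dual k H →ₗ[k] H :=
    { toFun := fun ξ => contrFst ξ (Q.casimir Lam)
      map_add' := fun _ _ => by simp [contrFst, map_add_left]
      map_smul' := fun _ _ => by simp [contrFst, map_smul_left] }
  have h1 : Function.Injective κ :=
    (injective_iff_map_eq_zero κ).2 fun ξ hξ => contrFst_casimir_injective h h0 hξ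
  exact (LinearMap.injective_iff_surjective_of_finrank_eq_finrank
    (Subspace.dual_finrank_eq (K := k) (V := H))).1 h1 x

variable (Q) in
lemma counitId_casimir (Lam : H) : Q.counitId (Q.casimir Lam) = Lam := by
  rw [casimir, map_mul, map_mul, counitId_qL, counitId_pL, counitId_comul, one_mul, mul_one]

lemma contrFst_sub (a b : Module.Dual k H) (t : H ⊗[k] H) :
    contrFst (a - b) t = contrFst a t - contrFst b t := by
  induction t using tensor_ind₂ with
  | add => intro s t hs ht; simp only [map_add, hs, ht]; abel
  | tmul a b => simp [sub_smul]

lemma one_tmul_one_tmul_mul_in12 (b : H) (t : H ⊗[k] H) :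
    (1 ⊗ₜ (1 ⊗ₜ b)) * in12 t = in12 t * (1 ⊗ₜ (1 ⊗ₜ b)) := by
  apply tensor_ind₂ t; intro x y
  simp

/-- Left integrals are unique up to scalars. -/
lemma IsLeftIntegral.eq_smul (h : Q.IsLeftIntegral Lam)
    (h0 : Lam ≠ 0) {Lam' : H} (hL' : Q.IsLeftIntegral Lam') : ∃ c : k, Lam' = c • Lam := by
  obtain ⟨ξ, rfl⟩ := exists_contrFst_casimir_eq h h0 Lam'
  have h1 : ∀ x, ξ ∘ₗ mulLeft k (Q.antipode x) = Q.counit x • ξ := by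
    intro x
    rw [← sub_eq_zero]
    apply contrFst_casimir_injective h h0
    have h2 : ∀ a : Module.Dual k H, ∀ c : k, ∀ t, contrFst (c • a) t = c • contrFst a t := by
      intro a b t
      simp [contrFst, map_smul_left]
    rw [contrFst_sub, contrFst_comp_mulLeft, h.casimir_move, contrFst_one_tmul_mul, hL', h2, sub_self]
  have h2 : ξ = ξ 1 • Q.counit.toLinearMap := by
    ext y
    have := LinearMap.congr_fun (h1 (Q.antipodeInv y)) 1
    simpa [counit_antipodeInv, mul_comm] using this
  refine ⟨ξ 1, ?_⟩
  rw [h2]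
  simp only [LinearMap.smul_apply, AlgHom.toLinearMap_apply, map_one, smul_eq_mul, mul_one]
  conv_rhs => rw [← counitId_casimir Q Lam]
  generalize Q.casimir Lam = t
  apply tensor_ind₂ t; intro a b
  simp [smul_smul]

end Casimir

section DualBases

variable (Q Lam) in
/-- `λ` and `d = q^L Δ(Λ) p^L` are dual to each other: `λ(d₁) d₂ = 1`. -/
def IsDualTo (lam : Module.Dual k H) : Prop := contrFst lam (Q.casimir Lam) = 1

variable {lam : Module.Dual k H}

/-- `λ(S(x) y) = λ(y S̄(x))` -/
lemma IsDualTo.antipode_mul (hd : Q.IsDualTo Lam lam) (h : Q.IsLeftIntegral Lam)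
    (h' : Q.IsRightIntegral Lam) (x y : H) : lam (Q.antipode x * y) = lam (y * Q.antipodeInv x) := by
  have h0 : Lam ≠ 0 := by
    rintro rfl
    rw [IsDualTo, casimir, map_zero, mul_zero, zero_mul, map_zero] at hd
    have := congrArg Q.counit hd
    simp at this
  have : lam ∘ₗ mulLeft k (Q.antipode x) =
      lam ∘ₗ mulRight k (Q.antipodeInv x) := by
    rw [← sub_eq_zero]
    apply contrFst_casimir_injective h h0
    rw [contrFst_sub, contrFst_comp_mulLeft, contrFst_comp_mulRight, h.casimir_move, h'.casimir_move,
      contrFst_one_tmul_mul, contrFst_mul_one_tmul, hd, mul_one, one_mul, sub_self]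
  exact LinearMap.congr_fun this y

/-- `λ(x d₁) S(d₂) = x` -/
lemma IsDualTo.antipode_contrFst (hd : Q.IsDualTo Lam lam) (h : Q.IsLeftIntegral Lam) (x : H) :
    Q.antipode (contrFst (lam ∘ₗ mulLeft k x) (Q.casimir Lam)) = x := by
  conv_lhs => rw [← Q.antipode_antipodeInv x]
  rw [contrFst_comp_mulLeft, h.casimir_move, contrFst_one_tmul_mul, hd, mul_one,
    antipode_antipodeInv]

/-- `d₁ λ(S(d₂) y) = y` -/
lemma IsDualTo.contrSnd_eq (hd : Q.IsDualTo Lam lam) (h : Q.IsLeftIntegral Lam) (y : H) :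
    contrSnd (lam ∘ₗ mulRight k y ∘ₗ Q.antipode) (Q.casimir Lam) = y := by
  let ρ : H →ₗ[k] Module.Dual k H := (LinearMap.mul k H).compr₂ lam
  have h1 : Function.Injective ρ := by
    refine (injective_iff_map_eq_zero ρ).2 fun x hx => ?_
    rw [← hd.antipode_contrFst h x]
    have : lam ∘ₗ mulLeft k x = 0 := hx
    rw [this]
    simp [contrFst]
  have h2 := (LinearMap.injective_iff_surjective_of_finrank_eq_finrank
    (Subspace.dual_finrank_eq (K := k) (V := H)).symm).1 h1
  rw [← sub_eq_zero, ← Module.forall_dual_apply_eq_zero_iff k]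
  intro η
  obtain ⟨x, rfl⟩ := h2 η
  rw [map_sub, sub_eq_zero]
  change lam (x * _) = lam (x * y)
  conv_rhs => rw [← hd.antipode_contrFst h x]
  generalize Q.casimir Lam = t
  apply tensor_ind₂ t; intro a b
  simp [mul_comm]

/-- `λ(V₁ y₁ U₁) V₂ y₂ U₂ = λ(y) 1` -/
lemma IsDualTo.leftDualCoactHom_eq (hd : Q.IsDualTo Lam lam) (h : Q.IsLeftIntegral Lam)
    (h' : Q.IsRightIntegral Lam) : Q.leftDualCoactHom lam = lam.smulRight 1 := by
  let G : H ⊗[k] (H ⊗[k] H) →ₗ[k] H ⊗[k] H :=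
    TensorProduct.map (contrFst lam) LinearMap.id ∘ₗ (TensorProduct.assoc k H H H).symm.toLinearMap
  have h1 : ∀ t, G (Q.comulR t) = Q.comul (contrFst lam t) := by
    intro t
    apply tensor_ind₂ t; intro a b
    rw [comulR_tmul, contrFst_tmul, map_smul]
    generalize Q.comul b = v
    apply tensor_ind₂ v; intro a b
    simp [G, smul_tmul']
  have h2 : ∀ t, G (in12 Q.VR * Q.comulL t * in12 Q.UR) =
      TensorProduct.map (Q.leftDualCoactHom lam) LinearMap.id t := by
    have : ∀ v b, G (in12 v * (1 ⊗ₜ (1 ⊗ₜ b))) = contrFst lam v ⊗ₜ b := by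
      intro v b
      apply tensor_ind₂ v; intro a b
      simp [G]
    intro t
    apply tensor_ind₂ t; intro a b
    rw [comulL_tmul, ← mul_assoc, mul_assoc _ _ (in12 _), one_tmul_one_tmul_mul_in12, ← mul_assoc, ← map_mul, ← map_mul,
      this]
    simp [leftDualCoactHom, mul_assoc]
  have h3 := congrArg G (h.VR_comulL_UR h')
  change G (_ * Q.comulL (Q.casimir Lam) * _) = G (Q.comulR (Q.casimir Lam)) at h3
  rw [h1, h2, hd, map_one] at h3
  ext y
  have h4 : ∀ t, contrSnd (lam ∘ₗ mulRight k y ∘ₗ Q.antipode)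
      (TensorProduct.map (Q.leftDualCoactHom lam) LinearMap.id t) = Q.leftDualCoactHom lam
        (contrSnd (lam ∘ₗ mulRight k y ∘ₗ Q.antipode) t) := by
    intro t
    apply tensor_ind₂ t; intro a b
    simp
  rw [← hd.contrSnd_eq h y, ← h4, h3, hd.contrSnd_eq h y]
  simp [Algebra.TensorProduct.one_def, Q.antipode_one]

lemma IsDualTo.leftDualE_eq (hd : Q.IsDualTo Lam lam) (h : Q.IsLeftIntegral Lam)
    (h' : Q.IsRightIntegral Lam) : Q.leftDualE lam = lam := by
  ext m
  have h1 : ∀ q, Q.leftDualTwist m q ∘ₗ lam.smulRight 1 =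
      lam.smulRight (Q.leftDualTwist m q 1) := by intro q; ext; simp
  rw [leftDualE_apply, hd.leftDualCoactHom_eq h h', h1, LinearMap.trace_smulRight, qL_eq]
  have h2 : ∀ v, lam (Q.leftDualTwist m (Q.qLMap v) 1) =
      lam (m * Q.antipodeInv (Q.antipodeInv (Q.zagMap v))) := by
    intro v
    apply tensor_ind₃ v; intro a b c
    simp [leftDualTwist, mul_assoc, hd.antipode_mul h h', antipodeInv_mul]
  rw [h2, zagMap_phiInv, antipodeInv_one, antipodeInv_one, mul_one]

lemma exists_isDualTo (h : Q.IsLeftIntegral Lam) (h0 : Lam ≠ 0) :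
    ∃ lam, Q.IsDualTo Lam lam := exists_contrFst_casimir_eq h h0 1

lemma IsDualTo.apply_eq_one (hd : Q.IsDualTo Lam lam) (h : Q.IsLeftIntegral Lam)
    (h' : Q.IsRightIntegral Lam) : lam Lam = 1 := by
  have e := congrArg Q.counit hd
  rw [counit_contrFst, casimir, map_mul Q.idCounit, map_mul Q.idCounit, idCounit_qL, idCounit_pL, idCounit_comul, h,
    Q.counit_alpha, one_smul, h', counit_antipodeInv, Q.counit_beta, one_smul, map_one] at e
  exact e

/-- For a unimodular `H`, left integrals are right integrals, and a right cointegral `λ` with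
`λ(Λ) = 1` is dual to `d = q^L Δ(Λ) p^L`. -/
theorem IsUnimodular.exists_integral (hQ : Q.IsUnimodular) (hlam : Q.IsRightCointegral lam)
    (hlam0 : lam ≠ 0) :
    (∃! Lam : H, Q.IsLeftIntegral Lam ∧ lam Lam = 1) ∧
    ∀ Lam : H, Q.IsLeftIntegral Lam → lam Lam = 1 →
      Q.IsRightIntegral Lam ∧ Q.IsDualTo Lam lam := by
  obtain ⟨ξ, rfl⟩ := hlam
  obtain ⟨Lam, hr, hl, h0⟩ : ∃ r, Q.IsRightIntegral r ∧ Q.IsLeftIntegral r ∧ r ≠ 0 := by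
    obtain ⟨m, hm⟩ := DFunLike.ne_iff.1 hlam0
    obtain ⟨r, hr, e⟩ := exists_leftDualE_eq Q m
    refine ⟨r, hr, hQ.isLeftIntegral hr, ?_⟩
    rintro rfl
    rw [e, map_zero] at hm
    exact hm rfl
  obtain ⟨l, hd⟩ := exists_isDualTo hl h0
  have h1 : Q.leftDualE ξ = ξ Lam • l := by
    ext m
    obtain ⟨r, hr', e⟩ := exists_leftDualE_eq Q m
    obtain ⟨c, rfl⟩ := hl.eq_smul h0 (hQ.isLeftIntegral hr')
    have e1 := e l
    rw [hd.leftDualE_eq hl hr, map_smul, hd.apply_eq_one hl hr] at e1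
    rw [e, LinearMap.smul_apply, e1, map_smul]
    simp [mul_comm]
  have hc : ξ Lam ≠ 0 := by
    intro h
    rw [h1, h, zero_smul] at hlam0
    exact hlam0 rfl
  have h2 : ∀ L, Q.IsLeftIntegral L → Q.leftDualE ξ L = 1 → L = (ξ Lam)⁻¹ • Lam := by
    intro L hL h
    obtain ⟨c, rfl⟩ := hl.eq_smul h0 hL
    rw [h1, LinearMap.smul_apply, map_smul, hd.apply_eq_one hl hr] at h
    congr 1
    simp only [smul_eq_mul, mul_one] at h
    exact eq_inv_of_mul_eq_one_right h
  have h3 : Q.leftDualE ξ ((ξ Lam)⁻¹ • Lam) = 1 := by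
    rw [h1, LinearMap.smul_apply, map_smul, hd.apply_eq_one hl hr]
    simp [hc]
  refine ⟨⟨(ξ Lam)⁻¹ • Lam, ⟨fun x => by rw [mul_smul_comm, hl, smul_comm], h3⟩,
    fun L hL => h2 L hL.1 hL.2⟩, fun L hL h => ?_⟩
  rw [h2 L hL h]
  refine ⟨fun x => by rw [smul_mul_assoc, hr, smul_comm], ?_⟩
  have h4 : Q.casimir ((ξ Lam)⁻¹ • Lam) = (ξ Lam)⁻¹ • Q.casimir Lam := by simp [casimir]
  rw [IsDualTo, h1, h4, map_smul, contrFst, map_smul_left, LinearMap.comp_smul,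
    LinearMap.smul_apply, smul_smul, inv_mul_cancel₀ hc, one_smul]
  exact hd

/-- `λ(S(a) V₁ m₁ p₁) V₂ m₂ p₂ = Y₁ λ(m S̄(Y₂))` for `Y = Δ(a) f̄`, `V = V^R` and `p = p^R`. -/
lemma IsDualTo.contrFst_VR_pR (hd : Q.IsDualTo Lam lam) (h : Q.IsLeftIntegral Lam)
    (h' : Q.IsRightIntegral Lam) (a m : H) :
    contrFst (lam ∘ₗ mulLeft k (Q.antipode a)) (Q.VR * Q.comul m * Q.pR) =
      contrSnd (lam ∘ₗ mulLeft k m ∘ₗ Q.antipodeInv) (Q.comul a * Q.drinfeldFInv) := by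
  let χ : Module.Dual k H := lam ∘ₗ mulRight k m ∘ₗ Q.antipode
  have hχ : lam ∘ₗ mulLeft k m ∘ₗ Q.antipodeInv = χ := by
    ext x
    exact (hd.antipode_mul h h' x m).symm
  let η : Module.Dual k H := lam ∘ₗ mulLeft k (Q.antipode a)
  let G : H ⊗[k] (H ⊗[k] H) →ₗ[k] H :=
    TensorProduct.lid k H ∘ₗ TensorProduct.map η (contrSnd χ)
  have h1 : ∀ t, G (Q.comulR t * in23 Q.drinfeldFInv) =
      contrSnd χ (Q.comul (contrFst η t) * Q.drinfeldFInv) := by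
    intro t
    apply tensor_ind₂ t; intro a b
    simp [G]
  have h2 : ∀ t, G (in12 Q.VR * Q.comulL t * in12 Q.pR) =
      contrFst η (Q.VR * Q.comul (contrSnd χ t) * Q.pR) := by
    have : ∀ v b, G (in12 v * (1 ⊗ₜ (1 ⊗ₜ b))) = χ b • contrFst η v := by
      intro v b
      apply tensor_ind₂ v; intro a b
      simp [G, smul_smul]
    intro t
    apply tensor_ind₂ t; intro a b
    rw [comulL_tmul, ← mul_assoc, mul_assoc _ _ (in12 _), one_tmul_one_tmul_mul_in12, ← mul_assoc, ← map_mul, ← map_mul,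
      this]
    simp
  have h3 := congrArg G (h.comulR_drinfeldFInv h')
  change G (Q.comulR (Q.casimir Lam) * _) = G (_ * Q.comulL (Q.casimir Lam) * _) at h3
  rw [h1, h2, hd.contrSnd_eq h m] at h3
  rw [hχ, h3.symm]
  congr 3
  have := hd.antipode_contrFst h (Q.antipode a)
  rw [← Q.antipodeInv_antipode (contrFst η _), this, antipodeInv_antipode]

end DualBases

end Cointegral
end QuasiHopfAlgebra

/-! ### The adjoint algebra and the regular module -/

namespace QuasiHopfAlgebra

variable {k H : Type*} [Field k] [Ring H] [Algebra k H] (Q : QuasiHopfAlgebra k H)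

section
variable {B : Type*} [Ring B] [Algebra k B] {L : ℕ → H →ₗ[k] B} {Q} {a a' b b' c : LegTree}

lemma ev_node' (h : H) : Q.ev L (a * b) h = pw (Q.ev L a) (Q.ev L b) (Q.comul h) := rfl

lemma can_left' (hL : IsLegs L) (h : a.leaves = a'.leaves ∧ (a * b).leaves.Nodup) :
    Q.can L (a * b) (a' * b) = Q.can L a a' := can_left hL h.1 h.2

lemma can_right' (hL : IsLegs L) (h : b.leaves = b'.leaves ∧ (a * b).leaves.Nodup) :
    Q.can L (a * b) (a * b') = Q.can L b b' := can_right hL h.1 h.2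

lemma can_assoc' (hL : IsLegs L) (h : (a * b * c).leaves.Nodup) :
    Q.can L (a * b * c) (a * (b * c)) = Q.ph L a b c :=
  (AssocPath.assoc a b c).can_eq hL h

lemma can_assocInv' (hL : IsLegs L) (h : (a * (b * c)).leaves.Nodup) :
    Q.can L (a * (b * c)) (a * b * c) = Q.phi' L a b c :=
  (AssocPath.assocInv a b c).can_eq hL h

end

/-- `x ⊗ y ↦ x a S(y)` -/
def adContr (a : H) : H ⊗[k] H →ₗ[k] H := pw ((LinearMap.mul k H).flip a) Q.antipode

@[simp] lemma adContr_tmul (a x y : H) : Q.adContr a (x ⊗ₜ y) = x * a * Q.antipode y := rfl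

lemma adjointAct_apply (h a : H) : Q.adjointAct h a = Q.adContr a (Q.comul h) := by
  simp only [adjointAct, AlgHom.comp_apply]
  generalize Q.comul h = s
  apply tensor_ind₂ s; intro x y
  simp [mulRightAntipode, mul_assoc]

/-- `x ⊗ y ⊗ z ↦ x a S(y) α z` -/
def regMap (a : H) : H ⊗[k] (H ⊗[k] H) →ₗ[k] H := pw ((LinearMap.mul k H).flip a) Q.contrAlpha

@[simp] lemma regMap_tmul (a x y z : H) :
    Q.regMap a (x ⊗ₜ (y ⊗ₜ z)) = x * a * (Q.antipode y * Q.alpha * z) := rfl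

/-- `a ↦ x a S(y) α z` for the tensor `s = x ⊗ y ⊗ z` -/
def regAt (s : H ⊗[k] (H ⊗[k] H)) : H →ₗ[k] H where
  toFun a := Q.regMap a s
  map_add' a b := by simp [regMap, pw, map_add_left, LinearMap.comp_add]
  map_smul' c a := by simp [regMap, pw, map_smul_left, LinearMap.comp_smul]

lemma regAt_apply (s) (a : H) : Q.regAt s a = Q.regMap a s := rfl

/-- The map `g(a) = φ₁ a S(φ₂) α φ₃` from the adjoint algebra to `H`: the action of `a` on the
generator of the regular module. -/
def toReg : H →ₗ[k] H := Q.regAt Q.phi.val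

lemma toReg_apply (a : H) : Q.toReg a = Q.regMap a Q.phi.val := rfl

/-- `x ↦ g(x ▹ a)` -/
def adReg (a : H) : H →ₗ[k] H := Q.toReg ∘ₗ Q.adContr a ∘ₗ Q.comul.toLinearMap

lemma adReg_apply (a x : H) : Q.adReg a x = Q.toReg (Q.adjointAct x a) := by
  rw [adjointAct_apply]; rfl

lemma regMap_absorb (a x : H) (X) :
    Q.regMap a (Q.ev Q.legs₃ (2 * 3) x * X) = Q.counit x • Q.regMap a X := by
  apply tensor_ind₃ X; intro b c d
  exact Q.absorb_left Q.contrAlpha_comul (sandwich LinearMap.id (b * a * Q.antipode c) d)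
    (by simp [Q.antipode_mul, mul_assoc]) (by simp [mul_assoc]) x

/-- `g(h₁ ▹ a) h₂ = h g(a)`: the action of `a` on the regular module is a morphism. -/
lemma adReg_comul (a h : H) :
    pw (Q.adReg a) LinearMap.id (Q.comul h) = h * Q.toReg a := by
  have hL := Q.isLegs_legs₃
  have e := congrArg (Q.regMap a) (Q.ph_mul_ev (a := 1) (b := 2) (c := 3) hL (by decide) h)
  have e1 := kill_ev_left (2 * 3) hL (Q.regMap_absorb a) (t := 1 * (2 * 3)) (by decide) h
    (Q.ph Q.legs₃ 1 2 3)
  have e := e.trans e1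
  rw [ph_legs₃] at e
  have r1 : ∀ s, Q.regMap a (Q.ev Q.legs₃ 1 h * s) = h * Q.regMap a s := by
    intro s
    apply tensor_ind₃ s; intro a b c
    simp [ev, mul_assoc]
  refine Eq.trans ?_ (e.trans (r1 _))
  simp only [adReg, toReg, ev_node]
  generalize Q.comul h = s
  apply tensor_ind₂ s; intro x y
  change Q.regMap (Q.adContr a (Q.comul x)) _ * y = Q.regMap a (_ *
    (pw (Q.ev Q.legs₃ 1) (Q.ev Q.legs₃ 2) (Q.comul x) * _))
  generalize Q.comul x = w
  generalize Q.phi.val = v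
  apply tensor_ind₃ v; intro p q r
  induction w using tensor_ind₂ with
  | add => intro s t hs ht; simp_all [add_mul, mul_add]
  | tmul u w => simp [ev, Q.antipode_mul, mul_assoc]

lemma toReg_beta : Q.toReg Q.beta = 1 := by
  rw [toReg_apply, ← Q.zigMap_phi]
  generalize Q.phi.val = v
  apply tensor_ind₃ v; intro p q r
  simp [mul_assoc]

section Mul

/-- `x ⊗ y ⊗ z ⊗ w ↦ x a S(y) α z b S(w)` -/
def adMulMap (a b : H) : H ⊗[k] (H ⊗[k] (H ⊗[k] H)) →ₗ[k] H :=
  pw ((LinearMap.mul k H).flip a)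
    (pw Q.antipode (pw ((LinearMap.mul k H).flip b ∘ₗ LinearMap.mul k H Q.alpha) Q.antipode))

@[simp] lemma adMulMap_tmul (a b x y z w : H) : Q.adMulMap a b (x ⊗ₜ (y ⊗ₜ (z ⊗ₜ w))) =
    x * a * (Q.antipode y * (Q.alpha * z * b * Q.antipode w)) := rfl

lemma adjointMul_tmul (a b : H) : Q.adjointMul (a ⊗ₜ b) =
    Q.adMulMap a b (Q.can Q.legs₄ (1 * 2 * (3 * 4)) (1 * (2 * 3 * 4))) := by
  rw [← kappa_eq_can]
  unfold adjointMul
  generalize Q.kappa = s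
  apply tensor_ind₄ s; intro x y z w
  simp [mul_assoc, sweedler₂]

lemma adMulMap_absorb (a b x : H) (X) :
    Q.adMulMap a b (Q.ev Q.legs₄ (2 * 3) x * X) = Q.counit x • Q.adMulMap a b X := by
  apply tensor_ind₄ X; intro p q r s
  exact Q.absorb_left Q.contrAlpha_comul
    (sandwich LinearMap.id (p * a * Q.antipode q) (r * b * Q.antipode s))
    (by simp [Q.antipode_mul, mul_assoc]) (by simp [mul_assoc]) x

/-- The product of `A` is `H`-linear. -/
lemma adjointAct_mul (h a b : H) : Q.adjointAct h (Q.adjointMul (a ⊗ₜ b)) =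
    Q.adjointMul (Q.tensorAct Q.adjointAct Q.adjointAct h (a ⊗ₜ b)) := by
  have hL := Q.isLegs_legs₄
  have e := congrArg (Q.adMulMap a b)
    (can_mul_ev (Q := Q) hL (s := 1 * 2 * (3 * 4)) (t := 1 * (2 * 3 * 4)) (by decide) h)
  rw [kill_ev_left (2 * 3) hL (Q.adMulMap_absorb a b) (by decide)] at e
  rw [show kill (2 * 3) (1 * (2 * 3 * 4)) = 1 * 4 by decide] at e
  rw [adjointMul_tmul, adjointAct_apply]
  have r1 : ∀ s, Q.adContr (Q.adMulMap a b s) (Q.comul h) =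
      Q.adMulMap a b (Q.ev Q.legs₄ (1 * 4) h * s) := by
    intro s
    change _ = Q.adMulMap a b (pw (Q.ev Q.legs₄ 1) (Q.ev Q.legs₄ 4) (Q.comul h) * s)
    generalize Q.comul h = v
    apply tensor_ind₂ v; intro u v
    induction s using tensor_ind₄ with
    | add => intro s t hs ht; simp_all [mul_add, add_mul]
    | tmul p q r s => simp [ev, Q.antipode_mul, mul_assoc]
  rw [r1, ← e]
  change _ = Q.adjointMul (actTensor Q.adjointAct Q.adjointAct (Q.comul h) _)
  rw [ev_node']
  generalize Q.comul h = v
  apply tensor_ind₂ v; intro u v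
  change Q.adMulMap a b (_ * (pw (Q.ev Q.legs₄ 1) (Q.ev Q.legs₄ 2) (Q.comul u) *
    pw (Q.ev Q.legs₄ 3) (Q.ev Q.legs₄ 4) (Q.comul v))) =
    Q.adjointMul (Q.adjointAct u a ⊗ₜ Q.adjointAct v b)
  rw [adjointMul_tmul, adjointAct_apply, adjointAct_apply]
  generalize Q.comul u = u
  generalize Q.comul v = v
  generalize Q.can Q.legs₄ _ _ = s
  apply tensor_ind₄ s; intro p q r s
  induction u using tensor_ind₂ with
  | add => intro s t hs ht; simp_all [adMulMap, mul_add, add_mul]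
  | tmul u₁ u₂ =>
  induction v using tensor_ind₂ with
  | add => intro s t hs ht; simp_all [adMulMap, mul_add, add_mul]
  | tmul v₁ v₂ => simp [ev, Q.antipode_mul, mul_assoc]

/-- If a map absorbs the legs `4`, `5`, then its value on `φ₁₂₃ φ₃₄₅ φ₍₁₂₎₍₃₄₎₅` is its value on a
single canonical element. -/
lemma apply_ph_mul_ph_mul_ph {P : Type*} [AddCommGroup P] [Module k P]
    {E : H ⊗[k] (H ⊗[k] (H ⊗[k] (H ⊗[k] H))) →ₗ[k] P}
    (k45 : ∀ x X, E (Q.ev Q.legs₅ (4 * 5) x * X) = Q.counit x • E X) :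
    E (Q.ph Q.legs₅ 1 2 3 * (Q.ph Q.legs₅ 3 4 5 * Q.ph Q.legs₅ (1 * 2) (3 * 4) 5)) =
      E (Q.can Q.legs₅ (1 * 2 * (3 * 4) * 5) (1 * (2 * (3 * (4 * 5))))) := by
  have hL := Q.isLegs_legs₅
  rw [← can_trans hL (1 * 2 * (3 * (4 * 5))) (by decide) (by decide),
    kill_can_left_to (4 * 5) (1 * 2 * 3) (1 * (2 * 3)) hL k45 (by decide),
    can_assoc' hL (by decide),
    ← can_trans hL (1 * 2 * (3 * 4 * 5)) (by decide) (by decide),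
    can_assoc' hL (by decide), can_right' hL (by decide), can_assoc' hL (by decide)]

/-- `x ⊗ y ⊗ z ⊗ w ⊗ v ↦ x a S(y) α z b S(w) α v` -/
def regMap₂ (a b : H) : H ⊗[k] (H ⊗[k] (H ⊗[k] (H ⊗[k] H))) →ₗ[k] H :=
  pw ((LinearMap.mul k H).flip a)
    (pw Q.antipode (pw ((LinearMap.mul k H).flip b ∘ₗ LinearMap.mul k H Q.alpha) Q.contrAlpha))

@[simp] lemma regMap₂_tmul (a b x y z w v : H) :
    Q.regMap₂ a b (x ⊗ₜ (y ⊗ₜ (z ⊗ₜ (w ⊗ₜ v)))) =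
      x * a * (Q.antipode y * (Q.alpha * z * b * (Q.antipode w * Q.alpha * v))) := rfl

/-- `g(a ⋆ b) = g(φ₁ ▹ a) g(φ₂ ▹ b) φ₃`: the regular module is a module over `A`. -/
lemma toReg_mul (a b : H) : Q.toReg (Q.adjointMul (a ⊗ₜ b)) =
    pw (Q.adReg a) (pw (Q.adReg b) LinearMap.id) Q.phi.val := by
  have hL := Q.isLegs_legs₅
  set E := Q.regMap₂ a b with hE
  have k45 : ∀ x X, E (Q.ev Q.legs₅ (4 * 5) x * X) = Q.counit x • E X := by
    intro x X
    apply tensor_ind₅ X; intro p q r s t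
    exact Q.absorb_left Q.contrAlpha_comul
      (sandwich LinearMap.id (p * a * Q.antipode q * Q.alpha * r * b * Q.antipode s) t)
      (by simp [E, Q.antipode_mul, mul_assoc]) (by simp [E, mul_assoc]) x
  have k23 : ∀ x X, E (Q.ev Q.legs₅ (2 * 3) x * X) = Q.counit x • E X := by
    intro x X
    apply tensor_ind₅ X; intro p q r s t
    exact Q.absorb_left Q.contrAlpha_comul
      (sandwich LinearMap.id (p * a * Q.antipode q) (r * b * (Q.antipode s * Q.alpha * t)))
      (by simp [E, Q.antipode_mul, mul_assoc]) (by simp [E, mul_assoc]) x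
  have h1 : Q.toReg (Q.adjointMul (a ⊗ₜ b)) =
      E (Q.ph Q.legs₅ 1 4 5 * Q.can Q.legs₅ (1 * 2 * (3 * 4)) (1 * (2 * 3 * 4))) := by
    have : Q.can Q.legs₅ (1 * 2 * (3 * 4)) (1 * (2 * 3 * 4)) =
        firstFour₅ (Q.can Q.legs₄ (1 * 2 * (3 * 4)) (1 * (2 * 3 * 4))) := by
      refine ((Q.map_can (L := Q.legs₄) (L' := Q.legs₅) (s := 1 * 2 * (3 * 4))
        (t := 1 * (2 * 3 * 4)) firstFour₅ .leaf hL (by decide) (by decide) ?_)).symm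
      intro i hi
      fin_cases hi <;> rfl
    rw [this, toReg_apply, adjointMul_tmul, ph]
    generalize Q.can Q.legs₄ _ _ = s
    generalize Q.phi.val = v
    apply tensor_ind₃ v; intro u v w
    induction s using tensor_ind₄ with
    | add => intro s t hs ht; simp_all [regMap, mul_add, add_mul]
    | tmul p q r s => simp [E, place, ev, Q.antipode_mul, mul_assoc]
  have h2 : pw (Q.adReg a) (pw (Q.adReg b) LinearMap.id) Q.phi.val =
      E (Q.ph Q.legs₅ 1 2 3 * (Q.ph Q.legs₅ 3 4 5 * Q.ph Q.legs₅ (1 * 2) (3 * 4) 5)) := by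
    have : ∀ s t u, E (Q.place Q.legs₅ 1 2 3 s * (Q.place Q.legs₅ 3 4 5 t *
        Q.place Q.legs₅ (1 * 2) (3 * 4) 5 u)) =
        pw (Q.regAt s ∘ₗ Q.adContr a ∘ₗ Q.comul.toLinearMap)
          (pw (Q.regAt t ∘ₗ Q.adContr b ∘ₗ Q.comul.toLinearMap)
            LinearMap.id) u := by
      intro s t u
      apply tensor_ind₃ u; intro u v w
      change E (_ * (_ * (pw (Q.legs₅ 1) (Q.legs₅ 2) (Q.comul u) *
        (pw (Q.legs₅ 3) (Q.legs₅ 4) (Q.comul v) * _)))) =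
        Q.regMap (Q.adContr a (Q.comul u)) s * (Q.regMap (Q.adContr b (Q.comul v)) t * w)
      generalize Q.comul u = u
      generalize Q.comul v = v
      apply tensor_ind₃ s; intro s₁ s₂ s₃
      apply tensor_ind₃ t; intro t₁ t₂ t₃
      induction u using tensor_ind₂ with
      | add => intro s t hs ht; simp_all [add_mul, mul_add]
      | tmul u₁ u₂ =>
      induction v using tensor_ind₂ with
      | add => intro s t hs ht; simp_all [add_mul, mul_add]
      | tmul v₁ v₂ => simp [E, place, ev, Q.antipode_mul, mul_assoc]
    exact (this _ _ _).symm
  rw [h1, h2, Q.apply_ph_mul_ph_mul_ph k45,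
    ← can_trans hL (u := 1 * (2 * (3 * (4 * 5)))) (1 * (2 * 3 * (4 * 5))) (by decide) (by decide),
    kill_can_left_one (4 * 5) hL k45 (by decide),
    ← can_trans hL (u := 1 * (2 * 3 * (4 * 5))) (1 * (2 * 3 * 4) * 5) (by decide) (by decide),
    kill_can_left_to (2 * 3) (1 * 4 * 5) (1 * (4 * 5)) hL k23 (by decide),
    can_assoc' hL (by decide), can_left' hL (by decide)]

end Mul

end QuasiHopfAlgebra

/-! ### The coaction of the adjoint algebra -/

namespace QuasiHopfAlgebra

variable {k H : Type*} [Field k] [Ring H] [Algebra k H] (Q : QuasiHopfAlgebra k H)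

lemma tmul_mul_tmul_mul (a b c d : H) (Z : H ⊗[k] H) :
    (a ⊗ₜ[k] b) * ((c ⊗ₜ d) * Z) = ((a * c) ⊗ₜ (b * d)) * Z := by
  rw [← mul_assoc, tmul_mul_tmul]

/-- `x ⊗ y ⊗ z ⊗ w ⊗ t ↦ x Y₁ S(w) α t ⊗ y Y₂ S(z)` -/
def coactMap (Y : H ⊗[k] H) : H ⊗[k] (H ⊗[k] (H ⊗[k] (H ⊗[k] H))) →ₗ[k] H ⊗[k] H :=
  pw inL (pw ((LinearMap.mul k (H ⊗[k] H)).flip Y ∘ₗ inR)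
    (pw (inR ∘ₗ Q.antipode) (inL ∘ₗ Q.contrAlpha)))

@[simp] lemma coactMap_tmul (Y : H ⊗[k] H) (x y z w t : H) :
    Q.coactMap Y (x ⊗ₜ (y ⊗ₜ (z ⊗ₜ (w ⊗ₜ t)))) =
      (x ⊗ₜ y) * (Y * ((Q.antipode w * Q.alpha * t) ⊗ₜ Q.antipode z)) := by
  simp [coactMap, mul_assoc, tmul_mul_tmul_mul]

/-- `Δ(a) f⁻¹` -/
def comulFInv : H →ₗ[k] H ⊗[k] H :=
  (LinearMap.mul k (H ⊗[k] H)).flip Q.drinfeldFInv ∘ₗ Q.comul.toLinearMap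

lemma comulFInv_apply (a : H) : Q.comulFInv a = Q.comul a * Q.drinfeldFInv := rfl

lemma comulFInv_adContr [Module.Finite k H] (a x y : H) :
    Q.comulFInv (x * a * Q.antipode y) = Q.comul x * (Q.comulFInv a * Q.antipodeCop y) := by
  simp only [comulFInv_apply, map_mul, mul_assoc, comul_antipode_drinfeldFInv]

lemma coactMap_absorb (Y : H ⊗[k] H) (x : H) (X) :
    Q.coactMap Y (Q.ev Q.legs₅ (4 * 5) x * X) = Q.counit x • Q.coactMap Y X := by
  apply tensor_ind₅ X; intro p q r s t
  exact Q.absorb_left Q.contrAlpha_comul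
    (sandwich inL ((p ⊗ₜ q) * (Y * (Q.antipode s ⊗ₜ Q.antipode r))) (t ⊗ₜ 1))
    (by simp [Q.antipode_mul, mul_assoc]) (by simp [mul_assoc]) x

/-- `x ⊗ y ⊗ z ⊗ w ⊗ t ↦ x Y₁ S(w) t ⊗ y Y₂ S(z)` -/
def plainCoactMap (Y : H ⊗[k] H) : H ⊗[k] (H ⊗[k] (H ⊗[k] (H ⊗[k] H))) →ₗ[k] H ⊗[k] H :=
  pw inL (pw ((LinearMap.mul k (H ⊗[k] H)).flip Y ∘ₗ inR)
    (pw (inR ∘ₗ Q.antipode) (pw (inL ∘ₗ Q.antipode) inL)))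

@[simp] lemma plainCoactMap_tmul (Y : H ⊗[k] H) (x y z w t : H) :
    Q.plainCoactMap Y (x ⊗ₜ (y ⊗ₜ (z ⊗ₜ (w ⊗ₜ t)))) =
      (x ⊗ₜ y) * (Y * ((Q.antipode w * t) ⊗ₜ Q.antipode z)) := by
  simp [plainCoactMap, mul_assoc, tmul_mul_tmul_mul]

lemma adjointCoact_eq_plain (a : H) :
    Q.adjointCoact a = Q.plainCoactMap (Q.comulFInv a) Q.adjointCoactElement := by
  unfold adjointCoact
  generalize Q.adjointCoactElement = s
  apply tensor_ind₅ s; intro x y z w t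
  simp [comulFInv_apply, mul_assoc]

/-- The coaction of `A`, evaluated on a product of associators. -/
lemma adjointCoact_eq_ph [Module.Finite k H] (a : H) :
    Q.adjointCoact a = Q.coactMap (Q.comulFInv a)
      (Q.ph Q.legs₅ 1 2 3 * (Q.ph Q.legs₅ 3 4 5 * Q.ph Q.legs₅ (1 * 2) (3 * 4) 5)) := by
  have key : ∀ s t u : H ⊗[k] (H ⊗[k] H), Q.plainCoactMap (Q.comulFInv a)
    (idTensor (idTensor
      (includeLeft : H →ₐ[k] H ⊗[k] (H ⊗[k] H))) s *
    ((1 : H) ⊗ₜ[k] ((1 : H) ⊗ₜ[k] idTensor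
        (includeLeft : H →ₐ[k] H ⊗[k] H) (Q.qRMap t))) *
    idTensor
      (idTensor
        (Algebra.TensorProduct.assoc k k k H H H).toAlgHom)
      (Algebra.TensorProduct.assoc k k k H H ((H ⊗[k] H) ⊗[k] H)
        (Algebra.TensorProduct.map Q.comul
          (Algebra.TensorProduct.map Q.comul (AlgHom.id k H)) u))) = Q.coactMap (Q.comulFInv a)
      (Q.place Q.legs₅ 1 2 3 s * (Q.place Q.legs₅ 3 4 5 t * Q.place Q.legs₅ (1 * 2) (3 * 4) 5 u)) := by
    intro s t u
    apply tensor_ind₃ u; intro u v w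
    change _ = Q.coactMap _ (_ * (_ * (pw (Q.legs₅ 1) (Q.legs₅ 2) (Q.comul u) *
        (pw (Q.legs₅ 3) (Q.legs₅ 4) (Q.comul v) * _))))
    simp only [Algebra.TensorProduct.map_tmul, AlgHom.id_apply]
    generalize Q.comul u = u
    generalize Q.comul v = v
    apply tensor_ind₃ s; intro s₁ s₂ s₃
    apply tensor_ind₃ t; intro t₁ t₂ t₃
    apply tensor_ind₂ u; intro u₁ u₂
    apply tensor_ind₂ v; intro v₁ v₂
    simp [place, ev, Q.antipode_mul, mul_assoc, antipode_antipodeInv]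
  rw [adjointCoact_eq_plain, adjointCoactElement, qR_eq]
  exact key _ _ _

lemma adjointCoact_eq [Module.Finite k H] (a : H) :
    Q.adjointCoact a = Q.coactMap (Q.comulFInv a)
      (Q.can Q.legs₅ (1 * 2 * (3 * 4) * 5) (1 * (2 * (3 * (4 * 5))))) := by
  rw [adjointCoact_eq_ph, Q.apply_ph_mul_ph_mul_ph (Q.coactMap_absorb _)]

/-- `h₁ a₋₁ ⊗ h₂ ▹ a₀ = (h₁ ▹ a)₋₁ h₂ ⊗ (h₁ ▹ a)₀` -/
lemma tensorAct_adjointCoact [Module.Finite k H] (h a : H) :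
    Q.tensorAct (Algebra.lmul k H) Q.adjointAct h (Q.adjointCoact a) =
      pw (Q.adjointCoact ∘ₗ Q.adContr a ∘ₗ Q.comul.toLinearMap) inL (Q.comul h) := by
  have hL := Q.isLegs_legs₅
  have e := congrArg (Q.coactMap (Q.comulFInv a)) (can_mul_ev (Q := Q) hL
    (s := 1 * 2 * (3 * 4) * 5) (t := 1 * (2 * (3 * (4 * 5)))) (by decide) h)
  rw [kill_ev_left (4 * 5) hL (Q.coactMap_absorb _) (by decide),
    show kill (4 * 5) (1 * (2 * (3 * (4 * 5)))) = 1 * (2 * 3) by decide] at e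
  have r1 : ∀ s Y, Q.tensorAct (Algebra.lmul k H) Q.adjointAct h (Q.coactMap Y s) =
      Q.coactMap Y (Q.ev Q.legs₅ (1 * (2 * 3)) h * s) := by
    intro s Y
    change actTensor (Algebra.lmul k H) Q.adjointAct (Q.comul h) _ = _
    rw [ev_node']
    generalize Q.comul h = v
    apply tensor_ind₂ v; intro u v
    change _ = Q.coactMap Y (_ * pw (Q.legs₅ 2) (Q.legs₅ 3) (Q.comul v) * s)
    have : ∀ w : H ⊗[k] H, actTensor (Algebra.lmul k H) Q.adjointAct (u ⊗ₜ v) w =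
        pw ((LinearMap.mul k (H ⊗[k] H)).flip ((u ⊗ₜ 1) * w) ∘ₗ inR) (inR ∘ₗ Q.antipode)
          (Q.comul v) := by
      intro w
      induction w using tensor_ind₂ with
      | add => intro s t hs ht; simp only [mul_add, map_add, hs, ht, pw, LinearMap.add_comp,
          LinearMap.comp_add, map_add_left, LinearMap.add_apply]
      | tmul x y =>
        change (u * x) ⊗ₜ Q.adjointAct v y = _
        rw [adjointAct_apply]
        generalize Q.comul v = v
        apply tensor_ind₂ v; intro v w
        simp
    rw [this]
    generalize Q.comul v = v
    apply tensor_ind₂ v; intro v w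
    induction s using tensor_ind₅ with
    | add => intro s t hs ht; simp_all [mul_add, add_mul]
    | tmul x y z s t => simp [ev, Q.antipode_mul, mul_assoc, tmul_mul_tmul_mul]
  rw [adjointCoact_eq, r1, ← e, ev_node']
  generalize Q.comul h = v
  apply tensor_ind₂ v; intro u v
  change Q.coactMap _ (_ * (pw (Q.ev Q.legs₅ (1 * 2)) (Q.ev Q.legs₅ (3 * 4)) (Q.comul u) * _)) =
    Q.adjointCoact (Q.adContr a (Q.comul u)) * inL v
  generalize Q.comul u = u
  apply tensor_ind₂ u; intro u w
  change Q.coactMap _ (_ * (pw (Q.legs₅ 1) (Q.legs₅ 2) (Q.comul u) *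
    pw (Q.legs₅ 3) (Q.legs₅ 4) (Q.comul w) * _)) = _
  rw [adContr_tmul, adjointCoact_eq, comulFInv_adContr, antipodeCop]
  simp only [comp_apply, AlgHom.toLinearMap_apply, LinearEquiv.coe_coe]
  generalize Q.comulFInv a = Y
  generalize Q.comul u = u
  generalize Q.comul w = w
  generalize Q.can Q.legs₅ _ _ = s
  apply tensor_ind₅ s; intro s₁ s₂ s₃ s₄ s₅
  induction u using tensor_ind₂ with
  | add =>
    intro s t hs ht
    simp only [coactMap, pw, mul_add, add_mul, map_add, LinearMap.add_comp,
      map_add_left, LinearMap.comp_add, LinearMap.add_apply,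
      map_add_right] at *
    rw [hs, ht]
  | tmul u₁ u₂ =>
  induction w using tensor_ind₂ with
  | add =>
    intro s t hs ht
    simp only [coactMap, pw, mul_add, add_mul, map_add, LinearMap.add_comp,
      map_add_left, LinearMap.comp_add, LinearMap.add_apply,
      map_add_right] at *
    rw [hs, ht]
  | tmul w₁ w₂ => simp [ev, Q.antipode_mul, mul_assoc, tmul_mul_tmul_mul]


end QuasiHopfAlgebra

namespace QuasiHopfAlgebra

variable {k H : Type*} [Field k] [Ring H] [Algebra k H] (Q : QuasiHopfAlgebra k H)

section Insert
variable {W : Type*} [AddCommGroup W] [Module k W] (ρ : H →ₐ[k] Module.End k W)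

/-- `w ⊗ a ↦ t₁ w ⊗ s₁ (t₂ ▹ a) S(s₂) α s₃ t₃` -/
def insertAt (s t : H ⊗[k] (H ⊗[k] H)) : W ⊗[k] H →ₗ[k] W ⊗[k] H :=
  (multilin₃ (k := k) (fun x y z => TensorProduct.map (ρ x)
      ((LinearMap.mul k H).flip z ∘ₗ Q.regAt s ∘ₗ Q.adjointAct y))) t

@[simp] lemma insertAt_tmul (s : H ⊗[k] (H ⊗[k] H)) (x y z a : H) (w : W) :
    Q.insertAt ρ s (x ⊗ₜ (y ⊗ₜ z)) (w ⊗ₜ a) =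
      ρ x w ⊗ₜ (Q.regMap (Q.adContr a (Q.comul y)) s * z) := by
  rw [← adjointAct_apply]; rfl

lemma insertAt_add_right (s t t' : H ⊗[k] (H ⊗[k] H)) (w : W ⊗[k] H) :
    Q.insertAt ρ s (t + t') w = Q.insertAt ρ s t w + Q.insertAt ρ s t' w := by
  simp only [insertAt, map_add, LinearMap.add_apply]

/-- The map `w ⊗ a ↦ φ₁ w ⊗ g(φ₂ ▹ a) φ₃`, the action of `A` on the second factor of `W ⊗ H`. -/
def insertReg : W ⊗[k] H →ₗ[k] W ⊗[k] H := Q.insertAt ρ Q.phi.val Q.phi.val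

end Insert

/-- `x ⊗ y ⊗ z ⊗ w ⊗ t ⊗ v ↦ x Y₁ S(w) α t ⊗ y Y₂ S(z) α v` -/
def coactRegMap (Y : H ⊗[k] H) :
    H ⊗[k] (H ⊗[k] (H ⊗[k] (H ⊗[k] (H ⊗[k] H)))) →ₗ[k] H ⊗[k] H :=
  pw inL (pw ((LinearMap.mul k (H ⊗[k] H)).flip Y ∘ₗ inR)
    (pw (inR ∘ₗ Q.antipode) (pw (inL ∘ₗ Q.antipode)
      (pw (inL ∘ₗ LinearMap.mul k H Q.alpha) (inR ∘ₗ LinearMap.mul k H Q.alpha)))))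

@[simp] lemma coactRegMap_tmul (Y : H ⊗[k] H) (x y z w t v : H) :
    Q.coactRegMap Y (x ⊗ₜ (y ⊗ₜ (z ⊗ₜ (w ⊗ₜ (t ⊗ₜ v))))) =
      (x ⊗ₜ y) * (Y * ((Q.antipode w * (Q.alpha * t)) ⊗ₜ (Q.antipode z * (Q.alpha * v)))) := by
  simp [coactRegMap, mul_assoc, tmul_mul_tmul_mul]

/-- The first five factors of the sixfold tensor power. -/
def firstFive : H ⊗[k] (H ⊗[k] (H ⊗[k] (H ⊗[k] H))) →ₐ[k]
    H ⊗[k] (H ⊗[k] (H ⊗[k] (H ⊗[k] (H ⊗[k] H)))) :=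
  idTensor (idTensor
    (idTensor (idTensor
      includeLeft)))

@[simp] lemma firstFive_tmul (x y z w v : H) : firstFive (k := k) (x ⊗ₜ (y ⊗ₜ (z ⊗ₜ (w ⊗ₜ v)))) =
    x ⊗ₜ (y ⊗ₜ (z ⊗ₜ (w ⊗ₜ (v ⊗ₜ 1)))) := rfl

lemma insertReg_coact_eq [Module.Finite k H] (a : H) :
    Q.insertReg (Algebra.lmul k H) (Q.adjointCoact a) = Q.coactRegMap (Q.comulFInv a)
      (Q.ph Q.legs₆ 2 3 6 * (Q.ph Q.legs₆ 1 (2 * 3) 6 * (Q.ph Q.legs₆ 1 2 3 *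
        (Q.ph Q.legs₆ 3 4 5 * Q.ph Q.legs₆ (1 * 2) (3 * 4) 5)))) := by
  have hL := Q.isLegs_legs₆
  have e : Q.ph Q.legs₆ 1 2 3 * (Q.ph Q.legs₆ 3 4 5 * Q.ph Q.legs₆ (1 * 2) (3 * 4) 5) =
      firstFive (Q.ph Q.legs₅ 1 2 3 * (Q.ph Q.legs₅ 3 4 5 * Q.ph Q.legs₅ (1 * 2) (3 * 4) 5)) := by
    have h : ∀ s t : LegTree, SameLegs s t → (∀ i ∈ s.leaves, i ∈ [1, 2, 3, 4, 5]) →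
        firstFive (Q.can Q.legs₅ s t) = Q.can Q.legs₆ (s.bind .leaf) (t.bind .leaf) := by
      intro s t hs hi
      have hb : ∀ t : LegTree, (t.bind .leaf) = t := by
        intro t; induction t <;> simp_all [LegTree.bind]
      refine Q.map_can (L' := Q.legs₆) firstFive .leaf hL hs.1 (by rw [hb]; exact hs.2) fun i hs => ?_
      have := hi i hs
      fin_cases this <;> rfl
    rw [map_mul, map_mul, ← can_assoc' Q.isLegs_legs₅ (by decide),
      ← can_assoc' Q.isLegs_legs₅ (by decide), ← can_assoc' Q.isLegs_legs₅ (by decide),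
      h _ _ (by decide) (by decide), h _ _ (by decide) (by decide), h _ _ (by decide) (by decide)]
    exact (congrArg₂ _ (can_assoc' hL (by decide)) (congrArg₂ _ (can_assoc' hL (by decide))
      (can_assoc' hL (by decide)))).symm
  rw [e, adjointCoact_eq_ph, insertReg]
  generalize (Q.ph Q.legs₅ 1 2 3 * (Q.ph Q.legs₅ 3 4 5 * Q.ph Q.legs₅ (1 * 2) (3 * 4) 5)) = X
  generalize Q.comulFInv a = Y
  have key : ∀ s t, Q.insertAt (Algebra.lmul k H) s t (Q.coactMap Y X) = Q.coactRegMap Y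
      (Q.place Q.legs₆ 2 3 6 s * (Q.place Q.legs₆ 1 (2 * 3) 6 t * firstFive X)) := by
    intro s t
    have h0 : ∀ (x y z : H) (w : H ⊗[k] H), Q.insertAt (Algebra.lmul k H) s (x ⊗ₜ (y ⊗ₜ z)) w =
        pw ((LinearMap.mul k (H ⊗[k] H)).flip ((x ⊗ₜ 1) * pw
          ((LinearMap.mul k (H ⊗[k] H)).flip w ∘ₗ inR) (inR ∘ₗ Q.antipode) (Q.comul y)) ∘ₗ inR)
          (inR ∘ₗ Q.contrAlpha) s * (1 ⊗ₜ z) := by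
      intro x y z w
      induction w using tensor_ind₂ with
      | add =>
        intro s t hs ht
        simp only [map_add, hs, ht, pw, LinearMap.add_comp, LinearMap.comp_add, mul_add,
          map_add_left, LinearMap.add_apply, add_mul]
      | tmul b c =>
        rw [insertAt_tmul]
        generalize Q.comul y = y
        apply tensor_ind₃ s; intro s₁ s₂ s₃
        induction y using tensor_ind₂ with
        | add =>
          intro s t hs ht
          simp only [regMap_tmul, pw_tmul, map_add, mul_add, add_mul, tmul_add,
            LinearMap.add_apply, comp_apply, LinearMap.flip_apply, LinearMap.mul_apply']
            at *
          rw [hs, ht]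
        | tmul y₁ y₂ => simp [mul_assoc]
    induction t using tensor_ind₃ with
    | add => intro s t hs ht; simp only [insertAt_add_right, map_add, mul_add, add_mul, hs, ht]
    | tmul x y z =>
      rw [h0]
      clear h0
      change _ = Q.coactRegMap Y (_ * (_ * (pw (Q.legs₆ 2) (Q.legs₆ 3) (Q.comul y) * _) * _))
      generalize Q.comul y = y
      apply tensor_ind₃ s; intro s₁ s₂ s₃
      induction y using tensor_ind₂ with
      | add =>
        intro s t hs ht
        simp only [pw_tmul, map_add, mul_add, add_mul, 
          LinearMap.add_apply, comp_apply, LinearMap.flip_apply, LinearMap.mul_apply']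
          at *
        rw [hs, ht]
      | tmul y₁ y₂ =>
        induction X using tensor_ind₅ with
        | add =>
          intro s t hs ht
          simp only [pw_tmul, map_add, mul_add, add_mul, 
            LinearMap.add_apply, comp_apply, LinearMap.flip_apply, LinearMap.mul_apply']
            at *
          rw [hs, ht]
        | tmul X₁ X₂ X₃ X₄ X₅ =>
          simp [place, ev, Q.antipode_mul, mul_assoc, tmul_mul_tmul_mul]
  exact key _ _

lemma coactRegMap_absorb₄₅ (Y : H ⊗[k] H) (x : H) (X) :
    Q.coactRegMap Y (Q.ev Q.legs₆ (4 * 5) x * X) = Q.counit x • Q.coactRegMap Y X := by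
  apply tensor_ind₆ X; intro p q r s t v
  exact Q.absorb_left Q.contrAlpha_comul
    (sandwich inL ((p ⊗ₜ q) * (Y * (Q.antipode s ⊗ₜ Q.antipode r))) (t ⊗ₜ (Q.alpha * v)))
    (by simp [Q.antipode_mul, mul_assoc]) (by simp [mul_assoc]) x

lemma coactRegMap_absorb₃₆ (Y : H ⊗[k] H) (x : H) (X) :
    Q.coactRegMap Y (Q.ev Q.legs₆ (3 * 6) x * X) = Q.counit x • Q.coactRegMap Y X := by
  apply tensor_ind₆ X; intro p q r s t v
  exact Q.absorb_left Q.contrAlpha_comul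
    (sandwich inR ((p ⊗ₜ q) * (Y * (Q.antipode s ⊗ₜ Q.antipode r))) ((Q.alpha * t) ⊗ₜ v))
    (by simp [Q.antipode_mul, mul_assoc]) (by simp [mul_assoc]) x

lemma comul_adReg_eq [Module.Finite k H] (a : H) :
    pw (Q.comul.toLinearMap ∘ₗ Q.adReg a) LinearMap.id Q.phi.val =
      Q.coactRegMap (Q.comulFInv a) (Q.can Q.legs₆ (3 * 4 * (5 * 6)) (3 * (4 * 5 * 6)) *
        (Q.ph Q.legs₆ (1 * 2) (3 * 4) (5 * 6) * Q.ph Q.legs₆ (1 * 2 * (3 * 4)) 5 6)) := by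
  have hL := Q.isLegs_legs₆
  have e : Q.can Q.legs₆ (3 * 4 * (5 * 6)) (3 * (4 * 5 * 6)) =
      lastFour (Q.can Q.legs₄ (1 * 2 * (3 * 4)) (1 * (2 * 3 * 4))) := by
    refine ((Q.map_can (L := Q.legs₄) (L' := Q.legs₆) (s := 1 * 2 * (3 * 4))
        (t := 1 * (2 * 3 * 4)) lastFour (fun i => .leaf (i + 2)) hL (by decide) (by decide) ?_)).symm
    intro i hi
    fin_cases hi <;> rfl
  -- `Δ` of `x a S(y) α z` in terms of the element `𝐚 = f Δ(α)`
  have h1 : ∀ b x y z : H, Q.comul (x * b * (Q.antipode y * Q.alpha * z)) =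
      Q.comul x * (Q.comulFInv b * (Q.antipodeCop y * (Q.drinfeldA * Q.comul z))) := by
    intro b x y z
    rw [comulFInv_apply, ← drinfeldF_comul_alpha]
    have := congrArg (· * (Q.drinfeldF * (Q.comul Q.alpha * Q.comul z)))
      (Q.comul_antipode_drinfeldFInv y)
    simp only [mul_assoc] at this
    rw [← mul_assoc Q.drinfeldFInv Q.drinfeldF, drinfeldFInv_mul_drinfeldF, one_mul] at this
    simp only [map_mul, mul_assoc, this]
  rw [e, adReg, toReg]
  have key : ∀ s t, pw (Q.comul.toLinearMap ∘ₗ Q.regAt s ∘ₗ Q.adContr a ∘ₗ Q.comul.toLinearMap)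
      LinearMap.id t = Q.coactRegMap (Q.comulFInv a) (lastFour (Q.can Q.legs₄ (1 * 2 * (3 * 4))
        (1 * (2 * 3 * 4))) * (Q.place Q.legs₆ (1 * 2) (3 * 4) (5 * 6) s *
          Q.place Q.legs₆ (1 * 2 * (3 * 4)) 5 6 t)) := by
    intro s t
    apply tensor_ind₃ t; intro x y z
    change Q.comul (Q.regMap (Q.adContr a (Q.comul x)) s) * (y ⊗ₜ z) =
      Q.coactRegMap (Q.comulFInv a) (_ * (_ * (pw (Q.ev Q.legs₆ (1 * 2)) (Q.ev Q.legs₆ (3 * 4))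
        (Q.comul x) * _)))
    generalize Q.comul x = x
    apply tensor_ind₃ s; intro s₁ s₂ s₃
    induction x using tensor_ind₂ with
    | add =>
      intro s t hs ht
      simp only [regMap_tmul, map_add, hs, ht, add_mul, mul_add] at *
    | tmul x₁ x₂ =>
      rw [adContr_tmul, regMap_tmul, h1, comulFInv_adContr, drinfeldA_eq, antipodeCop]
      change _ = Q.coactRegMap (Q.comulFInv a) (_ * (pw (Q.legs₆ 1) (Q.legs₆ 2) (Q.comul s₁) *
        (pw (Q.legs₆ 3) (Q.legs₆ 4) (Q.comul s₂) * pw (Q.legs₆ 5) (Q.legs₆ 6) (Q.comul s₃)) *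
        (pw (Q.legs₆ 1) (Q.legs₆ 2) (Q.comul x₁) * pw (Q.legs₆ 3) (Q.legs₆ 4) (Q.comul x₂) * _)))
      simp only [comp_apply, AlgHom.toLinearMap_apply, LinearEquiv.coe_coe]
      generalize Q.comulFInv a = Y
      generalize Q.comul s₁ = s₁
      generalize Q.comul s₂ = s₂
      generalize Q.comul s₃ = s₃
      generalize Q.comul x₁ = x₁
      generalize Q.comul x₂ = x₂
      generalize Q.can Q.legs₄ _ _ = r
      apply tensor_ind₂ s₁; intro s₁₁ s₁₂
      apply tensor_ind₂ s₂; intro s₂₁ s₂₂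
      apply tensor_ind₂ s₃; intro s₃₁ s₃₂
      apply tensor_ind₂ x₁; intro x₁₁ x₁₂
      apply tensor_ind₂ x₂; intro x₂₁ x₂₂
      apply tensor_ind₄ r; intro r₁ r₂ r₃ r₄
      simp [ev, Q.antipode_mul, mul_assoc, tmul_mul_tmul_mul]
  exact key _ _

/-- `Δ(g(φ₁ ▹ a)) (φ₂ ⊗ φ₃) = φ₁ a₋₁ ⊗ g(φ₂ ▹ a₀) φ₃`: the half-braiding of `A` is compatible with
its action on regular modules. -/
lemma insertReg_coact [Module.Finite k H] (a : H) :
    Q.insertReg (Algebra.lmul k H) (Q.adjointCoact a) =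
      pw (Q.comul.toLinearMap ∘ₗ Q.adReg a) LinearMap.id Q.phi.val := by
  have hL := Q.isLegs_legs₆
  rw [insertReg_coact_eq, comul_adReg_eq]
  have k45 := Q.coactRegMap_absorb₄₅ (Q.comulFInv a)
  have k36 := Q.coactRegMap_absorb₃₆ (Q.comulFInv a)
  generalize Q.coactRegMap (Q.comulFInv a) = E at *
  trans E (Q.can Q.legs₆ (1 * 2 * (3 * 4) * 5 * 6) (1 * (2 * (3 * (4 * 5 * 6)))))
  · rw [← can_trans hL (1 * 2 * (3 * (4 * 5)) * 6) (by decide) (by decide),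
      kill_can_left_to (4 * 5) (1 * 2 * 3 * 6) (1 * (2 * (3 * 6))) hL k45 (by decide),
      ← can_trans hL (u := 1 * (2 * (3 * 6))) (1 * (2 * 3) * 6) (by decide) (by decide),
      can_left' hL (by decide), can_assoc' hL (by decide), 
      ← can_trans hL (u := 1 * (2 * (3 * 6))) (1 * (2 * 3 * 6)) (by decide) (by decide),
      can_assoc' hL (by decide), can_right' hL (by decide), can_assoc' hL (by decide),
      ← can_trans hL (u := 1 * 2 * (3 * (4 * 5)) * 6) (1 * 2 * (3 * 4 * 5) * 6)
        (by decide) (by decide), can_left' hL (by decide), can_left' hL (by decide),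
      can_right' hL (by decide), can_assoc' hL (by decide), can_assoc' hL (by decide)]
    simp only [mul_assoc]
  · rw [← can_trans hL (1 * 2 * (3 * (4 * 5 * 6))) (by decide) (by decide),
      kill_can_left_to (4 * 5) (1 * 2 * (3 * 6)) (1 * (2 * (3 * 6))) hL k45 (by decide),
      kill_can_left_one (3 * 6) hL k36 (by decide),
      ← can_trans hL (1 * 2 * (3 * 4 * (5 * 6))) (by decide) (by decide),
      can_right' hL (by decide),
      ← can_trans hL (u := 1 * 2 * (3 * 4 * (5 * 6))) (1 * 2 * (3 * 4) * (5 * 6))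
        (by decide) (by decide), can_assoc' hL (by decide), can_assoc' hL (by decide)]

end QuasiHopfAlgebra

/-! ### The adjoint algebra is determined by its action on regular modules -/

namespace QuasiHopfAlgebra

variable {k H : Type*} [Field k] [Ring H] [Algebra k H] (Q : QuasiHopfAlgebra k H)

section Reconstruct
variable {W : Type*} [AddCommGroup W] [Module k W] (ρ : H →ₐ[k] Module.End k W)

/-- For `V : H → W ⊗ H`, the map
`(p ⊗ q ⊗ r) ⊗ (x ⊗ y ⊗ z) ↦ x V(p)₁ ⊗ y V(p)₂ q β S(z r)`. -/
def reconstruct (V : H →ₗ[k] W ⊗[k] H) :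
    H ⊗[k] (H ⊗[k] H) →ₗ[k] H ⊗[k] (H ⊗[k] H) →ₗ[k] W ⊗[k] H :=
  multilin₃ (k := k) (fun p q r => multilin₃ (k := k) (fun x y z =>
    TensorProduct.map (ρ x) (mulLeft k y ∘ₗ
      mulRight k (q * (Q.beta * Q.antipode (z * r)))) (V p)))

@[simp] lemma reconstruct_tmul (V : H →ₗ[k] W ⊗[k] H) (p q r x y z : H) :
    Q.reconstruct ρ V (p ⊗ₜ (q ⊗ₜ r)) (x ⊗ₜ (y ⊗ₜ z)) = TensorProduct.map (ρ x)
      (mulLeft k y ∘ₗ mulRight k (q * (Q.beta * Q.antipode (z * r)))) (V p) :=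
  rfl

/-- `x ⊗ y ⊗ z ⊗ w ⊗ t ↦ x v ⊗ y a S(z) α w β S(t)` -/
def reconstructMap (v : W) (a : H) : H ⊗[k] (H ⊗[k] (H ⊗[k] (H ⊗[k] H))) →ₗ[k] W ⊗[k] H :=
  TensorProduct.map (LinearMap.applyₗ v ∘ₗ ρ.toLinearMap)
    (pw ((LinearMap.mul k H).flip a) (pw Q.antipode (LinearMap.mul k H Q.alpha ∘ₗ Q.contrBeta)))

@[simp] lemma reconstructMap_tmul (v : W) (a x y z w t : H) :
    Q.reconstructMap ρ v a (x ⊗ₜ (y ⊗ₜ (z ⊗ₜ (w ⊗ₜ t)))) =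
      ρ x v ⊗ₜ (y * a * (Q.antipode z * (Q.alpha * (w * Q.beta * Q.antipode t)))) := rfl

lemma reconstructMap_eq (v : W) (a : H) :
    Q.reconstructMap ρ v a (Q.can Q.legs₅ (1 * (2 * 3) * (4 * 5)) (1 * (2 * (3 * 4) * 5))) =
      v ⊗ₜ a := by
  have hL := Q.isLegs_legs₅
  set E := Q.reconstructMap ρ v a with hE
  have k34 : ∀ x X, E (Q.ev Q.legs₅ (3 * 4) x * X) = Q.counit x • E X := by
    intro x X
    apply tensor_ind₅ X; intro p q r s t
    exact Q.absorb_left Q.contrAlpha_comul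
      (TensorProduct.mk k W H (ρ p v) ∘ₗ
        sandwich LinearMap.id (q * a * Q.antipode r) (s * Q.beta * Q.antipode t))
      (by simp [E, Q.antipode_mul, mul_assoc]) (by simp [E, mul_assoc]) x
  have k45 : ∀ x X, E (X * Q.ev Q.legs₅ (4 * 5) x) = Q.counit x • E X := by
    intro x X
    apply tensor_ind₅ X; intro p q r s t
    exact Q.absorb_right Q.contrBeta_comul
      (TensorProduct.mk k W H (ρ p v) ∘ₗ
        sandwich LinearMap.id (q * a * Q.antipode r * Q.alpha * s) (Q.antipode t))
      (by simp [E, Q.antipode_mul, mul_assoc]) (by simp [E, mul_assoc]) x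
  rw [← can_trans hL (1 * (2 * 3 * (4 * 5))) (by decide) (by decide),
    kill_can_right_one (4 * 5) hL k45 (by decide),
    ← can_trans hL (1 * (2 * (3 * 4 * 5))) (by decide) (by decide),
    kill_can_left_one (3 * 4) hL k34 (by decide),
    ← can_trans hL (1 * (2 * (3 * (4 * 5)))) (by decide) (by decide),
    kill_can_right_one (4 * 5) hL k45 (by decide), can_right' hL (by decide),
    can_right' hL (by decide), can_assocInv' hL (by decide), phi']
  have : ∀ s, E (Q.place Q.legs₅ 3 4 5 s) = v ⊗ₜ (a * Q.zagMap s) := by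
    intro s
    apply tensor_ind₃ s; intro p q r
    simp [E, place, ev, mul_assoc]
  rw [this, zagMap_phiInv, mul_one]

lemma reconstruct_insertReg (w : W ⊗[k] H) :
    Q.reconstruct ρ (Q.insertReg ρ ∘ₗ (Q.tensorAct ρ Q.adjointAct).toLinearMap.flip w)
      Q.phiInv Q.phi.val = w := by
  induction w using tensor_ind₂ with
  | add =>
    intro w w' hw hw'
    have : ∀ s t V V', Q.reconstruct ρ (V + V') s t =
        Q.reconstruct ρ V s t + Q.reconstruct ρ V' s t := by
      intro s t V V'
      induction s using tensor_ind₃ with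
      | add => intro s s' hs hs'; simp only [map_add, LinearMap.add_apply, hs, hs']; abel
      | tmul p q r =>
        induction t using tensor_ind₃ with
        | add => intro s s' hs hs'; simp only [map_add, hs, hs']; abel
        | tmul x y z => simp
    rw [map_add, LinearMap.comp_add, this, hw, hw']
  | tmul v a =>
    refine Eq.trans ?_ (Q.reconstructMap_eq ρ v a)
    have hL := Q.isLegs_legs₅
    have e : Q.reconstructMap ρ v a
        (Q.can Q.legs₅ (1 * (2 * 3) * (4 * 5)) (1 * (2 * (3 * 4) * 5))) =
        Q.reconstructMap ρ v a (Q.ph Q.legs₅ 1 2 5 * (Q.ph Q.legs₅ 2 3 4 *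
          (Q.ph Q.legs₅ 1 (2 * 3) 4 * Q.phi' Q.legs₅ (1 * (2 * 3)) 4 5))) := by
      have k34 : ∀ x X, Q.reconstructMap ρ v a (Q.ev Q.legs₅ (3 * 4) x * X) =
          Q.counit x • Q.reconstructMap ρ v a X := by
        intro x X
        apply tensor_ind₅ X; intro p q r s t
        exact Q.absorb_left Q.contrAlpha_comul
          (TensorProduct.mk k W H (ρ p v) ∘ₗ
            sandwich LinearMap.id (q * a * Q.antipode r) (s * Q.beta * Q.antipode t))
          (by simp [Q.antipode_mul, mul_assoc]) (by simp [mul_assoc]) x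
      rw [← can_trans hL (1 * (2 * (3 * 4)) * 5) (by decide) (by decide),
        kill_can_left_to (3 * 4) (1 * 2 * 5) (1 * (2 * 5)) hL k34 (by decide),
        can_assoc' hL (by decide),
        ← can_trans hL (1 * (2 * 3 * 4) * 5) (by decide) (by decide), can_left' hL (by decide),
        can_right' hL (by decide), can_assoc' hL (by decide),
        ← can_trans hL (1 * (2 * 3) * 4 * 5) (by decide) (by decide), can_left' hL (by decide),
        can_assoc' hL (by decide), can_assocInv' hL (by decide)]
    rw [e, ph, ph, ph, phi']
    have key : ∀ u s t r, Q.reconstruct ρ (Q.insertAt ρ s t ∘ₗ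
        (Q.tensorAct ρ Q.adjointAct).toLinearMap.flip (v ⊗ₜ a)) r u =
        Q.reconstructMap ρ v a (Q.place Q.legs₅ 1 2 5 u * (Q.place Q.legs₅ 2 3 4 s *
          (Q.place Q.legs₅ 1 (2 * 3) 4 t * Q.place Q.legs₅ (1 * (2 * 3)) 4 5 r))) := by
      intro u s t r
      apply tensor_ind₃ r; intro r₁ r₂ r₃
      apply tensor_ind₃ u; intro x y z
      rw [reconstruct_tmul, comp_apply, LinearMap.flip_apply, AlgHom.toLinearMap_apply]
      change TensorProduct.map _ _ (Q.insertAt ρ s t (actTensor ρ Q.adjointAct (Q.comul r₁) _)) =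
        Q.reconstructMap ρ v a (_ * (_ * (_ * (pw (Q.legs₅ 1)
          (pw (Q.legs₅ 2) (Q.legs₅ 3) ∘ₗ Q.comul.toLinearMap) (Q.comul r₁) * _))))
      generalize Q.comul r₁ = r₁
      apply tensor_ind₂ r₁; intro r₁ r₄
      change TensorProduct.map _ _ (Q.insertAt ρ s t (ρ r₁ v ⊗ₜ Q.adjointAct r₄ a)) =
        Q.reconstructMap ρ v a (_ * (_ * (_ * (_ * pw (Q.legs₅ 2) (Q.legs₅ 3) (Q.comul r₄) * _))))
      rw [adjointAct_apply]
      generalize Q.comul r₄ = r₄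
      apply tensor_ind₂ r₄; intro r₄ r₅
      induction t using tensor_ind₃ with
      | add => intro r r' h h'; simp only [insertAt_add_right, map_add, mul_add, add_mul, h, h']
      | tmul t₁ t₂ t₃ =>
      rw [insertAt_tmul]
      change TensorProduct.map _ _ _ =
        Q.reconstructMap ρ v a (_ * (_ * (_ * (pw (Q.legs₅ 2) (Q.legs₅ 3) (Q.comul t₂) * _) * _)))
      generalize Q.comul t₂ = t₂
      apply tensor_ind₃ s; intro s₁ s₂ s₃
      induction t₂ using tensor_ind₂ with
      | add =>
        intro s t hs ht
        simp only [regMap_tmul, map_add, add_mul, mul_add, tmul_add] at *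
        rw [hs, ht]
      | tmul y₁ y₂ =>
        simp [place, ev, Q.antipode_mul, mul_assoc]
    exact key _ _ _ _

/-- An element of `W ⊗ A` is determined by the actions of its translates on `W ⊗ H`. -/
lemma eq_of_insertReg_eq {w w' : W ⊗[k] H}
    (h : ∀ x, Q.insertReg ρ (Q.tensorAct ρ Q.adjointAct x w) =
      Q.insertReg ρ (Q.tensorAct ρ Q.adjointAct x w')) : w = w' := by
  rw [← Q.reconstruct_insertReg ρ w, ← Q.reconstruct_insertReg ρ w']
  congr 3
  exact LinearMap.ext h

end Reconstruct

end QuasiHopfAlgebra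

namespace QuasiHopfAlgebra

variable {k H : Type*} [Field k] [Ring H] [Algebra k H] (Q : QuasiHopfAlgebra k H)

section
variable {P : Type*} [AddCommGroup P] [Module k P]

lemma apply_phi_left (G : H ⊗[k] (H ⊗[k] H) →ₗ[k] P) (F : H ⊗[k] H →ₗ[k] P)
    (h : ∀ x y z, G (x ⊗ₜ (y ⊗ₜ z)) = Q.counit x • F (y ⊗ₜ z)) : G Q.phi.val = F 1 := by
  have key : ∀ s, G s = F (Q.place Q.legs₂ .one 1 2 s) := by
    intro s
    apply tensor_ind₃ s; intro x y z
    rw [h]; simp [place, ev, unitLeg_apply, Algebra.algebraMap_eq_smul_one]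
  rw [key]
  exact congrArg F (Q.ph_one_left Q.isLegs_legs₂ (by decide))

lemma apply_phi_mid (G : H ⊗[k] (H ⊗[k] H) →ₗ[k] P) (F : H ⊗[k] H →ₗ[k] P)
    (h : ∀ x y z, G (x ⊗ₜ (y ⊗ₜ z)) = Q.counit y • F (x ⊗ₜ z)) : G Q.phi.val = F 1 := by
  have key : ∀ s, G s = F (Q.place Q.legs₂ 1 .one 2 s) := by
    intro s
    apply tensor_ind₃ s; intro x y z
    rw [h]; simp [place, ev, unitLeg_apply, Algebra.algebraMap_eq_smul_one]
  rw [key]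
  exact congrArg F (Q.ph_mid_one Q.isLegs_legs₂)

variable {X Y : Type*} [AddCommGroup X] [Module k X] [AddCommGroup Y] [Module k Y]
  (ρ : H →ₐ[k] Module.End k X) (σ : H →ₐ[k] Module.End k Y)

lemma actTensor_tmul {A : Type*} [Ring A] [Algebra k A] (σ : A →ₐ[k] Module.End k Y) (x : H) (y : A)
    (v : X) (w : Y) : actTensor ρ σ (x ⊗ₜ y) (v ⊗ₜ w) = ρ x v ⊗ₜ σ y w := rfl

lemma tensorAct_invariant_left {v : X} (hv : ∀ h, ρ h v = Q.counit h • v) (h : H) (w : Y) :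
    Q.tensorAct ρ σ h (v ⊗ₜ w) = v ⊗ₜ σ h w := by
  conv_rhs => rw [← Q.counit_left h]
  change actTensor ρ σ (Q.comul h) _ = _
  generalize Q.comul h = s
  apply tensor_ind₂ s; intro x y
  simp [actTensor_tmul, hv, smul_tmul']

lemma tensorAct_invariant_right {w : Y} (hw : ∀ h, σ h w = Q.counit h • w) (h : H) (v : X) :
    Q.tensorAct ρ σ h (v ⊗ₜ w) = ρ h v ⊗ₜ w := by
  conv_rhs => rw [← Q.counit_right h]
  change actTensor ρ σ (Q.comul h) _ = _
  generalize Q.comul h = s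
  apply tensor_ind₂ s; intro x y
  simp [actTensor_tmul, hw, smul_tmul']

end

lemma adReg_one (a : H) : Q.adReg a 1 = Q.toReg a := by rw [adReg_apply, map_one]; rfl

lemma adjointAct_beta (h : H) : Q.adjointAct h Q.beta = Q.counit h • Q.beta := by
  rw [adjointAct_apply, ← contrBeta_comul]
  generalize Q.comul h = s
  apply tensor_ind₂ s; intro x y
  rfl

lemma adReg_beta (h : H) : Q.adReg Q.beta h = Q.counit h • 1 := by
  rw [adReg_apply, adjointAct_beta, map_smul, toReg_beta]

/-- `Σ φ₁ w ⊗ g(φ₂ ▹ a) φ₃` as a value of a pairing on `φ`. -/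
lemma insertReg_tmul {W : Type*} [AddCommGroup W] [Module k W] (ρ : H →ₐ[k] Module.End k W)
    (w : W) (a : H) : Q.insertReg ρ (w ⊗ₜ a) =
      TensorProduct.map (LinearMap.applyₗ w ∘ₗ ρ.toLinearMap) (pw (Q.adReg a) LinearMap.id)
        Q.phi.val := by
  rw [insertReg]
  have : ∀ s t, Q.insertAt ρ s t (w ⊗ₜ a) =
      TensorProduct.map (LinearMap.applyₗ w ∘ₗ ρ.toLinearMap)
        (pw (Q.regAt s ∘ₗ Q.adContr a ∘ₗ Q.comul.toLinearMap) LinearMap.id) t := by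
    intro s t
    induction t using tensor_ind₃ with
    | add => intro s t hs ht; simp only [insertAt_add_right, map_add, hs, ht]
    | tmul x y z => rw [insertAt_tmul]; rfl
  exact this _ _

lemma eq_of_toReg_eq {a b : H}
    (h : ∀ x, Q.toReg (Q.adjointAct x a) = Q.toReg (Q.adjointAct x b)) : a = b := by
  have hu : ∀ x, Q.unitAct x (1 : k) = Q.counit x • (1 : k) := fun x => rfl
  have key : ∀ a : H, Q.insertReg Q.unitAct ((1 : k) ⊗ₜ a) = 1 ⊗ₜ Q.toReg a := by
    intro a
    rw [insertReg_tmul]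
    refine (Q.apply_phi_left _ (TensorProduct.mk k k H 1 ∘ₗ pw (Q.adReg a) LinearMap.id) ?_).trans ?_
    · intro x y z
      simp [unitAct, smul_tmul']
    · simp [Algebra.TensorProduct.one_def, adReg_one]
  have := Q.eq_of_insertReg_eq Q.unitAct (w := (1 : k) ⊗ₜ a) (w' := 1 ⊗ₜ b) fun x => by
    rw [tensorAct_invariant_left _ _ _ hu, tensorAct_invariant_left _ _ _ hu, key, key, h]
  simpa using congrArg (TensorProduct.lid k H) this

lemma adjointMul_beta_left (a : H) : Q.adjointMul (Q.beta ⊗ₜ a) = a := by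
  have key : ∀ a, Q.toReg (Q.adjointMul (Q.beta ⊗ₜ a)) = Q.toReg a := by
    intro a
    rw [toReg_mul]
    refine (Q.apply_phi_left _ (pw (Q.adReg a) LinearMap.id) fun x y z => ?_).trans ?_
    · simp [adReg_beta]
    · simp [Algebra.TensorProduct.one_def, adReg_one]
  refine Q.eq_of_toReg_eq fun x => ?_
  rw [adjointAct_mul, tensorAct_invariant_left _ _ _ Q.adjointAct_beta, key]

lemma adjointMul_beta_right (a : H) : Q.adjointMul (a ⊗ₜ Q.beta) = a := by
  have key : ∀ a, Q.toReg (Q.adjointMul (a ⊗ₜ Q.beta)) = Q.toReg a := by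
    intro a
    rw [toReg_mul]
    refine (Q.apply_phi_mid _ (pw (Q.adReg a) LinearMap.id) fun x y z => ?_).trans ?_
    · simp [adReg_beta]
    · simp [Algebra.TensorProduct.one_def, adReg_one]
  refine Q.eq_of_toReg_eq fun x => ?_
  rw [adjointAct_mul, tensorAct_invariant_right _ _ _ Q.adjointAct_beta, key]

section Coaction
variable [Module.Finite k H]

lemma adjointCoact_beta : Q.adjointCoact Q.beta = 1 ⊗ₜ Q.beta := by
  have hr : ∀ (h : H) (w : H ⊗[k] H), Q.insertReg (Algebra.lmul k H) (w * (h ⊗ₜ 1)) =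
      Q.insertReg (Algebra.lmul k H) w * (h ⊗ₜ 1) := by
    intro h w
    apply tensor_ind₂ w; intro x y
    rw [tmul_mul_tmul, mul_one, insertReg_tmul, insertReg_tmul]
    generalize Q.phi.val = s
    apply tensor_ind₃ s; intro p q r
    simp [mul_assoc]
  refine Q.eq_of_insertReg_eq (Algebra.lmul k H) fun x => ?_
  rw [tensorAct_adjointCoact, tensorAct_invariant_right _ _ _ Q.adjointAct_beta]
  have h1 : ∀ s, pw (Q.adjointCoact ∘ₗ Q.adContr Q.beta ∘ₗ Q.comul.toLinearMap) inL s =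
      Q.adjointCoact Q.beta * (TensorProduct.lid k H
        (Algebra.TensorProduct.map Q.counit (AlgHom.id k H) s) ⊗ₜ 1) := by
    intro s
    apply tensor_ind₂ s; intro p q
    have := Q.adjointAct_beta p
    rw [adjointAct_apply] at this
    simp [this, ← smul_tmul']
  rw [h1, counit_left, hr, insertReg_coact,
    show ((Algebra.lmul k H) x 1 : H) ⊗ₜ[k] Q.beta = (1 ⊗ₜ Q.beta) * (x ⊗ₜ 1) by simp, hr]
  congr 1
  rw [insertReg_tmul]
  trans (1 : H ⊗[k] H)
  · refine (Q.apply_phi_left _ LinearMap.id fun x y z => ?_)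
    simp [adReg_beta]
  · refine (Q.apply_phi_mid _ LinearMap.id fun x y z => ?_).symm
    simp [adReg_beta]

lemma counitId_adjointCoact (a : H) : Q.counitId (Q.adjointCoact a) = a := by
  have h1 : ∀ a, Q.toReg (Q.counitId (Q.adjointCoact a)) = Q.toReg a := by
    intro a
    have e := congrArg Q.counitId (Q.insertReg_coact a)
    have e1 : ∀ w, Q.counitId (Q.insertReg (Algebra.lmul k H) w) = Q.toReg (Q.counitId w) := by
      intro w
      apply tensor_ind₂ w; intro x y
      rw [insertReg_tmul]
      refine (Q.apply_phi_left (Q.counitId.toLinearMap ∘ₗ _)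
        (Q.counit x • pw (Q.adReg y) LinearMap.id) fun p q r => ?_).trans ?_
      · simp [mul_smul]
      · simp [Algebra.TensorProduct.one_def, adReg_one]
    rw [e1] at e
    rw [e]
    refine (Q.apply_phi_mid (Q.counitId.toLinearMap ∘ₗ _)
      (pw (Q.adReg a) LinearMap.id) fun p q r => ?_).trans ?_
    · simp
    · simp [Algebra.TensorProduct.one_def, adReg_one]
  refine Q.eq_of_toReg_eq fun x => ?_
  rw [← h1 (Q.adjointAct x a)]
  congr 1
  have e := congrArg Q.counitId (Q.tensorAct_adjointCoact x a)
  have e1 : ∀ w, Q.counitId (Q.tensorAct (Algebra.lmul k H) Q.adjointAct x w) =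
      Q.adjointAct x (Q.counitId w) := by
    intro w
    apply tensor_ind₂ w; intro y z
    conv_rhs => rw [← Q.counit_left x]
    change Q.counitId (actTensor _ _ (Q.comul x) _) = _
    generalize Q.comul x = s
    apply tensor_ind₂ s; intro p q
    simp [actTensor_tmul, mul_smul, smul_comm (Q.counit p)]
  rw [e1] at e
  rw [e, adjointAct_apply]
  conv_rhs => rw [← Q.adjointAct_apply, ← Q.counit_right x]
  generalize Q.comul x = s
  apply tensor_ind₂ s; intro p q
  simp [adjointAct_apply]

/-- `h₁ (a₋₁ x) ⊗ h₂ ▹ a₀ = (h₁ ▹ a)₋₁ (h₂ x) ⊗ (h₁ ▹ a)₀` -/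
lemma tensorAct_braid {X : Type*} [AddCommGroup X] [Module k X] (ρ : H →ₐ[k] Module.End k X)
    (h : H) (t : H ⊗[k] X) :
    Q.tensorAct ρ Q.adjointAct h (Q.adjoint.braid ρ t) =
      Q.adjoint.braid ρ (Q.tensorAct Q.adjointAct ρ h t) := by
  apply tensor_ind₂ t; intro a x
  change Q.tensorAct ρ Q.adjointAct h (TensorProduct.map (LinearMap.applyₗ x ∘ₗ ρ.toLinearMap)
    LinearMap.id (Q.adjointCoact a)) = _
  have h1 : ∀ w, Q.tensorAct ρ Q.adjointAct h (TensorProduct.map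
      (LinearMap.applyₗ x ∘ₗ ρ.toLinearMap) LinearMap.id w) =
      TensorProduct.map (LinearMap.applyₗ x ∘ₗ ρ.toLinearMap) LinearMap.id
        (Q.tensorAct (Algebra.lmul k H) Q.adjointAct h w) := by
    intro w
    apply tensor_ind₂ w; intro y z
    change actTensor _ _ (Q.comul h) _ = TensorProduct.map _ _ (actTensor _ _ (Q.comul h) _)
    generalize Q.comul h = s
    apply tensor_ind₂ s; intro p q
    simp [actTensor_tmul]
  rw [h1, tensorAct_adjointCoact]
  change _ = Q.adjoint.braid ρ (actTensor _ _ (Q.comul h) _)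
  generalize Q.comul h = s
  apply tensor_ind₂ s; intro p q
  rw [actTensor_tmul, pw_tmul, adjointAct_apply]
  change _ = TensorProduct.map (LinearMap.applyₗ (ρ q x) ∘ₗ ρ.toLinearMap)
    LinearMap.id (Q.adjointCoact (Q.adContr a (Q.comul p)))
  simp only [comp_apply, AlgHom.toLinearMap_apply]
  generalize Q.adjointCoact _ = w
  apply tensor_ind₂ w; intro y z
  simp

/-- The product of `A` is commutative with respect to the braiding. -/
lemma adjointMul_braid (t : H ⊗[k] H) :
    Q.adjointMul (Q.adjoint.braid Q.adjointAct t) = Q.adjointMul t := by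
  have key : ∀ t, Q.toReg (Q.adjointMul (Q.adjoint.braid Q.adjointAct t)) =
      Q.toReg (Q.adjointMul t) := by
    intro t
    apply tensor_ind₂ t; intro a b
    have h1 : ∀ w, Q.toReg (Q.adjointMul (TensorProduct.map
        (LinearMap.applyₗ b ∘ₗ Q.adjointAct.toLinearMap) LinearMap.id w)) =
        pw (Q.adReg b) LinearMap.id (Q.insertReg (Algebra.lmul k H) w) := by
      intro w
      apply tensor_ind₂ w; intro y z
      rw [TensorProduct.map_tmul, LinearMap.id_apply, toReg_mul, insertReg_tmul]
      generalize Q.phi.val = s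
      apply tensor_ind₃ s; intro p q r
      simp [adReg_apply]
    refine (h1 (Q.adjointCoact a)).trans ?_
    rw [insertReg_coact, toReg_mul]
    generalize Q.phi.val = s
    apply tensor_ind₃ s; intro p q r
    have h2 := Q.adReg_comul (Q.adjointAct q b) (Q.adReg a p)
    simp only [pw_tmul, comp_apply, AlgHom.toLinearMap_apply, LinearMap.id_apply,
      adReg_apply Q b, ← mul_assoc, ← h2]
    generalize Q.comul _ = s
    apply tensor_ind₂ s; intro y z
    simp [adReg_apply, mul_assoc]
  refine Q.eq_of_toReg_eq fun x => ?_
  have h3 : ∀ t, Q.adjointAct x (Q.adjointMul t) =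
      Q.adjointMul (Q.tensorAct Q.adjointAct Q.adjointAct x t) := by
    intro t
    apply tensor_ind₂ t; intro a b
    exact Q.adjointAct_mul x a b
  rw [h3, h3, tensorAct_braid, key]

end Coaction

end QuasiHopfAlgebra

/-! ### Legs acting on modules, and operators which intertwine them -/

namespace LegTree

/-- The word `s` with the block `b` replaced by `b'`. -/
def subst (b b' s : LegTree) : LegTree := (collapse b s).bind fun i => if i = 0 then b' else leaf i

/-- Replacing the block `b` of `s` by `b'` gives `s'`, up to unit objects. -/
def Replaces (b b' s s' : LegTree) : Prop :=
  subst b b s = s ∧ (subst b b' s).strip = s'.strip ∧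
    (subst b b' s).leaves.Nodup ∧ s.leaves.Nodup ∧ s'.leaves.Nodup ∧
    ∀ i ∈ (collapse b s).leaves, i ≠ 0 → i ∉ b.leaves ∧ i ∉ b'.leaves

instance (b b' s s' : LegTree) : Decidable (Replaces b b' s s') := by
  unfold Replaces; infer_instance

/-- Replacing the block `b` by `b'` turns the words `s`, `t` with the same legs into `s'`, `t'`. -/
def Replaces₂ (b b' s t s' t' : LegTree) : Prop :=
  Replaces b b' s s' ∧ Replaces b b' t t' ∧ (collapse b s).leaves = (collapse b t).leaves ∧
    (subst b b' s).leaves = (subst b b' t).leaves ∧ s'.leaves = t'.leaves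

instance (b b' s t s' t' : LegTree) : Decidable (Replaces₂ b b' s t s' t') := by
  unfold Replaces₂; infer_instance

/-- The pair `s'`, `t'` arises from `s`, `t` by putting them in the same larger word. -/
def Whiskers (s t : LegTree) : LegTree → LegTree → Prop
  | node a b, node a' b' => (s = node a b ∧ t = node a' b') ∨ (b = b' ∧ Whiskers s t a a') ∨
      (a = a' ∧ Whiskers s t b b')
  | s', t' => s = s' ∧ t = t'

instance decWhiskers (s t : LegTree) : ∀ s' t', Decidable (Whiskers s t s' t')
  | node a b, node a' b' =>
    have := decWhiskers s t a a'
    have := decWhiskers s t b b'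
    by unfold Whiskers; infer_instance
  | one, _ => by unfold Whiskers; infer_instance
  | leaf _, _ => by unfold Whiskers; infer_instance
  | node _ _, one => by unfold Whiskers; infer_instance
  | node _ _, leaf _ => by unfold Whiskers; infer_instance

lemma Whiskers.cases {s t s' t' : LegTree} (h : Whiskers s t s' t') : (s = s' ∧ t = t') ∨
    (∃ a a' b, s' = node a b ∧ t' = node a' b ∧ Whiskers s t a a') ∨
    (∃ a b b', s' = node a b ∧ t' = node a b' ∧ Whiskers s t b b') := by
  cases s' <;> cases t' <;> simp only [Whiskers] at h
  case node.node a b a' b' =>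
    obtain h | ⟨rfl, h⟩ | ⟨rfl, h⟩ := h
    · exact .inl h
    · exact .inr (.inl ⟨a, a', b, rfl, rfl, h⟩)
    · exact .inr (.inr ⟨a, b, b', rfl, rfl, h⟩)
  all_goals exact .inl h

lemma Whiskers.leaves_eq {s t s' t' : LegTree} (h : Whiskers s t s' t') (h' : s.leaves = t.leaves) :
    s'.leaves = t'.leaves := by
  induction s' generalizing t' with
  | node a b iha ihb =>
    obtain h | ⟨_, a', _, h0, rfl, hw⟩ | ⟨_, _, b', h0, rfl, hw⟩ := h.cases
    · rw [← h.1, ← h.2, h']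
    · cases h0; rw [leaves, leaves, iha hw]
    · cases h0; rw [leaves, leaves, ihb hw]
  | _ =>
    obtain h | ⟨_, _, _, h0, _⟩ | ⟨_, _, _, h0, _⟩ := h.cases
    · rw [← h.1, ← h.2, h']
    all_goals cases h0

lemma bind_leaf (t : LegTree) : t.bind leaf = t := by
  induction t <;> simp_all [LegTree.bind]

end LegTree

namespace QuasiHopfAlgebra

variable {k H : Type*} [Field k] [Ring H] [Algebra k H] {Q : QuasiHopfAlgebra k H}

lemma ev_congr {B : Type*} [Ring B] [Algebra k B] {L L' : ℕ → H →ₗ[k] B} {t : LegTree}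
    (h : ∀ i ∈ t.leaves, L i = L' i) : Q.ev L t = Q.ev L' t := by
  induction t with
  | one => rfl
  | leaf i => exact h i (by simp [leaves])
  | node a b iha ihb =>
    simp only [leaves, List.mem_append] at h
    rw [ev, ev, iha fun i hi => h i (.inl hi), ihb fun i hi => h i (.inr hi)]

section Intertwines
variable {U V W : Type*} [AddCommGroup U] [Module k U] [AddCommGroup V] [Module k V]
  [AddCommGroup W] [Module k W] {L : ℕ → H →ₗ[k] Module.End k V} {L' : ℕ → H →ₗ[k] Module.End k W}
  {L'' : ℕ → H →ₗ[k] Module.End k U} {f : V →ₗ[k] W} {g : W →ₗ[k] U} {b b' b'' s t s' t' : LegTree}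

/-- The pairs of endomorphisms which are intertwined by `f`. -/
def intertwined (f : V →ₗ[k] W) : Subalgebra k (Module.End k V × Module.End k W) where
  carrier := {p | ∀ v, f (p.1 v) = p.2 (f v)}
  mul_mem' {p q} hp hq v := by
    change f (p.1 (q.1 v)) = p.2 (q.2 (f v))
    rw [hp, hq]
  add_mem' {p q} hp hq v := by
    change f (p.1 v + q.1 v) = p.2 (f v) + q.2 (f v)
    rw [map_add, hp, hq]
  algebraMap_mem' c v := by
    simp [Module.algebraMap_end_apply]

lemma can_intertwine (hL : IsLegs L) (hL' : IsLegs L') (σ τ : ℕ → LegTree)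
    (h : s.leaves = t.leaves) (hs : (s.bind σ).leaves.Nodup) (hs' : (s.bind τ).leaves.Nodup)
    (hf : ∀ i ∈ s.leaves, ∀ x v, f (Q.ev L (σ i) x v) = Q.ev L' (τ i) x (f v)) (v : V) :
    f (Q.can L (s.bind σ) (t.bind σ) v) = Q.can L' (s.bind τ) (t.bind τ) (f v) := by
  let N : ℕ → H →ₗ[k] Module.End k V × Module.End k W :=
    fun i => (Q.ev L (σ i)).prod (Q.ev L' (τ i))
  have hp : Q.AssocPath N s t (Q.can N s t) := can_path h
  have hm := AssocPath.mem (intertwined f) hp fun i hi x v => hf i hi x v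
  have h1 := ((hp.map (AlgHom.fst k _ _)).bind (L := L) σ fun i _ => rfl).can_eq hL hs
  have h2 := ((hp.map (AlgHom.snd k _ _)).bind (L := L') τ fun i _ => rfl).can_eq hL' hs'
  rw [h1, h2]
  exact hm v

lemma ev_intertwine (σ τ : ℕ → LegTree)
    (hf : ∀ i ∈ s.leaves, ∀ x v, f (Q.ev L (σ i) x v) = Q.ev L' (τ i) x (f v)) (x : H) (v : V) :
    f (Q.ev L (s.bind σ) x v) = Q.ev L' (s.bind τ) x (f v) := by
  let N : ℕ → H →ₗ[k] Module.End k V × Module.End k W :=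
    fun i => (Q.ev L (σ i)).prod (Q.ev L' (τ i))
  have hm := ev_mem (Q := Q) (L := N) (t := s) (intertwined f) (fun i hi x v => hf i hi x v) x
  have h1 := ev_map (Q := Q) (L := N) (AlgHom.fst k _ _) s x
  have h2 := ev_map (Q := Q) (L := N) (AlgHom.snd k _ _) s x
  have h3 : Q.ev (fun i => (AlgHom.fst k _ _).toLinearMap ∘ₗ N i) s = Q.ev L (s.bind σ) :=
    (ev_bind (Q := Q) (L := L) σ fun i _ => rfl).symm
  have h4 : Q.ev (fun i => (AlgHom.snd k _ _).toLinearMap ∘ₗ N i) s = Q.ev L' (s.bind τ) :=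
    (ev_bind (Q := Q) (L := L') τ fun i _ => rfl).symm
  rw [h3] at h1
  rw [h4] at h2
  rw [← h1, ← h2]
  exact hm v

lemma can_natural (hL : IsLegs L) (hL' : IsLegs L') (h : SameLegs s t)
    (hf : ∀ i ∈ s.leaves, ∀ x v, f (L i x v) = L' i x (f v)) (v : V) :
    f (Q.can L s t v) = Q.can L' s t (f v) := by
  have := can_intertwine (Q := Q) (f := f) hL hL' leaf leaf h.1 (by rw [bind_leaf]; exact h.2)
    (by rw [bind_leaf]; exact h.2) hf v
  simpa only [bind_leaf] using this

/-- `f` intertwines the action on the block `b` with the action on the block `b'`, and the action on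
every leg outside these blocks. -/
structure Intertwines (Q : QuasiHopfAlgebra k H) (L : ℕ → H →ₗ[k] Module.End k V)
    (L' : ℕ → H →ₗ[k] Module.End k W) (f : V →ₗ[k] W) (b b' : LegTree) : Prop where
  block : ∀ x v, f (Q.ev L b x v) = Q.ev L' b' x (f v)
  other : ∀ i ∉ b.leaves, i ∉ b'.leaves → ∀ x v, f (L i x v) = L' i x (f v)

namespace Intertwines

lemma leaf (hf : Q.Intertwines L L' f b b') (u : LegTree)
    (h : ∀ i ∈ u.leaves, i ≠ 0 → i ∉ b.leaves ∧ i ∉ b'.leaves) :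
    ∀ i ∈ u.leaves, ∀ x v, f (Q.ev L (if i = 0 then b else .leaf i) x v) =
      Q.ev L' (if i = 0 then b' else .leaf i) x (f v) := by
  intro i hi x v
  split_ifs with h0
  · exact hf.block x v
  · exact hf.other i (h i hi h0).1 (h i hi h0).2 x v

/-- `f` carries a canonical composite which does not break up `b` to the corresponding one. -/
lemma can (hf : Q.Intertwines L L' f b b') (hL : IsLegs L) (hL' : IsLegs L') (s' t' : LegTree)
    (h : Replaces₂ b b' s t s' t') (v : V) : f (Q.can L s t v) = Q.can L' s' t' (f v) := by
  obtain ⟨⟨h1, h2, h3, h4, h5, h6⟩, ⟨h1', h2', h3', h4', h5', h6'⟩, h7, h8, h9⟩ := h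
  have := can_intertwine (Q := Q) (f := f) hL hL' (fun i => if i = 0 then b else .leaf i)
    (fun i => if i = 0 then b' else .leaf i) h7 (by change (LegTree.subst b b s).leaves.Nodup; rwa [h1])
    h3
    (hf.leaf _ h6) v
  change f (Q.can L (LegTree.subst b b s) (LegTree.subst b b t) v) =
    Q.can L' (LegTree.subst b b' s) (LegTree.subst b b' t) _ at this
  rw [h1, h1'] at this
  rw [this, ← can_strip hL' ⟨h8, h3⟩, ← can_strip hL' ⟨h9, h5⟩, h2, h2']

/-- The same as `Intertwines.can`, for blocks `b` that may be trivial. -/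
lemma can' (hf : Q.Intertwines L L' f b b') (hL : IsLegs L) (hL' : IsLegs L') (s' t' : LegTree)
    (h : Replaces₂ b' b s' t' s t) (v : V) : f (Q.can L s t v) = Q.can L' s' t' (f v) := by
  obtain ⟨⟨h1, h2, h3, h4, h5, h6⟩, ⟨h1', h2', h3', h4', h5', h6'⟩, h7, h8, h9⟩ := h
  have := can_intertwine (Q := Q) (f := f) hL hL' (fun i => if i = 0 then b else .leaf i)
    (fun i => if i = 0 then b' else .leaf i) h7 h3
    (by change (LegTree.subst b' b' s').leaves.Nodup; rwa [h1])
    (hf.leaf _ fun i hi hi' => (h6 i hi hi').symm) v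
  change f (Q.can L (LegTree.subst b' b s') (LegTree.subst b' b t') v) =
    Q.can L' (LegTree.subst b' b' s') (LegTree.subst b' b' t') _ at this
  rw [h1, h1'] at this
  rw [← this, ← can_strip hL ⟨h8, h3⟩, ← can_strip hL ⟨h9, h5⟩, h2, h2']

/-- `f` intertwines the actions on larger blocks which contain `b` and `b'`. -/
lemma extend (hf : Q.Intertwines L L' f b b') (hL' : IsLegs L') (s s' : LegTree)
    (h : Replaces b b' s s' ∧ ∀ i ∈ b.leaves ++ b'.leaves, i ∈ s.leaves ++ s'.leaves) :
    Q.Intertwines L L' f s s' := by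
  obtain ⟨⟨h1, h2, h3, h4, h5, h6⟩, h7⟩ := h
  refine ⟨fun x v => ?_, fun i hi hi' => hf.other i ?_ ?_⟩
  · have := ev_intertwine (Q := Q) (f := f) _ _ (hf.leaf _ h6) x v
    change f (Q.ev L (LegTree.subst b b s) x v) = Q.ev L' (LegTree.subst b b' s) x _ at this
    rw [h1] at this
    rw [this, ← ev_strip hL' h3, h2, ev_strip hL' h5]
  · intro h; have := h7 i (by simp [h]); simp at this; tauto
  · intro h; have := h7 i (by simp [h]); simp at this; tauto

lemma comp (hg : Q.Intertwines L' L'' g b' b'') (hf : Q.Intertwines L L' f b b')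
    (h : ∀ i ∈ b'.leaves, i ∈ b''.leaves ∨ i ∈ b.leaves) :
    Q.Intertwines L L'' (g ∘ₗ f) b b'' where
  block x v := by simp only [comp_apply, hf.block, hg.block]
  other i hi hi' x v := by
    have : i ∉ b'.leaves := fun h0 => by rcases h i h0 with h | h <;> contradiction
    simp only [comp_apply, hf.other i hi this, hg.other i this hi']

end Intertwines

lemma intertwines_can (hL : IsLegs L) (h : SameLegs b b') :
    Q.Intertwines L L (Q.can L b b') b b' where
  block x v := LinearMap.congr_fun (can_mul_ev hL h x) v
  other i hi _ x v := LinearMap.congr_fun (can_commute (u := .leaf i) hL h.1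
    (fun j hj hj' => by simp [leaves] at hj'; subst hj'; exact hi hj) x).eq v

lemma can_trans_apply (hL : IsLegs L) (t : LegTree) {u : LegTree} (h : SameLegs s t)
    (h' : t.leaves = u.leaves) (v : V) : Q.can L t u (Q.can L s t v) = Q.can L s u v :=
  LinearMap.congr_fun (can_trans hL t h h') v

lemma can_self_apply (hL : IsLegs L) (h : s.leaves.Nodup) (v : V) : Q.can L s s v = v :=
  LinearMap.congr_fun (can_self hL h) v

lemma can_whisker {B : Type*} [Ring B] [Algebra k B] {L : ℕ → H →ₗ[k] B} (hL : IsLegs L)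
    (s' t' : LegTree) (h : Whiskers s t s' t' ∧ s.leaves = t.leaves ∧ s'.leaves.Nodup) :
    Q.can L s t = Q.can L s' t' := by
  obtain ⟨h, h1, h2⟩ := h
  induction s' generalizing t' with
  | node a b iha ihb =>
    have h3 := List.nodup_append'.1 h2
    obtain h | ⟨_, a', _, h0, rfl, hw⟩ | ⟨_, _, b', h0, rfl, hw⟩ := h.cases
    · rw [h.1, h.2]
    · cases h0; rw [can_left hL (hw.leaves_eq h1) h2, iha _ hw h3.1]
    · cases h0; rw [can_right hL (hw.leaves_eq h1) h2, ihb _ hw h3.2.1]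
  | _ =>
    obtain h | ⟨_, _, _, h0, _⟩ | ⟨_, _, _, h0, _⟩ := h.cases
    · rw [h.1, h.2]
    all_goals cases h0

lemma can_split (hL : IsLegs L) (p q r : LegTree) (h : SameLegs p q ∧ q.leaves = r.leaves) (v : V) :
    Q.can L p r v = Q.can L q r (Q.can L p q v) :=
  (can_trans_apply hL q h.1 h.2 v).symm

/-- Two canonical composites, put in a common context, compose to a canonical composite. -/
lemma can_comp (hL : IsLegs L) (p q r : LegTree) (h : Whiskers s t p q ∧ s.leaves = t.leaves ∧
      p.leaves.Nodup ∧ Whiskers s' t' q r ∧ s'.leaves = t'.leaves ∧ p.leaves = q.leaves ∧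
      q.leaves = r.leaves)
    (v : V) : Q.can L s' t' (Q.can L s t v) = Q.can L p r v := by
  obtain ⟨h1, h2, h3, h4, h5, h6, h7⟩ := h
  rw [can_whisker hL p q ⟨h1, h2, h3⟩, can_whisker hL q r ⟨h4, h5, h6 ▸ h3⟩,
    can_trans_apply hL q ⟨h6, h3⟩ h7]

end Intertwines

section HeadLegs
variable {X V W : Type*} [AddCommGroup X] [Module k X] [AddCommGroup V] [Module k V]
  [AddCommGroup W] [Module k W]

/-- The legs of `X ⊗ W`, where the leg `n` acts on `X` and the other legs act on `W`. -/
def headLegs (σ : H →ₐ[k] Module.End k X) (n : ℕ) (L : ℕ → H →ₗ[k] Module.End k W) :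
    ℕ → H →ₗ[k] Module.End k (X ⊗[k] W) := fun i =>
  if i = n then LinearMap.rTensorHom W ∘ₗ σ.toLinearMap else LinearMap.lTensorHom X ∘ₗ L i

variable {σ : H →ₐ[k] Module.End k X} {n : ℕ} {L : ℕ → H →ₗ[k] Module.End k W}
  {L' : ℕ → H →ₗ[k] Module.End k V}

lemma headLegs_self (x : H) (a : X) (w : W) : headLegs σ n L n x (a ⊗ₜ w) = σ x a ⊗ₜ w := by
  simp [headLegs]

lemma headLegs_of_ne {i : ℕ} (h : i ≠ n) (x : H) :
    headLegs σ n L i x = lTensor X (L i x) := by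
  simp [headLegs, h]

lemma ev_headLegs {t : LegTree} (h : n ∉ t.leaves) (x : H) :
    Q.ev (headLegs σ n L) t x = lTensor X (Q.ev L t x) := by
  let F : Module.End k W →ₐ[k] Module.End k (X ⊗[k] W) :=
    AlgHom.ofLinearMap (LinearMap.lTensorHom X) (LinearMap.lTensor_id X W)
      fun f g => LinearMap.lTensor_comp X f g
  have h1 := ev_map (Q := Q) (L := L) F t x
  refine Eq.trans ?_ h1.symm
  refine LinearMap.congr_fun (ev_congr fun i hi => ?_) x
  have : i ≠ n := fun h' => h (h' ▸ hi)
  simp [headLegs, this]; rfl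

lemma ev_headLegs_tmul {t : LegTree} (h : n ∉ t.leaves) (x : H) (a : X) (w : W) :
    Q.ev (headLegs σ n L) t x (a ⊗ₜ w) = a ⊗ₜ Q.ev L t x w := by
  rw [ev_headLegs h]; rfl

lemma isLegs_headLegs (hL : IsLegs L) : IsLegs (headLegs σ n L) where
  one i := by
    by_cases h : i = n
    · subst h; refine TensorProduct.ext' fun a w => ?_; rw [headLegs_self, map_one]; rfl
    · rw [headLegs_of_ne h, hL.one]; exact LinearMap.lTensor_id X W
  mul i x y := by
    by_cases h : i = n
    · subst h; refine TensorProduct.ext' fun a w => ?_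
      simp [headLegs_self, Module.End.mul_apply]
    · rw [headLegs_of_ne h, headLegs_of_ne h, headLegs_of_ne h, hL.mul]
      exact LinearMap.lTensor_comp X _ _
  comm i j hij x y := by
    refine LinearMap.ext fun v => ?_
    rw [Module.End.mul_apply, Module.End.mul_apply]
    apply tensor_ind₂ v; intro a w
    by_cases h : i = n
    · subst h
      rw [headLegs_of_ne (Ne.symm hij), headLegs_self, lTensor_tmul,
        lTensor_tmul, headLegs_self]
    · rw [headLegs_of_ne h]
      by_cases h' : j = n
      · subst h'
        rw [headLegs_self, lTensor_tmul, lTensor_tmul, headLegs_self]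
      · rw [headLegs_of_ne h', lTensor_tmul, lTensor_tmul,
          lTensor_tmul, lTensor_tmul]
        exact congrArg _ (LinearMap.congr_fun (hL.comm i j hij x y).eq w)

lemma can_headLegs {s t : LegTree} (hL : IsLegs L) (h : SameLegs s t) (hn : n ∉ s.leaves) :
    Q.can (headLegs σ n L) s t = lTensor X (Q.can L s t) :=
  TensorProduct.ext' fun a w => (can_natural (f := TensorProduct.mk k X W a) hL
    (isLegs_headLegs hL) h (fun i hi x v => by
      have : i ≠ n := fun h' => hn (h' ▸ hi)
      rw [headLegs_of_ne this]; rfl) w).symm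

lemma lTensor_headLegs {f : V →ₗ[k] W} {i : ℕ}
    (hf : i ≠ n → ∀ x v, f (L' i x v) = L i x (f v)) (x : H) (v : X ⊗[k] V) :
    lTensor X f (headLegs σ n L' i x v) =
      headLegs σ n L i x (lTensor X f v) := by
  apply tensor_ind₂ v; intro a w
  by_cases h : i = n
  · subst h
    rw [headLegs_self, lTensor_tmul, lTensor_tmul, headLegs_self]
  · rw [headLegs_of_ne h, headLegs_of_ne h, lTensor_tmul, lTensor_tmul,
      lTensor_tmul, lTensor_tmul, hf h]

lemma Intertwines.lTensor {f : V →ₗ[k] W} {b b' : LegTree} (hf : Q.Intertwines L' L f b b')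
    (hn : n ∉ b.leaves ++ b'.leaves) :
    Q.Intertwines (headLegs σ n L') (headLegs σ n L) (lTensor X f) b b' := by
  simp only [List.mem_append, not_or] at hn
  refine ⟨fun x v => ?_, fun i hi hi' x v => lTensor_headLegs (fun _ => hf.other i hi hi') x v⟩
  rw [ev_headLegs hn.1, ev_headLegs hn.2, ← comp_apply, ← comp_apply,
    ← LinearMap.lTensor_comp, ← LinearMap.lTensor_comp]
  congr 2
  exact LinearMap.ext fun v => hf.block x v

end HeadLegs

end QuasiHopfAlgebra

/-! ### The operators of the adjoint algebra -/

namespace QuasiHopfAlgebra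

variable {k H : Type*} [Field k] [Ring H] [Algebra k H] (Q : QuasiHopfAlgebra k H)

section Operators
variable {V W : Type*} [AddCommGroup V] [Module k V] [AddCommGroup W] [Module k W]
  (L : ℕ → H →ₗ[k] Module.End k W) (L' : ℕ → H →ₗ[k] Module.End k V)

/-- The legs of `A ⊗ W`, the leg `n` being `A`. -/
abbrev adLegs (n : ℕ) := headLegs Q.adjointAct n L

variable {L} in
lemma isLegs_adLegs (n : ℕ) (hL : IsLegs L) :
    IsLegs (k := k) (H := H) (B := Module.End k (H ⊗[k] W)) (Q.adLegs L n) := isLegs_headLegs hL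

/-- The action `a ⊗ w ↦ g(a) w` of `A` on the block `t`. -/
def actOn (t : LegTree) : H ⊗[k] W →ₗ[k] W := TensorProduct.lift (Q.ev L t ∘ₗ Q.toReg)

@[simp] lemma actOn_tmul (t : LegTree) (a : H) (w : W) :
    Q.actOn L t (a ⊗ₜ w) = Q.ev L t (Q.toReg a) w := rfl

/-- `x ⊗ a ↦ (w ↦ a ⊗ x w)`, where `x` acts on the block `t`. -/
def moveMap (t : LegTree) : H ⊗[k] H →ₗ[k] W →ₗ[k] H ⊗[k] W :=
  multilin₂ (k := k) (fun x a => TensorProduct.mk k H W a ∘ₗ Q.ev L t x)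

@[simp] lemma moveMap_tmul (t : LegTree) (x a : H) (w : W) :
    Q.moveMap L t (x ⊗ₜ a) w = a ⊗ₜ Q.ev L t x w := rfl

/-- The half-braiding `a ⊗ w ↦ a₀ ⊗ a₋₁ w` of `A` with the block `t`. -/
def braidOn (t : LegTree) : H ⊗[k] W →ₗ[k] H ⊗[k] W :=
  TensorProduct.lift (Q.moveMap L t ∘ₗ Q.adjointCoact)

lemma braidOn_tmul (t : LegTree) (a : H) (w : W) :
    Q.braidOn L t (a ⊗ₜ w) = Q.moveMap L t (Q.adjointCoact a) w := rfl

variable (W) in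
/-- The product of the first two factors of `A ⊗ A ⊗ W`. -/
def mulOn : H ⊗[k] (H ⊗[k] W) →ₗ[k] H ⊗[k] W :=
  rTensor W Q.adjointMul ∘ₗ (TensorProduct.assoc k H H W).symm.toLinearMap

@[simp] lemma mulOn_tmul (a b : H) (w : W) :
    Q.mulOn W (a ⊗ₜ (b ⊗ₜ w)) = Q.adjointMul (a ⊗ₜ b) ⊗ₜ w := rfl

variable {L L' Q} {s t t' : LegTree} {n m : ℕ}

lemma braidOn_natural {f : V →ₗ[k] W} (hf : ∀ x v, f (Q.ev L' t x v) = Q.ev L t x (f v))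
    (v : H ⊗[k] V) :
    Q.braidOn L t (lTensor H f v) = lTensor H f (Q.braidOn L' t v) := by
  apply tensor_ind₂ v; intro a w
  rw [lTensor_tmul, braidOn_tmul, braidOn_tmul]
  generalize Q.adjointCoact a = u
  apply tensor_ind₂ u; intro x b
  simp [hf]

lemma mulOn_natural {f : V →ₗ[k] W} (v : H ⊗[k] (H ⊗[k] V)) :
    Q.mulOn W (lTensor H (lTensor H f) v) =
      lTensor H f (Q.mulOn V v) := by
  apply tensor_ind₃ v; intro a b w
  simp

section
variable (hL : IsLegs L)
include hL

omit hL in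
lemma ev_adLegs_node (h : (node (leaf n) t).leaves.Nodup) (x : H) (a : H) (w : W) :
    Q.ev (B := Module.End k _) (Q.adLegs L n) (node (leaf n) t) x (a ⊗ₜ w) =
      TensorProduct.map (LinearMap.applyₗ a ∘ₗ Q.adjointAct.toLinearMap)
        (LinearMap.applyₗ w ∘ₗ Q.ev L t) (Q.comul x) := by
  have hn : n ∉ t.leaves := by simp [leaves] at h; exact h.1
  rw [ev_node]
  generalize Q.comul x = s
  apply tensor_ind₂ s; intro x y
  rw [pw_tmul, Module.End.mul_apply, ev_headLegs_tmul hn]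
  exact headLegs_self _ _ _

omit hL in
lemma ev_adLegs_node' (h : (node (leaf n) t).leaves.Nodup) (x : H) (a : H) (w : W) :
    Q.ev (B := Module.End k _) (Q.adLegs L n) (node t (leaf n)) x (a ⊗ₜ w) =
      TensorProduct.map (LinearMap.applyₗ a ∘ₗ Q.adjointAct.toLinearMap)
        (LinearMap.applyₗ w ∘ₗ Q.ev L t) (TensorProduct.comm k H H (Q.comul x)) := by
  have hn : n ∉ t.leaves := by simp [leaves] at h; exact h.1
  rw [ev_node]
  generalize Q.comul x = s
  apply tensor_ind₂ s; intro x y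
  rw [pw_tmul, Module.End.mul_apply, ev, headLegs_self, ev_headLegs_tmul hn]
  rfl

lemma actOn_intertwines (h : (node (leaf n) t).leaves.Nodup) :
    Q.Intertwines (Q.adLegs L n) L (Q.actOn L t) (node (leaf n) t) t where
  block x v := by
    have ht : t.leaves.Nodup := by simp [leaves] at h; exact h.2
    apply tensor_ind₂ v; intro a w
    rw [ev_adLegs_node h, actOn_tmul, ← Module.End.mul_apply, ← Q.ev_mul hL ht,
      ← adReg_comul]
    generalize Q.comul x = s
    apply tensor_ind₂ s; intro x y
    simp [adReg_apply, Q.ev_mul hL ht]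
  other i hi hi' x v := by
    simp only [leaves, List.cons_append, List.nil_append, List.mem_cons, not_or] at hi
    apply tensor_ind₂ v; intro a w
    rw [headLegs_of_ne hi.1, lTensor_tmul, actOn_tmul, actOn_tmul]
    exact LinearMap.congr_fun (Q.ev_commute hL (a := t) (b := leaf i)
      (fun j hj hj' => by simp [leaves] at hj'; subst hj'; exact hi' hj) (Q.toReg a) x).eq w

lemma actOn_can (h : (node (leaf n) t).leaves.Nodup) (ht : t.leaves = t'.leaves) (v : H ⊗[k] W) :
    Q.actOn L t' (Q.can (B := Module.End k _) (Q.adLegs L n) (node (leaf n) t) (node (leaf n) t') v) =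
      Q.can L t t' (Q.actOn L t v) := by
  have hn : n ∉ t.leaves ∧ t.leaves.Nodup := by simpa [leaves] using h
  rw [can_right (isLegs_headLegs hL) ht h]
  apply tensor_ind₂ v; intro a w
  have e : Q.can (B := Module.End k _) (Q.adLegs L n) t t' (a ⊗ₜ w) = a ⊗ₜ Q.can L t t' w :=
    LinearMap.congr_fun (can_headLegs hL ⟨ht, hn.2⟩ hn.1) (a ⊗ₜ w)
  rw [e, actOn_tmul, actOn_tmul]
  exact (LinearMap.congr_fun (can_mul_ev hL ⟨ht, hn.2⟩ (Q.toReg a)) w).symm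

variable [Module.Finite k H]

lemma braidOn_intertwines (h : (node (leaf n) t).leaves.Nodup) :
    Q.Intertwines (Q.adLegs L n) (Q.adLegs L n) (Q.braidOn L t) (node (leaf n) t)
      (node t (leaf n)) where
  block x v := by
    have ht : t.leaves.Nodup := by simp [leaves] at h; exact h.2
    apply tensor_ind₂ v; intro a w
    rw [ev_adLegs_node h, braidOn_tmul]
    have e1 : ∀ u, Q.ev (B := Module.End k _) (Q.adLegs L n) (node t (leaf n)) x (Q.moveMap L t u w) =
        Q.moveMap L t (Q.tensorAct (Algebra.lmul k H) Q.adjointAct x u) w := by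
      intro u
      apply tensor_ind₂ u; intro y b
      rw [moveMap_tmul, ev_adLegs_node' h]
      change _ = Q.moveMap L t (actTensor _ _ (Q.comul x) _) w
      generalize Q.comul x = s
      apply tensor_ind₂ s; intro p q
      simp [actTensor_tmul, Q.ev_mul hL ht]
    rw [e1, tensorAct_adjointCoact]
    generalize Q.comul x = s
    apply tensor_ind₂ s; intro p q
    simp only [TensorProduct.map_tmul, comp_apply, LinearMap.applyₗ_apply_apply,
      AlgHom.toLinearMap_apply, braidOn_tmul, pw_tmul, adjointAct_apply]
    generalize Q.adjointCoact _ = u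
    apply tensor_ind₂ u; intro y b
    simp [Q.ev_mul hL ht]
  other i hi hi' x v := by
    simp only [leaves, List.cons_append, List.nil_append, List.mem_cons, not_or] at hi
    have : lTensor H (L i x) = Q.adLegs L n i x := (headLegs_of_ne hi.1 x).symm
    rw [← this]
    refine braidOn_natural (fun y w => ?_) v
    exact LinearMap.congr_fun (Q.ev_commute hL (a := leaf i) (b := t)
        (fun j hj hj' => by simp [leaves] at hj; subst hj; exact hi.2 hj') x y).eq w

/-- Acting on the block `s t` is braiding past `s` and then acting on `t`. -/
lemma actOn_braidOn (h : (node (leaf n) (node s t)).leaves.Nodup) (v : H ⊗[k] W) :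
    Q.actOn L t (Q.can (B := Module.End k _) (Q.adLegs L n) (node (node s (leaf n)) t) (node s (node (leaf n) t))
      (Q.braidOn L s v)) =
    Q.actOn L (node s t) (Q.can (B := Module.End k _) (Q.adLegs L n) (node (node (leaf n) s) t)
      (node (leaf n) (node s t)) v) := by
  have h' := h
  simp only [leaves, List.nodup_append', List.mem_append, List.cons_append, List.nil_append,
    List.nodup_cons, not_or] at h'
  obtain ⟨⟨hns, hnt⟩, hs, ht, hd⟩ := h'
  have hM := Q.isLegs_adLegs n hL
  rw [can_assoc hM (by
    simp only [leaves, List.nodup_append', List.cons_append, List.nil_append, List.nodup_cons,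
      List.disjoint_cons_right]
    exact ⟨hs, ⟨hnt, ht⟩, hns, hd⟩), can_assoc hM (by simpa [leaves, List.nodup_append'] using h)]
  have hc := fun x y w => LinearMap.congr_fun (Q.ev_commute hL (a := s) (b := t) hd x y).eq w
  simp only [Module.End.mul_apply] at hc
  apply tensor_ind₂ v; intro a w
  trans pw (Q.ev L s) (Q.ev L t) (Q.insertReg (Algebra.lmul k H) (Q.adjointCoact a)) w
  · rw [braidOn_tmul]
    generalize Q.adjointCoact a = u
    apply tensor_ind₂ u; intro x b
    rw [moveMap_tmul, insertReg_tmul, ph]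
    generalize Q.phi.val = r
    apply tensor_ind₃ r; intro p q r
    simp only [place, pw_tmul, Module.End.mul_apply]
    rw [ev_headLegs_tmul hnt, ev, headLegs_self, ev_headLegs_tmul hns]
    simp [Q.ev_mul hL hs, Q.ev_mul hL ht, adReg_apply, hc]
  · rw [insertReg_coact, ph]
    generalize Q.phi.val = r
    apply tensor_ind₃ r; intro p q r
    simp only [place, pw_tmul, Module.End.mul_apply]
    rw [ev_headLegs_tmul hnt, ev_headLegs_tmul hns, ev, headLegs_self, actOn_tmul, ev_node,
      pw_mul _ _ (Q.ev_mul hL hs) (Q.ev_mul hL ht) (fun x y => Q.ev_commute hL hd x y)]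
    simp [adReg_apply]

end

/-- Acting with a product is acting twice. -/
lemma actOn_mulOn (hL : IsLegs L) (h : (node (leaf n) (node (leaf m) t)).leaves.Nodup)
    (v : H ⊗[k] (H ⊗[k] W)) :
    Q.actOn L t (Q.mulOn W v) = Q.actOn L t (lTensor H (Q.actOn L t)
      (Q.can (B := Module.End k _) (Q.adLegs (Q.adLegs L m) n) (node (node (leaf n) (leaf m)) t)
        (node (leaf n) (node (leaf m) t)) v)) := by
  have h' := h
  simp only [leaves, List.cons_append, List.nil_append, List.nodup_cons, List.mem_cons,
    not_or] at h'
  obtain ⟨⟨hnm, hnt⟩, hmt, ht⟩ := h'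
  have hM := Q.isLegs_adLegs n
    (Q.isLegs_adLegs m hL)
  rw [can_assoc hM (by simpa [leaves] using h), ph]
  apply tensor_ind₃ v; intro a b w
  rw [mulOn_tmul, actOn_tmul, toReg_mul]
  generalize Q.phi.val = r
  apply tensor_ind₃ r; intro p q r
  simp only [place, pw_tmul, Module.End.mul_apply]
  rw [ev_headLegs_tmul hnt, ev_headLegs_tmul hmt, ev, ev,
    headLegs_of_ne (Ne.symm hnm), lTensor_tmul, headLegs_self, headLegs_self]
  simp [Q.ev_mul hL ht, adReg_apply]

lemma mulOn_intertwines (hnm : n ≠ m) :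
    Q.Intertwines (Q.adLegs (Q.adLegs L m) n) (Q.adLegs L n) (Q.mulOn W)
      (node (leaf n) (leaf m)) (leaf n) where
  block x v := by
    apply tensor_ind₃ v; intro a b w
    rw [mulOn_tmul, ev, headLegs_self, adjointAct_mul, ev_node]
    change _ = Q.adjointMul (actTensor _ _ (Q.comul x) _) ⊗ₜ w
    generalize Q.comul x = r
    apply tensor_ind₂ r; intro p q
    rw [pw_tmul, Module.End.mul_apply, ev, ev, headLegs_of_ne (Ne.symm hnm),
      lTensor_tmul, headLegs_self, headLegs_self]
    rfl
  other i hi hi' x v := by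
    simp only [leaves, List.cons_append, List.nil_append, List.mem_cons, not_or] at hi
    apply tensor_ind₃ v; intro a b w
    rw [mulOn_tmul, headLegs_of_ne hi.1, headLegs_of_ne hi.1, lTensor_tmul,
      lTensor_tmul, headLegs_of_ne hi.2.1, lTensor_tmul, mulOn_tmul]

end Operators

end QuasiHopfAlgebra

/-! ### The adjoint algebra is a commutative algebra in the centre -/

namespace QuasiHopfAlgebra

variable {k H : Type*} [Field k] [Ring H] [Algebra k H] {Q : QuasiHopfAlgebra k H}

section Injective
variable {V W : Type*} [AddCommGroup V] [Module k V] [AddCommGroup W] [Module k W]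
  [Module.Finite k H] {L : ℕ → H →ₗ[k] Module.End k W} {L' : ℕ → H →ₗ[k] Module.End k V}
  {r b : LegTree} {n m : ℕ}

/-- The action of `A` on a regular leg `m` which is adjoined to `W`. -/
def probe (Q : QuasiHopfAlgebra k H) (L : ℕ → H →ₗ[k] Module.End k W) (r : LegTree) (n m : ℕ) :
    H ⊗[k] W →ₗ[k] H ⊗[k] W :=
  Q.actOn (headLegs (Algebra.lmul k H) m L) (leaf m) ∘ₗ
    Q.can (B := Module.End k _) (Q.adLegs (headLegs (Algebra.lmul k H) m L) n)
      (r * leaf n * leaf m) (r * (leaf n * leaf m)) ∘ₗ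
    lTensor H (TensorProduct.mk k H W 1)

omit [Module.Finite k H] in
lemma probe_eq (hL : IsLegs L) (h : (r * leaf n * leaf m).leaves.Nodup) (ρ : H →ₐ[k] Module.End k W)
    (hρ : ρ.toLinearMap = Q.ev L r) (v : H ⊗[k] W) :
    Q.probe L r n m v =
      TensorProduct.comm k W H (Q.insertReg ρ (TensorProduct.comm k H W v)) := by
  have h' := h
  change ((r.leaves ++ [n]) ++ [m]).Nodup at h'
  simp only [List.nodup_append', List.disjoint_singleton, List.mem_append, not_or] at h'
  obtain ⟨⟨hr, -, hnr⟩, -, hmr, hmn⟩ := h'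
  have hmn : m ≠ n := by simpa using hmn
  have hM := Q.isLegs_adLegs n
    (isLegs_headLegs (σ := Algebra.lmul k H) (n := m) hL)
  simp only [probe, comp_apply]
  rw [can_assoc' hM h, ph]
  apply tensor_ind₂ v; intro a w
  rw [TensorProduct.comm_tmul, insertReg_tmul, hρ]
  generalize Q.phi.val = r
  apply tensor_ind₃ r; intro p q r
  simp only [place, pw_tmul, Module.End.mul_apply, lTensor_tmul,
    TensorProduct.mk_apply]
  rw [show Q.ev (headLegs Q.adjointAct n (headLegs (Algebra.lmul k H) m L)) (leaf m) r =
    lTensor H (headLegs (Algebra.lmul k H) m L m r) from headLegs_of_ne hmn r,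
    lTensor_tmul, headLegs_self,
    show Q.ev (headLegs Q.adjointAct n (headLegs (Algebra.lmul k H) m L)) (leaf n) q =
      headLegs Q.adjointAct n (headLegs (Algebra.lmul k H) m L) n q from rfl, headLegs_self,
    ev_headLegs_tmul hnr, ev_headLegs_tmul hmr, actOn_tmul, ev, headLegs_self]
  simp [adReg_apply]

omit [Module.Finite k H] in
/-- Maps to `A ⊗ W` which intertwine the actions of `H` agree if they agree after acting on an
adjoined regular leg. -/
lemma eq_of_probe_eq (hL : IsLegs L) (h : (r * leaf n * leaf m).leaves.Nodup)
    {F G : V →ₗ[k] H ⊗[k] W}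
    (hF : ∀ x v, F (Q.ev L' b x v) =
      Q.ev (B := Module.End k _) (Q.adLegs L n) (r * leaf n) x (F v))
    (hG : ∀ x v, G (Q.ev L' b x v) =
      Q.ev (B := Module.End k _) (Q.adLegs L n) (r * leaf n) x (G v))
    (hFG : ∀ v, Q.probe L r n m (F v) = Q.probe L r n m (G v)) (v : V) : F v = G v := by
  have h' := h
  change ((r.leaves ++ [n]) ++ [m]).Nodup at h'
  simp only [List.nodup_append', List.disjoint_singleton, List.mem_append, not_or] at h'
  obtain ⟨⟨hr, -, hnr⟩, -, hmr, hmn⟩ := h'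
  let ρ : H →ₐ[k] Module.End k W := AlgHom.ofLinearMap (Q.ev L r) (Q.ev_one hL r) (Q.ev_mul hL hr)
  have key : ∀ x (u : H ⊗[k] W), TensorProduct.comm k H W
      (Q.ev (B := Module.End k _) (Q.adLegs L n) (r * leaf n) x u) =
      Q.tensorAct ρ Q.adjointAct x (TensorProduct.comm k H W u) := by
    intro x u
    apply tensor_ind₂ u; intro a w
    have e := ev_adLegs_node' (Q := Q) (L := L) (n := n) (t := r)
      (by simpa [leaves] using ⟨hnr, hr⟩) x a w
    refine (congrArg _ e).trans ?_
    change _ = actTensor ρ Q.adjointAct (Q.comul x) (w ⊗ₜ a)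
    generalize Q.comul x = s
    apply tensor_ind₂ s; intro p q
    rw [actTensor_tmul]; rfl
  have h1 := Q.eq_of_insertReg_eq ρ (w := TensorProduct.comm k H W (F v))
    (w' := TensorProduct.comm k H W (G v)) fun x => by
      have := hFG (Q.ev L' b x v)
      rw [probe_eq hL h ρ rfl, probe_eq hL h ρ rfl, hF, hG, key, key] at this
      exact (TensorProduct.comm k W H).injective this
  exact (TensorProduct.comm k H W).injective h1

end Injective

local notation "canV" => QuasiHopfAlgebra.can (B := Module.End k _) Q
local notation "evV" => QuasiHopfAlgebra.ev (B := Module.End k _) Q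

section Hexagon
variable {V W : Type*} [AddCommGroup V] [Module k V] [AddCommGroup W] [Module k W]
  [Module.Finite k H] {L : ℕ → H →ₗ[k] Module.End k W} {L' : ℕ → H →ₗ[k] Module.End k V}

variable (Q L) in
/-- Braiding `A` past the legs `2` and `3` one after the other. -/
def braidTwice :
    H ⊗[k] W →ₗ[k] H ⊗[k] W :=
  canV (Q.adLegs L 1) (2 * (3 * 1)) (2 * 3 * 1) ∘ₗ Q.braidOn L 3 ∘ₗ
    canV (Q.adLegs L 1) (2 * 1 * 3) (2 * (1 * 3)) ∘ₗ Q.braidOn L 2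

variable (Q L) in
/-- Braiding `A` past the product of the legs `2` and `3`. -/
def braidProd :
    H ⊗[k] W →ₗ[k] H ⊗[k] W :=
  Q.braidOn L (2 * 3) ∘ₗ canV (Q.adLegs L 1) (1 * 2 * 3) (1 * (2 * 3))

lemma actOn_braidProd (hL : IsLegs L) (v : H ⊗[k] W) :
    Q.actOn L 4 (canV (Q.adLegs L 1) (2 * 3 * 1 * 4) (2 * 3 * (1 * 4)) (Q.braidProd L v)) =
      Q.actOn L (2 * 3 * 4) (canV (Q.adLegs L 1) (1 * 2 * 3 * 4) (1 * (2 * 3 * 4)) v) := by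
  have hM := Q.isLegs_adLegs 1 hL
  simp only [braidProd, comp_apply]
  refine (actOn_braidOn (n := 1) (s := 2 * 3) (t := 4) hL (by decide) _).trans ?_
  rw [can_comp hM (1 * 2 * 3 * 4) (1 * (2 * 3) * 4) (1 * (2 * 3 * 4)) (by decide)]
  rfl

lemma actOn_braidTwice (hL : IsLegs L) (v : H ⊗[k] W) :
    Q.actOn L 4 (canV (Q.adLegs L 1) (2 * 3 * 1 * 4) (2 * 3 * (1 * 4)) (Q.braidTwice L v)) =
      Q.actOn L (2 * 3 * 4) (canV (Q.adLegs L 1) (1 * 2 * 3 * 4) (1 * (2 * 3 * 4)) v) := by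
  have hM := Q.isLegs_adLegs 1 hL
  have h4 : Q.Intertwines (Q.adLegs L 1) L (Q.actOn L 4) (1 * 4) 4 :=
    actOn_intertwines hL (by decide)
  have h2 : Q.Intertwines (Q.adLegs L 1) (Q.adLegs L 1) (Q.braidOn L 2) (1 * 2) (2 * 1) :=
    braidOn_intertwines hL (by decide)
  have h3 : Q.Intertwines (Q.adLegs L 1) (Q.adLegs L 1) (Q.braidOn L 3) (1 * 3) (3 * 1) :=
    braidOn_intertwines hL (by decide)
  simp only [braidTwice, comp_apply]
  rw [can_comp hM (2 * (3 * 1) * 4) (2 * 3 * 1 * 4) (2 * 3 * (1 * 4)) (by decide),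
    can_split hM (2 * (3 * 1) * 4) (2 * (3 * (1 * 4))) (2 * 3 * (1 * 4)) (by decide),
    can_split hM (2 * (3 * 1) * 4) (2 * (3 * 1 * 4)) (2 * (3 * (1 * 4))) (by decide),
    h4.can hM hL (2 * (3 * 4)) (2 * 3 * 4) (by decide),
    ← h3.can hM hM (2 * (3 * 1) * 4) (2 * (3 * 1 * 4)) (s := 2 * (1 * 3) * 4)
      (t := 2 * (1 * 3 * 4)) (by decide),
    ← can_whisker hM (s := 3 * 1 * 4) (t := 3 * (1 * 4)) (2 * (3 * 1 * 4)) _ (by decide)]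
  refine (congrArg _ (actOn_braidOn (n := 1) (s := 3) (t := 4) hL (by decide) _)).trans ?_
  change Q.can L (2 * (3 * 4)) (2 * 3 * 4) (Q.actOn L (3 * 4) (canV (Q.adLegs L 1) (1 * 3 * 4)
    (1 * (3 * 4)) _)) = _
  rw [can_comp hM (2 * (1 * 3) * 4) (2 * (1 * 3 * 4)) (2 * (1 * (3 * 4))) (by decide),
    can_comp hM (2 * 1 * 3 * 4) (2 * (1 * 3) * 4) (2 * (1 * (3 * 4))) (by decide),
    can_split hM (2 * 1 * 3 * 4) (2 * 1 * (3 * 4)) (2 * (1 * (3 * 4))) (by decide),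
    ← h2.can hM hM (2 * 1 * 3 * 4) (2 * 1 * (3 * 4)) (s := 1 * 2 * 3 * 4)
      (t := 1 * 2 * (3 * 4)) (by decide)]
  refine (congrArg _ (actOn_braidOn (n := 1) (s := 2) (t := 3 * 4) hL (by decide) _)).trans ?_
  refine (actOn_can (n := 1) (t := 2 * (3 * 4)) (t' := 2 * 3 * 4) hL (by decide) (by decide)
    _).symm.trans ?_
  change Q.actOn L (2 * 3 * 4) (canV (Q.adLegs L 1) (1 * (2 * (3 * 4))) (1 * (2 * 3 * 4))
    (canV (Q.adLegs L 1) (1 * 2 * (3 * 4)) (1 * (2 * (3 * 4))) _)) = _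
  rw [can_comp hM (1 * 2 * (3 * 4)) (1 * (2 * (3 * 4))) (1 * (2 * 3 * 4)) (by decide),
    can_comp hM (1 * 2 * 3 * 4) (1 * 2 * (3 * 4)) (1 * (2 * 3 * 4)) (by decide)]

/-- The hexagon identity for the half-braiding of `A`. -/
lemma braidTwice_eq (hL : IsLegs L) (v : H ⊗[k] W) : Q.braidTwice L v = Q.braidProd L v := by
  have hM := Q.isLegs_adLegs 1 hL
  have h2 : Q.Intertwines (Q.adLegs L 1) (Q.adLegs L 1) (Q.braidOn L 2) (1 * 2) (2 * 1) :=
    braidOn_intertwines hL (by decide)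
  have h3 : Q.Intertwines (Q.adLegs L 1) (Q.adLegs L 1) (Q.braidOn L 3) (1 * 3) (3 * 1) :=
    braidOn_intertwines hL (by decide)
  have h23 : Q.Intertwines (Q.adLegs L 1) (Q.adLegs L 1) (Q.braidOn L (2 * 3)) (1 * (2 * 3))
      (2 * 3 * 1) := braidOn_intertwines hL (by decide)
  have hc := fun s t (h : SameLegs s t) => intertwines_can (Q := Q) hM h
  let L' : ℕ → H →ₗ[k] Module.End k (H ⊗[k] W) := headLegs (Algebra.lmul k H) 4 L
  have hL' : IsLegs (B := Module.End k (H ⊗[k] W)) L' := isLegs_headLegs hL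
  have hM' := Q.isLegs_adLegs 1 hL'
  let j := lTensor H (TensorProduct.mk k H W 1)
  have hj : ∀ s t, SameLegs s t ∧ 4 ∉ s.leaves → ∀ v, j (canV (Q.adLegs L 1) s t v) =
      canV (Q.adLegs L' 1) s t (j v) := fun s t h v =>
    can_natural hM hM' h.1 (fun i hi => lTensor_headLegs fun _ x w => by
      have hi' : i ≠ 4 := fun h' => h.2 (h' ▸ hi)
      change 1 ⊗ₜ _ = headLegs (Algebra.lmul k H) 4 L i x (1 ⊗ₜ w)
      rw [headLegs_of_ne hi']
      rfl) v
  have hb : ∀ (s : LegTree) v, 4 ∉ s.leaves → j (Q.braidOn L s v) = Q.braidOn L' s (j v) :=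
    fun s v hs => (braidOn_natural (fun x w => (ev_headLegs_tmul hs x 1 w).symm) v).symm
  refine eq_of_probe_eq (Q := Q) (r := 2 * 3) (n := 1) (m := 4) (b := 1 * 2 * 3) (L' := Q.adLegs L 1) hL
    (by decide) (fun x v => ?_) (fun x v => ?_) (fun v => ?_) v
  · simp only [braidTwice, comp_apply]
    rw [(h2.extend hM (1 * 2 * 3) (2 * 1 * 3) (by decide)).block, (hc _ _ (by decide)).block,
      (h3.extend hM (2 * (1 * 3)) (2 * (3 * 1)) (by decide)).block, (hc _ _ (by decide)).block]
    rfl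
  · simp only [braidProd, comp_apply]
    rw [(hc _ _ (by decide)).block, h23.block]
    rfl
  · have e1 : j (Q.braidTwice L v) = Q.braidTwice L' (j v) := by
      simp only [braidTwice, comp_apply]
      rw [hj _ _ (by decide), hb _ _ (by decide), hj _ _ (by decide), hb _ _ (by decide)]
    have e2 : j (Q.braidProd L v) = Q.braidProd L' (j v) := by
      simp only [braidProd, comp_apply]
      rw [hb _ _ (by decide), hj _ _ (by decide)]
    have e3 := (actOn_braidTwice (Q := Q) hL' (j v)).trans (actOn_braidProd hL' (j v)).symm
    rw [← e1, ← e2] at e3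
    exact e3

end Hexagon

variable (Q) in
/-- The legs of the regular module: the leg `n` acts by multiplication, the others trivially. -/
def regLegs (n : ℕ) : ℕ → H →ₗ[k] Module.End k H := fun i =>
  if i = n then (Algebra.lmul k H).toLinearMap
  else LinearMap.toSpanSingleton k (Module.End k H) 1 ∘ₗ Q.counit.toLinearMap

lemma regLegs_self (n : ℕ) (x y : H) : Q.regLegs n n x y = x * y := by simp [regLegs]

lemma regLegs_of_ne {n i : ℕ} (h : i ≠ n) (x : H) : Q.regLegs n i x = Q.counit x • 1 := by
  simp [regLegs, h]

lemma isLegs_regLegs (n : ℕ) : IsLegs (Q.regLegs n) where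
  one i := by
    by_cases h : i = n
    · subst h; ext; simp [regLegs_self]
    · simp [regLegs_of_ne h]
  mul i x y := by
    by_cases h : i = n
    · subst h; ext; simp [regLegs_self, mul_assoc]
    · rw [regLegs_of_ne h, regLegs_of_ne h, regLegs_of_ne h, map_mul]
      simp [mul_smul, smul_comm (Q.counit x)]
  comm i j hij x y := by
    by_cases h : i = n
    · rw [regLegs_of_ne (i := j) (by omega)]
      exact (Commute.one_right _).smul_right _
    · rw [regLegs_of_ne h]
      exact (Commute.one_left _).smul_left _

lemma exists_regLegs₂ (Q : QuasiHopfAlgebra k H) :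
    ∃ L : ℕ → H →ₗ[k] Module.End k (H ⊗[k] H), IsLegs L ∧
    (∀ x y z : H, L 2 x (y ⊗ₜ z) = (x * y) ⊗ₜ z) ∧ ∀ x y z : H, L 3 x (y ⊗ₜ z) = y ⊗ₜ (x * z) := by
  refine ⟨headLegs (Algebra.lmul k H) 2 (Q.regLegs 3), isLegs_headLegs (isLegs_regLegs 3),
    fun x y z => headLegs_self _ _ _, fun x y z => ?_⟩
  rw [headLegs_of_ne (by decide), lTensor_tmul, regLegs_self]

/-- The hexagon `braidTwice_eq`, evaluated on `1 ⊗ 1` in two regular modules, is the compatibility of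
the coaction with `φ`. -/
lemma isYetterDrinfeld_adjoint [Module.Finite k H] : Q.adjoint.IsYetterDrinfeld Q where
  coact_coact a := by
    obtain ⟨L, hL, h2, h3⟩ := exists_regLegs₂ Q
    have hM := Q.isLegs_adLegs 1 hL
    let σ : H ⊗[k] (H ⊗[k] H) →ₗ[k] H ⊗[k] (H ⊗[k] H) :=
      (TensorProduct.assoc k H H H).toLinearMap ∘ₗ (TensorProduct.comm k H (H ⊗[k] H)).toLinearMap
    have hσ : ∀ x y z : H, σ (x ⊗ₜ (y ⊗ₜ z)) = y ⊗ₜ (z ⊗ₜ x) := fun _ _ _ => rfl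
    clear_value σ
    have key := congrArg σ (congrArg (canV (Q.adLegs L 1) (2 * 3 * 1) (2 * (3 * 1)))
      (braidTwice_eq (Q := Q) hL (a ⊗ₜ (1 ⊗ₜ 1))))
    simp only [braidTwice, braidProd, comp_apply] at key
    rw [can_trans_apply hM _ (by decide) (by decide), can_self_apply hM (by decide),
      can_assoc' hM (by decide), can_assoc' hM (by decide), can_assoc' hM (by decide), ph, ph, ph,
      braidOn_tmul] at key
    have hp : ∀ (p q r a : H) (u : H ⊗[k] H), Q.place (B := Module.End k _) (Q.adLegs L 1) 1 2 3
        (p ⊗ₜ (q ⊗ₜ r)) (a ⊗ₜ u) = Q.adjointAct p a ⊗ₜ L 2 q (L 3 r u) := fun p q r a u => by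
      change headLegs Q.adjointAct 1 L 1 p (headLegs Q.adjointAct 1 L 2 q
        (headLegs Q.adjointAct 1 L 3 r (a ⊗ₜ u))) = _
      rw [headLegs_of_ne (i := 3) (by decide), headLegs_of_ne (i := 2) (by decide),
        lTensor_tmul, lTensor_tmul, headLegs_self]
    have hp' : ∀ (p q r a : H) (u : H ⊗[k] H), Q.place (B := Module.End k _) (Q.adLegs L 1) 2 1 3
        (p ⊗ₜ (q ⊗ₜ r)) (a ⊗ₜ u) = Q.adjointAct q a ⊗ₜ L 2 p (L 3 r u) := fun p q r a u => by
      change headLegs Q.adjointAct 1 L 2 p (headLegs Q.adjointAct 1 L 1 q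
        (headLegs Q.adjointAct 1 L 3 r (a ⊗ₜ u))) = _
      rw [headLegs_of_ne (i := 3) (by decide), headLegs_of_ne (i := 2) (by decide),
        lTensor_tmul, headLegs_self, lTensor_tmul]
    have hp'' : ∀ (p q r a : H) (u : H ⊗[k] H), Q.place (B := Module.End k _) (Q.adLegs L 1) 2 3 1
        (p ⊗ₜ (q ⊗ₜ r)) (a ⊗ₜ u) = Q.adjointAct r a ⊗ₜ L 2 p (L 3 q u) := fun p q r a u => by
      change headLegs Q.adjointAct 1 L 2 p (headLegs Q.adjointAct 1 L 3 q
        (headLegs Q.adjointAct 1 L 1 r (a ⊗ₜ u))) = _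
      rw [headLegs_of_ne (i := 3) (by decide), headLegs_of_ne (i := 2) (by decide),
        headLegs_self, lTensor_tmul, lTensor_tmul]
    have h3' : ∀ x y z : H, Q.ev L 3 x (y ⊗ₜ z) = y ⊗ₜ (x * z) := h3
    have h2' : ∀ x y z : H, Q.ev L 2 x (y ⊗ₜ z) = (x * y) ⊗ₜ z := h2
    have h23 : ∀ (x : H) u, Q.ev L (2 * 3) x u = Q.comul x * u := fun x u => by
      rw [ev_node']
      generalize Q.comul x = s
      apply tensor_ind₂ s; intro x y
      apply tensor_ind₂ u; intro b c
      rw [pw_tmul, Module.End.mul_apply, h3', h2', tmul_mul_tmul]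
    refine Eq.trans (LinearMap.congr_fun (?_ : _ = σ ∘ₗ Q.braidOn L 3 ∘ₗ
      LinearMap.applyₗ (Q.moveMap L 2 (Q.adjointCoact a) (1 ⊗ₜ 1)) ∘ₗ
      Q.place (B := Module.End k _) (Q.adLegs L 1) 2 1 3) Q.phi.val) (key.trans (Eq.symm
      (LinearMap.congr_fun (?_ : _ = σ ∘ₗ
      Q.place (B := Module.End k _) (Q.adLegs L 1) 2 3 1 Q.phi.val ∘ₗ Q.braidOn L (2 * 3) ∘ₗ LinearMap.applyₗ (a ⊗ₜ (1 ⊗ₜ 1)) ∘ₗ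
      Q.place (B := Module.End k _) (Q.adLegs L 1) 1 2 3) Q.phi.val)))
    · refine LinearMap.ext fun φ => ?_
      apply tensor_ind₃ φ; intro p q r
      change TensorProduct.map (LinearMap.mul k H p) (TensorProduct.map
        ((LinearMap.mul k H).flip r) LinearMap.id ∘ₗ Q.adjointCoact ∘ₗ Q.adjointAct q)
        (Q.adjointCoact a) = σ (Q.braidOn L 3 (Q.place (B := Module.End k _) (Q.adLegs L 1) 2 1 3
          (p ⊗ₜ (q ⊗ₜ r)) (Q.moveMap L 2 (Q.adjointCoact a) (1 ⊗ₜ 1))))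
      generalize Q.adjointCoact a = u
      apply tensor_ind₂ u; intro x b
      rw [moveMap_tmul, h2', hp', h3, h2, braidOn_tmul, TensorProduct.map_tmul,
        comp_apply, comp_apply]
      generalize Q.adjointCoact (Q.adjointAct q b) = u
      apply tensor_ind₂ u; intro y c
      rw [moveMap_tmul, h3', hσ]; simp
    · refine LinearMap.ext fun φ => ?_
      apply tensor_ind₃ φ; intro p q r
      change actTensor (Algebra.lmul k H) (actTensor (Algebra.lmul k H) Q.adjointAct) Q.phi.val
        (TensorProduct.assoc k H H H (TensorProduct.map ((LinearMap.mul k (H ⊗[k] H)).flip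
          (q ⊗ₜ[k] r) ∘ₗ Q.comul.toLinearMap) LinearMap.id (Q.adjointCoact (Q.adjointAct p a)))) =
        σ (Q.place (B := Module.End k _) (Q.adLegs L 1) 2 3 1 Q.phi.val (Q.braidOn L (2 * 3)
          (Q.place (B := Module.End k _) (Q.adLegs L 1) 1 2 3 (p ⊗ₜ (q ⊗ₜ r))
            (a ⊗ₜ (1 ⊗ₜ 1)))))
      rw [hp, h3, h2, braidOn_tmul, mul_one, mul_one]
      generalize Q.adjointCoact (Q.adjointAct p a) = u
      apply tensor_ind₂ u; intro x b
      rw [moveMap_tmul, h23, TensorProduct.map_tmul]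
      change actTensor _ _ _ (TensorProduct.assoc k H H H ((Q.comul x * _) ⊗ₜ b)) = _
      generalize Q.comul x * q ⊗ₜ r = u
      generalize Q.phi.val = φ
      apply tensor_ind₂ u; intro y z
      apply tensor_ind₃ φ; intro p q r
      rw [hp'', h3, h2, hσ, TensorProduct.assoc_tmul, actTensor_tmul, actTensor_tmul]
      rfl
  counit_coact a := by
    refine Eq.trans ?_ (Q.counitId_adjointCoact a)
    rfl
  act_coact h a := by
    refine (Q.tensorAct_adjointCoact h a).trans ?_
    generalize Q.comul h = u
    apply tensor_ind₂ u; intro x y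
    change Q.adjointCoact (Q.adContr a (Q.comul x)) * inL y =
      TensorProduct.map ((LinearMap.mul k H).flip y) LinearMap.id
        (Q.adjointCoact (Q.adjointAct x a))
    rw [← adjointAct_apply]
    generalize Q.adjointCoact _ = u
    apply tensor_ind₂ u; intro y c
    simp

end QuasiHopfAlgebra

namespace QuasiHopfAlgebra

variable {k H : Type*} [Field k] [Ring H] [Algebra k H] {Q : QuasiHopfAlgebra k H}

local notation "canV" => QuasiHopfAlgebra.can (B := Module.End k _) Q
local notation "evV" => QuasiHopfAlgebra.ev (B := Module.End k _) Q

section Mul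
variable {V W : Type*} [AddCommGroup V] [Module k V] [AddCommGroup W] [Module k W]
  [Module.Finite k H] {L : ℕ → H →ₗ[k] Module.End k W}

variable (Q L) in
/-- Two successive actions of `A ⊗ A` on the block `t`. -/
def actTwice (t : LegTree) : H ⊗[k] (H ⊗[k] W) →ₗ[k] W :=
  Q.actOn L t ∘ₗ lTensor H (Q.actOn L t)

variable (Q L) in
/-- Braiding the product of two copies `1`, `2` of `A` past the leg `3`, one copy after the
other. -/
def braidFactors : H ⊗[k] (H ⊗[k] W) →ₗ[k] H ⊗[k] (H ⊗[k] W) :=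
  canV (Q.adLegs (Q.adLegs L 2) 1) (3 * 1 * 2) (3 * (1 * 2)) ∘ₗ Q.braidOn (Q.adLegs L 2) 3 ∘ₗ
    canV (Q.adLegs (Q.adLegs L 2) 1) (1 * (3 * 2)) (1 * 3 * 2) ∘ₗ
    lTensor H (Q.braidOn L 3) ∘ₗ
    canV (Q.adLegs (Q.adLegs L 2) 1) (1 * 2 * 3) (1 * (2 * 3))

omit [Module.Finite k H] in
lemma braidFactors_natural {L' : ℕ → H →ₗ[k] Module.End k V} (hL : IsLegs L) (hL' : IsLegs L')
    {f : V →ₗ[k] W} (hf : ∀ x v, f (L' 3 x v) = L 3 x (f v)) (v : H ⊗[k] (H ⊗[k] V)) :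
    Q.braidFactors L (lTensor H (lTensor H f) v) =
      lTensor H (lTensor H f) (Q.braidFactors L' v) := by
  have hN := Q.isLegs_adLegs 1 (Q.isLegs_adLegs 2 hL)
  have hN' := Q.isLegs_adLegs 1 (Q.isLegs_adLegs 2 hL')
  let j := lTensor H (lTensor H f)
  have hj : ∀ s t, SameLegs s t ∧ (∀ i ∈ s.leaves, i = 1 ∨ i = 2 ∨ i = 3) → ∀ v,
      j (canV (Q.adLegs (Q.adLegs L' 2) 1) s t v) = canV (Q.adLegs (Q.adLegs L 2) 1) s t (j v) :=
    fun s t h v => can_natural hN' hN h.1 (fun n hn => lTensor_headLegs fun h1 =>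
      lTensor_headLegs fun h2 x w => by
        obtain rfl : n = 3 := by have := h.2 n hn; tauto
        exact hf x w) v
  have e3 : ∀ u, j (Q.braidOn (Q.adLegs L' 2) 3 u) = Q.braidOn (Q.adLegs L 2) 3 (j u) :=
    fun u => (braidOn_natural (L := Q.adLegs L 2) (t := 3)
      (lTensor_headLegs (i := 3) fun _ => hf) u).symm
  have e4 : ∀ u, j (lTensor H (Q.braidOn L' 3) u) =
      lTensor H (Q.braidOn L 3) (j u) := fun u => by
    simp only [j, ← comp_apply, ← LinearMap.lTensor_comp]
    congr 2
    exact LinearMap.ext fun w => (braidOn_natural hf w).symm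
  simp only [braidFactors, comp_apply]
  change _ = j _
  rw [hj _ _ (by decide), e3, hj _ _ (by decide), e4, hj _ _ (by decide)]

lemma braidFactors_intertwines (hL : IsLegs L) :
    Q.Intertwines (Q.adLegs (Q.adLegs L 2) 1) (Q.adLegs (Q.adLegs L 2) 1) (Q.braidFactors L)
      (1 * 2 * 3) (3 * (1 * 2)) := by
  have hM2 := Q.isLegs_adLegs 2 hL
  have hN := Q.isLegs_adLegs 1 hM2
  have h1 : Q.Intertwines (Q.adLegs (Q.adLegs L 2) 1) (Q.adLegs (Q.adLegs L 2) 1)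
      (Q.braidOn (Q.adLegs L 2) 3) (1 * 3) (3 * 1) := braidOn_intertwines hM2 (by decide)
  have h2 : Q.Intertwines (Q.adLegs (Q.adLegs L 2) 1) (Q.adLegs (Q.adLegs L 2) 1)
      (lTensor H (Q.braidOn L 3)) (2 * 3) (3 * 2) :=
    (braidOn_intertwines (t := 3) hL (by decide)).lTensor (by decide)
  exact (intertwines_can hN (by decide)).comp ((h1.extend hN (1 * 3 * 2) (3 * 1 * 2)
    (by decide)).comp ((intertwines_can hN (by decide)).comp ((h2.extend hN (1 * (2 * 3))
    (1 * (3 * 2)) (by decide)).comp (intertwines_can hN (by decide)) (by decide)) (by decide))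
    (by decide)) (by decide)

lemma actOn_braidOn_mulOn (hL : IsLegs L) (v : H ⊗[k] (H ⊗[k] W)) :
    Q.actOn L 4 (canV (Q.adLegs L 1) (3 * 1 * 4) (3 * (1 * 4)) (Q.braidOn L 3 (Q.mulOn W v))) =
      Q.actTwice L (3 * 4) (canV (Q.adLegs (Q.adLegs L 2) 1) (1 * 2 * 3 * 4)
        (1 * (2 * (3 * 4))) v) := by
  have hM := Q.isLegs_adLegs 1 hL
  have hN := Q.isLegs_adLegs 1 (Q.isLegs_adLegs 2 hL)
  have hm : Q.Intertwines (Q.adLegs (Q.adLegs L 2) 1) (Q.adLegs L 1) (Q.mulOn W) (1 * 2) 1 :=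
    mulOn_intertwines (by decide)
  refine (actOn_braidOn (n := 1) (s := 3) (t := 4) hL (by decide) _).trans ?_
  change Q.actOn L (3 * 4) (canV (Q.adLegs L 1) (1 * 3 * 4) (1 * (3 * 4)) _) = _
  rw [← hm.can hN hM (1 * 3 * 4) (1 * (3 * 4)) (s := 1 * 2 * 3 * 4) (t := 1 * 2 * (3 * 4))
    (by decide)]
  refine (actOn_mulOn (n := 1) (m := 2) (t := 3 * 4) hL (by decide) _).trans ?_
  change Q.actTwice L (3 * 4) (canV (Q.adLegs (Q.adLegs L 2) 1) (1 * 2 * (3 * 4))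
    (1 * (2 * (3 * 4))) _) = _
  rw [can_trans_apply hN _ (by decide) (by decide)]

lemma actOn_mulOn_braidFactors (hL : IsLegs L) (v : H ⊗[k] (H ⊗[k] W)) :
    Q.actOn L 4 (canV (Q.adLegs L 1) (3 * 1 * 4) (3 * (1 * 4))
        (Q.mulOn W (Q.braidFactors L v))) =
      Q.actTwice L (3 * 4) (canV (Q.adLegs (Q.adLegs L 2) 1) (1 * 2 * 3 * 4)
        (1 * (2 * (3 * 4))) v) := by
  have hM := Q.isLegs_adLegs 1 hL
  have hM2 := Q.isLegs_adLegs 2 hL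
  have hN := Q.isLegs_adLegs 1 hM2
  have hm : Q.Intertwines (Q.adLegs (Q.adLegs L 2) 1) (Q.adLegs L 1) (Q.mulOn W) (1 * 2) 1 :=
    mulOn_intertwines (by decide)
  have h1 : Q.Intertwines (Q.adLegs (Q.adLegs L 2) 1) (Q.adLegs (Q.adLegs L 2) 1)
      (Q.braidOn (Q.adLegs L 2) 3) (1 * 3) (3 * 1) := braidOn_intertwines hM2 (by decide)
  have h2 : Q.Intertwines (Q.adLegs (Q.adLegs L 2) 1) (Q.adLegs (Q.adLegs L 2) 1)
      (lTensor H (Q.braidOn L 3)) (2 * 3) (3 * 2) :=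
    (braidOn_intertwines (t := 3) hL (by decide)).lTensor (by decide)
  have h4' : Q.Intertwines (Q.adLegs L 2) L (Q.actOn L 4) (2 * 4) 4 :=
    actOn_intertwines hL (by decide)
  have h4 : Q.Intertwines (Q.adLegs (Q.adLegs L 2) 1) (Q.adLegs L 1)
      (lTensor H (Q.actOn L 4)) (2 * 4) 4 := h4'.lTensor (by decide)
  simp only [braidFactors, comp_apply]
  rw [← hm.can hN hM (3 * 1 * 4) (3 * (1 * 4)) (s := 3 * (1 * 2) * 4) (t := 3 * (1 * 2 * 4))
    (by decide)]
  refine (actOn_mulOn (n := 1) (m := 2) (t := 4) hL (by decide) _).trans ?_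
  change Q.actOn L 4 (lTensor H (Q.actOn L 4) (canV (Q.adLegs (Q.adLegs L 2) 1)
    (1 * 2 * 4) (1 * (2 * 4)) _)) = _
  rw [can_comp hN (3 * (1 * 2) * 4) (3 * (1 * 2 * 4)) (3 * (1 * (2 * 4))) (by decide),
    can_comp hN (3 * 1 * 2 * 4) (3 * (1 * 2) * 4) (3 * (1 * (2 * 4))) (by decide),
    can_split hN (3 * 1 * 2 * 4) (3 * 1 * (2 * 4)) (3 * (1 * (2 * 4))) (by decide),
    ← h1.can hN hN (3 * 1 * 2 * 4) (3 * 1 * (2 * 4)) (s := 1 * 3 * 2 * 4)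
      (t := 1 * 3 * (2 * 4)) (by decide),
    h4.can hN hM (3 * 1 * 4) (3 * (1 * 4)) (by decide),
    ← braidOn_natural (L' := Q.adLegs L 2) (L := L) (f := Q.actOn L 4) (t := 3)
      (h4'.other 3 (by decide) (by decide))]
  refine (actOn_braidOn (n := 1) (s := 3) (t := 4) hL (by decide) _).trans ?_
  change Q.actOn L (3 * 4) (canV (Q.adLegs L 1) (1 * 3 * 4) (1 * (3 * 4)) _) = _
  rw [← h4.can hN hM (1 * 3 * 4) (1 * (3 * 4)) (s := 1 * 3 * (2 * 4)) (t := 1 * (3 * (2 * 4)))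
      (by decide),
    can_trans_apply hN _ (by decide) (by decide),
    can_comp hN (1 * (3 * 2) * 4) (1 * 3 * 2 * 4) (1 * (3 * (2 * 4))) (by decide),
    can_split hN (1 * (3 * 2) * 4) (1 * (3 * 2 * 4)) (1 * (3 * (2 * 4))) (by decide),
    ← h2.can hN hN (1 * (3 * 2) * 4) (1 * (3 * 2 * 4)) (s := 1 * (2 * 3) * 4)
      (t := 1 * (2 * 3 * 4)) (by decide),
    can_comp hN (1 * 2 * 3 * 4) (1 * (2 * 3) * 4) (1 * (2 * 3 * 4)) (by decide),
    ← can_whisker hN (s := 3 * 2 * 4) (t := 3 * (2 * 4)) (1 * (3 * 2 * 4)) _ (by decide)]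
  have e : ∀ u, lTensor H (Q.actOn L 4) (canV (Q.adLegs (Q.adLegs L 2) 1) (3 * 2 * 4)
      (3 * (2 * 4)) (lTensor H (Q.braidOn L 3) u)) =
      lTensor H (Q.actOn L (3 * 4)) (canV (Q.adLegs (Q.adLegs L 2) 1) (2 * 3 * 4)
      (2 * (3 * 4)) u) := fun u => by
    rw [can_headLegs hM2 (by decide) (by decide), can_headLegs hM2 (by decide) (by decide)]
    simp only [← comp_apply, ← LinearMap.lTensor_comp]
    congr 2
    exact LinearMap.ext fun w => actOn_braidOn (n := 2) (s := 3) (t := 4) hL (by decide) w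
  rw [e, can_comp hN (1 * 2 * 3 * 4) (1 * (2 * 3 * 4)) (1 * (2 * (3 * 4))) (by decide)]
  rfl

/-- The product of `A` is compatible with the half-braiding. -/
lemma braidOn_mulOn (hL : IsLegs L) (v : H ⊗[k] (H ⊗[k] W)) :
    Q.braidOn L 3 (Q.mulOn W v) = Q.mulOn W (Q.braidFactors L v) := by
  have hM := Q.isLegs_adLegs 1 hL
  have hN := Q.isLegs_adLegs 1 (Q.isLegs_adLegs 2 hL)
  have hm : Q.Intertwines (Q.adLegs (Q.adLegs L 2) 1) (Q.adLegs L 1) (Q.mulOn W) (1 * 2) 1 :=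
    mulOn_intertwines (by decide)
  have h0 : Q.Intertwines (Q.adLegs L 1) (Q.adLegs L 1) (Q.braidOn L 3) (1 * 3) (3 * 1) :=
    braidOn_intertwines hL (by decide)
  have hB := braidFactors_intertwines (Q := Q) hL
  let L' : ℕ → H →ₗ[k] Module.End k (H ⊗[k] W) := headLegs (Algebra.lmul k H) 4 L
  have hL' : IsLegs (B := Module.End k (H ⊗[k] W)) L' := isLegs_headLegs hL
  let i : W →ₗ[k] H ⊗[k] W := TensorProduct.mk k H W 1
  let j := lTensor H (lTensor H i)
  have hi : ∀ (s : LegTree) (x : H) (w : W), 4 ∉ s.leaves → i (Q.ev L s x w) = evV L' s x (i w) :=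
    fun s x w hs => (ev_headLegs_tmul hs x 1 w).symm
  refine eq_of_probe_eq (Q := Q) (r := 3) (n := 1) (m := 4) (b := 1 * 2 * 3) (L := L)
    (L' := Q.adLegs (Q.adLegs L 2) 1) hL (by decide) (F := Q.braidOn L 3 ∘ₗ Q.mulOn W)
    (G := Q.mulOn W ∘ₗ Q.braidFactors L) (fun x v => ?_) (fun x v => ?_) (fun v => ?_) v
  · rw [comp_apply, (hm.extend hM (1 * 2 * 3) (1 * 3) (by decide)).block, h0.block]
    rfl
  · rw [comp_apply, hB.block, (hm.extend hM (3 * (1 * 2)) (3 * 1) (by decide)).block]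
    rfl
  · have e1 : lTensor H i (Q.braidOn L 3 (Q.mulOn W v)) =
        Q.braidOn L' 3 (Q.mulOn _ (j v)) := by
      rw [← braidOn_natural (L := L') (t := 3) fun x w => hi 3 x w (by decide), ← mulOn_natural]
    have e2 : lTensor H i (Q.mulOn W (Q.braidFactors L v)) =
        Q.mulOn _ (Q.braidFactors L' (j v)) := by
      rw [← mulOn_natural, ← braidFactors_natural hL' hL fun x w => hi 3 x w (by decide)]
    have e3 := (actOn_braidOn_mulOn (Q := Q) hL' (j v)).trans (actOn_mulOn_braidFactors hL' (j v)).symm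
    rw [← e1, ← e2] at e3
    exact e3

end Mul

end QuasiHopfAlgebra

namespace QuasiHopfAlgebra

variable {k H : Type*} [Field k] [Ring H] [Algebra k H] {Q : QuasiHopfAlgebra k H}

local notation "canV" => QuasiHopfAlgebra.can (B := Module.End k _) Q
local notation "evV" => QuasiHopfAlgebra.ev (B := Module.End k _) Q

section Assoc
variable {V W : Type*} [AddCommGroup V] [Module k V] [AddCommGroup W] [Module k W]
  [Module.Finite k H] {L : ℕ → H →ₗ[k] Module.End k W}

omit [Module.Finite k H] in
lemma actOn_mulOn_mulOn (hL : IsLegs L) (v : H ⊗[k] (H ⊗[k] (H ⊗[k] W))) :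
    Q.actOn L 4 (Q.mulOn W (Q.mulOn (H ⊗[k] W) v)) =
      Q.actOn L 4 (Q.mulOn W (lTensor H (Q.mulOn W)
        (canV (Q.adLegs (Q.adLegs (Q.adLegs L 3) 2) 1) (1 * 2 * 3) (1 * (2 * 3)) v))) := by
  have hM3 := Q.isLegs_adLegs 3 hL
  have hM2 := Q.isLegs_adLegs 2 hL
  have hM23 := Q.isLegs_adLegs 2 hM3
  have hM12 := Q.isLegs_adLegs 1 hM2
  have hM13 := Q.isLegs_adLegs 1 hM3
  have hN := Q.isLegs_adLegs 1 hM23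
  have h12 : Q.Intertwines (Q.adLegs (Q.adLegs (Q.adLegs L 3) 2) 1) (Q.adLegs (Q.adLegs L 3) 1)
      (Q.mulOn (H ⊗[k] W)) (1 * 2) 1 := mulOn_intertwines (by decide)
  have h23 : Q.Intertwines (Q.adLegs (Q.adLegs (Q.adLegs L 3) 2) 1) (Q.adLegs (Q.adLegs L 2) 1)
      (lTensor H (Q.mulOn W)) (2 * 3) 2 :=
    Intertwines.lTensor (mulOn_intertwines (by decide)) (by decide)
  have h34 : Q.Intertwines (Q.adLegs (Q.adLegs (Q.adLegs L 3) 2) 1) (Q.adLegs (Q.adLegs L 2) 1)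
      (lTensor H (lTensor H (Q.actOn L 4))) (3 * 4) 4 :=
    Intertwines.lTensor (Intertwines.lTensor (actOn_intertwines hL (by decide)) (by decide))
      (by decide)
  trans Q.actOn L 4 (lTensor H (Q.actOn L 4)
    (lTensor H (lTensor H (Q.actOn L 4))
      (canV (Q.adLegs (Q.adLegs (Q.adLegs L 3) 2) 1) (1 * 2 * 3 * 4) (1 * (2 * (3 * 4))) v)))
  · refine (actOn_mulOn (n := 1) (m := 3) (t := 4) hL (by decide) _).trans ?_
    change Q.actOn L 4 (lTensor H (Q.actOn L 4) (canV (Q.adLegs (Q.adLegs L 3) 1)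
      (1 * 3 * 4) (1 * (3 * 4)) _)) = _
    rw [← h12.can hN hM13 (1 * 3 * 4) (1 * (3 * 4)) (s := 1 * 2 * 3 * 4) (t := 1 * 2 * (3 * 4))
      (by decide), ← mulOn_natural]
    refine (actOn_mulOn (n := 1) (m := 2) (t := 4) hL (by decide) _).trans ?_
    change Q.actOn L 4 (lTensor H (Q.actOn L 4) (canV (Q.adLegs (Q.adLegs L 2) 1)
      (1 * 2 * 4) (1 * (2 * 4)) _)) = _
    rw [← h34.can hN hM12 (1 * 2 * 4) (1 * (2 * 4)) (s := 1 * 2 * (3 * 4)) (t := 1 * (2 * (3 * 4)))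
      (by decide), can_trans_apply hN _ (by decide) (by decide)]
  · refine ((actOn_mulOn (n := 1) (m := 2) (t := 4) hL (by decide) _).trans ?_).symm
    change Q.actOn L 4 (lTensor H (Q.actOn L 4) (canV (Q.adLegs (Q.adLegs L 2) 1)
      (1 * 2 * 4) (1 * (2 * 4)) _)) = _
    have e : ∀ u, lTensor H (Q.actOn L 4) (lTensor H (Q.mulOn W) u) =
        lTensor H (Q.actOn L 4) (lTensor H (lTensor H (Q.actOn L 4))
          (canV (Q.adLegs (Q.adLegs (Q.adLegs L 3) 2) 1) (2 * 3 * 4) (2 * (3 * 4)) u)) := fun u => by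
      rw [can_headLegs hM23 (by decide) (by decide)]
      simp only [← comp_apply, ← LinearMap.lTensor_comp]
      congr 2
      exact LinearMap.ext fun w => actOn_mulOn (n := 2) (m := 3) (t := 4) hL (by decide) w
    rw [← h23.can hN hM12 (1 * 2 * 4) (1 * (2 * 4)) (s := 1 * (2 * 3) * 4) (t := 1 * (2 * 3 * 4))
      (by decide), e,
      can_comp hN (1 * (2 * 3) * 4) (1 * (2 * 3 * 4)) (1 * (2 * (3 * 4))) (by decide),
      can_comp hN (1 * 2 * 3 * 4) (1 * (2 * 3) * 4) (1 * (2 * (3 * 4))) (by decide)]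

end Assoc

lemma adjointMul_assoc [Module.Finite k H] :
    Q.adjointMul ∘ₗ TensorProduct.map Q.adjointMul LinearMap.id =
    Q.adjointMul ∘ₗ TensorProduct.map LinearMap.id Q.adjointMul ∘ₗ
      Q.associatorHom Q.adjointAct Q.adjointAct Q.adjointAct := by
  let L := Q.regLegs 4
  have hL : IsLegs L := isLegs_regLegs (Q := Q) 4
  have hM3 := Q.isLegs_adLegs 3 hL
  have hM12 := Q.isLegs_adLegs 1 (Q.isLegs_adLegs 2 hL)
  have hM13 := Q.isLegs_adLegs 1 hM3
  have hM1 := Q.isLegs_adLegs 1 hL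
  have hN := Q.isLegs_adLegs 1 (Q.isLegs_adLegs 2 hM3)
  let N := Q.adLegs (Q.adLegs (Q.adLegs L 3) 2) 1
  have h12 : Q.Intertwines N (Q.adLegs (Q.adLegs L 3) 1) (Q.mulOn (H ⊗[k] H)) (1 * 2) 1 :=
    mulOn_intertwines (by decide)
  have h13 : Q.Intertwines (Q.adLegs (Q.adLegs L 3) 1) (Q.adLegs L 1) (Q.mulOn H) (1 * 3) 1 :=
    mulOn_intertwines (by decide)
  have h12' : Q.Intertwines (Q.adLegs (Q.adLegs L 2) 1) (Q.adLegs L 1) (Q.mulOn H) (1 * 2) 1 :=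
    mulOn_intertwines (by decide)
  have h23 : Q.Intertwines N (Q.adLegs (Q.adLegs L 2) 1)
      (lTensor H (Q.mulOn H)) (2 * 3) 2 :=
    Intertwines.lTensor (mulOn_intertwines (by decide)) (by decide)
  refine TensorProduct.ext_threefold fun a b c => eq_of_toReg_eq Q fun x => ?_
  let v : H ⊗[k] (H ⊗[k] (H ⊗[k] H)) := a ⊗ₜ (b ⊗ₜ (c ⊗ₜ 1))
  have e0 : ∀ f : H, Q.toReg (Q.adjointAct x f) = Q.actOn L 4 (evV (Q.adLegs L 1) 1 x (f ⊗ₜ 1)) := by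
    intro f
    rw [show evV (Q.adLegs L 1) 1 x (f ⊗ₜ 1) = _ from headLegs_self x f 1, actOn_tmul]
    exact ((regLegs_self (Q := Q) 4 _ _).trans (mul_one _)).symm
  have e1 : Q.mulOn H (lTensor H (Q.mulOn H) (canV N (1 * 2 * 3) (1 * (2 * 3)) v)) =
      Q.adjointMul (TensorProduct.map LinearMap.id Q.adjointMul
        (Q.associatorHom Q.adjointAct Q.adjointAct Q.adjointAct ((a ⊗ₜ b) ⊗ₜ c))) ⊗ₜ 1 := by
    rw [can_assoc' hN (by decide), ph, associatorHom, comp_apply]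
    change _ = Q.adjointMul (TensorProduct.map LinearMap.id Q.adjointMul
      (actTensor _ _ Q.phi.val (a ⊗ₜ (b ⊗ₜ c)))) ⊗ₜ 1
    generalize Q.phi.val = φ
    apply tensor_ind₃ φ; intro p q r
    have e2 : Q.place N 1 2 3 (p ⊗ₜ (q ⊗ₜ r)) v =
        Q.adjointAct p a ⊗ₜ (Q.adjointAct q b ⊗ₜ (Q.adjointAct r c ⊗ₜ 1)) := by
      change N 1 p (N 2 q (N 3 r v)) = _
      simp only [N, v]
      rw [headLegs_of_ne (i := 3) (by decide), headLegs_of_ne (i := 2) (by decide),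
        lTensor_tmul, headLegs_of_ne (i := 3) (by decide), lTensor_tmul,
        headLegs_self, lTensor_tmul, headLegs_self, headLegs_self]
    rw [e2]
    simp [actTensor_tmul]
  have e3 : Q.mulOn H (Q.mulOn (H ⊗[k] H) v) =
      Q.adjointMul (TensorProduct.map Q.adjointMul LinearMap.id ((a ⊗ₜ b) ⊗ₜ c)) ⊗ₜ 1 := rfl
  rw [e0, e0, comp_apply, comp_apply, comp_apply, ← e1, ← e3,
    ← h13.block, ← (h12.extend hM13 (1 * 2 * 3) (1 * 3) (by decide)).block, ← h12'.block,
    ← (h23.extend hM12 (1 * (2 * 3)) (1 * 2) (by decide)).block,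
    ← (intertwines_can hN (b := 1 * 2 * 3) (b' := 1 * (2 * 3)) (by decide)).block]
  exact actOn_mulOn_mulOn hL _

section Coaction
variable [Module.Finite k H]

omit [Module.Finite k H] in
lemma adjoint_braid_regLegs (u : H ⊗[k] H) : Q.adjoint.braid (Algebra.lmul k H) u =
    TensorProduct.comm k H H (Q.braidOn (Q.regLegs 3) 3 u) := by
  apply tensor_ind₂ u; intro a y
  rw [braidOn_tmul]
  change TensorProduct.map (LinearMap.applyₗ y ∘ₗ (Algebra.lmul k H).toLinearMap) LinearMap.id
    (Q.adjointCoact a) = _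
  generalize Q.adjointCoact a = u
  apply tensor_ind₂ u; intro x b
  rw [moveMap_tmul, show Q.ev (Q.regLegs 3) 3 x y = x * y from regLegs_self 3 x y]
  rfl

omit [Module.Finite k H] in
lemma tensor_coact (a b : H) : (YDData.tensor Q Q.adjoint Q.adjoint).coact (a ⊗ₜ b) =
    TensorProduct.comm k (H ⊗[k] H) H ((TensorProduct.assoc k H H H).symm
      (Q.braidFactors (Q.regLegs 3) (a ⊗ₜ (b ⊗ₜ 1)))) := by
  have hL := isLegs_regLegs (Q := Q) 3
  have hN := Q.isLegs_adLegs 1 (Q.isLegs_adLegs 2 hL)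
  let N := Q.adLegs (Q.adLegs (Q.regLegs 3) 2) 1
  have n1 : ∀ x a b y, N 1 x (a ⊗ₜ (b ⊗ₜ y)) = Q.adjointAct x a ⊗ₜ (b ⊗ₜ y) := fun x a b y =>
    headLegs_self _ _ _
  have n2 : ∀ x a b y, N 2 x (a ⊗ₜ (b ⊗ₜ y)) = a ⊗ₜ (Q.adjointAct x b ⊗ₜ y) := fun x a b y => by
    simp only [N]
    rw [headLegs_of_ne (by decide), lTensor_tmul, headLegs_self]
  have n3 : ∀ x a b y, N 3 x (a ⊗ₜ (b ⊗ₜ y)) = a ⊗ₜ (b ⊗ₜ (x * y)) := fun x a b y => by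
    simp only [N]
    rw [headLegs_of_ne (by decide), lTensor_tmul, headLegs_of_ne (by decide),
      lTensor_tmul, regLegs_self]
  let τ₁ : H ⊗[k] (H ⊗[k] H) →ₗ[k] H ⊗[k] (H ⊗[k] H) :=
    lTensor H (TensorProduct.comm k H H).toLinearMap
  let τ₂ := (TensorProduct.assoc k H H H).symm.toLinearMap ∘ₗ τ₁
  let τ₃ := rTensor H (TensorProduct.comm k H H).toLinearMap ∘ₗ τ₂
  have s1 : Q.associatorHom Q.adjointAct Q.adjointAct (Algebra.lmul k H) ((a ⊗ₜ b) ⊗ₜ 1) =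
      canV N (1 * 2 * 3) (1 * (2 * 3)) (a ⊗ₜ (b ⊗ₜ 1)) := by
    rw [can_assoc' hN (by decide), ph]
    change actTensor _ _ Q.phi.val (a ⊗ₜ (b ⊗ₜ 1)) = _
    generalize Q.phi.val = φ
    apply tensor_ind₃ φ; intro p q r
    change _ = N 1 p (N 2 q (N 3 r (a ⊗ₜ (b ⊗ₜ 1))))
    rw [n3, n2, n1, actTensor_tmul, actTensor_tmul]
    rfl
  have s2 : ∀ u, TensorProduct.map LinearMap.id (Q.adjoint.braid (Algebra.lmul k H)) u =
      τ₁ (lTensor H (Q.braidOn (Q.regLegs 3) 3) u) := fun u => by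
    apply tensor_ind₂ u; intro a u
    rw [TensorProduct.map_tmul, adjoint_braid_regLegs]; rfl
  have s3 : ∀ u, Q.associatorInv Q.adjointAct (Algebra.lmul k H) Q.adjointAct (τ₁ u) =
      τ₂ (canV N (1 * (3 * 2)) (1 * 3 * 2) u) := fun u => by
    rw [can_assocInv' hN (by decide), phi']
    simp only [associatorInv, τ₂, comp_apply]
    congr 1
    generalize Q.phiInv = φ
    apply tensor_ind₃ φ; intro p q r
    apply tensor_ind₃ u; intro a b y
    change _ = τ₁ (N 1 p (N 3 q (N 2 r (a ⊗ₜ (b ⊗ₜ y)))))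
    rw [n2, n3, n1]
    change actTensor _ _ _ (a ⊗ₜ (y ⊗ₜ b)) = _
    rw [actTensor_tmul, actTensor_tmul]
    rfl
  have s4 : ∀ u, TensorProduct.map (Q.adjoint.braid (Algebra.lmul k H)) LinearMap.id (τ₂ u) =
      τ₃ (Q.braidOn (Q.adLegs (Q.regLegs 3) 2) 3 u) := fun u => by
    apply tensor_ind₃ u; intro a b y
    change Q.adjoint.braid (Algebra.lmul k H) (a ⊗ₜ y) ⊗ₜ b = _
    rw [adjoint_braid_regLegs, braidOn_tmul, braidOn_tmul]
    generalize Q.adjointCoact a = u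
    apply tensor_ind₂ u; intro x c
    rw [moveMap_tmul, moveMap_tmul, ev_headLegs_tmul (by decide)]
    rfl
  have s5 : ∀ u, Q.associatorHom (Algebra.lmul k H) Q.adjointAct Q.adjointAct (τ₃ u) =
      TensorProduct.comm k (H ⊗[k] H) H ((TensorProduct.assoc k H H H).symm
        (canV N (3 * 1 * 2) (3 * (1 * 2)) u)) := fun u => by
    rw [can_assoc' hN (by decide), ph]
    simp only [associatorHom, comp_apply]
    generalize Q.phi.val = φ
    apply tensor_ind₃ φ; intro p q r
    apply tensor_ind₃ u; intro a b y
    change actTensor _ _ _ (y ⊗ₜ (a ⊗ₜ b)) = TensorProduct.comm k (H ⊗[k] H) H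
      ((TensorProduct.assoc k H H H).symm (N 3 p (N 1 q (N 2 r (a ⊗ₜ (b ⊗ₜ y))))))
    rw [n2, n1, n3, actTensor_tmul, actTensor_tmul]
    rfl
  change Q.associatorHom (Algebra.lmul k H) Q.adjointAct Q.adjointAct (TensorProduct.map
    (Q.adjoint.braid (Algebra.lmul k H)) LinearMap.id (Q.associatorInv Q.adjointAct
    (Algebra.lmul k H) Q.adjointAct (TensorProduct.map LinearMap.id
    (Q.adjoint.braid (Algebra.lmul k H)) (Q.associatorHom Q.adjointAct Q.adjointAct
    (Algebra.lmul k H) ((a ⊗ₜ b) ⊗ₜ 1))))) = _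
  rw [s1, s2, s3, s4, s5]
  rfl

omit [Module.Finite k H] in
lemma adjointCoact_eq_braidOn (c : H) : Q.adjointCoact c =
    TensorProduct.comm k H H (Q.braidOn (Q.regLegs 3) 3 (c ⊗ₜ 1)) := by
  rw [← adjoint_braid_regLegs]
  change _ = TensorProduct.map (LinearMap.applyₗ 1 ∘ₗ (Algebra.lmul k H).toLinearMap) LinearMap.id
    (Q.adjointCoact c)
  generalize Q.adjointCoact c = u
  induction u using tensor_ind₂ with
  | add => intro s t hs ht; simp only [map_add, ← hs, ← ht]
  | tmul x c => simp

lemma adjointMul_isHom : YDData.IsHom (YDData.tensor Q Q.adjoint Q.adjoint) Q.adjoint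
    Q.adjointMul where
  act h := TensorProduct.ext' fun a b => (Q.adjointAct_mul h a b).symm
  coact := TensorProduct.ext' fun a b => by
    have e1 := braidOn_mulOn (Q := Q) (isLegs_regLegs (Q := Q) 3) (a ⊗ₜ[k] (b ⊗ₜ[k] (1 : H)))
    rw [comp_apply, comp_apply, tensor_coact]
    refine (adjointCoact_eq_braidOn _).trans ?_
    rw [← mulOn_tmul, e1]
    generalize Q.braidFactors (Q.regLegs 3) (a ⊗ₜ[k] (b ⊗ₜ[k] (1 : H))) = u
    apply tensor_ind₃ u; intro a b y
    rfl

end Coaction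

end QuasiHopfAlgebra

/-! ### The Frobenius form -/

namespace QuasiHopfAlgebra

variable {k H : Type*} [Field k] [Ring H] [Algebra k H] (Q : QuasiHopfAlgebra k H)

section Form

/-- `S(ψ₁) q₁ ψ₂₁ p₁ ⊗ q₂ ψ₂₂ p₂ S(ψ₃) = α ⊗ β` for `q = q^L`, `p = p^R` and `ψ = φ⁻¹`. -/
lemma qL_comul_pR :
    pw (mulRight k Q.qL ∘ₗ inL ∘ₗ Q.antipode)
      (pw Q.comul.toLinearMap (mulLeft k Q.pR ∘ₗ inR ∘ₗ Q.antipode)) Q.phiInv =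
    Q.alpha ⊗ₜ Q.beta := by
  have hL := Q.isLegs_legs₄
  let E : H ⊗[k] (H ⊗[k] (H ⊗[k] H)) →ₗ[k] H ⊗[k] H :=
    TensorProduct.map Q.contrAlpha Q.contrBeta ∘ₗ (TensorProduct.assoc k H H (H ⊗[k] H)).symm
  have hE : ∀ x y z w : H, E (x ⊗ₜ (y ⊗ₜ (z ⊗ₜ w))) =
      (Q.antipode x * Q.alpha * y) ⊗ₜ (z * Q.beta * Q.antipode w) := fun _ _ _ _ => rfl
  have k12 : ∀ x X, E (Q.ev Q.legs₄ (1 * 2) x * X) = Q.counit x • E X := by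
    intro x X
    apply tensor_ind₄ X; intro a b c d
    exact Q.absorb_left Q.contrAlpha_comul
      (sandwich inL (Q.antipode a ⊗ₜ 1) (b ⊗ₜ (c * Q.beta * Q.antipode d)))
      (by simp [hE, Q.antipode_mul, mul_assoc]) (by simp [hE, mul_assoc]) x
  have k34 : ∀ x X, E (X * Q.ev Q.legs₄ (3 * 4) x) = Q.counit x • E X := by
    intro x X
    apply tensor_ind₄ X; intro a b c d
    exact Q.absorb_right Q.contrBeta_comul
      (sandwich inR ((Q.antipode a * Q.alpha * b) ⊗ₜ c) (1 ⊗ₜ Q.antipode d))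
      (by simp [hE, Q.antipode_mul, mul_assoc]) (by simp [hE, mul_assoc]) x
  have key : ∀ s t u : H ⊗[k] (H ⊗[k] H), pw (mulRight k
      (TensorProduct.map Q.contrAlpha LinearMap.id ((TensorProduct.assoc k H H H).symm s)) ∘ₗ
        inL ∘ₗ Q.antipode) (pw Q.comul.toLinearMap (mulLeft k
      (TensorProduct.map LinearMap.id Q.contrBeta u) ∘ₗ inR ∘ₗ Q.antipode)) t =
      E (Q.place Q.legs₄ 1 2 3 s * Q.place Q.legs₄ 1 (2 * 3) 4 t * Q.place Q.legs₄ 2 3 4 u) := by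
    intro s t u
    apply tensor_ind₃ t; intro t₁ t₂ t₃
    change _ = E (_ * (_ * (pw (Q.legs₄ 2) (Q.legs₄ 3) (Q.comul t₂) * _)) * _)
    rw [pw_tmul, pw_tmul]
    change _ * (Q.comul t₂ * _) = _
    generalize Q.comul t₂ = v
    induction s using tensor_ind₃ with
    | add =>
      intro s t hs ht
      simp only [comp_apply, mulRight_apply, map_add, mul_add, add_mul] at hs ht ⊢
      rw [hs, ht]
    | tmul s₁ s₂ s₃ =>
    induction u using tensor_ind₃ with
    | add =>
      intro s t hs ht
      simp only [comp_apply, mulLeft_apply, map_add, mul_add, add_mul] at hs ht ⊢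
      rw [hs, ht]
    | tmul u₁ u₂ u₃ =>
    apply tensor_ind₂ v; intro v₁ v₂
    simp [place, ev, hE, Q.antipode_mul, mul_assoc]
  have hq : Q.qL = TensorProduct.map Q.contrAlpha LinearMap.id
      ((TensorProduct.assoc k H H H).symm Q.phiInv) := by
    unfold qL
    generalize Q.phiInv = t
    apply tensor_ind₃ t; intro a b c
    rfl
  have hp : Q.pR = TensorProduct.map LinearMap.id Q.contrBeta Q.phiInv := by
    unfold pR
    generalize Q.phiInv = t
    apply tensor_ind₃ t; intro a b c
    rfl
  rw [hq, hp, key]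
  change E (Q.phi' Q.legs₄ 1 2 3 * Q.phi' Q.legs₄ 1 (2 * 3) 4 * Q.phi' Q.legs₄ 2 3 4) = _
  have e : Q.phi' Q.legs₄ 1 2 3 * Q.phi' Q.legs₄ 1 (2 * 3) 4 * Q.phi' Q.legs₄ 2 3 4 =
      Q.can Q.legs₄ (1 * 2 * (3 * 4)) (1 * 2 * 3 * 4) *
        Q.can Q.legs₄ (1 * (2 * (3 * 4))) (1 * 2 * (3 * 4)) := by
    rw [can_trans hL (1 * 2 * (3 * 4)) (by decide) (by decide),
      ← can_trans hL (s := 1 * (2 * (3 * 4))) (u := 1 * 2 * 3 * 4) (1 * (2 * 3 * 4))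
        (by decide) (by decide),
      ← can_trans hL (s := 1 * (2 * 3 * 4)) (u := 1 * 2 * 3 * 4) (1 * (2 * 3) * 4)
        (by decide) (by decide), can_left' hL (by decide), can_right' hL (by decide),
      can_assocInv' hL (by decide), can_assocInv' hL (by decide), can_assocInv' hL (by decide)]
  have e2 := kill_can_left_to (E := E) (s := 1 * 2 * (3 * 4)) (t := 1 * 2 * 3 * 4) (1 * 2) (3 * 4)
    (3 * 4) hL k12 (by decide) (Q.can Q.legs₄ (1 * (2 * (3 * 4))) (1 * 2 * (3 * 4)))
  have e3 := kill_can_right_to (E := E) (s := 1 * (2 * (3 * 4))) (t := 1 * 2 * (3 * 4)) (3 * 4)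
    (1 * 2) (1 * 2) hL k34 (by decide) 1
  rw [e, e2, can_self hL (by decide), one_mul]
  rw [can_self hL (by decide), one_mul, one_mul] at e3
  rw [e3]
  change E (1 ⊗ₜ (1 ⊗ₜ (1 ⊗ₜ 1))) = _
  rw [hE, Q.antipode_one]
  simp

variable {Q}
variable {Lam : H} {lam : Module.Dual k H}

variable (Q lam) in
/-- `x ⊗ y ⊗ z ⊗ w ⊗ t ↦ x K(S(y) α z) S(w) α t` -/
def formMap (K : H →ₗ[k] H) : H ⊗[k] (H ⊗[k] (H ⊗[k] (H ⊗[k] H))) →ₗ[k] H :=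
  pw LinearMap.id (pw (K ∘ₗ Q.contrAlpha) Q.contrAlpha ∘ₗ
    (TensorProduct.assoc k H H (H ⊗[k] H)).symm.toLinearMap)

@[simp] lemma formMap_tmul (K : H →ₗ[k] H) (x y z w t : H) :
    Q.formMap K (x ⊗ₜ (y ⊗ₜ (z ⊗ₜ (w ⊗ₜ t)))) =
      x * (K (Q.antipode y * Q.alpha * z) * (Q.antipode w * Q.alpha * t)) := rfl

variable (Q) in
/-- `x ⊗ y ⊗ z ⊗ w ↦ x K(S(y) α z) S(w)` -/
def formMap₄ (K : H →ₗ[k] H) : H ⊗[k] (H ⊗[k] (H ⊗[k] H)) →ₗ[k] H :=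
  pw LinearMap.id (pw (K ∘ₗ Q.contrAlpha) Q.antipode ∘ₗ
    (TensorProduct.assoc k H H H).symm.toLinearMap)

@[simp] lemma formMap₄_tmul (K : H →ₗ[k] H) (x y z w : H) :
    Q.formMap₄ K (x ⊗ₜ (y ⊗ₜ (z ⊗ₜ w))) =
      x * (K (Q.antipode y * Q.alpha * z) * Q.antipode w) := rfl

lemma formMap_can (K : H →ₗ[k] H) :
    Q.formMap K (Q.can Q.legs₅ (1 * 2 * (3 * 4) * 5) (1 * (2 * (3 * (4 * 5))))) =
      Q.toReg (Q.formMap₄ K (Q.can Q.legs₄ (1 * 2 * (3 * 4)) (1 * (2 * 3) * 4))) := by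
  have hL := Q.isLegs_legs₅
  set E := Q.formMap K with hE
  have k45 : ∀ x X, E (Q.ev Q.legs₅ (4 * 5) x * X) = Q.counit x • E X := by
    intro x X
    apply tensor_ind₅ X; intro p q r s t
    exact Q.absorb_left Q.contrAlpha_comul
      (sandwich LinearMap.id (p * K (Q.antipode q * Q.alpha * r) * Q.antipode s) t)
      (by simp [E, Q.antipode_mul, mul_assoc]) (by simp [E, mul_assoc]) x
  have k23 : ∀ x X, E (Q.ev Q.legs₅ (2 * 3) x * X) = Q.counit x • E X := by
    intro x X
    apply tensor_ind₅ X; intro p q r s t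
    exact Q.absorb_left Q.contrAlpha_comul
      (sandwich K p (Q.antipode s * Q.alpha * t) ∘ₗ sandwich LinearMap.id (Q.antipode q) r)
      (by simp [E, Q.antipode_mul, mul_assoc]) (by simp [E, mul_assoc]) x
  have e : Q.can Q.legs₅ (1 * 2 * (3 * 4)) (1 * (2 * 3) * 4) =
      firstFour₅ (Q.can Q.legs₄ (1 * 2 * (3 * 4)) (1 * (2 * 3) * 4)) := by
    refine ((Q.map_can (L := Q.legs₄) (L' := Q.legs₅) (s := 1 * 2 * (3 * 4))
      (t := 1 * (2 * 3) * 4) firstFour₅ .leaf hL (by decide) (by decide) ?_)).symm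
    intro i hi
    fin_cases hi <;> rfl
  rw [← can_trans hL (u := 1 * (2 * (3 * (4 * 5)))) (1 * (2 * 3) * (4 * 5)) (by decide) (by decide),
    kill_can_left_one (4 * 5) hL k45 (by decide),
    ← can_trans hL (u := 1 * (2 * 3) * (4 * 5)) (1 * (2 * 3) * 4 * 5) (by decide) (by decide),
    kill_can_left_to (2 * 3) (1 * 4 * 5) (1 * (4 * 5)) hL k23 (by decide),
    can_assoc' hL (by decide), can_left' hL (by decide), e, toReg_apply, ph]
  generalize Q.can Q.legs₄ _ _ = s
  generalize Q.phi.val = v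
  apply tensor_ind₃ v; intro u v w
  induction s using tensor_ind₄ with
  | add => intro s t hs ht; simp_all [regMap, mul_add, add_mul]
  | tmul p q r s => simp [E, place, ev, Q.antipode_mul, mul_assoc]

lemma formMap₄_contrFst [Module.Finite k H] (η : Module.Dual k H) :
    Q.formMap₄ (contrFst η ∘ₗ mulRight k Q.pR ∘ₗ mulLeft k Q.VR ∘ₗ
      Q.comul.toLinearMap) (Q.can Q.legs₄ (1 * 2 * (3 * 4)) (1 * (2 * 3) * 4)) =
        η Q.alpha • Q.beta := by
  have hL := Q.isLegs_legs₄
  set K := contrFst η ∘ₗ mulRight k Q.pR ∘ₗ mulLeft k Q.VR ∘ₗ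
      Q.comul.toLinearMap with hK
  have key : ∀ s t, Q.formMap₄ K (Q.place Q.legs₄ 1 2 3 s * Q.place Q.legs₄ (1 * 2) 3 4 t) =
      contrFst η (pw (mulRight k (Q.qLFromVRMap s) ∘ₗ inL ∘ₗ Q.antipode)
        (pw Q.comul.toLinearMap (mulLeft k Q.pR ∘ₗ inR ∘ₗ Q.antipode)) t) := by
    intro s t
    apply tensor_ind₃ t; intro t₁ t₂ t₃
    induction s using tensor_ind₃ with
    | add =>
      intro s t hs ht
      simp only [pw_tmul, comp_apply, mulRight_apply, map_add, mul_add,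
        add_mul] at hs ht ⊢
      rw [hs, ht]
    | tmul s₁ s₂ s₃ =>
      have e : (Q.antipode t₁ ⊗ₜ[k] (1 : H)) * Q.qLFromVRMap (s₁ ⊗ₜ (s₂ ⊗ₜ s₃)) =
          (1 ⊗ₜ s₁) * (pw inR (mulLeft k Q.VR ∘ₗ Q.comul.toLinearMap ∘ₗ Q.antipode)
            (Q.comul t₁) * Q.comul (Q.antipode s₂ * Q.alpha * s₃)) := by
        rw [Q.VR_comul, qLFromVRMap_tmul, tmul_mul_tmul_mul, mul_assoc (_ ⊗ₜ[k] (1 : H)),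
          tmul_mul_tmul_mul]
        simp
      rw [pw_tmul, pw_tmul]
      change Q.formMap₄ K (_ * (pw (Q.legs₄ 1) (Q.legs₄ 2) (Q.comul t₁) * _)) =
        contrFst η ((Q.antipode t₁ ⊗ₜ[k] (1 : H)) * Q.qLFromVRMap (s₁ ⊗ₜ (s₂ ⊗ₜ s₃)) *
          (Q.comul t₂ * (Q.pR * (1 ⊗ₜ Q.antipode t₃))))
      rw [e]
      generalize Q.comul t₁ = v
      apply tensor_ind₂ v; intro v₁ v₂
      simp only [place, ev, pw_tmul, legs₄_one, legs₄_two, legs₄_three, legs₄_four,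
        tmul_mul_tmul, one_mul, mul_one, formMap₄_tmul, Q.antipode_mul,
        comp_apply, inR_apply, mulLeft_apply, mulRight_apply,
        AlgHom.toLinearMap_apply, map_mul, hK]
      simp only [mul_assoc, contrFst_one_tmul_mul]
      simp only [← mul_assoc, contrFst_mul_one_tmul]
  have e : Q.can Q.legs₄ (1 * 2 * (3 * 4)) (1 * (2 * 3) * 4) =
      Q.ph Q.legs₄ 1 2 3 * Q.phi' Q.legs₄ (1 * 2) 3 4 := by
    rw [← can_trans hL (u := 1 * (2 * 3) * 4) (1 * 2 * 3 * 4) (by decide) (by decide),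
      can_assocInv' hL (by decide), can_left' hL (by decide), can_assoc' hL (by decide)]
  rw [e]
  refine (key _ _).trans ?_
  rw [qLFromVRMap_phi, qL_comul_pR]
  simp [contrFst]

/-- The form `λ^cat` is colinear. -/
lemma IsDualTo.contrSnd_catForm [Module.Finite k H] (hd : Q.IsDualTo Lam lam)
    (h : Q.IsLeftIntegral Lam) (h' : Q.IsRightIntegral Lam) (a : H) :
    contrSnd (Q.catForm lam) (Q.adjointCoact a) = Q.catForm lam a • 1 := by
  have hN := hd.antipode_mul h h'
  have hc : ∀ X, contrSnd (Q.catForm lam) (Q.coactMap (Q.comulFInv a) X) =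
      Q.formMap (contrFst (lam ∘ₗ mulLeft k (Q.antipode a)) ∘ₗ
        mulRight k Q.pR ∘ₗ mulLeft k Q.VR ∘ₗ Q.comul.toLinearMap) X := by
    intro X
    apply tensor_ind₅ X; intro x y z w t
    rw [formMap_tmul, coactMap_tmul]
    refine Eq.trans ?_ (congrArg (fun u => x * (u * _))
      (hd.contrFst_VR_pR h h' a (Q.antipode y * Q.alpha * z)).symm)
    rw [← comulFInv_apply]
    generalize Q.comulFInv a = Y
    apply tensor_ind₂ Y; intro u v
    simp [contrSnd, catForm, mul_assoc, hN, antipodeInv_mul]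
  rw [adjointCoact_eq, hc, formMap_can, formMap₄_contrFst, map_smul, toReg_beta, catForm]
  simp [hN]

/-- The form `λ^cat` is linear over `H`. -/
lemma IsDualTo.catForm_adjointAct [Module.Finite k H] (hd : Q.IsDualTo Lam lam)
    (h : Q.IsLeftIntegral Lam) (h' : Q.IsRightIntegral Lam) (x a : H) :
    Q.catForm lam (Q.adjointAct x a) = Q.counit x * Q.catForm lam a := by
  have hN := hd.antipode_mul h h'
  have : ∀ t, Q.catForm lam (Q.adContr a t) = lam (Q.contrAlpha t * Q.antipodeInv a) := by
    intro t
    apply tensor_ind₂ t; intro u v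
    simp [adContr, catForm, mul_assoc, hN, antipodeInv_mul]
  rw [adjointAct_apply, this, contrAlpha_comul]
  simp [catForm]

lemma IsDualTo.form_isHom [Module.Finite k H] (hd : Q.IsDualTo Lam lam)
    (h : Q.IsLeftIntegral Lam) (h' : Q.IsRightIntegral Lam) :
    YDData.IsHom Q.adjoint (YDData.unit Q) (Q.catForm lam) where
  act x := LinearMap.ext fun a => hd.catForm_adjointAct h h' x a
  coact := by
    refine LinearMap.ext fun a => ?_
    have e := hd.contrSnd_catForm h h' a
    change (1 : H) ⊗ₜ Q.catForm lam a = TensorProduct.map LinearMap.id (Q.catForm lam)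
      (Q.adjointCoact a)
    apply (TensorProduct.rid k H).injective
    refine Eq.trans ?_ (Eq.trans e.symm ?_)
    · simp
    · generalize Q.adjointCoact a = t
      apply tensor_ind₂ t; intro u v
      simp [contrSnd]

lemma IsHom.comp' {U V W : Type*} [AddCommGroup U] [Module k U] [AddCommGroup V] [Module k V]
    [AddCommGroup W] [Module k W] {L : YDData k H U} {M : YDData k H V} {N : YDData k H W}
    {f : U →ₗ[k] V} {g : V →ₗ[k] W} (hg : YDData.IsHom M N g) (hf : YDData.IsHom L M f) :
    YDData.IsHom L N (g ∘ₗ f) where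
  act x := by rw [LinearMap.comp_assoc, hf.act, ← LinearMap.comp_assoc, hg.act,
    LinearMap.comp_assoc]
  coact := by
    rw [← LinearMap.comp_assoc, hg.coact, LinearMap.comp_assoc, hf.coact, ← LinearMap.comp_assoc,
      ← TensorProduct.map_comp]
    rfl

end Form

end QuasiHopfAlgebra

/-! ### The self-duality -/

namespace QuasiHopfAlgebra

variable {k H : Type*} [Field k] [Ring H] [Algebra k H] {Q : QuasiHopfAlgebra k H}
variable {Lam : H} {lam : Module.Dual k H}

section Duality

lemma contrSnd_rTensor (η : Module.Dual k H) (f : H →ₗ[k] H) (X : H ⊗[k] H) :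
    contrSnd η (rTensor H f X) = f (contrSnd η X) := by
  apply tensor_ind₂ X; intro x y
  simp [contrSnd]

lemma contrSnd_lTensor (η : Module.Dual k H) (f : H →ₗ[k] H) (X : H ⊗[k] H) :
    contrSnd η (lTensor H f X) = contrSnd (η ∘ₗ f) X := by
  apply tensor_ind₂ X; intro x y
  simp [contrSnd]

lemma contrFst_rTensor (η : Module.Dual k H) (f : H →ₗ[k] H) (X : H ⊗[k] H) :
    contrFst η (rTensor H f X) = contrFst (η ∘ₗ f) X := by
  apply tensor_ind₂ X; intro x y
  simp [contrFst]

/-- In finite dimension, a right inverse of a copairing with respect to a pairing is a left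
inverse. -/
lemma contrFst_eq_of_contrSnd_eq [Module.Finite k H] (B : H →ₗ[k] Module.Dual k H) (X : H ⊗[k] H)
    (hB : ∀ b, contrSnd (B.flip b) X = b) (a : H) : contrFst (B a) X = a := by
  let ψ : Module.Dual k H →ₗ[k] H :=
    { toFun := fun ξ => contrSnd ξ X
      map_add' := fun ξ η => by simp [contrSnd, map_add_right]
      map_smul' := fun c ξ => by simp [contrSnd, map_smul_right] }
  have hs : Function.Surjective ψ := fun b => ⟨_, hB b⟩
  have hi : Function.Injective ψ :=
    (LinearMap.injective_iff_surjective_of_finrank_eq_finrank Subspace.dual_finrank_eq).2 hs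
  refine (Module.forall_dual_apply_eq_zero_iff k _).1 ?_ |> sub_eq_zero.1
  intro ξ
  have e : B.flip (contrSnd ξ X) = ξ := hi (hB (contrSnd ξ X))
  rw [map_sub, apply_contrFst, sub_eq_zero]
  exact LinearMap.congr_fun e a

lemma lTensor_adjointAct (h : H) (X : H ⊗[k] H) : lTensor H (Q.adjointAct h) X =
    pw (mulRight k X ∘ₗ inR) (inR ∘ₗ Q.antipode) (Q.comul h) := by
  induction X using tensor_ind₂ with
  | add =>
    intro s t hs ht
    rw [map_add, hs, ht]
    generalize Q.comul h = v
    induction v using tensor_ind₂ with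
    | add => intro s t hs ht; simp only [map_add, ← hs, ← ht]; abel
    | tmul u v => simp [mul_add, add_mul]
  | tmul x y =>
    rw [lTensor_tmul, adjointAct_apply]
    generalize Q.comul h = v
    apply tensor_ind₂ v; intro u v
    simp

lemma rTensor_adjointAct (h : H) (X : H ⊗[k] H) : rTensor H (Q.adjointAct h) X =
    pw (mulRight k X ∘ₗ inL) (inL ∘ₗ Q.antipode) (Q.comul h) := by
  induction X using tensor_ind₂ with
  | add =>
    intro s t hs ht
    rw [map_add, hs, ht]
    generalize Q.comul h = v
    induction v using tensor_ind₂ with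
    | add => intro s t hs ht; simp only [map_add, ← hs, ← ht]; abel
    | tmul u v => simp [mul_add, add_mul]
  | tmul x y =>
    rw [rTensor_tmul, adjointAct_apply]
    generalize Q.comul h = v
    apply tensor_ind₂ v; intro u v
    simp

lemma rTensor_antipode_left (x : H) (d : H ⊗[k] H) :
    rTensor H Q.antipode ((x ⊗ₜ 1) * d) =
      rTensor H Q.antipode d * (Q.antipode x ⊗ₜ 1) := by
  apply tensor_ind₂ d; intro u v
  simp [Q.antipode_mul]

lemma rTensor_antipode_right (x : H) (d : H ⊗[k] H) :
    rTensor H Q.antipode (d * (x ⊗ₜ 1)) =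
      (Q.antipode x ⊗ₜ 1) * rTensor H Q.antipode d := by
  apply tensor_ind₂ d; intro u v
  simp [Q.antipode_mul]

lemma rTensor_antipode_one_left (x : H) (d : H ⊗[k] H) :
    rTensor H Q.antipode ((1 ⊗ₜ x) * d) =
      (1 ⊗ₜ x) * rTensor H Q.antipode d := by
  apply tensor_ind₂ d; intro u v
  simp

lemma rTensor_antipode_one_right (x : H) (d : H ⊗[k] H) :
    rTensor H Q.antipode (d * (1 ⊗ₜ x)) =
      rTensor H Q.antipode d * (1 ⊗ₜ x) := by
  apply tensor_ind₂ d; intro u v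
  simp

variable (Q) in
/-- `x ⊗ y ↦ S(y) ⊗ x` -/
def flipFst : H ⊗[k] H →ₗ[k] H ⊗[k] H :=
  rTensor H Q.antipode ∘ₗ (TensorProduct.comm k H H).toLinearMap

@[simp] lemma flipFst_tmul (x y : H) : Q.flipFst (x ⊗ₜ y) = Q.antipode y ⊗ₜ x := rfl

variable (Q Lam) in
/-- `S(f̄₂ d₁) ⊗ d₂ f̄₁`, where `d` is the Casimir element of a left integral: the copairing of the
adjoint algebra before the action of `β`. -/
def preCoeval : H ⊗[k] H :=
  rTensor H Q.antipode (Q.casimir Lam) * Q.flipFst Q.drinfeldFInv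

lemma adjointCoeval_one :
    Q.adjointCoeval Lam 1 = rTensor H (Q.adjointAct Q.beta) (Q.preCoeval Lam) := by
  rw [adjointCoeval, LinearMap.toSpanSingleton_apply, one_smul, preCoeval]
  change sweedler₄ _ _ _ _ _ (TensorProduct.assoc k H H (H ⊗[k] H)
    (Q.drinfeldFInv ⊗ₜ[k] Q.casimir Lam)) = _
  generalize Q.drinfeldFInv = s
  generalize Q.casimir Lam = t
  apply tensor_ind₂ s; intro x y
  apply tensor_ind₂ t; intro u v
  simp [sweedler₄, sweedler₃, sweedler₂, Q.antipode_mul]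

lemma lTensor_preCoeval [Module.Finite k H] (h : Q.IsLeftIntegral Lam) (h' : Q.IsRightIntegral Lam)
    (x : H) : lTensor H (Q.adjointAct x) (Q.preCoeval Lam) =
      rTensor H (Q.adjointAct (Q.antipode x)) (Q.preCoeval Lam) := by
  have e1 : ∀ t, pw (mulRight k (Q.preCoeval Lam) ∘ₗ inR) (inR ∘ₗ Q.antipode) t =
      rTensor H Q.antipode (Q.casimir Lam) *
        Q.flipFst (Q.drinfeldFInv * Q.flipAntipode t) := by
    intro t
    apply tensor_ind₂ t; intro u v
    simp only [pw_tmul, comp_apply, mulRight_apply, inR_apply, preCoeval]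
    rw [← mul_assoc, ← rTensor_antipode_one_left, ← h.casimir_move, rTensor_antipode_left,
      mul_assoc, mul_assoc]
    congr 1
    generalize Q.drinfeldFInv = s
    apply tensor_ind₂ s; intro a b
    simp [Q.antipode_mul]
  have e2 : ∀ t, pw (mulRight k (Q.preCoeval Lam) ∘ₗ inL) (inL ∘ₗ Q.antipode) t =
      rTensor H Q.antipode (Q.casimir Lam) * Q.flipFst (t * Q.drinfeldFInv) := by
    intro t
    apply tensor_ind₂ t; intro u v
    simp only [pw_tmul, comp_apply, mulRight_apply, inL_apply, preCoeval]
    rw [← Q.antipode_antipodeInv u, ← mul_assoc, ← rTensor_antipode_right, h'.casimir_move,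
      rTensor_antipode_one_right, mul_assoc, mul_assoc, Q.antipode_antipodeInv]
    congr 1
    generalize Q.drinfeldFInv = s
    apply tensor_ind₂ s; intro a b
    simp [Q.antipode_mul]
  rw [lTensor_adjointAct, rTensor_adjointAct, e1, e2, comul_antipode_drinfeldFInv]
  rfl

variable (Q lam) in
/-- `u ⊗ v ↦ (a ↦ λ(v S̄(a u b)))`; its value at `𝐚` is the pairing with `b`. -/
def pairWith (b : H) : H ⊗[k] H →ₗ[k] Module.Dual k H :=
  TensorProduct.lift (LinearMap.mk₂ k
    (fun u v => lam ∘ₗ mulLeft k v ∘ₗ Q.antipodeInv ∘ₗ mulRight k (u * b))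
    (by intros; ext; simp [add_mul, mul_add, mul_assoc]) (by intros; ext; simp [mul_assoc])
    (by intros; ext; simp [add_mul]) (by intros; ext; simp))

@[simp] lemma pairWith_tmul (a b u v : H) :
    Q.pairWith lam b (u ⊗ₜ v) a = lam (v * Q.antipodeInv (a * (u * b))) := rfl

lemma adjointEval_tmul [Module.Finite k H] (hd : Q.IsDualTo Lam lam) (h : Q.IsLeftIntegral Lam)
    (h' : Q.IsRightIntegral Lam) (a b : H) :
    Q.adjointEval lam (a ⊗ₜ b) = Q.pairWith lam b Q.drinfeldA a := by
  rw [adjointEval, comp_apply, adjointMul_tmul, drinfeldA_eq]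
  generalize Q.can Q.legs₄ _ _ = X
  apply tensor_ind₄ X; intro x y z w
  simp [catForm, adMulMap, antipodeInv_mul, mul_assoc, hd.antipode_mul h h']

/-- `D₁ e(D₂, b) = α ▹ b` for `D = preCoeval Λ` -/
lemma contrSnd_preCoeval [Module.Finite k H] (hd : Q.IsDualTo Lam lam) (h : Q.IsLeftIntegral Lam)
    (h' : Q.IsRightIntegral Lam) (b : H) :
    contrSnd ((TensorProduct.curry (Q.adjointEval lam)).flip b) (Q.preCoeval Lam) =
      Q.adjointAct Q.alpha b := by
  have e : (TensorProduct.curry (Q.adjointEval lam)).flip b = Q.pairWith lam b Q.drinfeldA :=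
    LinearMap.ext fun a => adjointEval_tmul hd h h' a b
  have key : ∀ s t, contrSnd (Q.pairWith lam b t)
      (rTensor H Q.antipode (Q.casimir Lam) * Q.flipFst s) = Q.adContr b (s * t) := by
    intro s t
    apply tensor_ind₂ s; intro x y
    induction t using tensor_ind₂ with
    | add =>
      intro s t hs ht
      simp only [mul_add, map_add, ← hs, ← ht]
      simp [contrSnd, map_add_right]
    | tmul u v =>
      have h1 := congrArg (fun c => Q.antipode c * Q.antipode y)
        (hd.contrSnd_eq h (v * Q.antipodeInv (x * (u * b))))
      refine Eq.trans ?_ (h1.trans ?_)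
      · generalize Q.casimir Lam = d
        apply tensor_ind₂ d; intro p q
        simp [contrSnd, antipodeInv_mul, mul_assoc, hd.antipode_mul h h']
      · simp [Q.antipode_mul, mul_assoc]
  rw [e, preCoeval, key, drinfeldFInv_mul_drinfeldA, adjointAct_apply]

lemma adjointCoeval_isHom_act [Module.Finite k H] (h : Q.IsLeftIntegral Lam)
    (h' : Q.IsRightIntegral Lam) (x : H) :
    Q.tensorAct Q.adjointAct Q.adjointAct x (Q.adjointCoeval Lam 1) =
      Q.counit x • Q.adjointCoeval Lam 1 := by
  have e : ∀ t, actTensor Q.adjointAct Q.adjointAct t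
      (rTensor H (Q.adjointAct Q.beta) (Q.preCoeval Lam)) =
      rTensor H (Q.adjointAct (Q.contrBeta t)) (Q.preCoeval Lam) := by
    intro t
    induction t using tensor_ind₂ with
    | add => intro s t hs ht; simp only [map_add, LinearMap.add_apply, hs, ht, LinearMap.rTensor_add]
    | tmul u v =>
      rw [contrBeta_tmul, map_mul, map_mul, Module.End.mul_eq_comp, LinearMap.rTensor_comp,
        comp_apply, ← lTensor_preCoeval h h']
      generalize Q.preCoeval Lam = X
      apply tensor_ind₂ X; intro a b
      rfl
  rw [adjointCoeval_one, tensorAct, AlgHom.comp_apply, e, contrBeta_comul, map_smul,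
    LinearMap.rTensor_smul, LinearMap.smul_apply]

lemma adjoint_zigzag_left [Module.Finite k H] (hd : Q.IsDualTo Lam lam) (h : Q.IsLeftIntegral Lam)
    (h' : Q.IsRightIntegral Lam) (b : H) :
    TensorProduct.rid k H (lTensor H (Q.adjointEval lam)
      (Q.associatorHom Q.adjointAct Q.adjointAct Q.adjointAct
        (Q.adjointCoeval Lam 1 ⊗ₜ b))) = b := by
  have e : ∀ X, TensorProduct.rid k H (lTensor H (Q.adjointEval lam)
      (actTensor Q.adjointAct (actTensor Q.adjointAct Q.adjointAct) X
        (TensorProduct.assoc k H H H (Q.adjointCoeval Lam 1 ⊗ₜ b)))) =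
      Q.adjointAct (Q.zigMap X) b := by
    intro X
    apply tensor_ind₃ X; intro x y z
    have h1 := congrArg (Q.adjointAct (x * Q.beta * Q.antipode y))
      (contrSnd_preCoeval hd h h' (Q.adjointAct z b))
    rw [← contrSnd_rTensor, map_mul, Module.End.mul_eq_comp, LinearMap.rTensor_comp,
      comp_apply, ← lTensor_preCoeval h h'] at h1
    refine Eq.trans ?_ (h1.trans ?_)
    · rw [adjointCoeval_one]
      generalize Q.preCoeval Lam = X
      apply tensor_ind₂ X; intro u v
      simp [contrSnd, actTensor_tmul]
    · simp [zigMap_tmul]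
  refine (e _).trans ?_
  rw [zigMap_phi, map_one, Module.End.one_apply]

/-- With `e'(a, b) = e(p₁ ▹ a, p₂ ▹ b)` for `p = p^R` and `D = preCoeval Λ`, the composite is
`a ↦ e'(a, D₁) D₂`; the identity `D₁ e'(D₂, b) = b` and finite dimension show that it is `a`. -/
lemma adjoint_zigzag_right [Module.Finite k H] (hd : Q.IsDualTo Lam lam) (h : Q.IsLeftIntegral Lam)
    (h' : Q.IsRightIntegral Lam) (a : H) :
    TensorProduct.lid k H (rTensor H (Q.adjointEval lam)
      (Q.associatorInv Q.adjointAct Q.adjointAct Q.adjointAct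
        (a ⊗ₜ Q.adjointCoeval Lam 1))) = a := by
  let B : H ⊗[k] H →ₗ[k] H →ₗ[k] Module.Dual k H :=
    { toFun := fun p => TensorProduct.curry (Q.adjointEval lam ∘ₗ
        actTensor Q.adjointAct Q.adjointAct p)
      map_add' := fun p q => by ext; simp
      map_smul' := fun c p => by ext; simp }
  have hB : ∀ p q u v, B (p ⊗ₜ q) u v =
      Q.adjointEval lam (Q.adjointAct p u ⊗ₜ Q.adjointAct q v) := fun _ _ _ _ => rfl
  have e1 : ∀ X b, contrSnd ((B (Q.pRMap X)).flip b) (Q.preCoeval Lam) =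
      Q.adjointAct (Q.zagMap X) b := by
    intro X b
    induction X using tensor_ind₃ with
    | add =>
      intro s t hs ht
      have e : (B (Q.pRMap (s + t))).flip b = (B (Q.pRMap s)).flip b + (B (Q.pRMap t)).flip b := by
        ext; simp
      rw [e, map_add Q.zagMap, map_add Q.adjointAct, LinearMap.add_apply, ← hs, ← ht]
      simp [contrSnd, map_add_right]
    | tmul x y z =>
      have h1 := congrArg (Q.adjointAct (Q.antipode x))
        (contrSnd_preCoeval hd h h' (Q.adjointAct (y * Q.beta * Q.antipode z) b))
      rw [← contrSnd_rTensor, ← lTensor_preCoeval h h', contrSnd_lTensor] at h1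
      refine Eq.trans ?_ (h1.trans ?_)
      · congr 1
      · simp [zagMap_tmul]
  have e2 : ∀ X, TensorProduct.lid k H (rTensor H (Q.adjointEval lam)
      ((TensorProduct.assoc k H H H).symm
        (actTensor Q.adjointAct (actTensor Q.adjointAct Q.adjointAct) X
        (a ⊗ₜ Q.adjointCoeval Lam 1)))) = contrFst (B (Q.pRMap X) a) (Q.preCoeval Lam) := by
    intro X
    induction X using tensor_ind₃ with
    | add =>
      intro s t hs ht
      simp only [map_add, LinearMap.add_apply, hs, ht]
      simp [contrFst, map_add_left]
    | tmul x y z =>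
      have h1 : contrFst (B (x ⊗ₜ (y * Q.beta * Q.antipode z)) a) (Q.preCoeval Lam) =
          contrFst (B (x ⊗ₜ (y * Q.beta)) a)
            (lTensor H (Q.adjointAct z) (Q.preCoeval Lam)) := by
        rw [lTensor_preCoeval h h', contrFst_rTensor]
        refine congrArg (fun η => contrFst η _) (LinearMap.ext fun v => ?_)
        rw [comp_apply, hB, hB]
        simp
      rw [pRMap_tmul, h1, adjointCoeval_one]
      generalize Q.preCoeval Lam = X
      apply tensor_ind₂ X; intro u v
      simp [actTensor_tmul, hB]
  refine (e2 _).trans (contrFst_eq_of_contrSnd_eq _ _ (fun b => (e1 _ b).trans ?_) a)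
  rw [zagMap_phiInv, map_one, Module.End.one_apply]

end Duality

end QuasiHopfAlgebra

/-! ### Colinearity of the copairing -/

namespace QuasiHopfAlgebra

variable {k H : Type*} [Field k] [Ring H] [Algebra k H] {Q : QuasiHopfAlgebra k H}

local notation "canV" => QuasiHopfAlgebra.can (B := Module.End k _) Q
local notation "evV" => QuasiHopfAlgebra.ev (B := Module.End k _) Q

section
variable {V W : Type*} [AddCommGroup V] [Module k V] [AddCommGroup W] [Module k W]

variable (Q) in
/-- The form `θ` on `A` and the element `D` of `A ⊗ A` make `A` self-dual as an `H`-module, and `θ`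
is colinear. -/
structure IsSelfDuality (θ : Module.Dual k H) (D : H ⊗[k] H) : Prop where
  form_act : ∀ x a, θ (Q.adjointAct x a) = Q.counit x * θ a
  form_coact : ∀ a, contrSnd θ (Q.adjointCoact a) = θ a • 1
  copairing_act : ∀ x, Q.tensorAct Q.adjointAct Q.adjointAct x D = Q.counit x • D
  zigzag_left : ∀ b, TensorProduct.rid k H (lTensor H (θ ∘ₗ Q.adjointMul)
    (Q.associatorHom Q.adjointAct Q.adjointAct Q.adjointAct (D ⊗ₜ b))) = b
  zigzag_right : ∀ a, TensorProduct.lid k H (rTensor H (θ ∘ₗ Q.adjointMul)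
    (Q.associatorInv Q.adjointAct Q.adjointAct Q.adjointAct (a ⊗ₜ D))) = a

variable (W) in
/-- The form `θ` on the first factor of `A ⊗ W`. -/
def formOn (θ : Module.Dual k H) : H ⊗[k] W →ₗ[k] W :=
  (TensorProduct.lid k W).toLinearMap ∘ₗ rTensor W θ

@[simp] lemma formOn_tmul (θ : Module.Dual k H) (a : H) (w : W) :
    formOn W θ (a ⊗ₜ w) = θ a • w := rfl

variable (Q W) in
/-- The pairing `θ(a ⋆ b)` of the first two factors of `A ⊗ A ⊗ W`. -/
def evalOn (θ : Module.Dual k H) : H ⊗[k] (H ⊗[k] W) →ₗ[k] W := formOn W θ ∘ₗ Q.mulOn W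

@[simp] lemma evalOn_tmul (θ : Module.Dual k H) (a b : H) (w : W) :
    Q.evalOn W θ (a ⊗ₜ (b ⊗ₜ w)) = θ (Q.adjointMul (a ⊗ₜ b)) • w := rfl

variable (W) in
/-- The map `w ↦ D ⊗ w`. -/
def coevOn (D : H ⊗[k] H) : W →ₗ[k] H ⊗[k] (H ⊗[k] W) :=
  (TensorProduct.assoc k H H W).toLinearMap ∘ₗ TensorProduct.mk k (H ⊗[k] H) W D

lemma coevOn_apply (D : H ⊗[k] H) (w : W) :
    coevOn W D w = TensorProduct.assoc k H H W (D ⊗ₜ w) := rfl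

variable {L : ℕ → H →ₗ[k] Module.End k W} {L' : ℕ → H →ₗ[k] Module.End k V}
  {θ : Module.Dual k H} {D : H ⊗[k] H} {m n p : ℕ}

lemma evalOn_natural (f : V →ₗ[k] W) (v : H ⊗[k] (H ⊗[k] V)) :
    Q.evalOn W θ (lTensor H (lTensor H f) v) = f (Q.evalOn V θ v) := by
  apply tensor_ind₃ v; intro a b w
  simp

lemma coevOn_natural (f : V →ₗ[k] W) (v : V) :
    coevOn W D (f v) = lTensor H (lTensor H f) (coevOn V D v) := by
  rw [coevOn_apply, coevOn_apply]
  apply tensor_ind₂ D; intro a b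
  rfl

/-- The element `w ∈ W`, put behind an element of `A ⊗ A ⊗ A`. -/
def insertLast (w : W) : H ⊗[k] (H ⊗[k] H) →ₗ[k] H ⊗[k] (H ⊗[k] (H ⊗[k] W)) :=
  lTensor H (lTensor H ((TensorProduct.mk k H W).flip w))

@[simp] lemma insertLast_tmul (a b c : H) (w : W) :
    insertLast w (a ⊗ₜ[k] (b ⊗ₜ c)) = a ⊗ₜ (b ⊗ₜ (c ⊗ₜ w)) := rfl

lemma place_adLegs (h : n ≠ m ∧ n ≠ p ∧ m ≠ p) (X u) (w : W) :
    Q.place (B := Module.End k (H ⊗[k] (H ⊗[k] (H ⊗[k] W)))) (Q.adLegs (Q.adLegs (Q.adLegs L p) m) n) (leaf n) (leaf m)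
      (leaf p) X (insertLast w u) =
    insertLast w (actTensor Q.adjointAct (actTensor Q.adjointAct Q.adjointAct) X u) := by
  obtain ⟨hnm, hnp, hmp⟩ := h
  apply tensor_ind₃ X; intro x y z
  apply tensor_ind₃ u; intro a b c
  simp only [place, pw_tmul, Module.End.mul_apply, insertLast_tmul, actTensor_tmul, ev]
  rw [headLegs_of_ne hnp.symm, lTensor_tmul, headLegs_of_ne hmp.symm,
    lTensor_tmul, headLegs_self, headLegs_of_ne hnm.symm, lTensor_tmul,
    headLegs_self, headLegs_self]

namespace IsSelfDuality

variable (S : Q.IsSelfDuality θ D)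
include S

lemma formOn_braidOn (t : LegTree) (hL : IsLegs L) (v : H ⊗[k] W) :
    formOn W θ (Q.braidOn L t v) = formOn W θ v := by
  apply tensor_ind₂ v; intro a w
  have e : ∀ u, formOn W θ (Q.moveMap L t u w) = Q.ev L t (contrSnd θ u) w := by
    intro u
    apply tensor_ind₂ u; intro x b
    simp [contrSnd]
  rw [braidOn_tmul, e, S.form_coact, map_smul, Q.ev_one hL]
  rfl

lemma evalOn_intertwines (h : n ≠ m) :
    Q.Intertwines (Q.adLegs (Q.adLegs L m) n) L (Q.evalOn W θ) (leaf n * leaf m) one where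
  block x v := by
    refine (congrArg (formOn W θ) ((mulOn_intertwines h).block x v)).trans ?_
    rw [evalOn, comp_apply]
    generalize Q.mulOn W v = v
    apply tensor_ind₂ v; intro a w
    refine (congrArg (formOn W θ) (headLegs_self _ _ _)).trans ?_
    rw [formOn_tmul, S.form_act]
    exact mul_smul _ _ _
  other i hi hi' x v := by
    have hi : i ≠ n ∧ i ≠ m := by simpa [leaves] using hi
    rw [headLegs_of_ne hi.1, headLegs_of_ne hi.2]
    exact evalOn_natural _ v

lemma coevOn_intertwines (h : n ≠ m) :
    Q.Intertwines L (Q.adLegs (Q.adLegs L m) n) (coevOn W D) one (leaf n * leaf m) where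
  block x v := by
    have e : ∀ t u, pw (Q.ev (B := Module.End k _) (Q.adLegs (Q.adLegs L m) n) (leaf n))
        (Q.ev (B := Module.End k _) (Q.adLegs (Q.adLegs L m) n) (leaf m)) t
          (TensorProduct.assoc k H H W (u ⊗ₜ v)) =
        TensorProduct.assoc k H H W (actTensor Q.adjointAct Q.adjointAct t u ⊗ₜ v) := by
      intro t u
      apply tensor_ind₂ t; intro x y
      apply tensor_ind₂ u; intro a b
      simp only [pw_tmul, Module.End.mul_apply, ev, TensorProduct.assoc_tmul, actTensor_tmul]
      rw [headLegs_of_ne h.symm, lTensor_tmul, headLegs_self, headLegs_self]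
    rw [coevOn_apply, coevOn_apply, ev_node', e]
    change _ = TensorProduct.assoc k H H W (Q.tensorAct _ _ x D ⊗ₜ v)
    rw [S.copairing_act, ← smul_tmul', ← TensorProduct.tmul_smul]
    rfl
  other i hi hi' x v := by
    have hi : i ≠ n ∧ i ≠ m := by simpa [leaves] using hi'
    rw [headLegs_of_ne hi.1, headLegs_of_ne hi.2]
    exact coevOn_natural _ v

lemma evalOn_coevOn (hL : IsLegs L) (v : H ⊗[k] W) :
    lTensor H (Q.evalOn W θ) (canV (Q.adLegs (Q.adLegs (Q.adLegs L 4) 2) 1) (1 * 2 * 4)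
      (1 * (2 * 4)) (coevOn (H ⊗[k] W) D v)) = v := by
  have hN := Q.isLegs_adLegs 1 (Q.isLegs_adLegs 2 (Q.isLegs_adLegs 4 hL))
  rw [can_assoc' hN (by decide)]
  apply tensor_ind₂ v; intro a w
  have e1 : coevOn (H ⊗[k] W) D (a ⊗ₜ w) =
      insertLast w (TensorProduct.assoc k H H H (D ⊗ₜ a)) := by
    rw [coevOn_apply]
    clear S
    apply tensor_ind₂ D; intro a b
    rfl
  have e2 : ∀ u, lTensor H (Q.evalOn W θ) (insertLast w u) =
      TensorProduct.rid k H (lTensor H (θ ∘ₗ Q.adjointMul) u) ⊗ₜ w := by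
    intro u
    apply tensor_ind₃ u; intro a b c
    simp [TensorProduct.smul_tmul]
  rw [e1, ph]
  refine (congrArg _ (place_adLegs (n := 1) (m := 2) (p := 4) (by decide) _ _ _)).trans ?_
  rw [e2]
  exact congrArg (· ⊗ₜ w) (S.zigzag_left a)

lemma evalOn_coevOn' (hL : IsLegs L) (v : H ⊗[k] W) :
    Q.evalOn (H ⊗[k] W) θ (canV (Q.adLegs (Q.adLegs (Q.adLegs L 5) 4) 2) (2 * (4 * 5))
      (2 * 4 * 5) (lTensor H (coevOn W D) v)) = v := by
  have hN := Q.isLegs_adLegs 2 (Q.isLegs_adLegs 4 (Q.isLegs_adLegs 5 hL))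
  rw [can_assocInv' hN (by decide)]
  apply tensor_ind₂ v; intro a w
  have e1 : lTensor H (coevOn W D) (a ⊗ₜ w) = insertLast w (a ⊗ₜ D) := by
    rw [lTensor_tmul, coevOn_apply]
    clear S
    apply tensor_ind₂ D; intro a b
    rfl
  have e2 : ∀ u, Q.evalOn (H ⊗[k] W) θ (insertLast w u) =
      TensorProduct.lid k H (rTensor H (θ ∘ₗ Q.adjointMul)
        ((TensorProduct.assoc k H H H).symm u)) ⊗ₜ w := by
    intro u
    apply tensor_ind₃ u; intro a b c
    simp [smul_tmul']
  rw [e1, phi']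
  refine (congrArg _ (place_adLegs (n := 2) (m := 4) (p := 5) (by decide) _ _ _)).trans ?_
  rw [e2]
  exact congrArg (· ⊗ₜ w) (S.zigzag_right a)

variable [Module.Finite k H]

lemma evalOn_braidFactors (hL : IsLegs L) (v : H ⊗[k] (H ⊗[k] W)) :
    Q.evalOn W θ (Q.braidFactors L v) = Q.evalOn W θ v := by
  rw [evalOn, comp_apply, ← braidOn_mulOn hL, S.formOn_braidOn _ hL]
  rfl

omit S [Module.Finite k H] in
lemma can_relabel (hL : IsLegs L) (f : ℕ → LegTree) (s t s' t' : LegTree)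
    (hf : f 1 = 2 ∧ f 2 = 4 ∧ f 3 = 3) (h : s.leaves = t.leaves ∧ (s.bind f).leaves.Nodup ∧
      s.bind f = s' ∧ t.bind f = t' ∧ s.leaves ⊆ [1, 2, 3])
    (v : H ⊗[k] (H ⊗[k] W)) : canV (Q.adLegs (Q.adLegs L 2) 1) s t v =
      canV (Q.adLegs (Q.adLegs L 4) 2) s' t' v := by
  obtain ⟨h1, h2, rfl, rfl, h3⟩ := h
  obtain ⟨hf1, hf2, hf3⟩ := hf
  refine LinearMap.congr_fun (Q.map_can (AlgHom.id k _) f (isLegs_headLegs (isLegs_headLegs hL)) h1 h2 fun i hi => ?_) v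
  have := h3 hi
  fin_cases this <;> simp only [hf1, hf2, hf3] <;> rfl

/-- The pairing absorbs the half-braidings of its two arguments. -/
lemma evalOn_braid (hL : IsLegs L) (v : H ⊗[k] (H ⊗[k] W)) :
    Q.evalOn W θ (canV (Q.adLegs (Q.adLegs L 4) 2) (3 * 2 * 4) (3 * (2 * 4))
      (Q.braidOn (Q.adLegs L 4) 3 (canV (Q.adLegs (Q.adLegs L 4) 2) (2 * (3 * 4)) (2 * 3 * 4)
        (lTensor H (Q.braidOn L 3) (canV (Q.adLegs (Q.adLegs L 4) 2) (2 * 4 * 3)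
          (2 * (4 * 3)) v))))) = Q.evalOn W θ v := by
  let f : ℕ → LegTree := fun i => if i = 1 then 2 else if i = 2 then 4 else leaf i
  rw [← S.evalOn_braidFactors hL v]
  simp only [braidFactors, comp_apply]
  rw [can_relabel hL f (3 * 1 * 2) (3 * (1 * 2)) (3 * 2 * 4) (3 * (2 * 4)) ⟨rfl, rfl, rfl⟩
      (by decide), can_relabel hL f (1 * (3 * 2)) (1 * 3 * 2) (2 * (3 * 4)) (2 * 3 * 4)
      ⟨rfl, rfl, rfl⟩ (by decide), can_relabel hL f (1 * 2 * 3) (1 * (2 * 3)) (2 * 4 * 3)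
      (2 * (4 * 3)) ⟨rfl, rfl, rfl⟩ (by decide)]
  rfl

variable (Q L θ D) in
omit S in
/-- The inverse of the half-braiding of `A`, obtained from the duality: the copairing creates the
copies `1`, `2` of `A`, the copy `2` is braided past the leg `3`, and then paired with the copy
`4`. -/
def braidInv : H ⊗[k] W →ₗ[k] H ⊗[k] W :=
  lTensor H (Q.evalOn W θ) ∘ₗ
    canV (Q.adLegs (Q.adLegs (Q.adLegs L 4) 2) 1) (1 * (3 * 2 * 4)) (1 * 3 * (2 * 4)) ∘ₗ
    lTensor H (Q.braidOn (Q.adLegs L 4) 3) ∘ₗ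
    canV (Q.adLegs (Q.adLegs (Q.adLegs L 4) 2) 1) (1 * 2 * (3 * 4)) (1 * (2 * 3 * 4)) ∘ₗ
    coevOn (H ⊗[k] W) D

lemma braidInv_braidOn (hL : IsLegs L) (v : H ⊗[k] W) :
    braidInv Q L θ D (Q.braidOn L 3 v) = v := by
  have hM4 := Q.isLegs_adLegs 4 hL
  have hM1 := Q.isLegs_adLegs 1 hL
  have hM24 := Q.isLegs_adLegs 2 hM4
  have hN := Q.isLegs_adLegs 1 hM24
  have hd : Q.Intertwines (Q.adLegs L 4) (Q.adLegs (Q.adLegs (Q.adLegs L 4) 2) 1)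
      (coevOn (H ⊗[k] W) D) one (1 * 2) := S.coevOn_intertwines (by decide)
  have he : Q.Intertwines (Q.adLegs (Q.adLegs (Q.adLegs L 4) 2) 1) (Q.adLegs L 1)
      (lTensor H (Q.evalOn W θ)) (2 * 4) one :=
    (S.evalOn_intertwines (by decide)).lTensor (by decide)
  have h34 : Q.Intertwines (Q.adLegs (Q.adLegs (Q.adLegs L 4) 2) 1)
      (Q.adLegs (Q.adLegs (Q.adLegs L 4) 2) 1)
      (lTensor H (lTensor H (Q.braidOn L 3))) (4 * 3) (3 * 4) :=
    ((braidOn_intertwines (t := 3) hL (by decide)).lTensor (by decide)).lTensor (by decide)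
  have hE : ∀ z, lTensor H (Q.evalOn W θ)
      (canV (Q.adLegs (Q.adLegs (Q.adLegs L 4) 2) 1) (3 * 2 * 4) (3 * (2 * 4))
      (lTensor H (Q.braidOn (Q.adLegs L 4) 3)
        (canV (Q.adLegs (Q.adLegs (Q.adLegs L 4) 2) 1) (2 * (3 * 4)) (2 * 3 * 4)
        (lTensor H (lTensor H (Q.braidOn L 3))
          (canV (Q.adLegs (Q.adLegs (Q.adLegs L 4) 2) 1) (2 * 4 * 3) (2 * (4 * 3)) z))))) =
      lTensor H (Q.evalOn W θ) z := fun z => by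
    rw [can_headLegs hM24 (by decide) (by decide), can_headLegs hM24 (by decide) (by decide),
      can_headLegs hM24 (by decide) (by decide)]
    simp only [← comp_apply, ← LinearMap.lTensor_comp]
    congr 2
    exact LinearMap.ext fun w => S.evalOn_braid hL w
  simp only [braidInv, comp_apply]
  rw [coevOn_natural, can_split hN (1 * 2 * (3 * 4)) (1 * (2 * (3 * 4))) (1 * (2 * 3 * 4))
      (by decide), ← h34.can hN hN (1 * 2 * (3 * 4)) (1 * (2 * (3 * 4))) (s := 1 * 2 * (4 * 3))
      (t := 1 * (2 * (4 * 3))) (by decide),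
    can_split hN (1 * 2 * (4 * 3)) (1 * (2 * 4 * 3)) (1 * (2 * (4 * 3))) (by decide),
    can_split hN (1 * (3 * 2 * 4)) (1 * (3 * (2 * 4))) (1 * 3 * (2 * 4)) (by decide),
    he.can hN hM1 (1 * 3) (1 * 3) (by decide), can_self_apply hM1 (by decide),
    ← can_whisker hN (s := 3 * 2 * 4) (t := 3 * (2 * 4)) (1 * (3 * 2 * 4)) _ (by decide),
    ← can_whisker hN (s := 2 * (3 * 4)) (t := 2 * 3 * 4) (1 * (2 * (3 * 4))) _ (by decide),
    ← can_whisker hN (s := 2 * 4 * 3) (t := 2 * (4 * 3)) (1 * (2 * 4 * 3)) _ (by decide), hE,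
    can_split hN (1 * 2 * (4 * 3)) (1 * (2 * 4) * 3) (1 * (2 * 4 * 3)) (by decide),
    he.can hN hM1 (1 * 3) (1 * 3) (by decide), can_self_apply hM1 (by decide),
    can_split hN (1 * 2 * (4 * 3)) (1 * 2 * 4 * 3) (1 * (2 * 4) * 3) (by decide),
    ← hd.can' hM4 hN (1 * 2 * (4 * 3)) (1 * 2 * 4 * 3) (s := 4 * 3) (t := 4 * 3) (by decide),
    can_self_apply hM4 (by decide),
    ← can_whisker hN (s := 1 * 2 * 4) (t := 1 * (2 * 4)) (1 * 2 * 4 * 3) _ (by decide),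
    S.evalOn_coevOn hL]

lemma braidOn_braidInv [Module.Finite k W] (hL : IsLegs L) (v : H ⊗[k] W) :
    Q.braidOn L 3 (braidInv Q L θ D v) = v := by
  have e : (braidInv Q L θ D : Module.End k (H ⊗[k] W)) * Q.braidOn L 3 = 1 :=
    LinearMap.ext (S.braidInv_braidOn hL)
  exact LinearMap.congr_fun (mul_eq_one_comm.1 e) v

/-- Braiding the two factors of the copairing past the leg `3` and pairing the second factor with
`A` does nothing. -/
lemma evalOn_braidFactors_coevOn [Module.Finite k W] (hL : IsLegs L) (v : H ⊗[k] W) :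
    lTensor H (Q.evalOn W θ)
      (canV (Q.adLegs (Q.adLegs (Q.adLegs L 4) 2) 1) (3 * (1 * 2) * 4) (3 * 1 * (2 * 4))
        (Q.braidFactors (Q.adLegs L 4) (coevOn (H ⊗[k] W) D v))) = v := by
  have hM4 := Q.isLegs_adLegs 4 hL
  have hM24 := Q.isLegs_adLegs 2 hM4
  have hN := Q.isLegs_adLegs 1 hM24
  have hd : Q.Intertwines (Q.adLegs L 4) (Q.adLegs (Q.adLegs (Q.adLegs L 4) 2) 1)
      (coevOn (H ⊗[k] W) D) one (1 * 2) := S.coevOn_intertwines (by decide)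
  have h13 : Q.Intertwines (Q.adLegs (Q.adLegs (Q.adLegs L 4) 2) 1)
      (Q.adLegs (Q.adLegs (Q.adLegs L 4) 2) 1)
      (Q.braidOn (Q.adLegs (Q.adLegs L 4) 2) 3) (1 * 3) (3 * 1) :=
    braidOn_intertwines hM24 (by decide)
  have h23 : Q.Intertwines (Q.adLegs (Q.adLegs (Q.adLegs L 4) 2) 1)
      (Q.adLegs (Q.adLegs (Q.adLegs L 4) 2) 1)
      (lTensor H (Q.braidOn (Q.adLegs L 4) 3)) (2 * 3) (3 * 2) :=
    (braidOn_intertwines (t := 3) hM4 (by decide)).lTensor (by decide)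
  refine Eq.trans ?_ (S.braidOn_braidInv hL v)
  simp only [braidInv, comp_apply, braidFactors]
  rw [braidOn_natural (L' := Q.adLegs (Q.adLegs L 4) 2) (L := L) (t := 3) fun x w =>
      (S.evalOn_intertwines (n := 2) (m := 4) (by decide)).other 3 (by decide) (by decide) x w]
  congr 1
  rw [can_comp hN (3 * 1 * 2 * 4) (3 * (1 * 2) * 4) (3 * 1 * (2 * 4)) (by decide),
    ← h13.can hN hN (3 * 1 * 2 * 4) (3 * 1 * (2 * 4)) (s := 1 * 3 * 2 * 4)
      (t := 1 * 3 * (2 * 4)) (by decide),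
    can_comp hN (1 * (3 * 2) * 4) (1 * 3 * 2 * 4) (1 * 3 * (2 * 4)) (by decide),
    can_split hN (1 * (3 * 2) * 4) (1 * (3 * 2 * 4)) (1 * 3 * (2 * 4)) (by decide),
    ← h23.can hN hN (1 * (3 * 2) * 4) (1 * (3 * 2 * 4)) (s := 1 * (2 * 3) * 4)
      (t := 1 * (2 * 3 * 4)) (by decide),
    can_comp hN (1 * 2 * 3 * 4) (1 * (2 * 3) * 4) (1 * (2 * 3 * 4)) (by decide),
    can_split hN (1 * 2 * (3 * 4)) (1 * 2 * 3 * 4) (1 * (2 * 3 * 4)) (by decide),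
    ← hd.can' hM4 hN (1 * 2 * (3 * 4)) (1 * 2 * 3 * 4) (s := 3 * 4) (t := 3 * 4) (by decide),
    can_self_apply hM4 (by decide)]

omit [Module.Finite k H] in
lemma evalOn_coevOn_second (hL : IsLegs L) (v : H ⊗[k] W) :
    lTensor H (Q.evalOn W θ)
      (canV (Q.adLegs (Q.adLegs (Q.adLegs L 4) 2) 1) (3 * (1 * 2) * 4) (3 * 1 * (2 * 4))
        (coevOn (H ⊗[k] W) D v)) = v := by
  have hM4 := Q.isLegs_adLegs 4 hL
  have hM1 := Q.isLegs_adLegs 1 hL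
  have hN := Q.isLegs_adLegs 1 (Q.isLegs_adLegs 2 hM4)
  have hd : Q.Intertwines (Q.adLegs L 4) (Q.adLegs (Q.adLegs (Q.adLegs L 4) 2) 1)
      (coevOn (H ⊗[k] W) D) one (1 * 2) := S.coevOn_intertwines (by decide)
  have he : Q.Intertwines (Q.adLegs (Q.adLegs (Q.adLegs L 4) 2) 1) (Q.adLegs L 1)
      (lTensor H (Q.evalOn W θ)) (2 * 4) one :=
    (S.evalOn_intertwines (by decide)).lTensor (by decide)
  rw [can_split hN (3 * (1 * 2) * 4) (3 * (1 * (2 * 4))) (3 * 1 * (2 * 4)) (by decide),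
    he.can hN hM1 (3 * 1) (3 * 1) (by decide), can_self_apply hM1 (by decide),
    can_split hN (3 * (1 * 2) * 4) (3 * (1 * 2 * 4)) (3 * (1 * (2 * 4))) (by decide),
    ← hd.can' hM4 hN (3 * (1 * 2) * 4) (3 * (1 * 2 * 4)) (s := 3 * 4) (t := 3 * 4) (by decide),
    can_self_apply hM4 (by decide),
    ← can_whisker hN (s := 1 * 2 * 4) (t := 1 * (2 * 4)) (3 * (1 * 2 * 4)) _ (by decide),
    S.evalOn_coevOn hL]

/-- The copairing is invariant under the half-braiding of `A ⊗ A`. -/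
lemma braidFactors_coevOn [Module.Finite k W] (hL : IsLegs L) (w : W) :
    Q.braidFactors L (coevOn W D w) = coevOn W D w := by
  have hL5 := Q.isLegs_adLegs 5 hL
  have hM45 := Q.isLegs_adLegs 4 hL5
  have hM24 := Q.isLegs_adLegs 2 hM45
  have hN := Q.isLegs_adLegs 1 hM24
  have hM15 := Q.isLegs_adLegs 1 hL5
  have hM12 := Q.isLegs_adLegs 1 (Q.isLegs_adLegs 2 hL)
  have hd : Q.Intertwines (Q.adLegs (Q.adLegs L 5) 4)
      (Q.adLegs (Q.adLegs (Q.adLegs (Q.adLegs L 5) 4) 2) 1)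
      (coevOn (H ⊗[k] (H ⊗[k] W)) D) one (1 * 2) := S.coevOn_intertwines (by decide)
  have hd45 : Q.Intertwines L (Q.adLegs (Q.adLegs L 5) 4) (coevOn W D) one (4 * 5) :=
    S.coevOn_intertwines (by decide)
  have hd' : Q.Intertwines (Q.adLegs (Q.adLegs L 2) 1)
      (Q.adLegs (Q.adLegs (Q.adLegs (Q.adLegs L 5) 4) 2) 1)
      (lTensor H (lTensor H (coevOn W D))) one (4 * 5) :=
    (hd45.lTensor (by decide)).lTensor (by decide)
  have he : Q.Intertwines (Q.adLegs (Q.adLegs (Q.adLegs (Q.adLegs L 5) 4) 2) 1)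
      (Q.adLegs (Q.adLegs L 5) 1) (lTensor H (Q.evalOn (H ⊗[k] W) θ)) (2 * 4) one :=
    (S.evalOn_intertwines (by decide)).lTensor (by decide)
  have hB := braidFactors_intertwines (Q := Q) hM45
  have hz : ∀ u, lTensor H (Q.evalOn (H ⊗[k] W) θ)
      (canV (Q.adLegs (Q.adLegs (Q.adLegs (Q.adLegs L 5) 4) 2) 1) (2 * (4 * 5)) (2 * 4 * 5)
        (lTensor H (lTensor H (coevOn W D)) u)) = u := fun u => by
    rw [can_headLegs hM24 (by decide) (by decide)]
    simp only [← comp_apply, ← LinearMap.lTensor_comp]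
    refine (congrArg (fun F => lTensor H F u) (LinearMap.ext fun y =>
      S.evalOn_coevOn' hL y)).trans (LinearMap.congr_fun (LinearMap.lTensor_id _ _) u)
  -- pairing the second factor with a further copairing gives back `X`, up to an associator
  have hF : ∀ X, lTensor H (Q.evalOn (H ⊗[k] W) θ)
      (canV (Q.adLegs (Q.adLegs (Q.adLegs (Q.adLegs L 5) 4) 2) 1) (3 * (1 * 2) * 4)
        (3 * 1 * (2 * 4)) (canV (Q.adLegs (Q.adLegs (Q.adLegs (Q.adLegs L 5) 4) 2) 1)
          (3 * (1 * 2) * (4 * 5)) (3 * (1 * 2) * 4 * 5)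
          (lTensor H (lTensor H (coevOn W D)) X))) =
      canV (Q.adLegs (Q.adLegs L 2) 1) (3 * (1 * 2)) (3 * 1 * 2) X := fun X => by
    rw [can_comp hN (3 * (1 * 2) * (4 * 5)) (3 * (1 * 2) * 4 * 5) (3 * 1 * (2 * 4) * 5)
        (by decide),
      can_split hN (3 * (1 * 2) * (4 * 5)) (3 * 1 * (2 * 4 * 5)) (3 * 1 * (2 * 4) * 5) (by decide),
      he.can hN hM15 (3 * 1 * 5) (3 * 1 * 5) (by decide), can_self_apply hM15 (by decide),
      can_split hN (3 * (1 * 2) * (4 * 5)) (3 * 1 * (2 * (4 * 5))) (3 * 1 * (2 * 4 * 5))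
        (by decide),
      ← can_whisker hN (s := 2 * (4 * 5)) (t := 2 * 4 * 5) (3 * 1 * (2 * (4 * 5))) _ (by decide),
      ← hd'.can' hM12 hN (3 * (1 * 2) * (4 * 5)) (3 * 1 * (2 * (4 * 5))) (s := 3 * (1 * 2))
        (t := 3 * 1 * 2) (by decide), hz]
  have e1 := S.evalOn_braidFactors_coevOn hL5 (canV (Q.adLegs (Q.adLegs L 5) 4) (3 * (4 * 5))
    (3 * 4 * 5) (coevOn W D w))
  have e2 := S.evalOn_coevOn_second hL5 (canV (Q.adLegs (Q.adLegs L 5) 4) (3 * (4 * 5))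
    (3 * 4 * 5) (coevOn W D w))
  rw [hd.can' hM45 hN (1 * 2 * 3 * (4 * 5)) (1 * 2 * 3 * 4 * 5) (by decide), coevOn_natural,
    hB.can hN hN (3 * (1 * 2) * (4 * 5)) (3 * (1 * 2) * 4 * 5) (by decide),
    braidFactors_natural hM45 hL (hd45.other 3 (by decide) (by decide)), hF] at e1
  rw [hd.can' hM45 hN (3 * (1 * 2) * (4 * 5)) (3 * (1 * 2) * 4 * 5) (by decide), coevOn_natural,
    hF] at e2
  have e3 := congrArg (canV (Q.adLegs (Q.adLegs L 2) 1) (3 * 1 * 2) (3 * (1 * 2)))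
    (e1.trans e2.symm)
  rw [can_trans_apply hM12 _ (by decide) (by decide), can_trans_apply hM12 _ (by decide)
    (by decide), can_self_apply hM12 (by decide), can_self_apply hM12 (by decide)] at e3
  exact e3

lemma copairing_isHom :
    YDData.IsHom (YDData.unit Q) (YDData.tensor Q Q.adjoint Q.adjoint)
      (LinearMap.toSpanSingleton k (H ⊗[k] H) D) where
  act x := LinearMap.ext_ring (by
    change (Q.counit x * 1) • D = Q.tensorAct Q.adjointAct Q.adjointAct x ((1 : k) • D)
    rw [one_smul, mul_one, S.copairing_act])
  coact := LinearMap.ext_ring (by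
    have e1 : ∀ D, (YDData.tensor Q Q.adjoint Q.adjoint).coact D =
        TensorProduct.comm k (H ⊗[k] H) H ((TensorProduct.assoc k H H H).symm
          (Q.braidFactors (Q.regLegs 3) (coevOn H D 1))) := by
      intro D
      induction D using tensor_ind₂ with
      | add =>
        intro s t hs ht
        simp only [coevOn_apply, map_add, add_tmul] at hs ht ⊢
        rw [hs, ht]
      | tmul a b => exact tensor_coact a b
    change (YDData.tensor Q Q.adjoint Q.adjoint).coact ((1 : k) • D) = (1 : H) ⊗ₜ ((1 : k) • D)
    rw [one_smul, e1, S.braidFactors_coevOn (isLegs_regLegs 3), coevOn_apply,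
      LinearEquiv.symm_apply_apply, TensorProduct.comm_tmul])

end IsSelfDuality

section Duality
variable {Lam : H} {lam : Module.Dual k H} [Module.Finite k H]

lemma IsDualTo.isSelfDuality (hd : Q.IsDualTo Lam lam) (h : Q.IsLeftIntegral Lam)
    (h' : Q.IsRightIntegral Lam) : Q.IsSelfDuality (Q.catForm lam) (Q.adjointCoeval Lam 1) where
  form_act := hd.catForm_adjointAct h h'
  form_coact := hd.contrSnd_catForm h h'
  copairing_act := adjointCoeval_isHom_act h h'
  zigzag_left := adjoint_zigzag_left hd h h'
  zigzag_right := adjoint_zigzag_right hd h h'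

lemma IsDualTo.isLeftDual (hd : Q.IsDualTo Lam lam) (h : Q.IsLeftIntegral Lam)
    (h' : Q.IsRightIntegral Lam) : YDData.IsLeftDual Q Q.adjoint Q.adjoint
      (Q.adjointEval lam) (Q.adjointCoeval Lam) where
  eval_isHom := IsHom.comp' (hd.form_isHom h h') adjointMul_isHom
  coeval_isHom := by
    have e := (hd.isSelfDuality h h').copairing_isHom
    rwa [show LinearMap.toSpanSingleton k (H ⊗[k] H) (Q.adjointCoeval Lam 1) = Q.adjointCoeval Lam
      from LinearMap.ext_ring (one_smul _ _)] at e
  zigzag_left := LinearMap.ext fun b => adjoint_zigzag_left hd h h' b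
  zigzag_right := LinearMap.ext fun a => adjoint_zigzag_right hd h h' a

end Duality

lemma isAlgebra_adjoint [Module.Finite k H] :
    Q.adjoint.IsAlgebra Q Q.adjointMul Q.adjointUnit where
  isYetterDrinfeld := isYetterDrinfeld_adjoint
  mul_isHom := adjointMul_isHom
  unit_isHom :=
    { act := fun x => LinearMap.ext_ring (by
        change (Q.counit x * 1) • Q.beta = Q.adjointAct x ((1 : k) • Q.beta)
        rw [one_smul, mul_one, adjointAct_beta])
      coact := LinearMap.ext_ring (by
        change Q.adjointCoact ((1 : k) • Q.beta) = (1 : H) ⊗ₜ ((1 : k) • Q.beta)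
        rw [one_smul, adjointCoact_beta]) }
  mul_assoc := adjointMul_assoc
  unit_mul := LinearMap.ext fun a => by
    change Q.adjointMul (((1 : k) • Q.beta) ⊗ₜ a) = a
    rw [one_smul, adjointMul_beta_left]
  mul_unit := LinearMap.ext fun a => by
    change Q.adjointMul (a ⊗ₜ ((1 : k) • Q.beta)) = a
    rw [one_smul, adjointMul_beta_right]

end

end QuasiHopfAlgebra

end

theorem mainTheorem2 {k H : Type*} [Field k] [Ring H] [Algebra k H] [Module.Finite k H]
    (Q : QuasiHopfAlgebra k H) (hQ : Q.IsUnimodular)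
    (lam : Module.Dual k H) (hlam : Q.IsRightCointegral lam) (hlam0 : lam ≠ 0) :
    Function.Bijective Q.antipode ∧
    (∃! Lam : H, Q.IsLeftIntegral Lam ∧ lam Lam = 1) ∧
    (∀ Lam : H, Q.IsLeftIntegral Lam → lam Lam = 1 →
      Q.adjoint.IsYetterDrinfeld Q ∧
      QuasiHopfAlgebra.YDData.IsLeftDual Q Q.adjoint Q.adjoint
        (Q.adjointEval lam) (Q.adjointCoeval Lam)) ∧
    Q.adjoint.IsFrobeniusAlgebra Q Q.adjointMul Q.adjointUnit (Q.catForm lam) ∧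
    Q.adjoint.IsCommutative Q.adjointMul := by
  obtain ⟨hex, hdual⟩ := hQ.exists_integral hlam hlam0
  obtain ⟨Lam, ⟨h, h1⟩, -⟩ := id hex
  obtain ⟨h', hd⟩ := hdual Lam h h1
  exact ⟨Q.antipode_bijective, hex,
    fun Lam h h1 => ⟨QuasiHopfAlgebra.isYetterDrinfeld_adjoint,
      (hdual Lam h h1).2.isLeftDual h (hdual Lam h h1).1⟩,
    { isAlgebra := QuasiHopfAlgebra.isAlgebra_adjoint
      form_isHom := hd.form_isHom h h'
      nondegenerate := ⟨_, hd.isLeftDual h h'⟩ },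
    LinearMap.ext Q.adjointMul_braid⟩
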